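/- Assume the Riemann Hypothesis. Let $E:\mathbb R\to\mathbb R$ be an even function with $E(0)=1$ and $E(\nu)=0$ for $|\nu|>1$, absolutely continuous, and with derivative $E'$ of bounded variation. Let $\lambda>0$ and put $A^E=\int_0^1E(\nu)\,d\nu$. For $r\ge 0$ and $s=\sigma+i\tau$ with $\sigma>1/2$ let $$D_{2r}(s)=\sum_{n=1}^\infty\frac{\Lambda(n)\Lambda(n+2r)}{n^{2s}},\qquad \Phi^\lambda(s)=D_0(s)+2\sum_{0<2r\le\lambda}E(2r/\lambda)\,D_{2r}(s),$$ where $\Lambda$ is von Mangoldt's function and $r$ runs over integers (the series converge absolutely). Let $\hat E^\lambda(t)=\int_{\mathbb R}E(\nu/\lambda)e^{-i\nu t}\,d\nu$. The function $$M^\lambda(z)=\frac1\pi\int_0^\infty\hat E^\lambda(t)\,t^{-z}\,dt\qquad(0<\operatorname{Re}z<1),$$ given by an absolutely convergent integral, extends to a meromorphic function on $\operatorname{Re}z>-1$, analytic there except for at most simple poles at $z=1,3,5,\dots$; the extension is again denoted by $M^\lambda$. In the sums below $\rho,\rho',\rho''$ run over the complex (nontrivial) zeros of $\zeta$, each counted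 with its multiplicity. For $1/2<\sigma<1$ put $$\Sigma^\lambda(s)=\Big\{\frac{\zeta'(s)}{\zeta(s)}\Big\}^2+2\,\frac{\zeta'(s)}{\zeta(s)}\sum_\rho\Gamma(\rho-s)M^\lambda(\rho-s)\cos\frac{\pi(\rho-s)}2+\sum_{\rho',\rho''}\Gamma(\rho'-s)\Gamma(\rho''-s)M^\lambda(\rho'+\rho''-2s)\cos\frac{\pi(\rho'-\rho'')}2,$$ where both the single and the double series converge absolutely. Then there is a function $H_0^\lambda$ (depending on $\lambda$ and $E$), analytic in the strip $0<\sigma<1$, such that for all $s$ with $1/2<\sigma<1$ $$\Phi^\lambda(s)=\frac{2A^E\lambda}{2s-1}-4A^E\lambda\sum_\rho\frac1{2s-\rho}+\Sigma^\lambda(s)+H_0^\lambda(s),$$ where $\sum_\rho\frac1{2s-\rho}$ is the (convergent) symmetric sum $\lim_{T\to\infty}\sum_{|\operatorname{Im}\rho|\le T}\frac1{2s-\rho}$. -/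

import Mathlib

open Filter Topology MeasureTheory

noncomputable section

/-- Even sieving functions: `E` is even and real-valued, `E 0 = 1`, `E` vanishes outside `[-1, 1]`,
`E` is absolutely continuous, and its derivative (which exists almost everywhere) is of bounded
variation, that is, it agrees almost everywhere with a function of bounded variation on `ℝ`. -/
structure IsSievingFunction (E : ℝ → ℝ) : Prop where
  even : ∀ x, E (-x) = E x
  zero : E 0 = 1
  support : ∀ x, 1 < |x| → E x = 0
  abs_cont : ∀ a b : ℝ, AbsolutelyContinuousOnInterval E a b
  deriv_bv : ∃ g : ℝ → ℝ, BoundedVariationOn g Set.univ ∧ ∀ᵐ x : ℝ, HasDerivAt E (g x) x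

/-- The constant `A^E = ∫_0^1 E(ν) dν`. -/
def sieveMean (E : ℝ → ℝ) : ℝ := ∫ x in (0 : ℝ)..1, E x

/-- The coefficients `Λ(n) Λ(n + 2r)`. -/
def pairCoeff (r : ℕ) (n : ℕ) : ℂ :=
  ((ArithmeticFunction.vonMangoldt n * ArithmeticFunction.vonMangoldt (n + 2 * r) : ℝ) : ℂ)

/-- The Dirichlet series `D_{2r}(s) = ∑_{n ≥ 1} Λ(n) Λ(n + 2r) n^{-2s}`. -/
def pairSeries (r : ℕ) (s : ℂ) : ℂ := LSeries (pairCoeff r) (2 * s)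

/-- `Φ^λ(s) = D_0(s) + 2 ∑_{0 < 2r ≤ λ} E(2r/λ) D_{2r}(s)`. -/
def weightedPairSum (E : ℝ → ℝ) (lam : ℝ) (s : ℂ) : ℂ :=
  pairSeries 0 s +
    2 * ∑ r ∈ Finset.Icc 1 ⌊lam / 2⌋₊, (E (2 * (r : ℝ) / lam) : ℂ) * pairSeries r s

/-- The Fourier transform `∫_ℝ E(ν/λ) e^{-iνt} dν` of `ν ↦ E(ν/λ)`. -/
def sieveFourier (E : ℝ → ℝ) (lam : ℝ) (t : ℝ) : ℂ :=
  ∫ x : ℝ, (E (x / lam) : ℂ) * Complex.exp (-Complex.I * (x : ℂ) * (t : ℂ))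

/-- `M` is the Mellin transform `M^λ`: for `0 < Re z < 1` it is given by the absolutely convergent
integral `(1/π) ∫_0^∞ Ê^λ(t) t^{-z} dt`, and on the half-plane `Re z > -1` it is meromorphic, with
at most simple poles, which can lie only at `1, 3, 5, …`. By the identity theorem this determines
`M` on that half-plane, up to its irrelevant values at `1, 3, 5, …`. -/
structure IsMellinTransform (E : ℝ → ℝ) (lam : ℝ) (M : ℂ → ℂ) : Prop where
  integrable : ∀ z : ℂ, 0 < z.re → z.re < 1 →
    IntegrableOn (fun t : ℝ => sieveFourier E lam t * (t : ℂ) ^ (-z)) (Set.Ioi 0)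
  eq_integral : ∀ z : ℂ, 0 < z.re → z.re < 1 →
    M z = 1 / (Real.pi : ℂ) * ∫ t in Set.Ioi (0 : ℝ), sieveFourier E lam t * (t : ℂ) ^ (-z)
  analytic : ∀ z : ℂ, -1 < z.re → (∀ k : ℕ, z ≠ 2 * (k : ℂ) + 1) → AnalyticAt ℂ M z
  meromorphic : ∀ k : ℕ, MeromorphicAt M (2 * (k : ℂ) + 1)
  simple_poles : ∀ k : ℕ, (-1 : ℤ) ≤ meromorphicOrderAt M (2 * (k : ℂ) + 1)

/-- The complex (nontrivial) zeros of the Riemann zeta function. -/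
def zetaZeros : Set ℂ := {ρ | riemannZeta ρ = 0 ∧ 0 < ρ.re ∧ ρ.re < 1}

/-- The multiplicity of a zero of the zeta function. All sums over zeros below are weighted with
it, so that each zero is counted according to its multiplicity. -/
def zetaMult (ρ : ℂ) : ℂ := (analyticOrderNatAt riemannZeta ρ : ℂ)

/-- The symmetric sum `∑_ρ f(ρ)` over the complex zeros (with multiplicity) converges to `L`:
`L = lim_{T → ∞} ∑_{|Im ρ| ≤ T} f(ρ)`. Each of the partial sums is over a finite set of zeros. -/
def HasSymmetricZeroSum (f : ℂ → ℂ) (L : ℂ) : Prop :=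
  Tendsto (fun T : ℝ => ∑ᶠ ρ ∈ {ρ : ℂ | ρ ∈ zetaZeros ∧ |ρ.im| ≤ T}, zetaMult ρ * f ρ)
    atTop (𝓝 L)

/-- The term `Γ(ρ-s) M(ρ-s) cos(π(ρ-s)/2)` of the single series, with multiplicity. -/
def singleTerm (M : ℂ → ℂ) (s : ℂ) (ρ : zetaZeros) : ℂ :=
  zetaMult ρ * (Complex.Gamma (ρ - s) * M (ρ - s) *
    Complex.cos ((Real.pi : ℂ) * (ρ - s) / 2))

/-- The term `Γ(ρ'-s) Γ(ρ''-s) M(ρ'+ρ''-2s) cos(π(ρ'-ρ'')/2)` of the double series, with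
multiplicities. -/
def doubleTerm (M : ℂ → ℂ) (s : ℂ) (p : zetaZeros × zetaZeros) : ℂ :=
  zetaMult p.1 * zetaMult p.2 *
    (Complex.Gamma (p.1 - s) * Complex.Gamma (p.2 - s) * M (p.1 + p.2 - 2 * s) *
      Complex.cos ((Real.pi : ℂ) * (p.1 - p.2) / 2))

/-- The function `Σ^λ(s)`, built from `M = M^λ`. -/
def zeroSum (M : ℂ → ℂ) (s : ℂ) : ℂ :=
  (deriv riemannZeta s / riemannZeta s) ^ 2 +
    2 * (deriv riemannZeta s / riemannZeta s) * ∑' ρ : zetaZeros, singleTerm M s ρ +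
    ∑' p : zetaZeros × zetaZeros, doubleTerm M s p

end

open Complex (I Gamma sin cos norm_real re sub_re ofReal_re continuous_re ofReal_ne_zero
  abs_im_le_norm Gamma_ne_zero_of_re_pos sub_im add_re Gamma_add_one add_im zero_re one_re
  norm_exp neg_re norm_cpow_eq_rpow_re_of_pos cpow_neg continuous_ofReal abs_re_le_norm one_im
  ofReal_zero measurable_ofReal cpow_add real_smul norm_le_abs_re_add_abs_im
  differentiableOn_tsum_of_summable_norm Gamma_mul_Gamma_one_sub re_le_norm ofReal_im
  ofReal_eq_zero norm_ofNat norm_natCast_cpow_of_pos mul_im integral_cpow_mul_exp_neg_mul_Ioi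
  conj_conj I_re I_im Gamma_one sin_two_mul sin_add_pi_div_two mem_reProdIm inv_cpow im
  differentiableOn_dslope differentiableAt_Gamma cos_eq_zero_iff arg_ofReal_of_nonneg I_sq)
open Filter.Eventually (of_forall)
open Metric (ball closedBall isOpen_ball mem_ball_self ball_mem_nhds ball_subset_ball mem_ball
  sphere_subset_closedBall)
open Set (Ioi Ioc Icc indicator_of_mem indicator Iic indicator_of_notMem Iio mem_Ioi uIcc_of_le
  mem_Ioc mem_ofPred_eq mem_Iio Ioc_subset_Ioi_self Ioc_eq_empty)
open Real (exp rpow_add norm_of_nonneg rpow_le_rpow_of_exponent_le rpow_neg log rpow_neg_one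
  pi_pos rpow_le_rpow pi_ne_zero norm_eq_abs rpow_natCast rpow_le_rpow_of_nonpos exp_le_exp
  rpow_one mul_rpow exp_add one_le_rpow div_rpow exp_pos rpow_nonneg rpow_le_rpow_of_exponent_ge
  log_nonneg integral_rpow_mul_exp_neg_mul_Ioi exp_neg cosh)
open Or (inr inl)
open Nat (cast_nonneg)
open Finset (sum_congr sum_range_succ sum_add_distrib mul_sum)
open ENNReal (ofReal toReal_ofReal)
open scoped Real

/-! Put `f(x) = E(x/λ)`, let `d` be the derivative of `f` (odd, of bounded variation, supported in
`[-λ, λ]`), and let `K(z,v) = Γ(z+1) Γ(v+1) M(z+v) cos(π(z-v)/2)` be the kernel `sieveKer`. The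
theorem rests on the fact that `K(z,v)/(zv)` plays the role of a double Mellin transform of `f(x-y)`
over `x, y > 0`. In `y` the transform is `n_x(z)/z`, where `n_x(v) = ∫_0^∞ y^v d(x-y) dy` is
`sieveConv`. In `x` the transform of `n_x(v)` is `K(z,v)/z`, by the Beta integral and the reflection
formula (`mellin_sieveConv_of_neg`, `mellin_sieveConv_of_pos`). Since `Γ(z+1) = zΓ(z)`, the summands
of `Σ^λ` are the residues of `ζ'/ζ(z+s) ζ'/ζ(z'+s) K(z,z')/(zz')` at zeros of zeta, so `Σ^λ(s)` is
one side of an explicit formula for `T(s) = ∑_{k,l} Λ(k)Λ(l)(kl)^{-s} f(k-l)`.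

The explicit formula is `zeroSum_eq`, proved for `3/4 < σ < 7/8`. The residue theorem `residue_sum`
is used between the lines `Re z = 1/4` and `Re z = -3/8`, in one variable and then in the other. On
the right line `ζ'/ζ(z+s)` is a Dirichlet series, and Mellin inversion gives back `n_k(v)` and
`f(k-l)`. Two right lines are never integrated jointly: the kernel bound decays only like
`|y|^{-1/2}` along `y' = -y` there. With one line on the left everything converges absolutely. The
outcome expresses `Σ^λ` through `T`, a sum over `k` of left-line integrals of `n_k`, the sum of
`Λ(k)k^{-s} n_k(1-s)/(1-s)`, single and double left-line integrals of `K`, and `K(1-s,1-s)/(1-s)^2`.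

Every term is then continued to `0 < σ < 7/8`, with `A = ∫_0^∞ f = A^E λ`. The left-line integrals
are analytic there because `Re(z+s)` stays between `-3/8` and `1/2`; for the sum over `k` the line
is moved further, to `Re z = -1`, when `k > λ` (`exists_convInt_sum`). The diagonal term has the
polar part `2A/(2s-1)` (`exists_sieveKer_diag`). As `n_k(1-s)/(1-s)` is close to `2A k^{-s}`, its
sum is `-2A ζ'/ζ(2s)` plus an analytic function (`exists_sieveConv_sum`). Finally `T` is `Φ^λ` plus
an analytic function (`exists_pair_sum`): an even difference `k-l` gives `D_{2r}` up to an analytic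
error, and an odd one forces `k` or `l` to be a power of 2. Inserting the partial fractions of
`ζ'/ζ(2s)` yields the stated formula: its pole at `2s = 1` contributes `4A/(2s-1)`, from which the
diagonal takes away `2A/(2s-1)`. The identity theorem extends the formula from `3/4 < σ < 7/8` to
`1/2 < σ < 1`.

Analytic input: under RH `ζ'/ζ` is `O(|t|^ε)` away from the critical line and the pole, by Landau's
lemma. In the kernel the exponentials of Stirling's bound cancel against the cosine, and only powers
of `|z|`, `|v|`, `|z+v|` remain (`exists_sieveKer_bound`). Bounded variation of `d` supplies one
power of decay. -/

section Bounds

variable {a b c d : ℝ}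

/-! ### Monotonicity of products and powers -/

theorem mul_bound (h : a ≤ b) (h' : c ≤ d) (hc : 0 ≤ c := by positivity)
    (hb : 0 ≤ b := by positivity) : a * c ≤ b * d :=
  mul_le_mul h h' hc hb

theorem mul_bound_left (h : b ≤ c) (ha : 0 ≤ a := by positivity) : a * b ≤ a * c := mul_le_mul_of_nonneg_left h ha

theorem mul_bound_right (h : b ≤ c) (ha : 0 ≤ a := by positivity) : b * a ≤ c * a := mul_le_mul_of_nonneg_right h ha

theorem rpow_bound (h : a ≤ b) (ha : 0 ≤ a := by positivity) (hc : 0 ≤ c := by linarith) : a ^ c ≤ b ^ c :=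
  rpow_le_rpow ha h hc

theorem rpow_bound_neg (h : a ≤ b) (ha : 0 < a := by positivity) (hc : c ≤ 0 := by linarith) : b ^ c ≤ a ^ c :=
  rpow_le_rpow_of_nonpos ha h hc

theorem rpow_bound_exp (h : 1 ≤ a) (h' : b ≤ c := by linarith) : a ^ b ≤ a ^ c := rpow_le_rpow_of_exponent_le h h'

end Bounds

/-! ### Integrals and series depending on a parameter -/

/-- A holomorphic family of functions, locally dominated by integrable functions, has a holomorphic
integral. -/
theorem differentiableOn_integral_of_locally_dominated {X : Type*} [MeasurableSpace X]
    {μ : Measure X} {U : Set ℂ} (hU : IsOpen U) {F : ℂ → X → ℂ}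
    (hmeas : ∀ s ∈ U, AEStronglyMeasurable (F s) μ)
    (hdiff : ∀ x, DifferentiableOn ℂ (fun s => F s x) U)
    (hbound : ∀ s₀ ∈ U, ∃ r > 0, ∃ g : X → ℝ, Integrable g μ ∧ ∀ s ∈ ball s₀ r, s ∈ U → ∀ x, ‖F s x‖ ≤ g x) :
    DifferentiableOn ℂ (fun s => ∫ x, F s x ∂μ) U := fun s₀ hs₀ => by
  obtain ⟨r₁, hr₁, g, hg, hFg⟩ := hbound s₀ hs₀
  obtain ⟨r₂, hr₂, hball⟩ := Metric.isOpen_iff.1 hU s₀ hs₀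
  set r := min r₁ r₂ with hr
  have hrpos : 0 < r := lt_min hr₁ hr₂
  have hrU : ball s₀ r ⊆ U := (ball_subset_ball (min_le_right _ _)).trans hball
  have hrb : ∀ s ∈ ball s₀ r, ∀ x, ‖F s x‖ ≤ g x := fun s hs x =>
    hFg s (ball_subset_ball (min_le_left _ _) hs) (hrU hs) x
  have hat : ∀ s ∈ ball s₀ r, ∀ x, HasDerivAt (fun s => F s x) (deriv (fun s => F s x) s) s :=
    fun s hs x => ((hdiff x).differentiableAt (hU.mem_nhds (hrU hs))).hasDerivAt
  refine (DifferentiableAt.differentiableWithinAt ?_)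
  refine (hasDerivAt_integral_of_dominated_loc_of_deriv_le (𝕜 := ℂ) (E := ℂ) (μ := μ)
    (bound := fun x => g x / (r / 3))
    (F' := fun s x => deriv (fun s => F s x) s) (s := ball s₀ (r / 2)) (x₀ := s₀)
    (ball_mem_nhds _ (by positivity)) ?_ ?_ ?_ ?_ ?_ ?_).2.differentiableAt
  · filter_upwards [hU.mem_nhds hs₀] with s hs using hmeas s hs
  · exact hg.mono' (hmeas s₀ hs₀) (of_forall (hrb s₀ (mem_ball_self hrpos)))
  · have hlim : Tendsto (fun n : ℕ => s₀ + ((r / 2 / ((n : ℝ) + 1) : ℝ) : ℂ)) atTop (𝓝[≠] s₀) := by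
      refine tendsto_nhdsWithin_iff.2 ⟨?_, of_forall fun n => ?_⟩
      · have h1 : Tendsto (fun n : ℕ => (r / 2 / ((n : ℝ) + 1) : ℝ)) atTop (𝓝 0) := by
          have := (tendsto_one_div_add_atTop_nhds_zero_nat (𝕜 := ℝ)).const_mul (r / 2)
          simpa [div_eq_mul_inv] using this
        have h2 := ((continuous_ofReal.tendsto 0).comp h1).const_add s₀
        simpa [Function.comp_def] using h2
      · have : (r / 2 / ((n : ℝ) + 1) : ℝ) ≠ 0 := by positivity
        simpa using (ofReal_ne_zero.2 this)
    refine aestronglyMeasurable_of_tendsto_ae (u := atTop)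
      (f := fun (n : ℕ) x => slope (fun s => F s x) s₀ (s₀ + ((r / 2 / ((n : ℝ) + 1) : ℝ) : ℂ)))
      (fun n => ?_) (of_forall fun x => ?_)
    · have hm : s₀ + ((r / 2 / ((n : ℝ) + 1) : ℝ) : ℂ) ∈ ball s₀ r := ?_
      · have := ((hmeas _ (hrU hm)).sub (hmeas _ hs₀)).const_smul ((s₀ + ((r / 2 / ((n : ℝ) + 1) : ℝ) : ℂ)) - s₀)⁻¹
        exact this
      rw [mem_ball, dist_eq_norm, add_sub_cancel_left, norm_real, norm_eq_abs, abs_of_nonneg (by positivity)]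
      calc r / 2 / ((n : ℝ) + 1) ≤ r / 2 := div_le_self (by positivity) (by simp)
        _ < r := by linarith
    · exact (hasDerivAt_iff_tendsto_slope.1 (hat s₀ (mem_ball_self hrpos) x)).comp hlim
  -- Cauchy's estimate on circles of radius `r/3` about points of the ball of radius `r/2`; these
  -- stay inside the ball of radius `r` because `1/2 + 1/3 < 1`.
  · refine of_forall fun x s hs => ?_
    refine Complex.norm_deriv_le_of_forall_mem_sphere_norm_le (by positivity) ?_ ?_
    · refine DifferentiableOn.diffContOnCl ?_
      refine (hdiff x).mono (Set.Subset.trans ?_ hrU)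
      rw [closure_ball _ (by positivity)]
      refine Metric.closedBall_subset_ball' ?_
      have := mem_ball.1 hs
      linarith
    · intro z hz
      refine hrb z ?_ x
      rw [mem_ball]
      have h1 := mem_ball.1 hs
      have h2 := Metric.mem_sphere.1 hz
      linarith [dist_triangle z s s₀]
  · exact hg.div_const _
  · refine of_forall fun x s hs => hat s (ball_subset_ball (by linarith) hs) x

/-- Termwise integration of a series whose absolute values have an integrable sum. -/
theorem hasSum_integral_of_tsum_norm_le {α ι : Type*} [MeasurableSpace α] {μ : Measure α}
    [Countable ι] {F : ι → α → ℂ} {g : α → ℝ} (hF : ∀ i, AEStronglyMeasurable (F i) μ)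
    (hs : ∀ a, Summable fun i => ‖F i a‖) (hg : ∀ a, ∑' i, ‖F i a‖ ≤ g a) (hgi : Integrable g μ) :
    (∀ i, Integrable (F i) μ) ∧ Summable (fun i => ∫ a, ‖F i a‖ ∂μ) ∧
      HasSum (fun i => ∫ a, F i a ∂μ) (∫ a, ∑' i, F i a ∂μ) := by
  have hint : ∀ i, Integrable (F i) μ := fun i =>
    hgi.mono' (hF i) (of_forall fun a => ((hs a).le_tsum i (fun j _ => norm_nonneg _)).trans (hg a))
  have hsum : Summable (fun i => ∫ a, ‖F i a‖ ∂μ) := by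
    have h1 : ∑' i, ∫⁻ a, ‖F i a‖ₑ ∂μ ≠ ⊤ := by
      rw [← lintegral_tsum (fun i => (hF i).enorm)]
      refine ne_of_lt (lt_of_le_of_lt (lintegral_mono (g := fun a => ofReal (g a)) fun a => ?_) hgi.lintegral_lt_top)
      calc ∑' i, ‖F i a‖ₑ = ∑' i, ofReal ‖F i a‖ := by simp only [ofReal_norm]
        _ = ofReal (∑' i, ‖F i a‖) := (ENNReal.ofReal_tsum_of_nonneg (fun i => norm_nonneg _) (hs a)).symm
        _ ≤ ofReal (g a) := ENNReal.ofReal_le_ofReal (hg a)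
    refine (ENNReal.summable_toReal h1).congr fun i => ?_
    rw [integral_norm_eq_lintegral_enorm (hF i)]
  exact ⟨hint, hsum, hasSum_integral_of_summable_integral_norm hint hsum⟩

/-! ### Power weights on the line and in the plane -/

theorem integrable_one_add_abs_rpow {η : ℝ} (hη : 0 < η) :
    Integrable (fun y : ℝ => (1 + |y|) ^ (-1 - η)) := by
  have := integrable_one_add_norm (E := ℝ) (μ := volume) (r := 1 + η) (by simpa using hη)
  refine this.congr (of_forall fun y => ?_)
  simp only [norm_eq_abs]
  congr 1
  ring

/-- A bound for `|y|^{-p} |y'|^{-p'} |y+y'|^{-q}`-type kernels by products of summable powers. -/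
theorem one_add_abs_kernel_le {p p' q η : ℝ} (y y' : ℝ) (hp' : 0 < p' := by linarith)
    (hq : 0 < q := by linarith) (h1 : 1 + η ≤ p + p' := by linarith)
    (h2 : 2 + 2 * η ≤ p + p' + q := by linarith) (h3 : 1 + η ≤ p + q := by linarith)
    (h4 : 1 + η ≤ p' + q := by linarith) :
    (1 + |y|) ^ (-p) * (1 + |y'|) ^ (-p') * (1 + |y + y'|) ^ (-q) ≤
      (2 ^ q + 2 ^ p') * ((1 + |y|) ^ (-1 - η) * (1 + |y'|) ^ (-1 - η) +
        (1 + |y|) ^ (-1 - η) * (1 + |y + y'|) ^ (-1 - η)) := by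
  set A := 1 + |y| with hA
  set B := 1 + |y'| with hB
  set D := 1 + |y + y'| with hD
  have hA1 : 1 ≤ A := by simp [hA]
  have hB1 : 1 ≤ B := by simp [hB]
  have hD1 : 1 ≤ D := by simp [hD]
  have hA0 : 0 < A := by linarith
  have hB0 : 0 < B := by linarith
  have hD0 : 0 < D := by linarith
  have hAB : A ≤ B + D := by grind
  have hBA : B ≤ A + D := by grind
  have e1 : 0 ≤ A ^ (-1 - η) * B ^ (-1 - η) := by positivity
  have e2 : 0 ≤ A ^ (-1 - η) * D ^ (-1 - η) := by positivity
  have c1 : (0 : ℝ) < 2 ^ q := by positivity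
  have c2 : (0 : ℝ) < 2 ^ p' := by positivity
  -- By the triangle inequality the two largest of `A`, `B`, `D` are comparable. Either `D` is at
  -- least half of each of the others, or `A ≤ 2B` and `D ≤ A`.
  have hcases : (A / 2 ≤ D ∧ B / 2 ≤ D) ∨ (A / 2 ≤ B ∧ D ≤ A) := by
    by_cases ha : A / 2 ≤ D
    · by_cases hb : B / 2 ≤ D
      · exact inl ⟨ha, hb⟩
      · exact inr ⟨by linarith, by linarith⟩
    · exact inr ⟨by linarith, by linarith⟩
  have key : ∀ {u v : ℝ} {e : ℝ}, 0 < u → u ≤ v → 0 ≤ e → v ^ (-e) ≤ u ^ (-e) := fun hu huv he =>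
    rpow_le_rpow_of_nonpos hu huv (by linarith)
  rcases hcases with ⟨ha, hb⟩ | ⟨ha, hd⟩
  -- The factor `D^{-q}` is shared out: `q₁` of the exponent goes to `A` and `q - q₁` to `B`, so
  -- that both exponents reach at least `1 + η`. The hypotheses `h2`, `h3`, `h4` make the interval
  -- of admissible `q₁` nonempty.
  · obtain ⟨q₁, hq₁0, hq₁q, hq₁p, hq₁p'⟩ : ∃ q₁ : ℝ, 0 ≤ q₁ ∧ q₁ ≤ q ∧ 1 + η - p ≤ q₁ ∧ q₁ ≤ p' + q - 1 - η :=
      ⟨max 0 (1 + η - p), le_max_left _ _, max_le hq.le (by linarith), le_max_right _ _,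
        max_le (by linarith) (by linarith)⟩
    have hD1' : D ^ (-q) ≤ 2 ^ q * (A ^ (-q₁) * B ^ (-(q - q₁))) := by
      calc D ^ (-q) = D ^ (-q₁) * D ^ (-(q - q₁)) := by
            rw [← rpow_add hD0]; congr 1; ring
        _ ≤ (A / 2) ^ (-q₁) * (B / 2) ^ (-(q - q₁)) := by
            gcongr ?_ * ?_
            · exact key (by positivity) ha hq₁0
            · exact key (by positivity) hb (by linarith)
        _ = 2 ^ q * (A ^ (-q₁) * B ^ (-(q - q₁))) := by
            rw [div_rpow hA0.le (by norm_num), div_rpow hB0.le (by norm_num),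
              rpow_neg (by norm_num : (0 : ℝ) ≤ 2), rpow_neg (by norm_num : (0 : ℝ) ≤ 2)]
            have : (2 : ℝ) ^ q = 2 ^ q₁ * 2 ^ (q - q₁) := by rw [← rpow_add (by norm_num)]; congr 1; ring
            rw [this]; field_simp
    calc A ^ (-p) * B ^ (-p') * D ^ (-q)
        ≤ A ^ (-p) * B ^ (-p') * (2 ^ q * (A ^ (-q₁) * B ^ (-(q - q₁)))) := by gcongr
      _ = 2 ^ q * ((A ^ (-p) * A ^ (-q₁)) * (B ^ (-p') * B ^ (-(q - q₁)))) := by ring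
      _ = 2 ^ q * (A ^ (-p + -q₁) * B ^ (-p' + -(q - q₁))) := by rw [rpow_add hA0, rpow_add hB0]
      _ ≤ 2 ^ q * (A ^ (-1 - η) * B ^ (-1 - η)) := by
          gcongr ?_ * (?_ * ?_)
          · exact rpow_bound_exp hA1
          · exact rpow_bound_exp hB1
      _ ≤ _ := by nlinarith
  -- If `q < 1 + η`, the decay missing in `D` is borrowed from `A`, which is allowed since `D ≤ A`;
  -- the factor in `B` is first replaced by one in `A`.
  · set q' := max q (1 + η) with hq'
    have hq'q : q ≤ q' := le_max_left _ _
    have hq'η : 1 + η ≤ q' := le_max_right _ _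
    have hq'le : q' - q - p - p' ≤ -1 - η := by
      rcases max_choice q (1 + η) with h | h <;> rw [← hq'] at h <;> linarith
    calc A ^ (-p) * B ^ (-p') * D ^ (-q)
        ≤ A ^ (-p) * (A / 2) ^ (-p') * (D ^ (-q') * A ^ (q' - q)) := by
          gcongr ?_ * ?_ * ?_
          · exact key (by positivity) ha hp'.le
          · calc D ^ (-q) = D ^ (-q') * D ^ (q' - q) := by
                  rw [← rpow_add hD0]; congr 1; ring
              _ ≤ _ := by gcongr
      _ = 2 ^ p' * (A ^ (q' - q - p - p') * D ^ (-q')) := by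
          rw [div_rpow hA0.le (by norm_num), rpow_neg (by norm_num : (0 : ℝ) ≤ 2)]
          have : A ^ (q' - q - p - p') = A ^ (-p) * A ^ (-p') * A ^ (q' - q) := by
            rw [← rpow_add hA0, ← rpow_add hA0]; congr 1; ring
          rw [this]; field_simp
      _ ≤ 2 ^ p' * (A ^ (-1 - η) * D ^ (-1 - η)) := by
          gcongr ?_ * (?_ * ?_)
          · exact rpow_bound_exp hA1
          · exact rpow_bound_exp hD1
      _ ≤ _ := by nlinarith

/-! ### Vertical line integrals and Cauchy's theorem in a strip -/

/-- The normalized integral `(2πi)⁻¹ ∫ F(z) dz` over the vertical line `Re z = c`. -/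
noncomputable def vline (c : ℝ) (F : ℂ → ℂ) : ℂ :=
  (1 / (2 * (π : ℂ))) * ∫ y : ℝ, F (c + y * I)

theorem continuous_vertical {F : ℂ → ℂ} {c : ℝ} (hF : ∀ z : ℂ, z.re = c → ContinuousAt F z) :
    Continuous fun y : ℝ => F (c + y * I) := by
  refine continuous_iff_continuousAt.2 fun y => ?_
  refine ContinuousAt.comp (f := fun y : ℝ => (c + y * I : ℂ)) (hF _ (by simp)) ?_
  fun_prop

theorem exists_bound_of_decay {f : ℝ → ℂ} (hf : Continuous f) {C p Y : ℝ}
    (h : ∀ y, Y ≤ |y| → ‖f y‖ ≤ C * (1 + |y|) ^ (-p)) :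
    ∃ C', 0 ≤ C' ∧ ∀ y, ‖f y‖ ≤ C' * (1 + |y|) ^ (-p) := by
  have hc : Continuous fun y : ℝ => ‖f y‖ * (1 + |y|) ^ p :=
    hf.norm.mul ((continuous_const.add continuous_abs).rpow_const fun y => inl (by positivity : (0:ℝ) < 1 + |y|).ne')
  obtain ⟨C₁, hC₁⟩ := (isCompact_Icc (a := -Y) (b := Y)).exists_bound_of_continuousOn hc.continuousOn
  refine ⟨max (max C C₁) 0, le_max_right _ _, fun y => ?_⟩
  by_cases hy : Y ≤ |y|
  · refine (h y hy).trans ?_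
    gcongr
    exact (le_max_left _ _).trans (le_max_left _ _)
  · have hy' : y ∈ Icc (-Y) Y := abs_le.1 (not_le.1 hy).le
    have h2 := hC₁ y hy'
    rw [norm_of_nonneg (by positivity)] at h2
    have hpos : 0 < (1 + |y|) ^ p := by positivity
    rw [rpow_neg (by positivity), ← div_eq_mul_inv, le_div_iff₀ hpos]
    exact h2.trans ((le_max_right _ _).trans (le_max_left _ _))

theorem integrable_of_decay {f : ℝ → ℂ} (hf : Continuous f) {C η Y : ℝ} (hη : 0 < η)
    (h : ∀ y, Y ≤ |y| → ‖f y‖ ≤ C * (1 + |y|) ^ (-1 - η)) : Integrable f := by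
  have h' : ∀ y, Y ≤ |y| → ‖f y‖ ≤ C * (1 + |y|) ^ (-(1 + η)) := fun y hy => by rw [neg_add']; exact h y hy
  obtain ⟨C', -, hC'⟩ := exists_bound_of_decay hf h'
  refine ((integrable_one_add_abs_rpow hη).const_mul C').mono' hf.aestronglyMeasurable (of_forall fun y => ?_)
  rw [← neg_add']; exact hC' y

/-- Cauchy's theorem for a vertical strip. -/
theorem vline_eq_of_decay {F : ℂ → ℂ} {a b C η Y : ℝ} (hab : b ≤ a)
    (hd : ∀ z : ℂ, b ≤ z.re → z.re ≤ a → DifferentiableAt ℂ F z) (hη : 0 < η)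
    (hF : ∀ z : ℂ, b ≤ z.re → z.re ≤ a → Y ≤ |z.im| → ‖F z‖ ≤ C * (1 + |z.im|) ^ (-1 - η)) :
    vline a F = vline b F := by
  have hline : ∀ c : ℝ, b ≤ c → c ≤ a → Integrable fun y : ℝ => F (c + y * I) := fun c h1 h2 => by
    refine integrable_of_decay (C := C) (Y := Y) (continuous_vertical fun z hz =>
      (hd z (hz ▸ h1) (hz ▸ h2)).continuousAt) hη fun y hy => ?_
    have := hF (c + y * I) (by simpa using h1) (by simpa using h2) (by simpa using hy)
    simpa using this
  have hlim : ∀ c : ℝ, b ≤ c → c ≤ a → Tendsto (fun T : ℝ => ∫ y in (-T)..T, F (c + y * I))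
      atTop (𝓝 (∫ y : ℝ, F (c + y * I))) := fun c h1 h2 =>
    intervalIntegral_tendsto_integral (hline c h1 h2) tendsto_neg_atTop_atBot tendsto_id
  have hdecay : Tendsto (fun T : ℝ => C * (1 + |T|) ^ (-1 - η) * |a - b|) atTop (𝓝 0) := by
    have h1 : Tendsto (fun T : ℝ => (1 + |T|) ^ (-(1 + η))) atTop (𝓝 0) :=
      (tendsto_rpow_neg_atTop (by linarith)).comp (tendsto_atTop_add_const_left _ _ tendsto_abs_atTop_atTop)
    have h2 := (h1.const_mul C).mul_const |a - b|
    simp only [mul_zero, zero_mul] at h2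
    refine h2.congr fun T => ?_
    rw [neg_add']
  -- The two horizontal sides are treated together; `ε = ±1` selects the upper or the lower one.
  have hhor : ∀ ε : ℝ, |ε| = 1 → Tendsto (fun T : ℝ => ∫ x in b..a, F (x + (ε * T : ℝ) * I))
      atTop (𝓝 0) := fun ε hε => by
    refine squeeze_zero_norm' ?_ hdecay
    filter_upwards [eventually_ge_atTop (max Y 0)] with T hT
    refine intervalIntegral.norm_integral_le_of_norm_le_const fun x hx => ?_
    rw [Set.uIoc_of_le hab] at hx
    have habs : |ε * T| = |T| := by rw [abs_mul, hε, one_mul]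
    have := hF (x + (ε * T : ℝ) * I) (by simpa using hx.1.le) (by simpa using hx.2)
      (by simp only [add_im, ofReal_im, mul_im, ofReal_re, I_im, mul_one, I_re, mul_zero, add_zero, zero_add]
          rw [habs, abs_of_nonneg ((le_max_right _ _).trans hT)]
          exact (le_max_left _ _).trans hT)
    simp only [add_im, ofReal_im, mul_im, ofReal_re, I_im, mul_one, I_re, mul_zero, add_zero, zero_add] at this
    rwa [habs] at this
  have hrect : ∀ T : ℝ, 0 ≤ T → ((∫ x in b..a, F (x + ((-1 : ℝ) * T : ℝ) * I)) -
        ∫ x in b..a, F (x + ((1 : ℝ) * T : ℝ) * I)) +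
      I * (∫ y in (-T)..T, F (a + y * I)) -
      I * (∫ y in (-T)..T, F (b + y * I)) = 0 := fun T hT => by
    have := Complex.integral_boundary_rect_eq_zero_of_differentiableOn F
      (b + (-T : ℝ) * I) (a + (T : ℝ) * I) (fun z hz => by
        rw [mem_reProdIm] at hz
        have h1 : z.re ∈ Set.uIcc b a := by simpa using hz.1
        rw [uIcc_of_le hab] at h1
        exact (hd z h1.1 h1.2).differentiableWithinAt)
    simpa using this
  have hlim0 := (((hhor (-1) (by simp)).sub (hhor 1 (by simp))).add
    ((hlim a hab le_rfl).const_mul I)).sub ((hlim b le_rfl hab).const_mul I)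
  have hzero := tendsto_nhds_unique (hlim0.congr' (by
    filter_upwards [eventually_ge_atTop (0 : ℝ)] with T hT using hrect T hT)) tendsto_const_nhds
  have : I * ((∫ y : ℝ, F (a + y * I)) - ∫ y : ℝ, F (b + y * I)) = 0 := by linear_combination hzero
  have := (mul_eq_zero.1 this).resolve_left Complex.I_ne_zero
  rw [vline, vline, sub_eq_zero.1 this]

theorem integral_univ_div_sq_add_sq {u : ℝ} (hu : u ≠ 0) :
    ∫ y : ℝ, u / (u ^ 2 + y ^ 2) = π * SignType.sign u := by
  have h1 : ∀ y : ℝ, u / (u ^ 2 + y ^ 2) = u⁻¹ * (1 + (y / u) ^ 2)⁻¹ := fun y => by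
    have : u ^ 2 + y ^ 2 ≠ 0 := by positivity
    field_simp
  simp_rw [h1]
  rw [integral_const_mul, Measure.integral_comp_div (fun y : ℝ => (1 + y ^ 2)⁻¹) u,
    integral_univ_inv_one_add_sq, smul_eq_mul]
  rcases lt_or_gt_of_ne hu with h | h
  · rw [abs_of_neg h, sign_neg h]; field_simp; simp
  · rw [abs_of_pos h, sign_pos h]; field_simp; simp

/-- Pairing `y` with `-y` turns `1/(c+iy)` into a multiple of the Poisson kernel `c/(c²+y²)`, whose
integral is `π` times the sign of `c`. The difference of two such fractions is needed for absolute
convergence. The jump of the sign across a pole is what produces the residue later on. -/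
theorem integral_vertical_inv_sub_inv {u w : ℝ} (hu : u ≠ 0) (hw : w ≠ 0) :
    Integrable (fun y : ℝ => 1 / ((u : ℂ) + y * I) - 1 / ((w : ℂ) + y * I)) ∧
    ∫ y : ℝ, (1 / ((u : ℂ) + y * I) - 1 / ((w : ℂ) + y * I)) = π * (SignType.sign u - SignType.sign w : ℝ) := by
  have hne : ∀ {c : ℝ} (y : ℝ), c ≠ 0 → (c : ℂ) + y * I ≠ 0 := fun {c} y hc h => by
    have := congrArg re h; simp at this; exact hc this
  have hnorm : ∀ {c : ℝ} (y : ℝ), |y| ≤ ‖(c : ℂ) + y * I‖ := fun {c} y => by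
    simpa using abs_im_le_norm ((c : ℂ) + y * I)
  have hint : Integrable
      (fun y : ℝ => 1 / ((u : ℂ) + y * I) - 1 / ((w : ℂ) + y * I)) := by
    refine integrable_of_decay (C := 4 * |w - u|) (η := 1) (Y := 1) ?_ one_pos fun y hy => ?_
    · have := fun y => hne y hu
      have := fun y => hne y hw
      fun_prop (disch := simp_all)
    · rw [div_sub_div _ _ (hne y hu) (hne y hw), norm_div, norm_mul]
      have h1 : ‖1 * ((w : ℂ) + y * I) - ((u : ℂ) + y * I) * 1‖ = |w - u| := by
        rw [show 1 * ((w : ℂ) + y * I) - ((u : ℂ) + y * I) * 1 = ((w - u : ℝ) : ℂ) by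
          push_cast; ring, norm_real, norm_eq_abs]
      rw [h1, show (-1 - 1 : ℝ) = -(2 : ℕ) by norm_num, rpow_neg (by positivity),
        rpow_natCast, mul_comm (4 : ℝ), mul_assoc, div_eq_mul_inv]
      gcongr
      rw [← div_eq_mul_inv, inv_le_comm₀ (by
        have := norm_pos_iff.2 (hne y hu); have := norm_pos_iff.2 (hne y hw); positivity)
        (by positivity)]
      rw [inv_div]
      calc (1 + |y|) ^ 2 / 4 ≤ |y| * |y| := by nlinarith
        _ ≤ _ := mul_bound (hnorm y) (hnorm y)
  refine ⟨hint, ?_⟩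
  have hi : ∀ {c : ℝ}, c ≠ 0 → Integrable fun y : ℝ => c / (c ^ 2 + y ^ 2) := fun {c} hc => by
    by_contra h
    have h2 := integral_univ_div_sq_add_sq hc
    rw [integral_undef h] at h2
    rcases lt_or_gt_of_ne hc with h' | h'
    · rw [sign_neg h'] at h2; simp [pi_ne_zero] at h2
    · rw [sign_pos h'] at h2; simp at h2; exact pi_ne_zero h2.symm
  have hsum : ∀ {c : ℝ}, c ≠ 0 → ∀ y : ℝ, 1 / ((c : ℂ) + y * I) +
      1 / ((c : ℂ) + ((-y : ℝ) : ℂ) * I) = 2 * ((c / (c ^ 2 + y ^ 2) : ℝ) : ℂ) := fun {c} hc y => by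
    have h3 : (c : ℂ) ^ 2 + (y : ℂ) ^ 2 ≠ 0 := by
      have : (c ^ 2 + y ^ 2 : ℝ) ≠ 0 := by positivity
      exact_mod_cast this
    have h4 := hne y hc
    have h5 := hne (-y) hc
    have h6 : ((c : ℂ) + y * I) * ((c : ℂ) + ((-y : ℝ) : ℂ) * I) =
        (c : ℂ) ^ 2 + (y : ℂ) ^ 2 := by
      push_cast; linear_combination (-(y : ℂ) ^ 2) * I_sq
    rw [div_add_div _ _ h4 h5, h6]
    push_cast
    field_simp
    ring
  set f : ℝ → ℂ := fun y => 1 / ((u : ℂ) + y * I) - 1 / ((w : ℂ) + y * I) with hf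
  have h2 : (∫ y, f y) + ∫ y, f y = 2 * (π * (SignType.sign u - SignType.sign w : ℝ)) := by
    nth_rewrite 2 [← integral_neg_eq_self f]
    rw [← integral_add hint hint.comp_neg]
    have : ∀ y, f y + f (-y) = 2 * ((u / (u ^ 2 + y ^ 2) - w / (w ^ 2 + y ^ 2) : ℝ) : ℂ) := fun y => by
      have e1 := hsum hu y
      have e2 := hsum hw y
      simp only [hf]
      push_cast at e1 e2 ⊢
      linear_combination e1 - e2
    simp_rw [this]
    rw [integral_const_mul, integral_complex_ofReal, integral_sub (hi hu) (hi hw),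
      integral_univ_div_sq_add_sq hu, integral_univ_div_sq_add_sq hw]
    push_cast; ring
  have : (2 : ℂ) ≠ 0 := two_ne_zero
  have h3 : 2 * (∫ y, f y) = 2 * (π * (SignType.sign u - SignType.sign w : ℝ)) := by rw [← h2]; ring
  exact mul_left_cancel₀ this h3

theorem one_add_abs_le_two_mul_norm_sub {z p : ℂ} (h : 2 * |p.im| + 2 ≤ |z.im|) :
    (1 + |z.im|) / 2 ≤ ‖z - p‖ := by
  have h1 : |z.im| - |p.im| ≤ ‖z - p‖ := (abs_sub_abs_le_abs_sub _ _).trans (by simpa using abs_im_le_norm (z - p))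
  linarith

theorem integrable_vertical_div_sub {h : ℂ → ℂ} {c C η : ℝ} {p : ℂ} (hc : c ≠ p.re)
    (hd : ∀ z : ℂ, z.re = c → ContinuousAt h z) (hη : 0 < η)
    (hh : ∀ z : ℂ, z.re = c → ‖h z‖ ≤ C * (1 + |z.im|) ^ (-η)) :
    Integrable fun y : ℝ => h (c + y * I) / (c + y * I - p) := by
  refine integrable_of_decay (C := 2 * C) (Y := 2 * |p.im| + 2)
    (continuous_vertical (F := fun z => h z / (z - p)) fun z hz => ?_) hη fun y hy => ?_
  · refine (hd z hz).div (by fun_prop) (sub_ne_zero.2 fun hzp => hc ?_)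
    rw [← hz, hzp]
  · have h1 := one_add_abs_le_two_mul_norm_sub (z := c + y * I) (p := p) (by simpa using hy)
    have h2 := hh (c + y * I) (by simp)
    simp only [add_im, ofReal_im, mul_im, ofReal_re, I_im, mul_one, I_re, mul_zero, add_zero, zero_add] at h1 h2
    rw [norm_div, sub_eq_add_neg (-1 : ℝ), rpow_add (by positivity), rpow_neg_one]
    calc _ ≤ C * (1 + |y|) ^ (-η) / ((1 + |y|) / 2) :=
          div_le_div₀ ((norm_nonneg _).trans h2) h2 (by positivity) h1
      _ = _ := by field_simp

/-- Cauchy's formula for a vertical strip. -/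
theorem isOpen_strip (a b : ℝ) : IsOpen {s : ℂ | a < s.re ∧ s.re < b} :=
  (isOpen_lt continuous_const continuous_re).inter (isOpen_lt continuous_re continuous_const)

theorem ne_zero_of_re_ne {z : ℂ} (h : z.re ≠ 0) : z ≠ 0 := fun h0 => h (by rw [h0, zero_re])

/-- Since `h` may decay arbitrarily slowly, the pole is removed by subtracting `h(p)(1/(z-p) -
1/(z-q))`, which still decays quadratically. What is left is holomorphic in the strip and has equal
integrals over both lines; the subtracted part is integrated explicitly. -/
theorem vline_sub_vline_div_sub {h : ℂ → ℂ} {a b C η : ℝ} {p : ℂ} (hb : b < p.re) (ha : p.re < a)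
    (hd : ∀ z : ℂ, b ≤ z.re → z.re ≤ a → DifferentiableAt ℂ h z) (hη : 0 < η)
    (hh : ∀ z : ℂ, b ≤ z.re → z.re ≤ a → ‖h z‖ ≤ C * (1 + |z.im|) ^ (-η)) :
    vline a (fun z => h z / (z - p)) - vline b (fun z => h z / (z - p)) = h p := by
  have hab : b ≤ a := (hb.trans ha).le
  have hC : 0 ≤ C := by
    have := (norm_nonneg _).trans (hh p hb.le ha.le)
    exact nonneg_of_mul_nonneg_left this (by positivity)
  -- An auxiliary pole one unit to the right of the strip. It lies on the same side of both lines,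
  -- so its contributions cancel in the difference.
  set q : ℂ := p + ((a - p.re + 1 : ℝ) : ℂ) with hq
  have hqre : q.re = a + 1 := by simp [hq]; ring
  have hqim : q.im = p.im := by simp [hq]
  set F : ℂ → ℂ := fun z => dslope h p z + h p / (z - q) with hF
  have hFne : ∀ z, z ≠ p → F z = h z / (z - p) - h p * (1 / (z - p) - 1 / (z - q)) := fun z hz => by
    simp only [hF, dslope_of_ne h hz, slope_def_field]
    ring
  have hzq : ∀ z : ℂ, z.re ≤ a → z - q ≠ 0 := fun z hz => ne_zero_of_re_ne (by rw [sub_re]; linarith)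
  have hFd : ∀ z : ℂ, b ≤ z.re → z.re ≤ a → DifferentiableAt ℂ F z := fun z h1 h2 => by
    refine DifferentiableAt.add ?_ ((differentiableAt_const _).div (by fun_prop) (hzq z h2))
    rcases eq_or_ne z p with rfl | hz
    · have hs := (isOpen_strip b a).mem_nhds ⟨hb, ha⟩
      refine ((differentiableOn_dslope hs).2 fun w hw => ?_).differentiableAt hs
      exact (hd w (le_of_lt hw.1) (le_of_lt hw.2)).differentiableWithinAt
    · exact (differentiableAt_dslope_of_ne hz).2 (hd z h1 h2)
  set η' := min η 1 with hη'
  have hη'0 : 0 < η' := lt_min hη one_pos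
  have hη1 : η' ≤ η := min_le_left _ _
  have hη2 : η' ≤ 1 := min_le_right _ _
  have hdecay : ∀ z : ℂ, b ≤ z.re → z.re ≤ a → 2 * |p.im| + 2 ≤ |z.im| →
      ‖F z‖ ≤ (2 * C + 4 * (‖h p‖ * ‖p - q‖)) * (1 + |z.im|) ^ (-1 - η') := fun z h1 h2 h3 => by
    have e1 := one_add_abs_le_two_mul_norm_sub h3
    have e2 := one_add_abs_le_two_mul_norm_sub (z := z) (p := q) (by rw [hqim]; exact h3)
    set A := 1 + |z.im| with hA
    have hA1 : 1 ≤ A := by simp [hA]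
    have hA0 : 0 < A := by linarith
    have hzp : z - p ≠ 0 := fun h0 => by rw [h0, norm_zero] at e1; linarith
    rw [hFne z (sub_ne_zero.1 hzp)]
    have e3 : h p * (1 / (z - p) - 1 / (z - q)) = h p * (p - q) / ((z - p) * (z - q)) := by
      field_simp [hzp, hzq z h2]
      ring
    rw [e3, add_mul]
    refine (norm_sub_le _ _).trans (add_le_add ?_ ?_)
    · rw [norm_div]
      calc _ ≤ C * A ^ (-η) / (A / 2) :=
            div_le_div₀ (by positivity) (hh z h1 h2) (by positivity) e1
        _ = 2 * C * (A ^ (-1 : ℝ) * A ^ (-η)) := by rw [rpow_neg_one]; field_simp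
        _ ≤ _ := by rw [← rpow_add hA0]; exact mul_bound_left (rpow_bound_exp hA1)
    · rw [norm_div, norm_mul, norm_mul]
      calc _ ≤ ‖h p‖ * ‖p - q‖ / ((A / 2) * (A / 2)) := by gcongr
        _ = 4 * (‖h p‖ * ‖p - q‖) * A ^ (-2 : ℝ) := by rw [rpow_neg hA0.le, Real.rpow_two]; field_simp; norm_num
        _ ≤ _ := mul_bound_left (rpow_bound_exp hA1)
  have hmain := vline_eq_of_decay hab hFd hη'0 hdecay
  have hker : ∀ c : ℝ, c ≠ p.re → c ≠ q.re →
      Integrable (fun y : ℝ => 1 / ((c : ℂ) + y * I - p) - 1 / (c + y * I - q)) ∧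
      ∫ y : ℝ, (1 / ((c : ℂ) + y * I - p) - 1 / (c + y * I - q)) =
        π * (SignType.sign (c - p.re) - SignType.sign (c - q.re) : ℝ) := fun c h1 h2 => by
    obtain ⟨i1, i2⟩ := integral_vertical_inv_sub_inv (sub_ne_zero.2 h1) (sub_ne_zero.2 h2)
    have e : ∀ y : ℝ, 1 / ((c : ℂ) + y * I - p) - 1 / (c + y * I - q) =
        (fun y : ℝ => 1 / (((c - p.re : ℝ) : ℂ) + y * I) -
          1 / (((c - q.re : ℝ) : ℂ) + y * I)) (y - p.im) := fun y => by
      have e1 : (c : ℂ) + y * I - p = ((c - p.re : ℝ) : ℂ) + ((y - p.im : ℝ) : ℂ) * I := by apply Complex.ext <;> simp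
      have e2 : (c : ℂ) + y * I - q = ((c - q.re : ℝ) : ℂ) + ((y - p.im : ℝ) : ℂ) * I := by
        apply Complex.ext <;> simp [hqim]
      rw [e1, e2]
    refine ⟨(i1.comp_sub_right p.im).congr (of_forall fun y => (e y).symm), ?_⟩
    simp_rw [e]
    rw [integral_sub_right_eq_self (fun y : ℝ => 1 / (((c - p.re : ℝ) : ℂ) + y * I) -
          1 / (((c - q.re : ℝ) : ℂ) + y * I)) p.im, i2]
  have hvl : ∀ c : ℝ, b ≤ c → c ≤ a → c ≠ p.re → vline c (fun z => h z / (z - p)) = vline c F + h p * ((1 / 2 : ℝ) *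
        (SignType.sign (c - p.re) - SignType.sign (c - q.re) : ℝ)) := fun c h1 h2 h3 => by
    have hcq : c ≠ q.re := by rw [hqre]; linarith
    obtain ⟨i1, i2⟩ := hker c h3 hcq
    have hi := integrable_vertical_div_sub h3 (fun z hz => (hd z (hz ▸ h1) (hz ▸ h2)).continuousAt) hη
      (fun z hz => hh z (hz ▸ h1) (hz ▸ h2))
    have : ∀ y : ℝ, F (c + y * I) = h (c + y * I) / (c + y * I - p) -
        h p * (1 / ((c : ℂ) + y * I - p) - 1 / (c + y * I - q)) := fun y =>
      hFne _ fun h0 => h3 (by rw [← h0]; simp)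
    simp only [vline]
    simp_rw [this]
    rw [integral_sub hi (i1.const_mul _), integral_const_mul, i2]
    generalize (∫ y : ℝ, h (c + y * I) / (c + y * I - p)) = J
    have : (π : ℂ) ≠ 0 := by exact_mod_cast pi_ne_zero
    field_simp
    push_cast
    ring
  rw [hvl a hab le_rfl ha.ne', hvl b le_rfl hab hb.ne, hmain, hqre,
    sign_pos (sub_pos.2 ha), sign_neg (sub_neg.2 hb), sign_neg (by linarith : a - (a + 1) < 0),
    sign_neg (by linarith : b - (a + 1) < 0)]
  simp
  ring

/-! ### Stirling's upper bound for the Gamma function -/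

/-- On `Re z = 1/2` one has `1 - z = conj z`, so the reflection formula gives `|Γ(z)|² = π /
cosh(πy)` exactly. -/
theorem norm_Gamma_one_half_add_le (y : ℝ) :
    ‖Gamma (1 / 2 + y * I)‖ ≤ 3 * exp (-(π * |y| / 2)) := by
  set z : ℂ := 1 / 2 + y * I with hz
  have h1 := Gamma_mul_Gamma_one_sub z
  have h2 : 1 - z = (starRingEnd ℂ) z := by apply Complex.ext <;> simp [hz]; norm_num
  rw [h2, Complex.Gamma_conj] at h1
  have h3 : sin (π * z) = Complex.cosh ((π * y : ℝ)) := by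
    rw [hz, show (π : ℂ) * (1 / 2 + y * I) =
      (π * y : ℝ) * I + π / 2 by push_cast; ring,
      sin_add_pi_div_two, Complex.cos_mul_I]
  have h4 : ‖Gamma z‖ ^ 2 = π / cosh (π * y) := by
    have := congrArg norm h1
    rw [norm_mul, RCLike.norm_conj, h3, norm_div, ← Complex.ofReal_cosh, norm_real,
      norm_real, norm_of_nonneg pi_pos.le,
      norm_of_nonneg (Real.cosh_pos _).le] at this
    rw [← this]; ring
  have h5 : exp (π * |y|) / 2 ≤ cosh (π * y) := by
    rw [← Real.cosh_abs, abs_mul, abs_of_pos pi_pos, Real.cosh_eq]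
    have := exp_pos (-(π * |y|))
    linarith
  refine le_of_sq_le_sq ?_ (by positivity) |> fun h => h
  rw [h4, mul_pow, ← Real.exp_nat_mul]
  calc π / cosh (π * y) ≤ π / (exp (π * |y|) / 2) := by
        gcongr
    _ = 2 * π * exp (-(π * |y|)) := by rw [exp_neg]; field_simp
    _ ≤ 3 ^ 2 * exp ((2 : ℕ) * -(π * |y| / 2)) := by
        rw [show ((2 : ℕ) : ℝ) * -(π * |y| / 2) = -(π * |y|) by push_cast; ring]
        gcongr
        nlinarith [Real.pi_lt_d2]

theorem norm_Gamma_le_Gamma_re {z : ℂ} (hz : 0 < z.re) : ‖Gamma z‖ ≤ Real.Gamma z.re := by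
  rw [Complex.Gamma_eq_integral hz, Complex.GammaIntegral, Real.Gamma_eq_integral hz]
  refine (norm_integral_le_integral_norm _).trans_eq ?_
  refine setIntegral_congr_fun measurableSet_Ioi fun t (ht : 0 < t) => ?_
  rw [norm_mul, norm_real, norm_cpow_eq_rpow_re_of_pos ht, norm_of_nonneg (exp_pos _).le]
  simp

-- Three lines theorem for `Γ(z) exp(-iπz/2 + (z - iy₀)²)` on `1/2 ≤ Re z ≤ 3/2`. The factor
-- `exp(-iπz/2)` compensates the decay of `Γ` in the upper half-plane. The Gaussian factor
-- concentrates at height `y₀`, so that on the right edge the growth in `Im z` can be replaced by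
-- growth in `y₀`.
open Complex.HadamardThreeLines in
theorem norm_Gamma_mul_exp_le {x : ℝ} (hx : 1 / 2 ≤ x) (hx' : x ≤ 3 / 2) (y₀ : ℝ) :
    ‖Gamma (x + y₀ * I)‖ * exp (π * y₀ / 2) ≤ 3 * exp 3 * (1 + |y₀|) ^ (x - 1 / 2) := by
  set g : ℂ → ℂ := fun z => Gamma z * Complex.exp (-I * π * z / 2 + (z - y₀ * I) ^ 2) with hg
  have hgn : ∀ z : ℂ, ‖g z‖ = ‖Gamma z‖ *
      exp (π * z.im / 2 + (z.re ^ 2 - (z.im - y₀) ^ 2)) := fun z => by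
    rw [hg, norm_mul, norm_exp]
    congr 2
    simp [pow_two]
  have hgd : ∀ z : ℂ, 0 < z.re → DifferentiableAt ℂ g z := fun z hz => by
    refine (differentiableAt_Gamma z fun m h => ?_).mul (by fun_prop)
    rw [h] at hz
    simp at hz
    linarith [(cast_nonneg m : (0 : ℝ) ≤ m)]
  have hbd : BddAbove ((norm ∘ g) '' verticalClosedStrip (1/2) (3/2)) := by
    obtain ⟨M, hM⟩ := (isCompact_Icc (a := (1 / 2 : ℝ)) (b := 3 / 2)).exists_bound_of_continuousOn
      (f := Real.Gamma) (fun t ht => (Real.differentiableAt_Gamma (fun m => by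
        have := ht.1; have : (0 : ℝ) ≤ m := cast_nonneg m; linarith)).continuousAt.continuousWithinAt)
    refine ⟨M * exp (3 + π * y₀ / 2 + π ^ 2 / 16), ?_⟩
    rintro _ ⟨z, hz, rfl⟩
    have hz' : z.re ∈ Icc (1 / 2 : ℝ) (3 / 2) := hz
    have h1 : ‖Gamma z‖ ≤ M := (norm_Gamma_le_Gamma_re (by linarith [hz'.1])).trans ((le_abs_self _).trans (hM _ hz'))
    simp only [Function.comp]
    rw [hgn]
    refine mul_le_mul h1 (exp_le_exp.2 ?_) (exp_pos _).le ((norm_nonneg _).trans h1)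
    nlinarith [hz'.1, hz'.2, sq_nonneg (z.im - y₀ - π / 4)]
  have hl : ∀ z ∈ re ⁻¹' {(1 / 2 : ℝ)}, ‖g z‖ ≤ 3 * exp 3 := fun z hz => by
    have hz : z.re = 1 / 2 := hz
    have hze : z = 1 / 2 + z.im * I := by apply Complex.ext <;> simp [hz]
    rw [hgn]
    have h1 := norm_Gamma_one_half_add_le z.im
    rw [← hze] at h1
    calc _ ≤ 3 * exp (-(π * |z.im| / 2)) *
          exp (π * z.im / 2 + (z.re ^ 2 - (z.im - y₀) ^ 2)) := by gcongr
      _ = 3 * exp (-(π * |z.im| / 2) + (π * z.im / 2 + (z.re ^ 2 - (z.im - y₀) ^ 2))) := by rw [mul_assoc, ← exp_add]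
      _ ≤ _ := by
          gcongr
          rw [hz]
          nlinarith [le_abs_self z.im, pi_pos, sq_nonneg (z.im - y₀)]
  have hr : ∀ z ∈ re ⁻¹' {(3 / 2 : ℝ)}, ‖g z‖ ≤ 3 * exp 3 * (1 + |y₀|) := fun z hz => by
    have hz : z.re = 3 / 2 := hz
    have hze : z = (1 / 2 + z.im * I) + 1 := by apply Complex.ext <;> simp [hz]; norm_num
    have hne : (1 / 2 + z.im * I : ℂ) ≠ 0 := fun h => by have := congrArg re h; simp at this
    have h1 := norm_Gamma_one_half_add_le z.im
    have h2 : ‖Gamma z‖ ≤ (1 + |z.im|) * (3 * exp (-(π * |z.im| / 2))) := by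
      conv_lhs => rw [hze, Gamma_add_one _ hne, norm_mul]
      gcongr
      refine (norm_add_le _ _).trans ?_
      simp
      norm_num
    have h3 : 1 + |z.im| ≤ (1 + |y₀|) * exp ((z.im - y₀) ^ 2 + 1 / 4) := by
      have e1 := abs_add_le y₀ (z.im - y₀)
      rw [add_sub_cancel] at e1
      have e2 : 1 + |z.im - y₀| ≤ exp ((z.im - y₀) ^ 2 + 1 / 4) := by
        have := Real.add_one_le_exp ((z.im - y₀) ^ 2 + 1 / 4)
        nlinarith [sq_abs (z.im - y₀), sq_nonneg (|z.im - y₀| - 1 / 2)]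
      calc 1 + |z.im| ≤ (1 + |y₀|) * (1 + |z.im - y₀|) := by
            nlinarith [abs_nonneg y₀, abs_nonneg (z.im - y₀)]
        _ ≤ _ := by gcongr
    rw [hgn]
    calc _ ≤ ((1 + |y₀|) * exp ((z.im - y₀) ^ 2 + 1 / 4)) *
            (3 * exp (-(π * |z.im| / 2))) *
          exp (π * z.im / 2 + (z.re ^ 2 - (z.im - y₀) ^ 2)) := by
            gcongr
            exact h2.trans (by gcongr)
      _ = (1 + |y₀|) * 3 * exp (((z.im - y₀) ^ 2 + 1 / 4) + -(π * |z.im| / 2) +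
          (π * z.im / 2 + (z.re ^ 2 - (z.im - y₀) ^ 2))) := by rw [exp_add (_ + -_), exp_add _ (-_)]; ring
      _ ≤ (1 + |y₀|) * 3 * exp 3 := by
          gcongr
          rw [hz]
          nlinarith [le_abs_self z.im, pi_pos]
      _ = _ := by ring
  have hmem : ((x : ℂ) + y₀ * I) ∈
      verticalClosedStrip (1/2) (3/2) := by
    simp only [verticalClosedStrip, Set.mem_preimage]
    constructor <;> simp <;> linarith
  have hmain := norm_le_interp_of_mem_verticalClosedStrip'
    (by norm_num : (1 / 2 : ℝ) < 3 / 2) hmem (DifferentiableOn.diffContOnCl fun z hz => by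
      refine (hgd z ?_).differentiableWithinAt
      rw [verticalStrip, Complex.closure_preimage_re, closure_Ioo (by norm_num)] at hz
      have := hz.1
      linarith) hbd hl hr
  have e1 : ((x : ℂ) + y₀ * I).re = x := by simp
  rw [hgn, e1] at hmain
  have e2 : ((x : ℂ) + y₀ * I).im = y₀ := by simp
  rw [e2, show (x - 1 / 2) / (3 / 2 - 1 / 2) = x - 1 / 2 by ring] at hmain
  calc _ ≤ ‖Gamma (x + y₀ * I)‖ *
        exp (π * y₀ / 2 + (x ^ 2 - (y₀ - y₀) ^ 2)) := by
          gcongr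
          nlinarith
    _ ≤ _ := hmain
    _ = _ := by
        generalize hK : 3 * exp 3 = K
        have hK0 : 0 < K := by rw [← hK]; positivity
        rw [mul_rpow hK0.le (by positivity), ← mul_assoc, ← rpow_add hK0]
        norm_num

theorem norm_Gamma_le_of_mem_strip {z : ℂ} (hx : 1 / 2 ≤ z.re) (hx' : z.re ≤ 3 / 2) : ‖Gamma z‖ ≤
      3 * exp 3 * (1 + |z.im|) ^ (z.re - 1 / 2) * exp (-(π * |z.im| / 2)) := by
  have h1 : ‖Gamma z‖ = ‖Gamma (z.re + |z.im| * I)‖ := by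
    rcases abs_choice z.im with h | h
    · rw [h, Complex.re_add_im]
    · have : ((z.re : ℂ) + (|z.im| : ℝ) * I) = (starRingEnd ℂ) z := by rw [h]; apply Complex.ext <;> simp
      rw [this, Complex.Gamma_conj, RCLike.norm_conj]
  have h2 := norm_Gamma_mul_exp_le hx hx' |z.im|
  rw [h1, exp_neg, ← div_eq_mul_inv, le_div_iff₀ (exp_pos _)]
  simpa using h2

/-- Stirling's upper bound for `Γ` in vertical strips, away from the real axis. -/
theorem exists_norm_Gamma_le_of_one_le (n : ℕ) : ∃ C : ℝ, 0 < C ∧ ∀ z : ℂ, 1 / 2 - n ≤ z.re →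
    z.re ≤ 3 / 2 + n → 1 ≤ |z.im| → ‖Gamma z‖ ≤ C * (1 + |z.im|) ^ (z.re - 1 / 2) * exp (-(π * |z.im| / 2)) := by
  induction n with
  | zero =>
    exact ⟨3 * exp 3, by positivity, fun z h1 h2 _ =>
      norm_Gamma_le_of_mem_strip (by simpa using h1) (by simpa using h2)⟩
  | succ n ih =>
    obtain ⟨C, hC, ih⟩ := ih
    refine ⟨C * (n + 3), by positivity, fun z h1 h2 h3 => ?_⟩
    push_cast at h1 h2
    set A := 1 + |z.im| with hA
    have hA0 : 0 < A := by positivity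
    have hn : (0 : ℝ) ≤ n := cast_nonneg n
    -- The strip grows by one unit on each side through `Γ(z+1) = zΓ(z)`. Dividing by `z` costs a
    -- factor 2, because `|Im z| ≥ 1`; multiplying by `z - 1` costs at most `n + 3`.
    by_cases c1 : z.re < 1 / 2 - n
    · have hz0 : z ≠ 0 := fun h => by rw [h] at h3; simp at h3; linarith
      have h4 := ih (z + 1) (by simp; linarith) (by simp; linarith) (by simpa using h3)
      rw [Gamma_add_one _ hz0, norm_mul] at h4
      simp only [add_re, one_re, add_im, one_im, add_zero, ← hA] at h4
      have h5 : A / 2 ≤ ‖z‖ := by linarith [abs_im_le_norm z]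
      have h6 : A / 2 * ‖Gamma z‖ ≤ C * A ^ (z.re + 1 - 1 / 2) * exp (-(π * |z.im| / 2)) :=
        (by gcongr : A / 2 * ‖Gamma z‖ ≤ ‖z‖ * ‖Gamma z‖).trans h4
      rw [show z.re + 1 - 1 / 2 = (z.re - 1 / 2) + 1 by ring, rpow_add hA0, rpow_one] at h6
      have h7 : ‖Gamma z‖ ≤
          2 * (C * A ^ (z.re - 1 / 2) * exp (-(π * |z.im| / 2))) := by
        refine le_of_mul_le_mul_left ?_ (by positivity : 0 < A / 2)
        linarith
      refine h7.trans ?_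
      rw [show C * (n + 3) * A ^ (z.re - 1 / 2) * exp (-(π * |z.im| / 2)) =
        (n + 3) * (C * A ^ (z.re - 1 / 2) * exp (-(π * |z.im| / 2))) by ring]
      gcongr
      linarith
    · by_cases c2 : 3 / 2 + n < z.re
      · have hz0 : z - 1 ≠ 0 := fun h => by have := congrArg im h; simp at this; rw [this] at h3; simp at h3; linarith
        have h4 := ih (z - 1) (by simp; linarith) (by simp; linarith) (by simpa using h3)
        simp only [sub_re, one_re, sub_im, one_im, sub_zero, ← hA] at h4
        have h5 : ‖z - 1‖ ≤ (n + 3) * A := by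
          refine (norm_le_abs_re_add_abs_im _).trans ?_
          simp only [sub_re, one_re, sub_im, one_im, sub_zero]
          rw [abs_of_nonneg (by linarith)]
          nlinarith [abs_nonneg z.im]
        have h6 : ‖Gamma z‖ = ‖z - 1‖ * ‖Gamma (z - 1)‖ := by rw [← norm_mul, ← Gamma_add_one _ hz0, sub_add_cancel]
        rw [h6]
        calc _ ≤ (n + 3) * A *
              (C * A ^ (z.re - 1 - 1 / 2) * exp (-(π * |z.im| / 2))) := by gcongr
          _ = C * (n + 3) * (A ^ (z.re - 1 - 1 / 2) * A ^ (1 : ℝ)) * exp (-(π * |z.im| / 2)) := by rw [rpow_one]; ring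
          _ = _ := by rw [← rpow_add hA0]; congr 3; ring
      · refine (ih z (not_lt.1 c1) (not_lt.1 c2) h3).trans ?_
        gcongr
        nlinarith

/-- Staying to the right of the poles allows the segment `|Im z| ≤ 1`, excluded before, to be filled
in by compactness. -/
theorem exists_norm_Gamma_le {x₀ X : ℝ} (hx₀ : 0 < x₀) : ∃ C : ℝ, 0 < C ∧ ∀ z : ℂ, x₀ ≤ z.re →
    z.re ≤ X → ‖Gamma z‖ ≤ C * (1 + |z.im|) ^ (z.re - 1 / 2) * exp (-(π * |z.im| / 2)) := by
  obtain ⟨n, hn⟩ := exists_nat_ge X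
  obtain ⟨C, hC, h⟩ := exists_norm_Gamma_le_of_one_le (n + 1)
  have hcont : ContinuousOn (fun z : ℂ => ‖Gamma z‖ * ((1 + |z.im|) ^ (z.re - 1 / 2) * exp (-(π * |z.im| / 2)))⁻¹)
      (Icc x₀ X ×ℂ Icc (-1) 1) := by
    refine ContinuousOn.mul (fun z hz => ?_) (Continuous.continuousOn ?_)
    · refine (differentiableAt_Gamma z fun m hm => ?_).continuousAt.norm.continuousWithinAt
      have := hz.1.1
      rw [hm] at this
      simp at this
      linarith [(cast_nonneg m : (0 : ℝ) ≤ m)]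
    · refine Continuous.inv₀ (Continuous.mul (Continuous.rpow (by fun_prop) (by fun_prop) fun z => inl ?_)
        (by fun_prop)) fun z => ?_
      · positivity
      · positivity
  obtain ⟨C₂, hC₂⟩ := (isCompact_Icc.reProdIm isCompact_Icc).exists_bound_of_continuousOn hcont
  refine ⟨max C C₂, lt_max_of_lt_left hC, fun z h1 h2 => ?_⟩
  by_cases h3 : 1 ≤ |z.im|
  · refine (h z ?_ ?_ h3).trans ?_
    · push_cast; linarith [(cast_nonneg n : (0 : ℝ) ≤ n)]
    · push_cast; linarith
    · gcongr
      exact le_max_left _ _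
  · have h4 := hC₂ z ⟨⟨h1, h2⟩, abs_le.1 (not_le.1 h3).le⟩
    rw [norm_of_nonneg (by positivity), ← div_eq_mul_inv, div_le_iff₀ (by positivity)] at h4
    refine h4.trans ?_
    rw [mul_assoc]
    gcongr
    exact le_max_right _ _

/-! ### Growth of `(s - 1) ζ(s)` for `Re s > -1` by the midpoint rule -/

/-- Three mean value estimates on `[0, 1/2]`, each integrating the previous one: for `φ2(c+x) -
φ2(c-x)`, for `φ1(c+x) + φ1(c-x) - 2φ1(c)`, and for `φ(c+x) - φ(c-x) - 2xφ1(c)`. By symmetry the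
second-order term drops out, and it is this gain that makes the series for zeta converge as far as
`Re s > -1`. -/
theorem norm_midpoint_le {φ φ1 φ2 φ3 : ℝ → ℂ} {c M : ℝ}
    (h1 : ∀ y ∈ Icc (c - 1 / 2) (c + 1 / 2), HasDerivAt φ (φ1 y) y)
    (h2 : ∀ y ∈ Icc (c - 1 / 2) (c + 1 / 2), HasDerivAt φ1 (φ2 y) y)
    (h3 : ∀ y ∈ Icc (c - 1 / 2) (c + 1 / 2), HasDerivAt φ2 (φ3 y) y)
    (hM : ∀ y ∈ Icc (c - 1 / 2) (c + 1 / 2), ‖φ3 y‖ ≤ M) :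
    ‖φ (c + 1 / 2) - φ (c - 1 / 2) - φ1 c‖ ≤ M := by
  have hc : c ∈ Icc (c - 1 / 2) (c + 1 / 2) := ⟨by linarith, by linarith⟩
  have hM0 : 0 ≤ M := (norm_nonneg _).trans (hM c hc)
  have hp : ∀ x ∈ Icc (0 : ℝ) (1 / 2), c + x ∈ Icc (c - 1 / 2) (c + 1 / 2) :=
    fun x hx => ⟨by linarith [hx.1], by linarith [hx.2]⟩
  have hm : ∀ x ∈ Icc (0 : ℝ) (1 / 2), c - x ∈ Icc (c - 1 / 2) (c + 1 / 2) :=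
    fun x hx => ⟨by linarith [hx.2], by linarith [hx.1]⟩
  have e2 : ∀ x ∈ Icc (0 : ℝ) (1 / 2), ‖φ2 (c + x) - φ2 (c - x)‖ ≤ M := fun x hx => by
    have := (convex_Icc (c - 1 / 2) (c + 1 / 2)).norm_image_sub_le_of_norm_hasDerivWithin_le
      (fun y hy => (h3 y hy).hasDerivWithinAt) hM (hm x hx) (hp x hx)
    refine this.trans ?_
    have h4 : ‖c + x - (c - x)‖ ≤ 1 := by rw [norm_eq_abs, abs_le]; constructor <;> linarith [hx.1, hx.2]
    nlinarith
  have e1 : ∀ x ∈ Icc (0 : ℝ) (1 / 2), ‖φ1 (c + x) + φ1 (c - x) - 2 * φ1 c‖ ≤ M := fun x hx => by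
    have hd : ∀ y ∈ Icc (0 : ℝ) (1 / 2), HasDerivWithinAt
        (fun y => φ1 (c + y) + φ1 (c - y)) (φ2 (c + y) - φ2 (c - y)) (Icc 0 (1 / 2)) y := fun y hy => by
      have ha := HasDerivAt.comp_const_add c y (h2 _ (hp y hy))
      have hb := HasDerivAt.comp_const_sub c y (h2 _ (hm y hy))
      simpa [sub_eq_add_neg] using! (ha.add hb).hasDerivWithinAt
    have := (convex_Icc (0 : ℝ) (1 / 2)).norm_image_sub_le_of_norm_hasDerivWithin_le
      hd e2 (⟨le_rfl, by norm_num⟩ : (0 : ℝ) ∈ Icc (0 : ℝ) (1 / 2)) hx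
    have h5 : φ1 (c + x) + φ1 (c - x) - (φ1 (c + 0) + φ1 (c - 0)) =
        φ1 (c + x) + φ1 (c - x) - 2 * φ1 c := by rw [add_zero, sub_zero]; ring
    rw [h5] at this
    refine this.trans ?_
    have h4 : ‖x - 0‖ ≤ 1 := by rw [norm_eq_abs, abs_le]; constructor <;> linarith [hx.1, hx.2]
    nlinarith
  have hd : ∀ y ∈ Icc (0 : ℝ) (1 / 2), HasDerivWithinAt (fun y : ℝ => φ (c + y) - φ (c - y) - (y : ℂ) * (2 * φ1 c))
      (φ1 (c + y) + φ1 (c - y) - 2 * φ1 c) (Icc 0 (1 / 2)) y := fun y hy => by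
    have ha := HasDerivAt.comp_const_add c y (h1 _ (hp y hy))
    have hb := HasDerivAt.comp_const_sub c y (h1 _ (hm y hy))
    have h6 := ((Complex.ofRealCLM.hasDerivAt (x := y)).mul_const (2 * φ1 c))
    simpa using! ((ha.sub hb).sub h6).hasDerivWithinAt
  have := (convex_Icc (0 : ℝ) (1 / 2)).norm_image_sub_le_of_norm_hasDerivWithin_le
    hd e1 (⟨le_rfl, by norm_num⟩ : (0 : ℝ) ∈ Icc (0 : ℝ) (1 / 2)) (⟨by norm_num, le_rfl⟩ : (1 / 2 : ℝ) ∈ Icc (0 : ℝ) (1 / 2))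
  have h5 : φ (c + 1 / 2) - φ (c - 1 / 2) - ((1 / 2 : ℝ) : ℂ) * (2 * φ1 c) -
      (φ (c + 0) - φ (c - 0) - ((0 : ℝ) : ℂ) * (2 * φ1 c)) =
      φ (c + 1 / 2) - φ (c - 1 / 2) - φ1 c := by
    rw [add_zero, sub_zero]; push_cast; ring
  rw [h5] at this
  refine this.trans ?_
  have h4 : ‖(1 / 2 : ℝ) - 0‖ ≤ 1 := by norm_num
  nlinarith

/-- The terms of the midpoint-rule series for `(s - 1) ζ(s)`. -/
noncomputable def zetaMidpointTerm (n : ℕ) (s : ℂ) : ℂ :=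
  (((n + 1 : ℝ) + 1 / 2 : ℝ) : ℂ) ^ (1 - s) - (((n + 1 : ℝ) - 1 / 2 : ℝ) : ℂ) ^ (1 - s) -
    (1 - s) * ((n + 1 : ℝ) : ℂ) ^ (-s)

theorem hasDerivAt_ofReal_cpow_mul {y : ℝ} (hy : 0 < y) (a w : ℂ) :
    HasDerivAt (fun y : ℝ => a * (y : ℂ) ^ w) (a * w * (y : ℂ) ^ (w - 1)) y := by
  have := ((hasDerivAt_id (y : ℂ)).cpow_const (c := w) (Complex.ofReal_mem_slitPlane.2 hy)).comp_ofReal.const_mul a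
  simpa [mul_assoc] using this

theorem norm_zetaMidpointTerm_le {s : ℂ} (hs : -1 < s.re) (n : ℕ) : ‖zetaMidpointTerm n s‖ ≤
      ‖1 - s‖ * ‖s‖ * ‖s + 1‖ * 2 ^ (s.re + 2) * ((n : ℝ) + 1) ^ (-s.re - 2) := by
  have hpos : ∀ y ∈ Icc ((n + 1 : ℝ) - 1 / 2) ((n + 1 : ℝ) + 1 / 2), 0 < y := fun y hy => by
    have := hy.1
    have h0 : (0 : ℝ) ≤ n := cast_nonneg n
    linarith
  have := norm_midpoint_le (c := (n + 1 : ℝ))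
    (φ := fun y : ℝ => 1 * (y : ℂ) ^ (1 - s)) (φ1 := fun y : ℝ => (1 - s) * (y : ℂ) ^ (-s))
    (φ2 := fun y : ℝ => (1 - s) * (-s) * (y : ℂ) ^ (-s - 1))
    (φ3 := fun y : ℝ => (1 - s) * (-s) * (-s - 1) * (y : ℂ) ^ (-s - 2))
    (M := ‖1 - s‖ * ‖s‖ * ‖s + 1‖ * 2 ^ (s.re + 2) * ((n : ℝ) + 1) ^ (-s.re - 2))
    (fun y hy => by convert hasDerivAt_ofReal_cpow_mul (hpos y hy) 1 (1 - s) using 1; ring_nf)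
    (fun y hy => by convert hasDerivAt_ofReal_cpow_mul (hpos y hy) (1 - s) (-s) using 1)
    (fun y hy => by convert hasDerivAt_ofReal_cpow_mul (hpos y hy) ((1 - s) * (-s)) (-s - 1) using 1; ring_nf)
    (fun y hy => by
      have h0 := hpos y hy
      rw [norm_mul, norm_mul, norm_mul, norm_neg, ← norm_neg (-s - 1),
        norm_cpow_eq_rpow_re_of_pos h0, show -(-s - 1) = s + 1 by ring, mul_assoc
        (‖1 - s‖ * ‖s‖ * ‖s + 1‖)]
      refine mul_bound_left ?_
      -- The interval of length one about `n + 1` stays above `(n+1)/2`, whence the factor `2^(Re s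
      -- + 2)`.
      have h1 : ((n : ℝ) + 1) / 2 ≤ y := by
        have := hy.1
        have h0 : (0 : ℝ) ≤ n := cast_nonneg n
        linarith
      have h2 : y ^ (-s - 2).re ≤ (((n : ℝ) + 1) / 2) ^ (-s - 2).re :=
        rpow_le_rpow_of_nonpos (by positivity) h1 (by simp; linarith)
      refine h2.trans_eq ?_
      have h3 : (-s - 2).re = -s.re - 2 := by simp
      rw [h3, div_rpow (by positivity) (by norm_num), div_eq_mul_inv, ← rpow_neg (by norm_num), mul_comm]
      congr 2; ring)
  simpa only [zetaMidpointTerm, one_mul] using this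

theorem differentiable_zetaMidpointTerm (n : ℕ) : Differentiable ℂ (zetaMidpointTerm n) := by
  have h0 : (0 : ℝ) ≤ n := cast_nonneg n
  have h1 : (((n + 1 : ℝ) + 1 / 2 : ℝ) : ℂ) ≠ 0 := by rw [Ne, ofReal_eq_zero]; linarith
  have h2 : (((n + 1 : ℝ) - 1 / 2 : ℝ) : ℂ) ≠ 0 := by rw [Ne, ofReal_eq_zero]; linarith
  have h3 : ((n + 1 : ℝ) : ℂ) ≠ 0 := by rw [Ne, ofReal_eq_zero]; linarith
  have hd : ∀ s : ℂ, DifferentiableAt ℂ (fun s : ℂ => 1 - s) s := fun s => by fun_prop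
  have hd' : ∀ s : ℂ, DifferentiableAt ℂ (fun s : ℂ => -s) s := fun s => by fun_prop
  intro s
  unfold zetaMidpointTerm
  exact (((hd s).const_cpow (inl h1)).sub ((hd s).const_cpow (inl h2))).sub ((hd s).mul ((hd' s).const_cpow (inl h3)))

theorem summable_nat_add_one_rpow {p : ℝ} (hp : p < -1) :
    Summable fun n : ℕ => ((n : ℝ) + 1) ^ p := by
  have := (summable_nat_add_iff 1).2 (Real.summable_nat_rpow.2 hp)
  simpa using this

theorem summable_zetaMidpointTerm {s : ℂ} (hs : -1 < s.re) : Summable fun n => zetaMidpointTerm n s :=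
  Summable.of_norm_bounded ((summable_nat_add_one_rpow (by linarith)).mul_left _) (norm_zetaMidpointTerm_le hs)

theorem riemannZeta₁_eq {s : ℂ} (hs : s ≠ 1) : riemannZeta₁ s = (s - 1) * riemannZeta s := by
  rw [riemannZeta_eq_inv_sub_mul hs, mul_inv_cancel_left₀ (sub_ne_zero.2 hs)]

/-- The differences `(n+3/2)^{1-s} - (n+1/2)^{1-s}` telescope to `-(1/2)^{1-s}`, while the midpoint
values sum to `(1-s)ζ(s)`. -/
theorem riemannZeta₁_eq_midpoint_of_one_lt {s : ℂ} (hs : 1 < s.re) :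
    riemannZeta₁ s = (1 / 2 : ℂ) ^ (1 - s) + ∑' n, zetaMidpointTerm n s := by
  have hs1 : s ≠ 1 := by rintro rfl; simp at hs
  have hz := zeta_eq_tsum_one_div_nat_add_one_cpow hs
  have hsum : Summable fun n : ℕ => ((n + 1 : ℝ) : ℂ) ^ (-s) := by
    refine Summable.of_norm_bounded (summable_nat_add_one_rpow (p := -s.re) (by linarith)) fun n => ?_
    rw [norm_cpow_eq_rpow_re_of_pos (by positivity)]
    simp
  have hz' : ∑' n : ℕ, ((n + 1 : ℝ) : ℂ) ^ (-s) = riemannZeta s := by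
    rw [hz]
    refine tsum_congr fun n => ?_
    rw [cpow_neg, one_div]; push_cast; rfl
  set u : ℕ → ℂ := fun n => (((n : ℝ) + 1 / 2 : ℝ) : ℂ) ^ (1 - s) with hu
  have hu0 : Tendsto u atTop (𝓝 0) := by
    rw [tendsto_zero_iff_norm_tendsto_zero]
    have h1 : ∀ n : ℕ, ‖u n‖ = ((n : ℝ) + 1 / 2) ^ (-(s.re - 1)) := fun n => by
      rw [hu, norm_cpow_eq_rpow_re_of_pos (by positivity)]; simp
    simp_rw [h1]
    exact (tendsto_rpow_neg_atTop (by linarith)).comp (tendsto_atTop_add_const_right _ _ tendsto_natCast_atTop_atTop)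
  have hdu : ∀ n, u (n + 1) - u n = zetaMidpointTerm n s + (1 - s) * ((n + 1 : ℝ) : ℂ) ^ (-s) := fun n => by
    simp only [hu, zetaMidpointTerm, Nat.cast_add, Nat.cast_one]
    rw [show ((n : ℝ) + 1 - 1 / 2) = n + 1 / 2 by ring]; ring
  have hsd : HasSum (fun n => u (n + 1) - u n) (∑' n, zetaMidpointTerm n s + (1 - s) * riemannZeta s) := by
    simp_rw [hdu]
    rw [← hz']
    exact (summable_zetaMidpointTerm (by linarith)).hasSum.add (hsum.hasSum.mul_left _)
  have ht := hsd.tendsto_sum_nat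
  simp_rw [Finset.sum_range_sub] at ht
  have := tendsto_nhds_unique ht (hu0.sub_const _)
  have hu00 : u 0 = (1 / 2 : ℂ) ^ (1 - s) := by simp [hu]
  rw [hu00] at this
  rw [riemannZeta₁_eq hs1]
  linear_combination -this

/-- Identity theorem, starting near `s = 2`. The half-plane is cut down to a bounded convex piece so
that the polynomial factors in the term bound become constants. -/
theorem riemannZeta₁_eq_midpoint {s : ℂ} (hs : -1 < s.re) :
    riemannZeta₁ s = (1 / 2 : ℂ) ^ (1 - s) + ∑' n, zetaMidpointTerm n s := by
  obtain ⟨κ, hκ, hκs⟩ : ∃ κ : ℝ, 0 < κ ∧ κ < min (s.re + 1) 1 := exists_between (by simp; linarith)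
  obtain ⟨hκ1, hκ2⟩ := lt_min_iff.1 hκs
  set R : ℝ := ‖s‖ + 3 with hR
  set U : Set ℂ := {z | -1 + κ < z.re} ∩ ball 0 R with hU
  have hUo : IsOpen U := (isOpen_lt continuous_const continuous_re).inter isOpen_ball
  have hUc : IsPreconnected U := ((convex_halfSpace_re_gt (-1 + κ)).inter (convex_ball 0 R)).isPreconnected
  have h2U : (2 : ℂ) ∈ U := ⟨by simp; linarith, by simp [hR]; linarith [norm_nonneg s]⟩
  have hsU : s ∈ U := ⟨by simp; linarith, by simp [hR]⟩
  have hdt : DifferentiableOn ℂ (fun z => ∑' n, zetaMidpointTerm n z) U := by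
    refine differentiableOn_tsum_of_summable_norm (u := fun n : ℕ =>
      (R + 1) * R * (R + 1) * 2 ^ (R + 2) * ((n : ℝ) + 1) ^ (-1 - κ))
      ((summable_nat_add_one_rpow (by linarith)).mul_left _)
      (fun n => (differentiable_zetaMidpointTerm n).differentiableOn) hUo fun n z hz => ?_
    have hz1 : -1 + κ < z.re := hz.1
    have hz2 : ‖z‖ ≤ R := (mem_ball_zero_iff.1 hz.2).le
    refine (norm_zetaMidpointTerm_le (by linarith) n).trans ?_
    have i1 : ‖1 - z‖ ≤ R + 1 := (norm_sub_le _ _).trans (by simp; linarith)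
    have i2 : ‖z + 1‖ ≤ R + 1 := (norm_add_le _ _).trans (by simp; linarith)
    have i3 : (2 : ℝ) ^ (z.re + 2) ≤ 2 ^ (R + 2) := rpow_le_rpow_of_exponent_le (by norm_num)
      (by linarith [re_le_norm z])
    have i4 : ((n : ℝ) + 1) ^ (-z.re - 2) ≤ ((n : ℝ) + 1) ^ (-1 - κ) :=
      rpow_bound_exp (by linarith [(cast_nonneg n : (0 : ℝ) ≤ n)])
    have hR0 : 0 ≤ R := by positivity
    exact mul_bound (mul_bound (mul_bound (mul_bound i1 hz2) i2) i3) i4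
  have hF : AnalyticOnNhd ℂ (fun z => (1 / 2 : ℂ) ^ (1 - z) + ∑' n, zetaMidpointTerm n z) U := by
    refine DifferentiableOn.analyticOnNhd (DifferentiableOn.add (fun z _ => ?_) hdt) hUo
    exact (DifferentiableAt.const_cpow (by fun_prop) (inl (by norm_num))).differentiableWithinAt
  have hev : riemannZeta₁ =ᶠ[𝓝 2] fun z => (1 / 2 : ℂ) ^ (1 - z) + ∑' n, zetaMidpointTerm n z := by
    filter_upwards [(isOpen_lt continuous_const continuous_re).mem_nhds (show (1 : ℝ) < (2 : ℂ).re by simp)] with z hz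
    exact riemannZeta₁_eq_midpoint_of_one_lt hz
  exact AnalyticOnNhd.eqOn_of_preconnected_of_eventuallyEq
    (differentiable_riemannZeta₁.differentiableOn.analyticOnNhd hUo) hF hUc h2U hev hsU

/-- The exponent 3 is the number of factors `1 - s`, `s`, `s + 1` in the midpoint error. -/
theorem exists_norm_riemannZeta₁_le {κ : ℝ} (hκ : 0 < κ) : ∃ C : ℝ, 1 ≤ C ∧ ∀ s : ℂ,
    -1 + κ ≤ s.re → s.re ≤ 5 → ‖riemannZeta₁ s‖ ≤ C * (1 + |s.im|) ^ (3 : ℕ) := by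
  have hS := summable_nat_add_one_rpow (p := -1 - κ) (by linarith)
  set S := ∑' n : ℕ, ((n : ℝ) + 1) ^ (-1 - κ)
  have hS0 : 0 ≤ S := tsum_nonneg fun n => by positivity
  refine ⟨16 + 7 ^ 3 * 2 ^ 7 * S, by nlinarith, fun s h1 h2 => ?_⟩
  rw [riemannZeta₁_eq_midpoint (by linarith)]
  have hT : 1 ≤ 1 + |s.im| := by linarith [abs_nonneg s.im]
  have hre : |s.re| ≤ 5 := abs_le.2 ⟨by linarith, h2⟩
  have hn : ‖s‖ ≤ 5 + |s.im| := (norm_le_abs_re_add_abs_im s).trans (by linarith)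
  have i0 : ‖s‖ ≤ 7 * (1 + |s.im|) := by linarith [abs_nonneg s.im]
  have i1 : ‖1 - s‖ ≤ 7 * (1 + |s.im|) := (norm_sub_le _ _).trans (by simp; linarith [abs_nonneg s.im])
  have i2 : ‖s + 1‖ ≤ 7 * (1 + |s.im|) := (norm_add_le _ _).trans (by simp; linarith [abs_nonneg s.im])
  have i3 : ‖(1 / 2 : ℂ) ^ (1 - s)‖ ≤ 16 := by
    have : (1 / 2 : ℂ) = ((1 / 2 : ℝ) : ℂ) := by push_cast; rfl
    rw [this, norm_cpow_eq_rpow_re_of_pos (by norm_num)]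
    calc (1 / 2 : ℝ) ^ (1 - s).re ≤ (1 / 2 : ℝ) ^ (-4 : ℝ) :=
          rpow_le_rpow_of_exponent_ge (by norm_num) (by norm_num) (by simp; linarith)
      _ = 16 := by
          rw [rpow_neg (by norm_num), show (4 : ℝ) = (4 : ℕ) by norm_num, rpow_natCast]
          norm_num
  have i4 : ‖∑' n, zetaMidpointTerm n s‖ ≤ 7 ^ 3 * 2 ^ 7 * (1 + |s.im|) ^ 3 * S := by
    rw [← tsum_mul_left]
    refine tsum_of_norm_bounded (hS.mul_left _).hasSum fun n => ?_
    refine (norm_zetaMidpointTerm_le (by linarith) n).trans ?_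
    have j3 : (2 : ℝ) ^ (s.re + 2) ≤ 2 ^ 7 := by
      rw [← rpow_natCast]
      exact rpow_le_rpow_of_exponent_le (by norm_num) (by norm_num; linarith)
    have j4 : ((n : ℝ) + 1) ^ (-s.re - 2) ≤ ((n : ℝ) + 1) ^ (-1 - κ) :=
      rpow_bound_exp (by linarith [(cast_nonneg n : (0 : ℝ) ≤ n)])
    refine (mul_bound (mul_bound (mul_bound (mul_bound i1 i0) i2) j3) j4).trans_eq (by ring)
  refine (norm_add_le _ _).trans ((add_le_add i3 i4).trans ?_)
  have : 1 ≤ (1 + |s.im|) ^ 3 := one_le_pow₀ hT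
  nlinarith

/-- On `Re s = 2` the terms after the first sum to at most `π²/6 - 1`, so `|ζ(s)| ≥ 2 - π²/6 > 1/3`.
This is the lower bound at the centre that Landau's lemma requires. -/
theorem norm_riemannZeta₁_ge {s : ℂ} (hs : s.re = 2) : 1 / 3 ≤ ‖riemannZeta₁ s‖ := by
  have hz := zeta_eq_tsum_one_div_nat_add_one_cpow (s := s) (by linarith)
  have hnorm : ∀ n : ℕ, ‖1 / ((n : ℂ) + 1) ^ s‖ = 1 / ((n : ℝ) + 1) ^ 2 := fun n => by
    have : ((n : ℂ) + 1) = ((n + 1 : ℝ) : ℂ) := by push_cast; rfl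
    rw [norm_div, norm_one, this, norm_cpow_eq_rpow_re_of_pos (by positivity), hs]
    norm_cast
  have hs2 : HasSum (fun n : ℕ => 1 / ((n : ℝ) + 1) ^ 2) (π ^ 2 / 6) := by
    have := (hasSum_nat_add_iff' 1).2 hasSum_zeta_two
    simpa using this
  have hs3 : HasSum (fun n : ℕ => 1 / (((n + 1 : ℕ) : ℝ) + 1) ^ 2) (π ^ 2 / 6 - 1) := by
    have := (hasSum_nat_add_iff' 1).2 hs2
    simpa using this
  have hsum : Summable fun n : ℕ => 1 / ((n : ℂ) + 1) ^ s := by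
    refine Summable.of_norm ?_
    simp_rw [hnorm]; exact hs2.summable
  rw [hsum.tsum_eq_zero_add] at hz
  have h4 : ‖∑' n : ℕ, 1 / (((n + 1 : ℕ) : ℂ) + 1) ^ s‖ ≤ π ^ 2 / 6 - 1 :=
    tsum_of_norm_bounded hs3 fun n => (hnorm (n + 1)).le
  have h5 : 1 / 3 ≤ ‖riemannZeta s‖ := by
    rw [hz]
    have h6 := norm_sub_le_norm_add (1 / (((0 : ℕ) : ℂ) + 1) ^ s) (∑' n : ℕ, 1 / (((n + 1 : ℕ) : ℂ) + 1) ^ s)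
    have h7 : ‖1 / (((0 : ℕ) : ℂ) + 1) ^ s‖ = 1 := by simp
    rw [h7] at h6
    refine le_trans ?_ h6
    have := Real.pi_lt_d2
    have := pi_pos
    nlinarith
  have h8 : 1 ≤ ‖s - 1‖ := by
    have := re_le_norm (s - 1)
    simp [hs] at this; linarith
  rw [riemannZeta₁_eq fun h => by simp [h] at hs, norm_mul]
  nlinarith [norm_nonneg (riemannZeta s)]

/-! ### Zeros of entire functions and Landau's lemma -/

theorem exists_eq_pow_mul_of_differentiable {f : ℂ → ℂ} (hf : Differentiable ℂ f) {ρ : ℂ}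
    (h : analyticOrderAt f ρ ≠ ⊤) : ∃ g : ℂ → ℂ, Differentiable ℂ g ∧ g ρ ≠ 0 ∧
      ∀ z, f z = (z - ρ) ^ analyticOrderNatAt f ρ * g z := by
  obtain ⟨g₀, hg₀, hne, hev⟩ := (hf.analyticAt ρ).analyticOrderAt_ne_top.1 h
  set n := analyticOrderNatAt f ρ
  set g : ℂ → ℂ := Function.update (fun z => f z / (z - ρ) ^ n) ρ (g₀ ρ) with hg
  have hgne : ∀ z, z ≠ ρ → g z = f z / (z - ρ) ^ n := fun z hz => Function.update_of_ne hz _ _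
  have hgρ : g ρ = g₀ ρ := Function.update_self _ _ _
  refine ⟨g, fun z => ?_, hgρ ▸ hne, fun z => ?_⟩
  · by_cases hz : z = ρ
    · subst hz
      refine hg₀.differentiableAt.congr_of_eventuallyEq ?_
      filter_upwards [hev] with w hw
      by_cases hwz : w = z
      · rw [hwz, hgρ]
      · rw [hgne w hwz, hw, smul_eq_mul, mul_div_cancel_left₀ _ (pow_ne_zero _ (sub_ne_zero.2 hwz))]
    · have : g =ᶠ[𝓝 z] fun z => f z / (z - ρ) ^ n := by
        filter_upwards [isOpen_ne.mem_nhds hz] with w hw using hgne w hw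
      refine DifferentiableAt.congr_of_eventuallyEq ?_ this
      exact (hf z).div (by fun_prop) (pow_ne_zero _ (sub_ne_zero.2 hz))
  · by_cases hz : z = ρ
    · subst hz
      rw [hgρ]; simpa using hev.self_of_nhds
    · rw [hgne z hz, mul_div_cancel₀ _ (pow_ne_zero _ (sub_ne_zero.2 hz))]

theorem analyticOrderAt_ne_top_of_differentiable {f : ℂ → ℂ} (hf : Differentiable ℂ f) {c : ℂ}
    (hc : f c ≠ 0) (z : ℂ) : analyticOrderAt f z ≠ ⊤ := by
  refine AnalyticOnNhd.analyticOrderAt_ne_top_of_isPreconnected (x := c)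
    (fun w _ => hf.analyticAt w) isPreconnected_univ (Set.mem_univ _) (Set.mem_univ z) ?_
  rw [(hf.analyticAt c).analyticOrderAt_eq_zero.2 hc]; simp

theorem exists_eq_prod_pow_mul_of_differentiable {f : ℂ → ℂ} (hf : Differentiable ℂ f) {c : ℂ}
    (hc : f c ≠ 0) (Z : Finset ℂ) : ∃ g : ℂ → ℂ, Differentiable ℂ g ∧ (∀ ρ ∈ Z, g ρ ≠ 0) ∧
      ∀ z, f z = (∏ ρ ∈ Z, (z - ρ) ^ analyticOrderNatAt f ρ) * g z := by
  classical
  induction Z using Finset.induction_on with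
  | empty => exact ⟨f, hf, by simp, by simp⟩
  | insert a Z ha ih =>
    obtain ⟨g, hg, hgZ, hfg⟩ := ih
    have hP : Differentiable ℂ fun z : ℂ => ∏ ρ ∈ Z, (z - ρ) ^ analyticOrderNatAt f ρ := by fun_prop
    have hPa : (∏ ρ ∈ Z, (a - ρ) ^ analyticOrderNatAt f ρ) ≠ 0 :=
      Finset.prod_ne_zero_iff.2 fun ρ hρ => pow_ne_zero _ (sub_ne_zero.2 fun h => ha (h ▸ hρ))
    have hord : analyticOrderAt f a = analyticOrderAt g a := by
      have : f = (fun z : ℂ => ∏ ρ ∈ Z, (z - ρ) ^ analyticOrderNatAt f ρ) * g := funext hfg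
      rw [this, analyticOrderAt_mul (hP.analyticAt a) (hg.analyticAt a),
        (hP.analyticAt a).analyticOrderAt_eq_zero.2 hPa, zero_add]
    have hnat : analyticOrderNatAt f a = analyticOrderNatAt g a := by
      rw [analyticOrderNatAt, hord, analyticOrderNatAt]
    obtain ⟨g', hg', hne, hgg'⟩ := exists_eq_pow_mul_of_differentiable hg (ρ := a)
      (hord ▸ analyticOrderAt_ne_top_of_differentiable hf hc a)
    refine ⟨g', hg', fun ρ hρ => ?_, fun z => ?_⟩
    · rcases Finset.mem_insert.1 hρ with rfl | h
      · exact hne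
      · have := hgZ ρ h
        rw [hgg'] at this
        exact right_ne_zero_of_mul this
    · rw [Finset.prod_insert ha, hfg z, hgg' z, hnat]; ring

/-- Jensen's inequality for the number of zeros, rewritten from divisors to a finite set weighted by
analytic orders. -/
theorem exists_finset_zeros {f : ℂ → ℂ} (hf : Differentiable ℂ f) {c : ℂ} (hc : f c ≠ 0)
    {r R M : ℝ} (hr : 0 < r) (hrR : r < R) (hM : 1 ≤ M) (hb : ∀ z ∈ closedBall c R, ‖f z‖ ≤ M) :
    ∃ Z : Finset ℂ, (∀ ρ, ρ ∈ Z ↔ ρ ∈ closedBall c r ∧ f ρ = 0) ∧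
      ∑ ρ ∈ Z, (analyticOrderNatAt f ρ : ℝ) ≤ log (M / ‖f c‖) / log (R / r) := by
  have hR : 0 < R := hr.trans hrR
  have han : ∀ s : Set ℂ, AnalyticOnNhd ℂ f s := fun s z _ => hf.analyticAt z
  have hfin := (MeromorphicOn.divisor f (closedBall c r)).finiteSupport (isCompact_closedBall c r)
  have hdiv : ∀ u ∈ closedBall c r,
      MeromorphicOn.divisor f (closedBall c r) u = (analyticOrderNatAt f u : ℤ) := fun u hu => by
    rw [MeromorphicOn.AnalyticOnNhd.divisor_apply (han _) hu, analyticOrderNatAt]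
    obtain ⟨n, hn⟩ := ENat.ne_top_iff_exists.1 (analyticOrderAt_ne_top_of_differentiable hf hc u)
    rw [← hn]; simp
  have hzero : ∀ u, analyticOrderNatAt f u ≠ 0 ↔ f u = 0 := fun u => by
    rw [← not_iff_not, not_not, analyticOrderNatAt, ENat.toNat_eq_zero]
    have h1 := analyticOrderAt_ne_top_of_differentiable hf hc u
    have h2 := (hf.analyticAt u).analyticOrderAt_eq_zero
    tauto
  have hout : ∀ u, u ∉ closedBall c r → MeromorphicOn.divisor f (closedBall c r) u = 0 := fun u hu =>
    Function.locallyFinsuppWithin.apply_eq_zero_of_notMem _ hu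
  refine ⟨hfin.toFinset, fun ρ => ?_, ?_⟩
  · rw [Set.Finite.mem_toFinset, Function.mem_support]
    by_cases h : ρ ∈ closedBall c r
    · rw [hdiv ρ h, ← hzero ρ]; simp [h]
    · simp only [h, false_and, iff_false, not_not]; exact hout ρ h
  · have := AnalyticOnNhd.sum_divisor_le (c := c) (r := r) (R := R) (M := M) (f := f)
      (abs_pos.2 hr.ne') (by rwa [abs_of_pos hr, abs_of_pos hR]) hM (han _) hc
      (fun z hz => hb z (by rw [abs_of_pos hR] at hz; exact sphere_subset_closedBall hz))
    rw [abs_of_pos hr, finsum_eq_sum_of_support_toFinset_subset _ hfin subset_rfl] at this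
    refine le_trans (le_of_eq ?_) this
    push_cast
    refine sum_congr rfl fun ρ hρ => ?_
    have : ρ ∈ closedBall c r := by
      by_contra h
      exact (Function.mem_support.1 ((Set.Finite.mem_toFinset _).1 hρ)) (hout ρ h)
    rw [hdiv ρ this]; simp

/-- A nonvanishing function that is not much larger on a disc than at the centre has a small
logarithmic derivative. -/
theorem norm_logDeriv_le_of_ne_zero {g : ℂ → ℂ} {c : ℂ} {r₁ r B : ℝ} (hr₁ : 0 < r₁) (hr : r₁ < r)
    (hB : 0 < B) (hg : DifferentiableOn ℂ g (ball c r)) (hne : ∀ z ∈ ball c r, g z ≠ 0)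
    (hb : ∀ z ∈ ball c r, ‖g z‖ ≤ exp B * ‖g c‖) {w : ℂ}
    (hw : w ∈ closedBall c r₁) :
    ‖deriv g w / g w‖ ≤ 8 * r / (r - r₁) ^ 2 * B := by
  have hr0 : 0 < r := hr₁.trans hr
  have hcr : c ∈ ball c r := mem_ball_self hr0
  have hdg : ∀ z ∈ ball c r, HasDerivAt g (deriv g z) z := fun z hz =>
    (hg.differentiableAt (isOpen_ball.mem_nhds hz)).hasDerivAt
  have hq : DifferentiableOn ℂ (fun z => deriv g z / g z) (ball c r) := (hg.deriv isOpen_ball).div hg hne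
  -- `u` is a branch of `log(g/g(c))`, the primitive of `g'/g` vanishing at `c`. The hypothesis
  -- bounds `Re u` from above, Borel–Carathéodory then bounds `|u|`, and Cauchy's estimate bounds
  -- `u' = g'/g`.
  obtain ⟨u, hu0, hu⟩ := hq.isExactOn_ball.with_val_at c 0
  have hconst : ∀ z ∈ ball c r, g z * Complex.exp (-u z) = g c := fun z hz => by
    have h1 : ∀ x ∈ ball c r,
        HasDerivWithinAt (fun z => g z * Complex.exp (-u z)) 0 (ball c r) x := fun x hx => by
      have := ((hdg x hx).mul (hu x hx).neg.cexp).hasDerivWithinAt (s := ball c r)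
      refine this.congr_deriv ?_
      have := hne x hx
      field_simp; ring
    have := (convex_ball c r).norm_image_sub_le_of_norm_hasDerivWithin_le (C := 0) h1 (fun x _ => by simp) hcr hz
    simp only [hu0, zero_mul, norm_le_zero_iff, sub_eq_zero, neg_zero, Complex.exp_zero, mul_one] at this
    exact this
  have hgc : 0 < ‖g c‖ := norm_pos_iff.2 (hne c hcr)
  have hre : ∀ z ∈ ball c r, (u z).re ≤ B := fun z hz => by
    have h1 := congrArg norm (hconst z hz)
    rw [norm_mul, norm_exp, neg_re, exp_neg] at h1
    have h2 := hb z hz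
    rw [← exp_le_exp]
    have h3 : ‖g z‖ = exp (u z).re * ‖g c‖ := by rw [← h1]; field_simp
    rw [h3] at h2
    exact le_of_mul_le_mul_right h2 hgc
  -- The gap `r - r₁` is halved: one half for Borel–Carathéodory, the other for Cauchy's estimate.
  set r₂ := (r₁ + r) / 2 with hr₂
  have hu2 : ∀ z ∈ closedBall c r₂, ‖u z‖ ≤ 4 * r / (r - r₁) * B := fun z hz => by
    have hz' : ‖z - c‖ ≤ r₂ := by rwa [mem_closedBall_iff_norm] at hz
    have hmaps : ∀ y ∈ ball (0 : ℂ) r, c + y ∈ ball c r := fun y hy => by simpa [mem_ball_iff_norm] using hy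
    have := Complex.borelCaratheodory_zero (f := fun y => u (c + y)) (M := B) (R := r) (z := z - c) hB
      (fun y hy => (DifferentiableAt.comp y (hu _ (hmaps y hy)).differentiableAt
        (by fun_prop)).differentiableWithinAt)
      (fun y hy => hre _ (hmaps y hy)) hr0 (by rw [mem_ball_zero_iff]; linarith) (by simpa using hu0)
    simp only [add_sub_cancel] at this
    refine this.trans ?_
    rw [div_le_iff₀ (by linarith)]
    have h1 : (r - r₁) / 2 ≤ r - ‖z - c‖ := by linarith
    have h2 : 4 * r / (r - r₁) * B * ((r - r₁) / 2) = 2 * B * r := by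
      have : r - r₁ ≠ 0 := by linarith
      field_simp; ring
    calc 2 * B * ‖z - c‖ ≤ 2 * B * r := by
          refine mul_le_mul_of_nonneg_left (by linarith) (by linarith)
      _ = 4 * r / (r - r₁) * B * ((r - r₁) / 2) := h2.symm
      _ ≤ _ := mul_le_mul_of_nonneg_left h1 (by
          have : 0 < r - r₁ := by linarith
          positivity)
  have hsub : closedBall w ((r - r₁) / 2) ⊆ closedBall c r₂ := by
    refine Metric.closedBall_subset_closedBall' ?_
    have := Metric.mem_closedBall.1 hw
    linarith
  have hsub' : closedBall c r₂ ⊆ ball c r := Metric.closedBall_subset_ball (by linarith)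
  have hwb : w ∈ ball c r := hsub' (hsub (Metric.mem_closedBall_self (by linarith)))
  have hd : DiffContOnCl ℂ u (ball w ((r - r₁) / 2)) := by
    refine DifferentiableOn.diffContOnCl fun z hz => ?_
    have hz' := hsub' (hsub (Metric.closure_ball_subset_closedBall hz))
    exact (hu z hz').differentiableAt.differentiableWithinAt
  have := Complex.norm_deriv_le_of_forall_mem_sphere_norm_le (by linarith) hd
    (fun z hz => hu2 z (hsub (sphere_subset_closedBall hz)))
  rw [(hu w hwb).deriv] at this
  refine this.trans_eq ?_
  have : r - r₁ ≠ 0 := by linarith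
  field_simp; ring

/-- Landau's lemma: local partial fractions of the logarithmic derivative. -/
theorem exists_landau_bound {r₁ r R : ℝ} (hr₁ : 0 < r₁) (hr : r₁ < r) (hR : r < R) :
    ∃ K : ℝ, 0 < K ∧ ∀ (f : ℂ → ℂ) (c : ℂ) (B : ℝ), Differentiable ℂ f → f c ≠ 0 → 1 ≤ B →
      1 ≤ exp B * ‖f c‖ → (∀ z ∈ closedBall c R, ‖f z‖ ≤ exp B * ‖f c‖) →
      ∃ Z : Finset ℂ, (∀ ρ, ρ ∈ Z ↔ ρ ∈ closedBall c r ∧ f ρ = 0) ∧ ∑ ρ ∈ Z, (analyticOrderNatAt f ρ : ℝ) ≤ K * B ∧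
        ∀ w ∈ closedBall c r₁, f w ≠ 0 →
          ‖deriv f w / f w - ∑ ρ ∈ Z, (analyticOrderNatAt f ρ : ℂ) / (w - ρ)‖ ≤ K * B := by
  have hr0 : 0 < r := hr₁.trans hr
  have hR0 : 0 < R := hr0.trans hR
  have hlog : 0 < log (R / r) := Real.log_pos ((one_lt_div hr0).2 hR)
  -- On the circle of radius `R` every zero in the disc of radius `r` satisfies `|c - ρ| ≤ r ≤ q (R
  -- - r) ≤ q |z - ρ|`. Dividing out the zeros therefore enlarges the ratio to the centre by at most
  -- `q` to the number of zeros, and that number is `O(B)`.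
  set q := max 1 (r / (R - r)) with hq
  have hq1 : 1 ≤ q := le_max_left _ _
  set K₁ := 1 / log (R / r) with hK₁
  set K₂ := 1 + K₁ * log q with hK₂
  have hK₁0 : 0 < K₁ := by positivity
  have hK₂0 : 1 ≤ K₂ := by have := log_nonneg hq1; simp only [hK₂]; nlinarith
  set K₃ := 8 * r / (r - r₁) ^ 2 with hK₃
  have hK₃0 : 0 < K₃ := by have := sub_pos.2 hr; positivity
  refine ⟨K₁ + K₃ * K₂, by positivity, fun f c B hf hc hB hB1 hb => ?_⟩
  obtain ⟨Z, hZ, hsum⟩ := exists_finset_zeros hf hc hr0 hR hB1 hb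
  have hfc : 0 < ‖f c‖ := norm_pos_iff.2 hc
  have hsum' : ∑ ρ ∈ Z, (analyticOrderNatAt f ρ : ℝ) ≤ K₁ * B := by
    rw [mul_div_cancel_right₀ _ hfc.ne', Real.log_exp] at hsum
    rw [hK₁, one_div, inv_mul_eq_div]; exact hsum
  refine ⟨Z, hZ, hsum'.trans (by nlinarith [mul_pos hK₃0 (by linarith : 0 < K₂)]), ?_⟩
  obtain ⟨g, hg, hgZ, hfg⟩ := exists_eq_prod_pow_mul_of_differentiable hf hc Z
  have hgne : ∀ z ∈ ball c r, g z ≠ 0 := fun z hz h0 =>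
    hgZ z ((hZ z).2 ⟨Metric.ball_subset_closedBall hz, by rw [hfg, h0, mul_zero]⟩) h0
  have hqB : q ^ (∑ ρ ∈ Z, analyticOrderNatAt f ρ) ≤ exp (K₁ * B * log q) := by
    rw [← rpow_natCast, Real.rpow_def_of_pos (by linarith), exp_le_exp, mul_comm]
    refine mul_le_mul_of_nonneg_right ?_ (log_nonneg hq1)
    push_cast; exact hsum'
  have hsphere : ∀ z ∈ Metric.sphere c R, ‖g z‖ ≤ exp (K₂ * B) * ‖g c‖ := fun z hz => by
    have hd : ∀ ρ ∈ Z, R - r ≤ ‖z - ρ‖ ∧ ‖c - ρ‖ ≤ q * ‖z - ρ‖ := fun ρ hρ => by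
      have h3 := Metric.mem_closedBall'.1 ((hZ ρ).1 hρ).1
      have h4 := Metric.mem_sphere'.1 hz
      have h5 := dist_triangle_right c z ρ
      have h6 : r ≤ q * (R - r) := (div_le_iff₀ (by linarith)).1 (le_max_right _ _)
      rw [← dist_eq_norm, ← dist_eq_norm]
      exact ⟨by linarith, by nlinarith⟩
    set P := ∏ ρ ∈ Z, ‖z - ρ‖ ^ analyticOrderNatAt f ρ
    have hP : 0 < P := Finset.prod_pos fun ρ hρ => pow_pos (by linarith [(hd ρ hρ).1]) _
    have hPc : ∏ ρ ∈ Z, ‖c - ρ‖ ^ analyticOrderNatAt f ρ ≤ exp (K₁ * B * log q) * P := by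
      refine le_trans ?_ (mul_bound_right hqB)
      rw [← Finset.prod_pow_eq_pow_sum, ← Finset.prod_mul_distrib]
      refine Finset.prod_le_prod (fun _ _ => by positivity) fun ρ hρ => ?_
      rw [← mul_pow]; exact pow_le_pow_left₀ (norm_nonneg _) (hd ρ hρ).2 _
    have h1 := hb z (sphere_subset_closedBall hz)
    rw [hfg z, hfg c, norm_mul, norm_mul, norm_prod, norm_prod] at h1
    simp only [norm_pow] at h1
    refine le_of_mul_le_mul_left (h1.trans ?_) hP
    calc _ ≤ exp B * (exp (K₁ * B * log q) * P * ‖g c‖) := by gcongr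
      _ = _ := by rw [show K₂ * B = B + K₁ * B * log q by rw [hK₂]; ring, exp_add]; ring
  have hball : ∀ z ∈ ball c r, ‖g z‖ ≤ exp (K₂ * B) * ‖g c‖ := fun z hz => by
    refine Complex.norm_le_of_forall_mem_frontier_norm_le (U := ball c R) Metric.isBounded_ball
      hg.diffContOnCl (fun w hw => hsphere w (Metric.frontier_ball_subset_sphere hw))
      (subset_closure (ball_subset_ball hR.le hz))
  intro w hw hfw
  have hfin := norm_logDeriv_le_of_ne_zero hr₁ hr (by nlinarith) hg.differentiableOn hgne hball hw
  have hwne : ∀ ρ ∈ Z, w - ρ ≠ 0 := fun ρ hρ h => by rw [sub_eq_zero] at h; subst h; exact hfw ((hZ _).1 hρ).2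
  have hgw : g w ≠ 0 := by rw [hfg] at hfw; exact right_ne_zero_of_mul hfw
  have hld : logDeriv f w = ∑ ρ ∈ Z, (analyticOrderNatAt f ρ : ℂ) / (w - ρ) + logDeriv g w := by
    have h1 : f = fun z => (∏ ρ ∈ Z, (z - ρ) ^ analyticOrderNatAt f ρ) * g z := funext hfg
    have h2 := logDeriv_mul (f := fun z => ∏ ρ ∈ Z, (z - ρ) ^ analyticOrderNatAt f ρ) (g := g) w
      (Finset.prod_ne_zero_iff.2 fun ρ hρ => pow_ne_zero _ (hwne ρ hρ)) hgw (by fun_prop) (hg w)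
    rw [← h1] at h2
    rw [h2]
    congr 1
    have h3 := logDeriv_prod (s := Z) (f := fun ρ z => (z - ρ) ^ analyticOrderNatAt f ρ) (x := w)
      (fun ρ hρ => pow_ne_zero _ (hwne ρ hρ)) fun ρ _ => by fun_prop
    refine Eq.trans ?_ (h3.trans (sum_congr rfl fun ρ hρ => ?_))
    · congr 1
    · rw [logDeriv_fun_pow (f := fun z : ℂ => z - ρ) (by fun_prop), logDeriv_apply]
      simp [div_eq_mul_inv]
  have : deriv f w / f w - ∑ ρ ∈ Z, (analyticOrderNatAt f ρ : ℂ) / (w - ρ) = deriv g w / g w := by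
    rw [← logDeriv_apply f, hld, logDeriv_apply]; ring
  rw [this]
  refine hfin.trans ?_
  nlinarith [mul_pos hK₁0 (by linarith : 0 < B)]

/-! ### Zeros of zeta under RH: multiplicity and density -/

/-- The multiplicity of a zero of the zeta function, as a real number. -/
noncomputable def zetaOrder (ρ : ℂ) : ℝ := analyticOrderNatAt riemannZeta ρ

theorem zetaMult_eq (ρ : ℂ) : zetaMult ρ = (zetaOrder ρ : ℂ) := by simp [zetaMult, zetaOrder]

theorem zetaOrder_nonneg (ρ : ℂ) : 0 ≤ zetaOrder ρ := cast_nonneg _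

theorem ne_one_of_mem_zetaZeros {ρ : ℂ} (h : ρ ∈ zetaZeros) : ρ ≠ 1 := by rintro rfl; have := h.2.2; simp at this

theorem RiemannHypothesis.re_eq (hRH : RiemannHypothesis) {ρ : ℂ} (h : ρ ∈ zetaZeros) :
    ρ.re = 1 / 2 := by
  refine hRH ρ h.1 ?_ (ne_one_of_mem_zetaZeros h)
  rintro ⟨n, hn⟩
  have := h.2.1
  rw [hn] at this
  simp at this
  have h0 : (0 : ℝ) ≤ n := cast_nonneg n
  linarith

theorem RiemannHypothesis.re_sub (hRH : RiemannHypothesis) (s : ℂ) (ρ : zetaZeros) :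
    (ρ.1 - s).re = 1 / 2 - s.re := by
  rw [sub_re, hRH.re_eq ρ.2]

theorem norm_zetaOrder (ρ : ℂ) : ‖(zetaOrder ρ : ℂ)‖ = zetaOrder ρ := by
  rw [norm_real, norm_of_nonneg (zetaOrder_nonneg _)]

theorem RiemannHypothesis.riemannZeta₁_eq_zero_iff (hRH : RiemannHypothesis) {s : ℂ}
    (hs : -1 < s.re) : riemannZeta₁ s = 0 ↔ s ∈ zetaZeros := by
  by_cases h1 : s = 1
  · subst h1
    rw [riemannZeta₁_one]
    exact ⟨fun h => absurd h one_ne_zero, fun h => absurd rfl (ne_one_of_mem_zetaZeros h)⟩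
  rw [riemannZeta₁_eq h1, mul_eq_zero, sub_eq_zero]
  refine ⟨fun h => ?_, fun h => inr h.1⟩
  have h0 := h.resolve_left h1
  have : s.re = 1 / 2 := by
    refine hRH s h0 ?_ h1
    rintro ⟨n, hn⟩
    rw [hn] at hs
    simp at hs
    have h0 : (0 : ℝ) ≤ n := cast_nonneg n
    linarith
  exact ⟨h0, by rw [this]; norm_num, by rw [this]; norm_num⟩

theorem analyticOrderNatAt_riemannZeta₁ {ρ : ℂ} (h : ρ ≠ 1) :
    (analyticOrderNatAt riemannZeta₁ ρ : ℝ) = zetaOrder ρ := by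
  have hz : AnalyticAt ℂ riemannZeta ρ := by
    refine DifferentiableOn.analyticAt (s := {1}ᶜ) (fun s hs =>
      (differentiableAt_riemannZeta hs).differentiableWithinAt) (isOpen_compl_singleton.mem_nhds h)
  have h1 : AnalyticAt ℂ (fun s : ℂ => s - 1) ρ := by fun_prop
  have h2 : riemannZeta₁ =ᶠ[𝓝 ρ] (fun s : ℂ => s - 1) * riemannZeta := by
    filter_upwards [isOpen_ne.mem_nhds h] with s hs using riemannZeta₁_eq hs
  rw [zetaOrder, analyticOrderNatAt, analyticOrderNatAt, analyticOrderAt_congr h2,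
    analyticOrderAt_mul h1 hz, h1.analyticOrderAt_eq_zero.2 (sub_ne_zero.2 h), zero_add]

theorem zetaOrder_pos {ρ : ℂ} (h : ρ ∈ zetaZeros) : 0 < zetaOrder ρ := by
  rw [← analyticOrderNatAt_riemannZeta₁ (ne_one_of_mem_zetaZeros h)]
  have h1 : riemannZeta₁ ρ = 0 := by rw [riemannZeta₁_eq (ne_one_of_mem_zetaZeros h), h.1, mul_zero]
  have h2 := analyticOrderAt_ne_top_of_differentiable differentiable_riemannZeta₁ (c := 1) (by simp) ρ
  have h3 := (differentiable_riemannZeta₁.analyticAt ρ).analyticOrderAt_ne_zero.2 h1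
  rw [analyticOrderNatAt, Nat.cast_pos, Nat.pos_iff_ne_zero, Ne, ENat.toNat_eq_zero]
  tauto

/-- Landau's lemma for `(s-1)ζ(s)` on discs about `2 + it`. The three radii lie just below 3, so the
largest disc remains in `Re s > -1`, where the growth is polynomial and the only zeros are
nontrivial ones. The logarithmic bound this gives is relaxed to `(1+|t|)^ε`. -/
theorem RiemannHypothesis.exists_landau (hRH : RiemannHypothesis) {κ ε : ℝ} (hκ : 0 < κ)
    (hκ1 : κ < 1) (hε : 0 < ε) : ∃ C : ℝ, 0 < C ∧ ∀ t : ℝ, ∃ Z : Finset zetaZeros,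
      (∀ ρ : zetaZeros, ρ ∈ Z ↔ ‖ρ.1 - (2 + t * I)‖ ≤ 3 - κ / 2) ∧
      ∑ ρ ∈ Z, zetaOrder ρ ≤ C * (1 + |t|) ^ ε ∧
      ∀ w : ℂ, ‖w - (2 + t * I)‖ ≤ 3 - κ → riemannZeta₁ w ≠ 0 →
        ‖deriv riemannZeta₁ w / riemannZeta₁ w - ∑ ρ ∈ Z, (zetaOrder ρ : ℂ) / (w - ρ)‖ ≤ C * (1 + |t|) ^ ε := by
  classical
  obtain ⟨K, hK, hland⟩ := exists_landau_bound (r₁ := 3 - κ) (r := 3 - κ / 2) (R := 3 - κ / 4)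
    (by linarith) (by linarith) (by linarith)
  obtain ⟨C₀, hC₀, hgrow⟩ := exists_norm_riemannZeta₁_le (κ := κ / 4) (by linarith)
  have hlogC : 0 ≤ log (192 * C₀) := log_nonneg (by linarith)
  refine ⟨K * (log (192 * C₀) + 3 / ε), by positivity, fun t => ?_⟩
  set c : ℂ := 2 + t * I with hc
  have hcre : c.re = 2 := by simp [hc]
  have hcim : c.im = t := by simp [hc]
  have hfc := norm_riemannZeta₁_ge hcre
  have hT : 1 ≤ 1 + |t| := by linarith [abs_nonneg t]
  -- `192 = 3 · 4³`: the 3 comes from `|f(c)| ≥ 1/3`, and the `4³` from `1 + |Im z| ≤ 4(1 + |t|)` on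
  -- the disc.
  set B := log (192 * C₀ * (1 + |t|) ^ 3) with hB
  have hpos : 0 < 192 * C₀ * (1 + |t|) ^ 3 := by positivity
  have hge : 192 ≤ 192 * C₀ * (1 + |t|) ^ 3 := by
    have : 1 ≤ (1 + |t|) ^ 3 := one_le_pow₀ hT
    nlinarith
  have hexpB : exp B = 192 * C₀ * (1 + |t|) ^ 3 := Real.exp_log hpos
  have hB1 : 1 ≤ B := by
    rw [hB, Real.le_log_iff_exp_le hpos]
    have := Real.exp_one_lt_d9; linarith
  have hBle : B ≤ (log (192 * C₀) + 3 / ε) * (1 + |t|) ^ ε := by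
    have h1 : 1 ≤ (1 + |t|) ^ ε := one_le_rpow hT hε.le
    have h2 : log (1 + |t|) ≤ (1 + |t|) ^ ε / ε := Real.log_le_rpow_div (by linarith) hε
    rw [hB, Real.log_mul (by positivity) (by positivity), Real.log_pow]
    push_cast
    have h3 : 3 * log (1 + |t|) ≤ 3 / ε * (1 + |t|) ^ ε := (mul_bound_left h2).trans_eq (by ring)
    nlinarith
  have hKB : K * B ≤ K * (log (192 * C₀) + 3 / ε) * (1 + |t|) ^ ε := by rw [mul_assoc]; exact mul_bound_left hBle
  have hreim : ∀ z ∈ closedBall c (3 - κ / 4), -1 + κ / 4 ≤ z.re ∧ z.re ≤ 5 ∧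
      |z.im| ≤ |t| + 3 := fun z hz => by
    rw [mem_closedBall_iff_norm] at hz
    have h1 := (abs_re_le_norm (z - c)).trans hz
    have h2 := (abs_im_le_norm (z - c)).trans hz
    rw [sub_re, hcre, abs_le] at h1
    rw [sub_im, hcim] at h2
    refine ⟨by linarith [h1.1], by linarith [h1.2], ?_⟩
    have := abs_sub_abs_le_abs_sub z.im t
    linarith
  obtain ⟨Z, hZ, hsum, hbd⟩ := hland riemannZeta₁ c B differentiable_riemannZeta₁
    (fun h => by rw [h, norm_zero] at hfc; linarith) hB1
    (by rw [hexpB]; nlinarith)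
    (fun z hz => by
      obtain ⟨h1, h2, h3⟩ := hreim z hz
      refine (hgrow z h1 h2).trans ?_
      rw [hexpB]
      have h4 : (1 + |z.im|) ^ 3 ≤ (4 * (1 + |t|)) ^ 3 :=
        pow_le_pow_left₀ (by positivity) (by linarith [abs_nonneg t]) 3
      calc C₀ * (1 + |z.im|) ^ 3 ≤ C₀ * (4 * (1 + |t|)) ^ 3 :=
            mul_le_mul_of_nonneg_left h4 (by linarith)
        _ = 192 * C₀ * (1 + |t|) ^ 3 * (1 / 3) := by ring
        _ ≤ _ := mul_bound_left hfc)
  have hmem : ∀ ρ ∈ Z, ρ ∈ zetaZeros := fun ρ hρ => by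
    obtain ⟨h1, h2⟩ := (hZ ρ).1 hρ
    have h3 := hreim ρ (Metric.closedBall_subset_closedBall (by linarith) h1)
    exact (hRH.riemannZeta₁_eq_zero_iff (by linarith [h3.1])).1 h2
  refine ⟨Z.subtype (· ∈ zetaZeros), fun ρ => ?_, ?_, fun w hw hw0 => ?_⟩
  · rw [Finset.mem_subtype, hZ, mem_closedBall_iff_norm]
    refine ⟨fun h => h.1, fun h => ⟨h, ?_⟩⟩
    exact (hRH.riemannZeta₁_eq_zero_iff (by linarith [ρ.2.2.1])).2 ρ.2
  · rw [Finset.sum_subtype_of_mem zetaOrder hmem]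
    refine le_trans (le_of_eq ?_) (hsum.trans hKB)
    exact sum_congr rfl fun ρ hρ => (analyticOrderNatAt_riemannZeta₁ (ne_one_of_mem_zetaZeros (hmem ρ hρ))).symm
  · rw [Finset.sum_subtype_of_mem (fun ρ => (zetaOrder ρ : ℂ) / (w - ρ)) hmem]
    refine le_trans (le_of_eq ?_) ((hbd w (by rwa [mem_closedBall_iff_norm]) hw0).trans hKB)
    congr 2
    exact sum_congr rfl fun ρ hρ => by
      rw [← analyticOrderNatAt_riemannZeta₁ (ne_one_of_mem_zetaZeros (hmem ρ hρ))]; simp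

/-- A zero on the critical line whose height is within 1 of `t` has distance at most `3/2 + 1` from
`2 + it`, hence lies in the disc of radius `3 - 1/4` counted by Landau's lemma. -/
theorem RiemannHypothesis.exists_window_bound (hRH : RiemannHypothesis) {ε : ℝ} (hε : 0 < ε) :
    ∃ C : ℝ, 0 < C ∧ ∀ (t : ℝ) (F : Finset zetaZeros), (∀ ρ ∈ F, |ρ.1.im - t| ≤ 1) →
      ∑ ρ ∈ F, zetaOrder ρ ≤ C * (1 + |t|) ^ ε := by
  obtain ⟨C, hC, h⟩ := hRH.exists_landau (κ := 1 / 2) (by norm_num) (by norm_num) hε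
  refine ⟨C, hC, fun t F hF => ?_⟩
  obtain ⟨Z, hZ, hsum, -⟩ := h t
  refine le_trans (Finset.sum_le_sum_of_subset_of_nonneg (fun ρ hρ => ?_) fun ρ _ _ => zetaOrder_nonneg ρ) hsum
  rw [hZ]
  refine (norm_le_abs_re_add_abs_im _).trans ?_
  have h1 : (ρ.1 - (2 + t * I)).re = -(3 / 2) := by simp [hRH.re_eq ρ.2]; norm_num
  have h2 : (ρ.1 - (2 + t * I)).im = ρ.1.im - t := by simp
  rw [h1, h2, abs_neg, abs_of_pos (by norm_num : (0 : ℝ) < 3 / 2)]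
  linarith [hF ρ hρ]

theorem summable_int_one_add_abs_rpow {η : ℝ} (hη : 0 < η) :
    Summable fun j : ℤ => (1 + |(j : ℝ)|) ^ (-1 - η) := by
  have h := summable_nat_add_one_rpow (p := -1 - η) (by linarith)
  rw [summable_int_iff_summable_nat_and_neg]
  constructor
  · refine h.congr fun n => ?_
    simp [add_comm]
  · refine h.congr fun n => ?_
    simp [add_comm]

theorem one_add_abs_add_le (a b : ℝ) : 1 + |a + b| ≤ (1 + |a|) * (1 + |b|) := by
  nlinarith [abs_add_le a b, mul_nonneg (abs_nonneg a) (abs_nonneg b)]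

/-- Sums over the zeros of the zeta function, weighted with a power of the distance. -/
theorem RiemannHypothesis.exists_tsum_bound (hRH : RiemannHypothesis) {ε η : ℝ} (hε : 0 < ε)
    (hη : 0 < η) : ∃ C : ℝ, 0 < C ∧ ∀ t : ℝ,
      Summable (fun ρ : zetaZeros => zetaOrder ρ * (1 + |ρ.1.im - t|) ^ (-1 - η)) ∧
      ∑' ρ : zetaZeros, zetaOrder ρ * (1 + |ρ.1.im - t|) ^ (-1 - η) ≤ C * (1 + |t|) ^ ε := by
  classical
  set e := min ε (η / 2) with he
  have he0 : 0 < e := lt_min hε (by linarith)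
  have he1 : e ≤ ε := min_le_left _ _
  have he2 : e ≤ η / 2 := min_le_right _ _
  obtain ⟨C, hC, hw⟩ := hRH.exists_window_bound he0
  have hS := summable_int_one_add_abs_rpow (η := η / 2) (by linarith)
  set S := ∑' j : ℤ, (1 + |(j : ℝ)|) ^ (-1 - η / 2) with hSdef
  have hS0 : 0 < S := hS.tsum_pos (fun j => by positivity) 0 (by positivity)
  refine ⟨2 ^ (1 + η) * C * S, by positivity, fun t => ?_⟩
  have hT : 1 ≤ 1 + |t| := by linarith [abs_nonneg t]
  have hfin : ∀ F : Finset zetaZeros, ∑ ρ ∈ F, zetaOrder ρ * (1 + |ρ.1.im - t|) ^ (-1 - η) ≤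
        2 ^ (1 + η) * C * S * (1 + |t|) ^ ε := fun F => by
    -- Zeros are grouped by the integer part `j` of `Im ρ - t`. The window bound at height `t + j`
    -- grows at most like `(1+|t|)^ε (1+|j|)^{η/2}`, and half of the decay `η` absorbs the growth in
    -- `j`.
    set J : zetaZeros → ℤ := fun ρ => ⌊ρ.1.im - t⌋ with hJ
    rw [← Finset.sum_fiberwise_of_maps_to (t := F.image J) (g := J) (fun ρ hρ => Finset.mem_image_of_mem _ hρ)]
    have hj : ∀ j ∈ F.image J, ∑ ρ ∈ F with J ρ = j, zetaOrder ρ * (1 + |ρ.1.im - t|) ^ (-1 - η) ≤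
          2 ^ (1 + η) * C * (1 + |t|) ^ ε * (1 + |(j : ℝ)|) ^ (-1 - η / 2) := fun j _ => by
      have hloc : ∀ ρ ∈ F.filter (fun ρ => J ρ = j), |ρ.1.im - (t + j)| ≤ 1 := fun ρ hρ => by
        have h1 := Int.floor_eq_iff.1 (Finset.mem_filter.1 hρ).2
        rw [abs_le]; constructor <;> linarith
      have hA : ∀ ρ ∈ F.filter (fun ρ => J ρ = j), (1 + |ρ.1.im - t|) ^ (-1 - η) ≤
          2 ^ (1 + η) * (1 + |(j : ℝ)|) ^ (-1 - η) := fun ρ hρ => by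
        have h1 := hloc ρ hρ
        have h2 : (1 + |(j : ℝ)|) / 2 ≤ 1 + |ρ.1.im - t| := by
          have := abs_sub_abs_le_abs_sub (j : ℝ) (ρ.1.im - t)
          have h5 : |(j : ℝ) - (ρ.1.im - t)| ≤ 1 := by rw [abs_sub_comm, sub_sub]; exact h1
          linarith [abs_nonneg (ρ.1.im - t)]
        refine (rpow_bound_neg h2).trans_eq ?_
        rw [div_rpow (by positivity) (by norm_num), div_eq_mul_inv, ← rpow_neg (by norm_num), mul_comm]
        congr 2; ring
      calc _ ≤ ∑ ρ ∈ F with J ρ = j, zetaOrder ρ * (2 ^ (1 + η) * (1 + |(j : ℝ)|) ^ (-1 - η)) :=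
            Finset.sum_le_sum fun ρ hρ => mul_le_mul_of_nonneg_left (hA ρ hρ) (zetaOrder_nonneg ρ)
        _ = (∑ ρ ∈ F with J ρ = j, zetaOrder ρ) * (2 ^ (1 + η) * (1 + |(j : ℝ)|) ^ (-1 - η)) := by rw [Finset.sum_mul]
        _ ≤ (C * (1 + |t + j|) ^ e) * (2 ^ (1 + η) * (1 + |(j : ℝ)|) ^ (-1 - η)) := mul_bound_right (hw _ _ hloc)
        _ ≤ (C * ((1 + |t|) ^ ε * (1 + |(j : ℝ)|) ^ (η / 2))) *
            (2 ^ (1 + η) * (1 + |(j : ℝ)|) ^ (-1 - η)) := by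
            refine mul_bound_right (mul_bound_left ?_)
            calc (1 + |t + j|) ^ e ≤ ((1 + |t|) * (1 + |(j : ℝ)|)) ^ e :=
                  rpow_bound (one_add_abs_add_le _ _)
              _ = (1 + |t|) ^ e * (1 + |(j : ℝ)|) ^ e := mul_rpow (by positivity) (by positivity)
              _ ≤ _ := mul_bound (rpow_le_rpow_of_exponent_le hT he1)
                  (rpow_le_rpow_of_exponent_le (by linarith [abs_nonneg (j : ℝ)]) he2)
        _ = 2 ^ (1 + η) * C * (1 + |t|) ^ ε * ((1 + |(j : ℝ)|) ^ (η / 2) * (1 + |(j : ℝ)|) ^ (-1 - η)) := by ring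
        _ = _ := by rw [← rpow_add (by positivity)]; congr 2; ring
    refine (Finset.sum_le_sum hj).trans ?_
    rw [← mul_sum]
    have h6 := hS.sum_le_tsum (F.image J) (fun j _ => by positivity)
    calc _ ≤ 2 ^ (1 + η) * C * (1 + |t|) ^ ε * S := mul_bound_left h6
      _ = _ := by ring
  have hnn : ∀ ρ : zetaZeros, 0 ≤ zetaOrder ρ * (1 + |ρ.1.im - t|) ^ (-1 - η) := fun ρ =>
    mul_nonneg (zetaOrder_nonneg ρ) (by positivity)
  exact ⟨summable_of_sum_le hnn hfin, Real.tsum_le_of_sum_le hnn hfin⟩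

theorem RiemannHypothesis.summable_zeros (hRH : RiemannHypothesis) {η : ℝ} (hη : 0 < η) (t : ℝ) :
    Summable (fun ρ : zetaZeros => zetaOrder ρ * (1 + |ρ.1.im - t|) ^ (-1 - η)) :=
  ((hRH.exists_tsum_bound one_pos hη).choose_spec.2 t).1

theorem RiemannHypothesis.countable_zetaZeros (hRH : RiemannHypothesis) : Countable zetaZeros := by
  have := (hRH.summable_zeros one_pos 0).countable_support
  have h2 : Function.support (fun ρ : zetaZeros =>
      zetaOrder ρ * (1 + |ρ.1.im - 0|) ^ (-1 - 1 : ℝ)) = Set.univ := by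
    refine Set.eq_univ_of_forall fun ρ => ?_
    have := zetaOrder_pos ρ.2
    rw [Function.mem_support]; positivity
  rw [h2] at this
  exact Set.countable_univ_iff.1 this

/-! ### Partial fractions of `ζ'/ζ` and its size away from the critical line -/

/-- The partial fraction attached to a zero, normalised at `2`. -/
noncomputable def zeroFrac (w : ℂ) (ρ : ℂ) : ℂ := 1 / (w - ρ) - 1 / (2 - ρ)

/-- Applied with `A = 1 + |γ - t|` and `B = 1 + |γ|`. The larger of the two is at least `(1+|t|)/2`
and takes up the power `1 - ε` of `1 + |t|`; one of its powers is cancelled by the denominator and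
the leftover `-ε` is handed to the smaller. -/
theorem one_add_abs_div_le {t A B ε : ℝ} (hA : 1 ≤ A) (hB : 1 ≤ B) (hε : 0 ≤ ε) (hε1 : ε ≤ 1)
    (h : 1 + |t| ≤ A + B) : (1 + |t|) / (A * B) ≤ 2 * (1 + |t|) ^ ε * (A ^ (-1 - ε) + B ^ (-1 - ε)) := by
  have hT : 0 < 1 + |t| := by positivity
  wlog hAB : A ≤ B generalizing A B
  · have := this hB hA (by linarith) (le_of_not_ge hAB)
    rwa [mul_comm, add_comm (A ^ (-1 - ε))]
  have hA0 : 0 < A := by linarith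
  have hB0 : 0 < B := by linarith
  have h1 : (1 + |t|) ≤ (1 + |t|) ^ ε * (2 * B ^ (1 - ε)) := by
    calc (1 + |t|) = (1 + |t|) ^ ε * (1 + |t|) ^ (1 - ε) := by
          rw [← rpow_add hT]; simp
      _ ≤ (1 + |t|) ^ ε * (2 * B) ^ (1 - ε) := mul_bound_left (rpow_bound (by linarith))
      _ ≤ _ := by
          rw [mul_rpow (by norm_num) hB0.le]
          refine mul_bound_left (mul_bound_right ?_)
          calc (2 : ℝ) ^ (1 - ε) ≤ 2 ^ (1 : ℝ) :=
                rpow_bound_exp (by norm_num)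
            _ = 2 := rpow_one 2
  have h2 : B ^ (1 - ε) / (A * B) ≤ A ^ (-1 - ε) := by
    have h3 : B ^ (1 - ε) = B * B ^ (-ε) := by rw [sub_eq_add_neg, rpow_add hB0, rpow_one]
    have h4 : A ^ (-1 - ε) = A⁻¹ * A ^ (-ε) := by rw [sub_eq_add_neg, rpow_add hA0, rpow_neg_one]
    rw [h3, h4]
    have h5 : B ^ (-ε) ≤ A ^ (-ε) := rpow_bound_neg hAB
    calc B * B ^ (-ε) / (A * B) = A⁻¹ * B ^ (-ε) := by field_simp
      _ ≤ _ := mul_bound_left h5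
  calc (1 + |t|) / (A * B) ≤ (1 + |t|) ^ ε * (2 * B ^ (1 - ε)) / (A * B) :=
        div_le_div_of_nonneg_right h1 (by positivity)
    _ = 2 * (1 + |t|) ^ ε * (B ^ (1 - ε) / (A * B)) := by ring
    _ ≤ 2 * (1 + |t|) ^ ε * (A ^ (-1 - ε) + B ^ (-1 - ε)) := by
        refine mul_bound_left ?_
        have : 0 ≤ B ^ (-1 - ε) := by positivity
        linarith

/-- The normalisation at 2 gives `zeroFrac w ρ = (2-w)/((w-ρ)(2-ρ))`, with quadratic decay in `ρ`,
which makes the series over zeros absolutely convergent. -/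
theorem norm_zeroFrac_le {w ρ : ℂ} {t D δ ε : ℝ} (hρ : ρ.re = 1 / 2) (hδ : 0 < δ) (hε : 0 ≤ ε)
    (hε1 : ε ≤ 1) (hD : ‖2 - w‖ ≤ D * (1 + |t|)) (h : δ * (1 + |ρ.im - t|) ≤ ‖w - ρ‖) :
    ‖zeroFrac w ρ‖ ≤ 4 * D / δ * (1 + |t|) ^ ε * ((1 + |ρ.im - t|) ^ (-1 - ε) + (1 + |ρ.im - 0|) ^ (-1 - ε)) := by
  have hA : 1 ≤ 1 + |ρ.im - t| := by linarith [abs_nonneg (ρ.im - t)]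
  have hB : 1 ≤ 1 + |ρ.im - 0| := by linarith [abs_nonneg (ρ.im - 0)]
  have hT : 0 < 1 + |t| := by positivity
  have hD0 : 0 ≤ D := by
    by_contra hneg
    have := mul_neg_of_neg_of_pos (not_le.1 hneg) hT
    linarith [norm_nonneg (2 - w)]
  have hAB : 1 + |t| ≤ (1 + |ρ.im - t|) + (1 + |ρ.im - 0|) := by
    have := abs_sub_abs_le_abs_sub t ρ.im
    rw [abs_sub_comm] at this
    rw [sub_zero]; linarith
  have h2 : (1 + |ρ.im - 0|) / 2 ≤ ‖2 - ρ‖ := by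
    have h3 := abs_im_le_norm (2 - ρ)
    have h4 := re_le_norm (2 - ρ)
    rw [sub_re, hρ] at h4
    rw [sub_im] at h3
    norm_num at h3 h4
    rw [sub_zero]; linarith
  have hw : w - ρ ≠ 0 := norm_pos_iff.1 (lt_of_lt_of_le (by positivity) h)
  have h2ρ : 2 - ρ ≠ 0 := norm_pos_iff.1 (lt_of_lt_of_le (by positivity) h2)
  have hz : zeroFrac w ρ = (2 - w) / ((w - ρ) * (2 - ρ)) := by rw [zeroFrac]; field_simp; ring
  rw [hz, norm_div, norm_mul]
  calc ‖2 - w‖ / (‖w - ρ‖ * ‖2 - ρ‖)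
      ≤ D * (1 + |t|) / (δ * (1 + |ρ.im - t|) * ((1 + |ρ.im - 0|) / 2)) :=
        div_le_div₀ (by positivity) hD (by positivity) (mul_bound h h2)
    _ = 2 * D / δ * ((1 + |t|) / ((1 + |ρ.im - t|) * (1 + |ρ.im - 0|))) := by field_simp
    _ ≤ 2 * D / δ * (2 * (1 + |t|) ^ ε * ((1 + |ρ.im - t|) ^ (-1 - ε) + (1 + |ρ.im - 0|) ^ (-1 - ε))) :=
        mul_bound_left (one_add_abs_div_le hA hB hε hε1 hAB)
    _ = _ := by ring

/-- `∑_ρ (1/(w-ρ) - 1/(2-ρ))`. -/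
noncomputable def zeroSeries (w : ℂ) : ℂ := ∑' ρ : zetaZeros, (zetaOrder ρ : ℂ) * zeroFrac w ρ

theorem norm_two_sub_le {w : ℂ} (h1 : -1 ≤ w.re) (h2 : w.re ≤ 5) : ‖2 - w‖ ≤ 3 * (1 + |w.im|) := by
  refine (norm_le_abs_re_add_abs_im _).trans ?_
  have h3 : |(2 - w).re| ≤ 3 := by rw [sub_re, abs_le]; norm_num; constructor <;> linarith
  have h4 : |(2 - w).im| = |w.im| := by simp
  rw [h4]; linarith [abs_nonneg w.im]

/-- A family of weights supported away from `w` gives a summable partial fraction series. -/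
theorem RiemannHypothesis.exists_tsum_zeroFrac_le (hRH : RiemannHypothesis) {δ ε : ℝ} (hδ : 0 < δ)
    (hε : 0 < ε) : ∃ C : ℝ, 0 < C ∧ ∀ (w : ℂ) (P : zetaZeros → Prop), -1 ≤ w.re → w.re ≤ 5 →
      (∀ ρ : zetaZeros, P ρ → δ * (1 + |ρ.1.im - w.im|) ≤ ‖w - ρ‖) →
      ∀ a : zetaZeros → ℂ, (∀ ρ, ‖a ρ‖ ≤ zetaOrder ρ) → (∀ ρ, ¬ P ρ → a ρ = 0) →
      Summable (fun ρ : zetaZeros => ‖a ρ * zeroFrac w ρ‖) ∧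
        ∑' ρ : zetaZeros, ‖a ρ * zeroFrac w ρ‖ ≤ C * (1 + |w.im|) ^ ε := by
  set e := min (ε / 2) 1 with he
  have he0 : 0 < e := lt_min (by linarith) one_pos
  have he1 : e ≤ 1 := min_le_right _ _
  have he2 : e ≤ ε / 2 := min_le_left _ _
  obtain ⟨C, hC, hN⟩ := hRH.exists_tsum_bound (ε := ε / 2) (by linarith) he0
  refine ⟨12 / δ * (C + C), by positivity, fun w P h1 h2 hP a ha haP => ?_⟩
  obtain ⟨hs1, hb1⟩ := hN w.im
  obtain ⟨hs2, hb2⟩ := hN 0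
  have hT : 1 ≤ 1 + |w.im| := by linarith [abs_nonneg w.im]
  have hle : ∀ ρ : zetaZeros, ‖a ρ * zeroFrac w ρ‖ ≤ 12 / δ * (1 + |w.im|) ^ e *
      (zetaOrder ρ * (1 + |ρ.1.im - w.im|) ^ (-1 - e) + zetaOrder ρ * (1 + |ρ.1.im - 0|) ^ (-1 - e)) := fun ρ => by
    by_cases hρ : P ρ
    · have h3 := norm_zeroFrac_le (hRH.re_eq ρ.2) hδ he0.le he1 (norm_two_sub_le h1 h2) (hP ρ hρ)
      rw [norm_mul]
      refine (mul_le_mul (ha ρ) h3 (norm_nonneg _) (zetaOrder_nonneg _)).trans_eq ?_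
      ring
    · rw [haP ρ hρ, zero_mul, norm_zero]
      have := zetaOrder_nonneg ρ
      positivity
  have hsum := (hs1.add hs2).mul_left (12 / δ * (1 + |w.im|) ^ e)
  have hS : Summable (fun ρ : zetaZeros => ‖a ρ * zeroFrac w ρ‖) :=
    Summable.of_nonneg_of_le (fun _ => norm_nonneg _) hle hsum
  refine ⟨hS, (hS.tsum_le_tsum hle hsum).trans ?_⟩
  rw [tsum_mul_left, hs1.tsum_add hs2]
  have h4 : (1 + |w.im|) ^ e ≤ (1 + |w.im|) ^ (ε / 2) := rpow_le_rpow_of_exponent_le hT he2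
  have h5 : C * (1 + |(0 : ℝ)|) ^ (ε / 2) ≤ C * (1 + |w.im|) ^ (ε / 2) := by
    refine mul_bound_left (rpow_bound ?_)
    simp
  have h6 : (1 + |w.im|) ^ ε = (1 + |w.im|) ^ (ε / 2) * (1 + |w.im|) ^ (ε / 2) := by
    rw [← rpow_add (by linarith)]; congr 1; ring
  calc _ ≤ 12 / δ * (1 + |w.im|) ^ (ε / 2) *
        (C * (1 + |w.im|) ^ (ε / 2) + C * (1 + |w.im|) ^ (ε / 2)) := by
        refine mul_le_mul (mul_bound_left h4) (by linarith) ?_ (by positivity)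
        exact add_nonneg (tsum_nonneg fun ρ => mul_nonneg (zetaOrder_nonneg ρ) (by positivity))
          (tsum_nonneg fun ρ => mul_nonneg (zetaOrder_nonneg ρ) (by positivity))
    _ = _ := by rw [h6]; ring

theorem mul_one_add_abs_le_norm_sub {w ρ : ℂ} {κ : ℝ} (hκ1 : κ ≤ 1)
    (h : κ ≤ |w.re - ρ.re|) : κ / 2 * (1 + |ρ.im - w.im|) ≤ ‖w - ρ‖ := by
  have h1 := abs_re_le_norm (w - ρ)
  have h2 := abs_im_le_norm (w - ρ)
  rw [sub_re] at h1
  rw [sub_im, abs_sub_comm] at h2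
  nlinarith [abs_nonneg (ρ.im - w.im)]

theorem RiemannHypothesis.exists_zeroSeries_bound (hRH : RiemannHypothesis) {κ ε : ℝ} (hκ : 0 < κ)
    (hε : 0 < ε) : ∃ C : ℝ, 0 < C ∧ ∀ w : ℂ, -1 ≤ w.re → w.re ≤ 5 → κ ≤ |w.re - 1 / 2| →
      Summable (fun ρ : zetaZeros => ‖(zetaOrder ρ : ℂ) * zeroFrac w ρ‖) ∧
      ∑' ρ : zetaZeros, ‖(zetaOrder ρ : ℂ) * zeroFrac w ρ‖ ≤ C * (1 + |w.im|) ^ ε ∧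
      ‖zeroSeries w‖ ≤ C * (1 + |w.im|) ^ ε := by
  obtain ⟨C, hC, h⟩ := hRH.exists_tsum_zeroFrac_le (δ := min κ 1 / 2) (by positivity) hε
  refine ⟨C, hC, fun w h1 h2 h3 => ?_⟩
  obtain ⟨h4, h5⟩ := h w (fun _ => True) h1 h2 (fun ρ _ => mul_one_add_abs_le_norm_sub
    (min_le_right _ _) (by rw [hRH.re_eq ρ.2]; exact (min_le_left _ _).trans h3))
    (fun ρ => (zetaOrder ρ : ℂ)) (fun ρ => (norm_zetaOrder ρ).le) (fun ρ h => absurd trivial h)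
  exact ⟨h4, h5, (norm_tsum_le_tsum_norm h4).trans h5⟩

/-- The partial fraction series with the zero at `w₀` omitted is analytic near `w₀`. -/
theorem RiemannHypothesis.exists_analyticAt_zeroSeries (hRH : RiemannHypothesis) (w₀ : ℂ) :
    ∃ δ : ℝ, 0 < δ ∧ (∀ w ∈ ball w₀ δ, w ≠ w₀ → riemannZeta₁ w ≠ 0) ∧
      ∀ a : zetaZeros → ℂ, (∀ ρ, ‖a ρ‖ ≤ zetaOrder ρ) → (∀ ρ : zetaZeros, ρ.1 = w₀ → a ρ = 0) →
        DifferentiableOn ℂ (fun w => ∑' ρ : zetaZeros, a ρ * zeroFrac w ρ) (ball w₀ δ) ∧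
        ∀ w ∈ ball w₀ δ, Summable fun ρ : zetaZeros => a ρ * zeroFrac w ρ := by
  have hiso : ∀ᶠ w in 𝓝[≠] w₀, riemannZeta₁ w ≠ 0 := by
    refine ((differentiable_riemannZeta₁.analyticAt w₀).eventually_eq_zero_or_eventually_ne_zero).resolve_left
      fun h => ?_
    exact analyticOrderAt_ne_top_of_differentiable differentiable_riemannZeta₁ (c := 1) (by simp) w₀
      (analyticOrderAt_eq_top.2 h)
  rw [eventually_nhdsWithin_iff, Metric.eventually_nhds_iff] at hiso
  obtain ⟨r, hr, hiso⟩ := hiso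
  refine ⟨r / 2, by linarith, fun w hw hne => hiso (by have := mem_ball.1 hw; linarith) hne, fun a ha ha0 => ?_⟩
  set δ := r / 2 with hδ
  have hδ0 : 0 < δ := by linarith
  set d := ((1 + δ) / δ + 1)⁻¹ with hd
  have hd0 : 0 < d := by positivity
  have hs1 := hRH.summable_zeros one_pos w₀.im
  have hs2 := hRH.summable_zeros one_pos 0
  have hkey : ∀ w ∈ ball w₀ δ, ∀ ρ : zetaZeros, ‖a ρ * zeroFrac w ρ‖ ≤
      4 * (‖w₀‖ + δ + 2) / d * (1 + |w₀.im|) ^ (1 : ℝ) * (zetaOrder ρ * (1 + |ρ.1.im - w₀.im|) ^ (-1 - 1 : ℝ) +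
          zetaOrder ρ * (1 + |ρ.1.im - 0|) ^ (-1 - 1 : ℝ)) := fun w hw ρ => by
    rw [mem_ball_iff_norm] at hw
    by_cases hρ : ρ.1 = w₀
    · rw [ha0 ρ hρ, zero_mul, norm_zero]
      have := zetaOrder_nonneg ρ
      positivity
    have hfar : r ≤ ‖ρ.1 - w₀‖ := by
      by_contra hlt
      refine hiso (by rw [dist_eq_norm]; exact not_le.1 hlt) hρ ?_
      exact (hRH.riemannZeta₁_eq_zero_iff (by linarith [ρ.2.2.1])).2 ρ.2
    have htri : ‖ρ.1 - w₀‖ ≤ ‖w - ρ‖ + δ := by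
      have := norm_sub_le_norm_sub_add_norm_sub ρ.1 w w₀
      rw [norm_sub_rev ρ.1 w] at this
      linarith
    have hge : δ ≤ ‖w - ρ‖ := by linarith
    have h1 : 1 + |ρ.1.im - w₀.im| ≤ ((1 + δ) / δ + 1) * ‖w - ρ‖ := by
      have h2 := abs_im_le_norm (ρ.1 - w₀)
      rw [sub_im] at h2
      have h3 : 1 + δ ≤ (1 + δ) / δ * ‖w - ρ‖ := by
        rw [div_mul_eq_mul_div, le_div_iff₀ hδ0]
        exact mul_le_mul_of_nonneg_left hge (by linarith)
      linarith
    have h4 : d * (1 + |ρ.1.im - w₀.im|) ≤ ‖w - ρ‖ := by rw [hd, inv_mul_le_iff₀ (by positivity)]; exact h1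
    have h5 : ‖2 - w‖ ≤ (‖w₀‖ + δ + 2) * (1 + |w₀.im|) := by
      have h6 : ‖2 - w‖ ≤ ‖w₀‖ + δ + 2 := by
        have h7 := norm_sub_le (2 : ℂ) w
        have h8 := norm_le_norm_add_norm_sub' w w₀
        simp at h7
        linarith
      have : 0 ≤ ‖w₀‖ + δ + 2 := by positivity
      nlinarith [abs_nonneg w₀.im]
    have h9 := norm_zeroFrac_le (hRH.re_eq ρ.2) hd0 zero_le_one le_rfl h5 h4
    rw [norm_mul]
    refine (mul_le_mul (ha ρ) h9 (norm_nonneg _) (zetaOrder_nonneg _)).trans_eq ?_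
    ring
  have hsum := (hs1.add hs2).mul_left (4 * (‖w₀‖ + δ + 2) / d * (1 + |w₀.im|) ^ (1 : ℝ))
  refine ⟨differentiableOn_tsum_of_summable_norm hsum (fun ρ => ?_) isOpen_ball
    fun ρ w hw => hkey w hw ρ, fun w hw => Summable.of_norm_bounded hsum (hkey w hw)⟩
  intro w hw
  by_cases hρ : ρ.1 = w₀
  · simp only [ha0 ρ hρ, zero_mul]; exact differentiableWithinAt_const _
  · have hne : w - ρ ≠ 0 := fun h => by
      rw [sub_eq_zero] at h
      refine hiso (y := w) (by have := mem_ball.1 hw; linarith) (h ▸ hρ) ?_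
      rw [h]
      exact (hRH.riemannZeta₁_eq_zero_iff (by linarith [ρ.2.2.1])).2 ρ.2
    unfold zeroFrac
    have hd : DifferentiableAt ℂ (fun w : ℂ => w - ρ.1) w := by fun_prop
    exact (((((differentiableAt_const (1 : ℂ)).fun_div hd hne).sub_const _).const_mul _)).differentiableWithinAt

/-- The logarithmic derivative of `(s - 1) ζ(s)` minus its partial fraction series. -/
noncomputable def zetaDefect (w : ℂ) : ℂ :=
  deriv riemannZeta₁ w / riemannZeta₁ w - zeroSeries w

/-- The regular part of `ζ'/ζ`. -/
noncomputable def zetaRegular (w : ℂ) : ℂ := limUnder (𝓝[≠] w) zetaDefect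

/-- At a zero of order `n` the pole `n/(w - w₀)` of the logarithmic derivative cancels against the
term of the series belonging to that zero. What is left is `g'/g` for the nonvanishing cofactor, the
series without that term, and a constant. -/
theorem RiemannHypothesis.exists_analyticAt_zetaDefect (hRH : RiemannHypothesis) {w₀ : ℂ}
    (h₀ : -1 < w₀.re) : ∃ g : ℂ → ℂ, AnalyticAt ℂ g w₀ ∧ (∀ᶠ w in 𝓝[≠] w₀, zetaDefect w = g w) ∧
      (riemannZeta₁ w₀ ≠ 0 → zetaDefect w₀ = g w₀) := by
  classical
  obtain ⟨δ, hδ, hne, han⟩ := hRH.exists_analyticAt_zeroSeries w₀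
  have hball : ball w₀ δ ∈ 𝓝 w₀ := ball_mem_nhds _ hδ
  have hord : ∀ ρ : zetaZeros, ‖(zetaOrder ρ : ℂ)‖ ≤ zetaOrder ρ := fun ρ => (norm_zetaOrder ρ).le
  by_cases hz : riemannZeta₁ w₀ = 0
  · have hmem := (hRH.riemannZeta₁_eq_zero_iff h₀).1 hz
    set ρ₀ : zetaZeros := ⟨w₀, hmem⟩ with hρ₀
    set a : zetaZeros → ℂ := Function.update (fun ρ : zetaZeros => (zetaOrder ρ : ℂ)) ρ₀ 0 with ha
    have ha0 : a ρ₀ = 0 := Function.update_self _ _ _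
    have ha1 : ∀ ρ, ρ ≠ ρ₀ → a ρ = zetaOrder ρ := fun ρ hρ => Function.update_of_ne hρ _ _
    obtain ⟨hdiff, hsum⟩ := han a (fun ρ => by
      by_cases hρ : ρ = ρ₀
      · rw [hρ, ha0, norm_zero]; exact zetaOrder_nonneg _
      · rw [ha1 ρ hρ]; exact hord ρ) (fun ρ hρ => by
        rw [show ρ = ρ₀ from Subtype.ext hρ, ha0])
    obtain ⟨g, hg, hgw, hfg⟩ := exists_eq_pow_mul_of_differentiable differentiable_riemannZeta₁
      (ρ := w₀) (analyticOrderAt_ne_top_of_differentiable differentiable_riemannZeta₁ (c := 1) (by simp) w₀)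
    set n := analyticOrderNatAt riemannZeta₁ w₀ with hn
    have hnz : (n : ℂ) = (zetaOrder w₀ : ℂ) := by
      have := analyticOrderNatAt_riemannZeta₁ (ne_one_of_mem_zetaZeros hmem)
      rw [← this]; simp [hn]
    refine ⟨fun w => deriv g w / g w - (∑' ρ : zetaZeros, a ρ * zeroFrac w ρ) + n / (2 - w₀),
      ?_, ?_, fun h => absurd hz h⟩
    · refine AnalyticAt.add (AnalyticAt.sub ?_ (hdiff.analyticAt hball)) analyticAt_const
      exact (hg.analyticAt w₀).deriv.div (hg.analyticAt w₀) hgw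
    · have hgne : ∀ᶠ w in 𝓝[≠] w₀, g w ≠ 0 :=
        (hg.continuous.continuousAt.eventually_ne hgw).filter_mono nhdsWithin_le_nhds
      filter_upwards [hgne, self_mem_nhdsWithin, nhdsWithin_le_nhds hball] with w h1 h2 h3
      have h2' : w - w₀ ≠ 0 := sub_ne_zero.2 h2
      have hld : deriv riemannZeta₁ w / riemannZeta₁ w = n / (w - w₀) + deriv g w / g w := by
        have e1 : riemannZeta₁ = fun z => (z - w₀) ^ n * g z := funext hfg
        have e2 := logDeriv_mul (f := fun z => (z - w₀) ^ n) (g := g) w (pow_ne_zero _ h2') h1 (by fun_prop) (hg w)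
        rw [← e1] at e2
        rw [← logDeriv_apply, e2, logDeriv_fun_pow (by fun_prop), logDeriv_apply, logDeriv_apply]
        simp [div_eq_mul_inv]
      have hS : zeroSeries w = (∑' ρ : zetaZeros, a ρ * zeroFrac w ρ) + n * zeroFrac w w₀ := by
        have e3 : HasSum (fun ρ : zetaZeros => a ρ * zeroFrac w ρ + (if ρ = ρ₀ then (n : ℂ) * zeroFrac w w₀ else 0))
            ((∑' ρ : zetaZeros, a ρ * zeroFrac w ρ) + n * zeroFrac w w₀) :=
          (hsum w h3).hasSum.add (hasSum_ite_eq ρ₀ _)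
        rw [zeroSeries, ← e3.tsum_eq]
        refine tsum_congr fun ρ => ?_
        by_cases hρ : ρ = ρ₀
        · rw [if_pos hρ, hρ, ha0, hnz]; ring
        · rw [if_neg hρ, ha1 ρ hρ, add_zero]
      rw [zetaDefect, hld, hS, zeroFrac]
      ring
  · obtain ⟨hdiff, hsum⟩ := han (fun ρ => (zetaOrder ρ : ℂ)) hord (fun ρ hρ => by
      exfalso; apply hz
      rw [← hρ]; exact (hRH.riemannZeta₁_eq_zero_iff (by linarith [ρ.2.2.1])).2 ρ.2)
    refine ⟨zetaDefect, ?_, of_forall fun _ => rfl, fun _ => rfl⟩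
    have hζ := differentiable_riemannZeta₁.analyticAt w₀
    exact (hζ.deriv.div hζ hz).sub (hdiff.analyticAt hball)

/-- Taking the limit over punctured neighbourhoods fills the removable singularities at the zeros,
where `zetaDefect` itself has a meaningless value. -/
theorem RiemannHypothesis.zetaRegular_spec (hRH : RiemannHypothesis) {w : ℂ} (h : -1 < w.re) :
    AnalyticAt ℂ zetaRegular w ∧ (riemannZeta₁ w ≠ 0 → zetaRegular w = zetaDefect w) := by
  obtain ⟨g, hg, hev, hw⟩ := hRH.exists_analyticAt_zetaDefect h
  have h1 : ∀ᶠ z in 𝓝 w, zetaRegular z = g z := by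
    have h2 : ∀ᶠ z in 𝓝 w, ∀ᶠ y in 𝓝[≠] z, zetaDefect y = g y := by
      have h3 := hev
      rw [eventually_nhdsWithin_iff] at h3
      filter_upwards [h3.eventually_nhds] with z hz
      by_cases hzw : z = w
      · rw [hzw]; exact hev
      · have h4 : ∀ᶠ y in 𝓝 z, y ≠ w := isOpen_ne.mem_nhds hzw
        exact (hz.and h4).filter_mono nhdsWithin_le_nhds |>.mono fun y hy => hy.1 hy.2
    filter_upwards [h2, hg.eventually_continuousAt] with z hz hc
    refine Tendsto.limUnder_eq ?_
    exact (hc.tendsto.mono_left nhdsWithin_le_nhds).congr' (hz.mono fun y hy => hy.symm)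
  exact ⟨hg.congr (h1.mono fun z hz => hz.symm), fun hne => by rw [h1.self_of_nhds, hw hne]⟩

/-- Zeros in the Landau disc about `2 + i Im w` are separated from the others. For the near ones
Landau's lemma controls the difference with their poles removed, and the normalising terms `1/(2-ρ)`
are bounded by the number of zeros. The far ones form an absolutely convergent tail. No lower bound
for `|w - ρ|` at near zeros enters, so the estimate also holds on the critical line. -/
theorem RiemannHypothesis.exists_zetaRegular_bound (hRH : RiemannHypothesis) {κ ε : ℝ}
    (hκ : 0 < κ) (hκ1 : κ < 1) (hε : 0 < ε) : ∃ C : ℝ, 0 < C ∧ ∀ w : ℂ, -1 + κ ≤ w.re →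
      w.re ≤ 2 → ‖zetaRegular w‖ ≤ C * (1 + |w.im|) ^ ε := by
  classical
  obtain ⟨C₁, hC₁, hland⟩ := hRH.exists_landau hκ hκ1 hε
  -- For a zero outside the disc both `κ/2` and `|Im ρ - Im w|` are at most `|w - ρ|`; adding `1 ≤
  -- (2/κ)|w - ρ|` to the second inequality gives this constant.
  set δ := (2 / κ + 1)⁻¹ with hδ
  have hδ0 : 0 < δ := by positivity
  obtain ⟨C₂, hC₂, hser⟩ := hRH.exists_tsum_zeroFrac_le hδ0 hε
  have hmain : ∀ w : ℂ, -1 + κ ≤ w.re → w.re ≤ 2 → riemannZeta₁ w ≠ 0 →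
      ‖zetaRegular w‖ ≤ (2 * C₁ + C₂) * (1 + |w.im|) ^ ε := fun w h1 h2 h3 => by
    obtain ⟨Z, hZ, hsum, hbd⟩ := hland w.im
    have hc : ‖w - (2 + w.im * I)‖ ≤ 3 - κ := by
      have : w - (2 + w.im * I) = ((w.re - 2 : ℝ) : ℂ) := by apply Complex.ext <;> simp
      rw [this, norm_real, norm_eq_abs, abs_le]
      constructor <;> linarith
    have hb := hbd w hc h3
    obtain ⟨hs1, hs2⟩ := hser w (fun ρ => ρ ∉ Z) (by linarith) (by linarith) (fun ρ hρ => by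
      rw [hZ, not_le] at hρ
      have h4 : κ / 2 ≤ ‖w - ρ‖ := by
        have := norm_sub_le_norm_sub_add_norm_sub ρ.1 w (2 + w.im * I)
        rw [norm_sub_rev ρ.1 w] at this
        linarith
      have h5 := abs_im_le_norm (w - ρ)
      rw [sub_im, abs_sub_comm] at h5
      rw [hδ, inv_mul_le_iff₀ (by positivity)]
      have h6 : 1 ≤ 2 / κ * ‖w - ρ‖ := by rw [div_mul_eq_mul_div, le_div_iff₀ hκ]; linarith
      linarith) (fun ρ => if ρ ∈ Z then 0 else (zetaOrder ρ : ℂ)) (fun ρ => by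
        split_ifs
        · rw [norm_zero]; exact zetaOrder_nonneg _
        · exact (norm_zetaOrder ρ).le)
      (fun ρ hρ => if_pos (not_not.1 hρ))
    have hS : zeroSeries w = (∑ ρ ∈ Z, (zetaOrder ρ : ℂ) * zeroFrac w ρ) +
        ∑' ρ : zetaZeros, (if ρ ∈ Z then 0 else (zetaOrder ρ : ℂ)) * zeroFrac w ρ := by
      have e1 : HasSum (fun ρ : zetaZeros => if ρ ∈ Z then (zetaOrder ρ : ℂ) * zeroFrac w ρ else 0)
          (∑ ρ ∈ Z, if ρ ∈ Z then (zetaOrder ρ : ℂ) * zeroFrac w ρ else 0) :=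
        hasSum_sum_of_ne_finset_zero fun ρ hρ => if_neg hρ
      rw [sum_congr rfl fun ρ hρ => if_pos hρ] at e1
      have e2 := e1.add hs1.of_norm.hasSum
      rw [zeroSeries, ← e2.tsum_eq]
      refine tsum_congr fun ρ => ?_
      by_cases hρ : ρ ∈ Z <;> simp [hρ]
    have hreg := (hRH.zetaRegular_spec (w := w) (by linarith)).2 h3
    have hsplit : ∑ ρ ∈ Z, (zetaOrder ρ : ℂ) * zeroFrac w ρ =
        ∑ ρ ∈ Z, (zetaOrder ρ : ℂ) / (w - ρ) - ∑ ρ ∈ Z, (zetaOrder ρ : ℂ) / (2 - ρ) := by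
      rw [← Finset.sum_sub_distrib]
      refine sum_congr rfl fun ρ _ => ?_
      rw [zeroFrac]; ring
    have h2ρ : ‖∑ ρ ∈ Z, (zetaOrder ρ : ℂ) / (2 - ρ)‖ ≤ C₁ * (1 + |w.im|) ^ ε := by
      refine (norm_sum_le_of_le Z fun ρ _ => ?_).trans hsum
      rw [norm_div, norm_zetaOrder]
      refine div_le_self (zetaOrder_nonneg _) ?_
      have h4 := re_le_norm (2 - ρ.1)
      rw [sub_re, hRH.re_eq ρ.2] at h4
      norm_num at h4; linarith
    rw [hreg, zetaDefect, hS, hsplit]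
    set X := ∑' ρ : zetaZeros, (if ρ ∈ Z then 0 else (zetaOrder ρ : ℂ)) * zeroFrac w ρ with hX
    have hXn : ‖X‖ ≤ C₂ * (1 + |w.im|) ^ ε := (norm_tsum_le_tsum_norm hs1).trans hs2
    set Y := ∑ ρ ∈ Z, (zetaOrder ρ : ℂ) / (2 - ρ)
    set V := ∑ ρ ∈ Z, (zetaOrder ρ : ℂ) / (w - ρ)
    rw [show deriv riemannZeta₁ w / riemannZeta₁ w - (V - Y + X) =
      (deriv riemannZeta₁ w / riemannZeta₁ w - V) + Y - X by ring]
    refine (norm_sub_le _ _).trans ((add_le_add_left (norm_add_le _ _) _).trans ?_)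
    linarith
  refine ⟨2 * C₁ + C₂, by positivity, fun w h1 h2 => ?_⟩
  by_cases h3 : riemannZeta₁ w = 0
  -- At a zero the bound follows by continuity from nearby points, since zeros are isolated.
  · have hmem := (hRH.riemannZeta₁_eq_zero_iff (by linarith)).1 h3
    have hre := hRH.re_eq hmem
    obtain ⟨δ', hδ', hne, -⟩ := hRH.exists_analyticAt_zeroSeries w
    have hcont := (hRH.zetaRegular_spec (w := w) (by linarith)).1.continuousAt
    have hev : ∀ᶠ z in 𝓝[≠] w, ‖zetaRegular z‖ ≤ (2 * C₁ + C₂) * (1 + |z.im|) ^ ε := by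
      filter_upwards [self_mem_nhdsWithin, nhdsWithin_le_nhds (ball_mem_nhds w hδ'), nhdsWithin_le_nhds
        ((isOpen_strip (-1 + κ) 2).mem_nhds ⟨by linarith, by linarith⟩)] with z z1 z2 z3
      exact hmain z z3.1.le z3.2.le (hne z z2 z1)
    have hr : ContinuousAt (fun z : ℂ => (2 * C₁ + C₂) * (1 + |z.im|) ^ ε) w :=
      continuousAt_const.mul (ContinuousAt.rpow_const (by fun_prop) (inr hε.le))
    exact le_of_tendsto_of_tendsto (hcont.norm.tendsto.mono_left nhdsWithin_le_nhds)
      (hr.tendsto.mono_left nhdsWithin_le_nhds) hev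
  · exact hmain w h1 h2 h3

/-- The three summands carry, in order, no pole, the pole at 1, and the poles at the zeros; residues
are taken for each of them separately. -/
theorem RiemannHypothesis.logDeriv_riemannZeta_eq (hRH : RiemannHypothesis) {w : ℂ}
    (h : -1 < w.re) (h1 : w ≠ 1) (h0 : w ∉ zetaZeros) :
    deriv riemannZeta w / riemannZeta w = zetaRegular w - 1 / (w - 1) + zeroSeries w := by
  have hz : riemannZeta₁ w ≠ 0 := fun hz => h0 ((hRH.riemannZeta₁_eq_zero_iff h).1 hz)
  rw [(hRH.zetaRegular_spec h).2 hz, zetaDefect, deriv_riemannZeta_eq_neg_inv_sub_sq_mul_add h1,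
    riemannZeta_eq_inv_sub_mul h1]
  have : w - 1 ≠ 0 := sub_ne_zero.2 h1
  field_simp
  ring

theorem RiemannHypothesis.exists_logDeriv_bound (hRH : RiemannHypothesis) {κ ε : ℝ}
    (hκ : 0 < κ) (hκ1 : κ < 1) (hε : 0 < ε) : ∃ C : ℝ, 0 < C ∧ ∀ w : ℂ, -1 + κ ≤ w.re →
      w.re ≤ 2 → κ ≤ |w.re - 1 / 2| → κ ≤ ‖w - 1‖ →
      ‖deriv riemannZeta w / riemannZeta w‖ ≤ C * (1 + |w.im|) ^ ε := by
  obtain ⟨C₁, hC₁, h1⟩ := hRH.exists_zetaRegular_bound hκ hκ1 hε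
  obtain ⟨C₂, hC₂, h2⟩ := hRH.exists_zeroSeries_bound hκ hε
  refine ⟨C₁ + 1 / κ + C₂, by positivity, fun w i1 i2 i3 i4 => ?_⟩
  have hne : w ≠ 1 := by rintro rfl; simp at i4; linarith
  have hnz : w ∉ zetaZeros := fun hm => by rw [hRH.re_eq hm] at i3; simp at i3; linarith
  rw [hRH.logDeriv_riemannZeta_eq (by linarith) hne hnz]
  have hT : 1 ≤ (1 + |w.im|) ^ ε := one_le_rpow (by linarith [abs_nonneg w.im]) hε.le
  have h3 : ‖1 / (w - 1)‖ ≤ 1 / κ * (1 + |w.im|) ^ ε := by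
    rw [norm_div, norm_one]
    have := one_div_le_one_div_of_le hκ i4
    have h4 : 0 < 1 / κ := by positivity
    nlinarith
  have := (h2 w (by linarith) (by linarith) i3).2.2
  have := h1 w i1 i2
  calc _ ≤ ‖zetaRegular w‖ + ‖1 / (w - 1)‖ + ‖zeroSeries w‖ :=
        (norm_add_le _ _).trans (add_le_add_left (norm_sub_le _ _) _)
    _ ≤ _ := by linarith

/-! ### Symmetric sums over the zeros -/

theorem zetaZeros_conj {ρ : ℂ} (h : ρ ∈ zetaZeros) : (starRingEnd ℂ) ρ ∈ zetaZeros := by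
  refine ⟨?_, by simpa using h.2.1, by simpa using h.2.2⟩
  rw [riemannZeta_conj, h.1, map_zero]

/-- The local factorisation at `ρ` is carried to the conjugate point by `ζ(conj z) = conj ζ(z)`. -/
theorem zetaOrder_conj {ρ : ℂ} (h : ρ ∈ zetaZeros) :
    zetaOrder ((starRingEnd ℂ) ρ) = zetaOrder ρ := by
  have hne := ne_one_of_mem_zetaZeros h
  have hne' := ne_one_of_mem_zetaZeros (zetaZeros_conj h)
  have hz : ∀ z : ℂ, z ≠ 1 → AnalyticAt ℂ riemannZeta z := fun z hz =>
    DifferentiableOn.analyticAt (s := {1}ᶜ) (fun s hs =>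
      (differentiableAt_riemannZeta hs).differentiableWithinAt) (isOpen_compl_singleton.mem_nhds hz)
  have htop : analyticOrderAt riemannZeta ρ ≠ ⊤ := fun htop => by
    have := zetaOrder_pos h
    rw [zetaOrder, analyticOrderNatAt, htop] at this
    simp at this
  obtain ⟨n, hn⟩ := ENat.ne_top_iff_exists.1 htop
  obtain ⟨g, hg, hg0, hev⟩ := (hz ρ hne).analyticOrderAt_eq_natCast.1 hn.symm
  have hcc : Tendsto (starRingEnd ℂ) (𝓝 ((starRingEnd ℂ) ρ)) (𝓝 ρ) := by
    have := Complex.continuous_conj.tendsto ((starRingEnd ℂ) ρ)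
    rwa [conj_conj] at this
  have hord : analyticOrderAt riemannZeta ((starRingEnd ℂ) ρ) = n := by
    refine (hz _ hne').analyticOrderAt_eq_natCast.2 ⟨fun z => (starRingEnd ℂ) (g ((starRingEnd ℂ) z)), ?_, ?_, ?_⟩
    · rw [Complex.analyticAt_iff_eventually_differentiableAt]
      have h1 := Complex.analyticAt_iff_eventually_differentiableAt.1 hg
      filter_upwards [hcc.eventually h1] with z hz
      have := hz.conj_conj
      rwa [conj_conj] at this
    · simpa using hg0
    · filter_upwards [hcc.eventually hev] with z hz
      rw [riemannZeta_conj, smul_eq_mul] at hz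
      have := congrArg (starRingEnd ℂ) hz
      simpa using this
  rw [zetaOrder, zetaOrder, analyticOrderNatAt, analyticOrderNatAt, hord, ← hn]

theorem finite_zetaZeros_abs_im_le (hRH : RiemannHypothesis) (T : ℝ) :
    {ρ : zetaZeros | |ρ.1.im| ≤ T}.Finite := by
  have h := hRH.summable_zeros one_pos 0
  have h1 := h.tendsto_cofinite_zero
  have hc : 0 < (1 + |T|) ^ (-1 - 1 : ℝ) := by positivity
  have h2 := h1.eventually (gt_mem_nhds hc)
  rw [eventually_cofinite] at h2
  refine h2.subset fun ρ (hρ : |ρ.1.im| ≤ T) => ?_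
  rw [mem_ofPred_eq, not_lt]
  have h3 : (1 : ℝ) ≤ zetaOrder ρ := by
    have := zetaOrder_pos ρ.2
    rw [zetaOrder] at this ⊢
    exact_mod_cast this
  have h4 : (1 + |T|) ^ (-1 - 1 : ℝ) ≤ (1 + |ρ.1.im - 0|) ^ (-1 - 1 : ℝ) := by
    refine rpow_bound_neg ?_
    rw [sub_zero]; linarith [le_abs_self T]
  have : 0 ≤ (1 + |ρ.1.im - 0|) ^ (-1 - 1 : ℝ) := by positivity
  nlinarith

/-- Summable families over the zeros have symmetric sums. -/
theorem tendsto_sum_zetaZeros (hRH : RiemannHypothesis) {F : zetaZeros → ℂ} {a : ℂ}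
    (h : HasSum F a) : Tendsto (fun T : ℝ => ∑ ρ ∈ (finite_zetaZeros_abs_im_le hRH T).toFinset, F ρ) atTop (𝓝 a) := by
  have h' : Tendsto (fun s : Finset zetaZeros => ∑ ρ ∈ s, F ρ) atTop (𝓝 a) := by simpa [HasSum] using h
  have hmono : Monotone fun T : ℝ => (finite_zetaZeros_abs_im_le hRH T).toFinset :=
    fun T T' hT ρ hρ => by
      rw [Set.Finite.mem_toFinset] at hρ ⊢
      exact le_trans hρ hT
  exact h'.comp (tendsto_atTop_finset_of_monotone hmono fun ρ =>
    ⟨|ρ.1.im|, by rw [Set.Finite.mem_toFinset]; exact le_refl |ρ.1.im|⟩)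

theorem hasSymmetricZeroSum_iff (hRH : RiemannHypothesis) {f : ℂ → ℂ} {a : ℂ} :
    HasSymmetricZeroSum f a ↔ Tendsto (fun T : ℝ =>
      ∑ ρ ∈ (finite_zetaZeros_abs_im_le hRH T).toFinset, (zetaOrder ρ : ℂ) * f ρ) atTop (𝓝 a) := by
  rw [HasSymmetricZeroSum]
  refine iff_of_eq (congrArg (fun F => Tendsto F atTop (𝓝 a)) (funext fun T => ?_))
  have hset : {ρ : ℂ | ρ ∈ zetaZeros ∧ |ρ.im| ≤ T} =
      Subtype.val '' ((finite_zetaZeros_abs_im_le hRH T).toFinset : Set zetaZeros) := by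
    ext ρ
    simp only [Set.Finite.coe_toFinset, Set.mem_image]
    exact ⟨fun h => ⟨⟨ρ, h.1⟩, h.2, rfl⟩, fun ⟨x, hx, hxρ⟩ => hxρ ▸ ⟨x.2, hx⟩⟩
  rw [hset, finsum_mem_image Subtype.val_injective.injOn, finsum_mem_coe_finset]
  simp_rw [zetaMult_eq]

/-- Averaging over `ρ` and its conjugate replaces `1/(2-ρ)` by `(3/2)/(9/4 + γ²)`, which is
absolutely summable. The truncation `|Im ρ| ≤ T` is invariant under conjugation, so the averaging
does not change its partial sums. -/
theorem exists_symmetric_sum_two_sub (hRH : RiemannHypothesis) :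
    ∃ C₀ : ℂ, HasSymmetricZeroSum (fun ρ => 1 / (2 - ρ)) C₀ := by
  classical
  have hs := hRH.summable_zeros one_pos 0
  have hsum : Summable fun ρ : zetaZeros => (zetaOrder ρ : ℂ) *
      ((1 / (2 - ρ.1) + 1 / (2 - (starRingEnd ℂ) ρ.1)) / 2) := by
    refine Summable.of_norm_bounded (hs.mul_left 6) fun ρ => ?_
    have hre := hRH.re_eq ρ.2
    have key : (1 / (2 - ρ.1) + 1 / (2 - (starRingEnd ℂ) ρ.1)) / 2 =
        ((3 / 2 / (9 / 4 + ρ.1.im ^ 2) : ℝ) : ℂ) := by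
      have e1 : (2 - ρ.1) ≠ 0 := ne_zero_of_re_ne (by simp [hre]; norm_num)
      have e2 : (2 - (starRingEnd ℂ) ρ.1) ≠ 0 := ne_zero_of_re_ne (by simp [hre]; norm_num)
      have e3 : ((9 / 4 + ρ.1.im ^ 2 : ℝ) : ℂ) ≠ 0 := by rw [Ne, ofReal_eq_zero]; positivity
      have e4 : (2 - ρ.1) * (2 - (starRingEnd ℂ) ρ.1) = ((9 / 4 + ρ.1.im ^ 2 : ℝ) : ℂ) := by
        apply Complex.ext <;> simp [hre, -Complex.ofReal_pow]
        · ring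
        · ring
      have e5 : (2 - ρ.1) + (2 - (starRingEnd ℂ) ρ.1) = 3 := by
        apply Complex.ext <;> simp [hre]
        norm_num
      rw [Complex.ofReal_div, ← e4]
      field_simp
      push_cast
      linear_combination e5
    rw [key, norm_mul, norm_zetaOrder, norm_real, norm_of_nonneg (by positivity), sub_zero]
    have e6 : 3 / 2 / (9 / 4 + ρ.1.im ^ 2) ≤ 6 * (1 + |ρ.1.im|) ^ (-1 - 1 : ℝ) := by
      rw [show (-1 - 1 : ℝ) = -((2 : ℕ) : ℝ) by norm_num, rpow_neg (by positivity),
        rpow_natCast, ← div_eq_mul_inv, div_le_div_iff₀ (by positivity) (by positivity)]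
      nlinarith [sq_abs ρ.1.im, sq_nonneg (|ρ.1.im| - 1)]
    calc zetaOrder ρ * (3 / 2 / (9 / 4 + ρ.1.im ^ 2))
        ≤ zetaOrder ρ * (6 * (1 + |ρ.1.im|) ^ (-1 - 1 : ℝ)) := mul_le_mul_of_nonneg_left e6 (zetaOrder_nonneg _)
      _ = _ := by ring
  refine ⟨_, (hasSymmetricZeroSum_iff hRH).2 ((tendsto_sum_zetaZeros hRH hsum.hasSum).congr fun T => ?_)⟩
  set A := (finite_zetaZeros_abs_im_le hRH T).toFinset
  let c : zetaZeros → zetaZeros := fun ρ => ⟨(starRingEnd ℂ) ρ, zetaZeros_conj ρ.2⟩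
  have hswap : ∑ ρ ∈ A, (zetaOrder ρ : ℂ) * (1 / (2 - (starRingEnd ℂ) ρ.1)) =
      ∑ ρ ∈ A, (zetaOrder ρ : ℂ) * (1 / (2 - ρ.1)) := by
    have hA : ∀ ρ ∈ A, c ρ ∈ A := fun ρ hρ => by
      rw [Set.Finite.mem_toFinset] at hρ ⊢
      simpa [c] using hρ
    refine Finset.sum_nbij' c c hA hA (fun ρ _ => ?_) (fun ρ _ => ?_) fun ρ _ => ?_
    · exact Subtype.ext (conj_conj _)
    · exact Subtype.ext (conj_conj _)
    · simp only [c]; rw [zetaOrder_conj ρ.2]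
  have : ∑ ρ ∈ A, (zetaOrder ρ : ℂ) * ((1 / (2 - ρ.1) + 1 / (2 - (starRingEnd ℂ) ρ.1)) / 2) =
      ((∑ ρ ∈ A, (zetaOrder ρ : ℂ) * (1 / (2 - ρ.1))) +
        ∑ ρ ∈ A, (zetaOrder ρ : ℂ) * (1 / (2 - (starRingEnd ℂ) ρ.1))) / 2 := by
    rw [← sum_add_distrib, Finset.sum_div]
    exact sum_congr rfl fun ρ _ => by ring
  rw [this, hswap]; ring

/-- The symmetric sum `∑_ρ 1/(w-ρ)` is, up to a constant, the series `∑_ρ (1/(w-ρ) - 1/(2-ρ))`. -/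
theorem exists_hasSymmetricZeroSum (hRH : RiemannHypothesis) : ∃ C₀ : ℂ, ∀ w : ℂ, 1 / 2 < w.re →
    w.re ≤ 5 → HasSymmetricZeroSum (fun ρ => 1 / (w - ρ)) (zeroSeries w + C₀) := by
  obtain ⟨C₀, hC₀⟩ := exists_symmetric_sum_two_sub hRH
  refine ⟨C₀, fun w h1 h2 => ?_⟩
  obtain ⟨C, _, h⟩ := hRH.exists_zeroSeries_bound (κ := w.re - 1 / 2) (by linarith) one_pos
  obtain ⟨hs, -, -⟩ := h w (by linarith) h2 (le_abs_self _)
  rw [hasSymmetricZeroSum_iff hRH] at hC₀ ⊢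
  refine ((tendsto_sum_zetaZeros hRH hs.of_norm.hasSum).add hC₀).congr fun T => ?_
  rw [← sum_add_distrib]
  refine sum_congr rfl fun ρ _ => ?_
  rw [zeroFrac]; ring

/-! ### The residue theorem against `ζ'/ζ` -/

theorem hasSum_of_hasSum_of_eq {ι : Type*} {f : ι → ℂ} {a b : ℂ} (h : HasSum f a) (e : a = b) : HasSum f b := e ▸ h

theorem vline_add {c : ℝ} {F G : ℂ → ℂ} (hF : Integrable fun y : ℝ => F (c + y * I))
    (hG : Integrable fun y : ℝ => G (c + y * I)) :
    vline c (fun z => F z + G z) = vline c F + vline c G := by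
  rw [vline, vline, vline, integral_add hF hG, mul_add]

theorem vline_sub {c : ℝ} {F G : ℂ → ℂ} (hF : Integrable fun y : ℝ => F (c + y * I))
    (hG : Integrable fun y : ℝ => G (c + y * I)) :
    vline c (fun z => F z - G z) = vline c F - vline c G := by
  rw [vline, vline, vline, integral_sub hF hG, mul_sub]

theorem vline_const_mul {c : ℝ} (k : ℂ) (F : ℂ → ℂ) :
    vline c (fun z => k * F z) = k * vline c F := by
  rw [vline, vline, integral_const_mul]; ring

theorem vline_congr {c : ℝ} {F G : ℂ → ℂ} (h : ∀ z : ℂ, z.re = c → F z = G z) :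
    vline c F = vline c G := by
  rw [vline, vline]
  congr 1
  exact integral_congr_ae (of_forall fun y => h _ (by simp))

theorem norm_le_of_one_add_abs {c κ : ℝ} (h : κ ≤ |c|) {z : ℂ} (hz : z.re = c)
    (hκ : 0 < κ := by linarith) (hκ1 : κ ≤ 1 := by linarith) : 1 / ‖z‖ ≤ 2 / κ * (1 + |z.im|)⁻¹ := by
  have h1 : κ / 2 * (1 + |(0 : ℂ).im - z.im|) ≤ ‖z - 0‖ := mul_one_add_abs_le_norm_sub hκ1 (by simpa [hz] using h)
  have hT : 0 < 1 + |z.im| := by positivity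
  simp only [Complex.zero_im, zero_sub, abs_neg, sub_zero] at h1
  have h2 := one_div_le_one_div_of_le (by positivity) h1
  refine h2.trans_eq ?_
  field_simp

theorem integrable_vline_div_sub {h : ℂ → ℂ} {a b C η : ℝ} {p : ℂ} (hb : b < p.re) (ha : p.re < a)
    (hd : ∀ z : ℂ, b ≤ z.re → z.re ≤ a → DifferentiableAt ℂ h z) (hη : 0 < η)
    (hh : ∀ z : ℂ, b ≤ z.re → z.re ≤ a → ‖h z‖ ≤ C * (1 + |z.im|) ^ (-η)) :
    (∀ c : ℝ, (c = a ∨ c = b) → Integrable fun y : ℝ => h (c + y * I) / (c + y * I - p)) ∧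
    vline a (fun z => h z / (z - p)) - vline b (fun z => h z / (z - p)) = h p := by
  refine ⟨fun c hc => integrable_vertical_div_sub ?_ (fun z hz => (hd z ?_ ?_).continuousAt) hη
    (fun z hz => hh z ?_ ?_), vline_sub_vline_div_sub hb ha hd hη hh⟩ <;>
  rcases hc with rfl | rfl <;> grind

/-- Residues at two poles of `h z / (z (z - p))`, one of them at the origin. -/
theorem vline_sub_vline_inv_sub_mul_div {h : ℂ → ℂ} {a b C η : ℝ} {p : ℂ} (hp0 : p ≠ 0)
    (hb : b < p.re) (ha : p.re < a) (hb0 : b < 0) (ha0 : 0 < a)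
    (hd : ∀ z : ℂ, b ≤ z.re → z.re ≤ a → DifferentiableAt ℂ h z) (hη : 0 < η)
    (hh : ∀ z : ℂ, b ≤ z.re → z.re ≤ a → ‖h z‖ ≤ C * (1 + |z.im|) ^ (-η)) :
    (∀ c : ℝ, (c = a ∨ c = b) → Integrable fun y : ℝ => (1 / ((c + y * I : ℂ) - p)) * (h (c + y * I) / (c + y * I))) ∧
    vline a (fun z => 1 / (z - p) * (h z / z)) - vline b (fun z => 1 / (z - p) * (h z / z)) = (h p - h 0) / p := by
  have hsplit : ∀ c : ℝ, (c = a ∨ c = b) → ∀ z : ℂ, z.re = c →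
      1 / (z - p) * (h z / z) = 1 / p * (h z / (z - p) - h z / (z - 0)) := fun c hc z hz => by
    have h1 : z ≠ 0 := by rintro rfl; simp at hz; grind
    have h2 : z - p ≠ 0 := by grind
    rw [sub_zero]; field_simp; ring
  obtain ⟨i1, h1⟩ := integrable_vline_div_sub hb ha hd hη hh
  obtain ⟨i2, h2⟩ := integrable_vline_div_sub (p := 0) (by simpa using hb0) (by simpa using ha0) hd hη hh
  have hv : ∀ c : ℝ, (c = a ∨ c = b) → vline c (fun z => 1 / (z - p) * (h z / z)) =
      1 / p * (vline c (fun z => h z / (z - p)) - vline c (fun z => h z / (z - 0))) := fun c hc => by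
    rw [vline_congr (hsplit c hc), vline_const_mul, vline_sub (i1 c hc) (i2 c hc)]
  refine ⟨fun c hc => (((i1 c hc).sub (i2 c hc)).const_mul (1 / p)).congr
    (of_forall fun y => (hsplit c hc _ (by simp)).symm), ?_⟩
  rw [hv a (inl rfl), hv b (inr rfl), ← h1, ← h2]
  ring

/-- The logarithmic derivative of the Riemann zeta function. -/
noncomputable def zetaLD (w : ℂ) : ℂ := deriv riemannZeta w / riemannZeta w

theorem re_im_norm_of_mem_ball {s s₀ : ℂ} {r : ℝ} (hs : s ∈ ball s₀ r) :
    (s₀.re - r < s.re ∧ s.re < s₀.re + r) ∧ |s.im| ≤ |s₀.im| + r ∧ ‖s‖ ≤ ‖s₀‖ + r := by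
  have hs' : ‖s - s₀‖ < r := by rwa [← dist_eq_norm]
  have a := abs_lt.1 ((abs_re_le_norm (s - s₀)).trans_lt hs')
  have b := (abs_im_le_norm (s - s₀)).trans hs'.le
  rw [sub_re] at a
  rw [sub_im] at b
  exact ⟨⟨by linarith, by linarith⟩, by linarith [abs_sub_abs_le_abs_sub s.im s₀.im],
    by linarith [norm_sub_norm_le s s₀]⟩

/-- Termwise integration of a series along a vertical line. -/
theorem hasSum_vline {ι : Type*} [Countable ι] {c : ℝ} {F : ι → ℂ → ℂ} {R : ℂ → ℂ} {g : ℝ → ℝ}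
    (hm : ∀ i, AEStronglyMeasurable (fun y : ℝ => F i (c + y * I)) volume)
    (hs : ∀ y : ℝ, Summable fun i => ‖F i (c + y * I)‖)
    (hg : ∀ y : ℝ, ∑' i, ‖F i (c + y * I)‖ ≤ g y) (hgi : Integrable g)
    (hR : ∀ z : ℂ, z.re = c → ∑' i, F i z = R z) :
    HasSum (fun i => vline c (F i)) (vline c R) ∧ Integrable fun y : ℝ => R (c + y * I) := by
  have hRe : ∀ y : ℝ, ∑' i, F i (c + y * I) = R (c + y * I) := fun y => hR _ (by simp)
  have h1 := (hasSum_integral_of_tsum_norm_le hm hs hg hgi).2.2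
  simp_rw [hRe] at h1
  refine ⟨h1.mul_left _, hgi.mono' ?_ (of_forall fun y => ?_)⟩
  · refine aestronglyMeasurable_of_tendsto_ae (ι := Finset ι) atTop (f := fun S (y : ℝ) => ∑ i ∈ S, F i (c + y * I))
      (fun S => Finset.aestronglyMeasurable_fun_sum S fun i _ => hm i)
      (of_forall fun y => ?_)
    rw [← hRe]
    exact (hs y).of_norm.hasSum
  · rw [← hRe]
    exact (norm_tsum_le_tsum_norm (hs y)).trans (hg y)

theorem one_add_abs_add_rpow_le (a b : ℝ) {ε : ℝ} (hε : 0 ≤ ε) :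
    (1 + |a + b|) ^ ε ≤ (1 + |a|) ^ ε * (1 + |b|) ^ ε := by
  rw [← mul_rpow (by positivity) (by positivity)]
  exact rpow_le_rpow (by positivity) (one_add_abs_add_le _ _) hε

set_option maxHeartbeats 1000000 in
/-- The residue theorem for `ζ'/ζ(z+s) h(z)/z` on a vertical strip. -/
theorem RiemannHypothesis.residue_sum (hRH : RiemannHypothesis) {s : ℂ} {h : ℂ → ℂ} {a b C η : ℝ}
    (hd : ∀ z : ℂ, b ≤ z.re → z.re ≤ a → DifferentiableAt ℂ h z) (hη : 0 < η)
    (hh : ∀ z : ℂ, b ≤ z.re → z.re ≤ a → ‖h z‖ ≤ C * (1 + |z.im|) ^ (-η))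
    (hs : 1 / 2 < s.re := by linarith) (hs1 : s.re < 1 := by linarith)
    (ha : 1 < s.re + a := by linarith) (ha2 : s.re + a ≤ 2 := by linarith)
    (hb1 : -1 < s.re + b := by linarith) (hb2 : s.re + b < 1 / 2 := by linarith) :
    HasSum (fun ρ : zetaZeros => (zetaOrder ρ : ℂ) * (h (ρ - s) / (ρ - s)))
      (vline a (fun z => zetaLD (z + s) * (h z / z)) - vline b (fun z => zetaLD (z + s) * (h z / z))
        + h (1 - s) / (1 - s) - zetaLD s * h 0) := by
  have hcount := hRH.countable_zetaZeros
  have hb0 : b < 0 := by linarith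
  have ha0 : 0 < a := by linarith
  -- Half of the decay of `h` pays for the growth of `ζ'/ζ`; the other half keeps the line integrals
  -- absolutely convergent.
  set ε := η / 2 with hε
  have hε0 : 0 < ε := by positivity
  -- `κ` bounds from below the distances of the shifted lines and of `s` from the critical line, of
  -- the left shifted line from `Re = -1`, and of both unshifted lines from the origin.
  obtain ⟨κ, hκ0, hκ⟩ : ∃ κ > 0, κ ≤ min (min (s.re + b + 1) (1 / 2 - (s.re + b)))
      (min (s.re - 1 / 2) (min a (min (-b) (1 / 2)))) :=
    ⟨_, by simp only [gt_iff_lt, lt_min_iff]; grind, le_rfl⟩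
  simp only [le_min_iff] at hκ
  obtain ⟨⟨k1, k2⟩, k3, k4, k5, k6⟩ := hκ
  have hcb : ∀ c : ℝ, (c = a ∨ c = b) → b ≤ c ∧ c ≤ a ∧ κ ≤ |c| ∧ κ ≤ |c + s.re - 1 / 2| ∧
      c + s.re ≠ 1 := by
    rintro c (rfl | rfl)
    · rw [abs_of_pos ha0, abs_of_pos (by linarith)]
      exact ⟨by linarith, le_rfl, k4, by linarith, ha.ne' ∘ (add_comm _ _).trans⟩
    · rw [abs_of_neg hb0, abs_of_neg (by linarith)]
      exact ⟨le_rfl, by linarith, by linarith, by linarith, fun h => by linarith⟩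
  obtain ⟨C₁, hC₁, hG⟩ := hRH.exists_zetaRegular_bound hκ0 (by linarith) hε0
  obtain ⟨C₂, hC₂, hS⟩ := hRH.exists_zeroSeries_bound hκ0 hε0
  have hre : ∀ z : ℂ, (z + s).re = z.re + s.re := fun z => add_re _ _
  set M := (1 + |s.im|) ^ ε * C
  have hcomb : ∀ z : ℂ, b ≤ z.re → z.re ≤ a →
      (1 + |(z + s).im|) ^ ε * ‖h z‖ ≤ M * (1 + |z.im|) ^ (-ε) := fun z h1 h2 => by
    have hT : 0 < 1 + |z.im| := by positivity
    calc _ ≤ ((1 + |z.im|) ^ ε * (1 + |s.im|) ^ ε) * (C * (1 + |z.im|) ^ (-η)) :=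
          mul_bound (add_im z s ▸ one_add_abs_add_rpow_le _ _ hε0.le) (hh z h1 h2)
      _ = M * (1 + |z.im|) ^ (ε + -η) := by rw [rpow_add hT]; ring
      _ = _ := by rw [hε]; ring_nf
  -- the regular part
  set g : ℂ → ℂ := fun z => zetaRegular (z + s) * h z with hg
  obtain ⟨hgint, hgres⟩ := integrable_vline_div_sub (h := g) (C := C₁ * M) (p := 0) (by simpa) (by simpa)
    (fun z h1 h2 => DifferentiableAt.mul (DifferentiableAt.comp z (f := fun z => z + s)
      (hRH.zetaRegular_spec (w := z + s) (by rw [hre]; linarith)).1.differentiableAt (by fun_prop)) (hd z h1 h2))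
    hε0 fun z h1 h2 => by
      rw [hg, norm_mul, mul_assoc]
      refine (mul_bound_right (hG (z + s) (by rw [hre]; linarith) (by rw [hre]; linarith))).trans ?_
      rw [mul_assoc]
      exact mul_bound_left (hcomb z h1 h2)
  -- the pole at 1
  have hqre : (1 - s).re = 1 - s.re := by simp
  have hq0 : (1 - s) ≠ 0 := fun h0 => by rw [h0, zero_re] at hqre; linarith
  obtain ⟨hpint, hpres⟩ := vline_sub_vline_inv_sub_mul_div hq0 (by linarith) (by linarith) hb0 ha0 hd hη hh
  -- the zeros
  have hρre := hRH.re_sub s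
  have hρ0 : ∀ ρ : zetaZeros, ρ.1 - s ≠ 0 := fun ρ => ne_zero_of_re_ne (by rw [hρre]; linarith)
  have hzre : ∀ ρ : zetaZeros, _ := fun ρ => vline_sub_vline_inv_sub_mul_div (hρ0 ρ)
    (by rw [hρre]; linarith) (by rw [hρre]; linarith) hb0 ha0 hd hη hh
  obtain ⟨hhint, hhres⟩ := integrable_vline_div_sub (p := 0) (by simpa) (by simpa) hd hη hh
  set F : zetaZeros → ℂ → ℂ := fun ρ z => (zetaOrder ρ : ℂ) * zeroFrac (z + s) ρ * (h z / z) with hF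
  have hfrac : ∀ ρ z, F ρ z = (zetaOrder ρ : ℂ) *
      (1 / (z - (ρ - s)) * (h z / z) - 1 / (2 - ρ.1) * (h z / (z - 0))) := fun ρ z => by
    simp only [hF, zeroFrac, sub_zero]; rw [show z - (ρ.1 - s) = z + s - ρ by ring]; ring
  have hi : ∀ (ρ : zetaZeros) (c : ℝ), (c = a ∨ c = b) → _ := fun ρ c hc => (hhint c hc).const_mul (1 / (2 - ρ.1))
  have hv : ∀ (ρ : zetaZeros) (c : ℝ), (c = a ∨ c = b) → vline c (F ρ) = (zetaOrder ρ : ℂ) *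
      (vline c (fun z => 1 / (z - (ρ - s)) * (h z / z)) - 1 / (2 - ρ.1) * vline c (fun z => h z / (z - 0))) :=
    fun ρ c hc => by
      rw [vline_congr fun z _ => hfrac ρ z, vline_const_mul, vline_sub ((hzre ρ).1 c hc) (hi ρ c hc), vline_const_mul]
  -- Shifting the line for a single zero crosses both `z = ρ - s` and `z = 0`. The residues at the
  -- origin add up to `h(0)` times the partial fraction series at `s`, which becomes part of
  -- `ζ'/ζ(s) h(0)`.
  have hterm : ∀ ρ : zetaZeros, (zetaOrder ρ : ℂ) * (h (ρ - s) / (ρ - s)) =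
      vline a (F ρ) - vline b (F ρ) - h 0 * ((zetaOrder ρ : ℂ) * zeroFrac s ρ) := fun ρ => by
    rw [hv ρ a (inl rfl), hv ρ b (inr rfl), zeroFrac, ← neg_sub ρ.1 s, div_neg]
    linear_combination -(zetaOrder ρ : ℂ) * ((hzre ρ).2 - 1 / (2 - ρ.1) * hhres)
  -- summation over the zeros on each line
  have hlineS : ∀ c : ℝ, (c = a ∨ c = b) → HasSum (fun ρ => vline c (F ρ))
      (vline c fun z => zeroSeries (z + s) * (h z / z)) ∧
      Integrable fun y : ℝ => (fun z => zeroSeries (z + s) * (h z / z)) (c + y * I) := fun c hc => by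
    obtain ⟨c1, c2, c3, c4, -⟩ := hcb c hc
    have hyre : ∀ y : ℝ, (c + y * I : ℂ).re = c := fun y => by simp
    have hser : ∀ y : ℝ, _ := fun y : ℝ => hS (c + y * I + s)
      (by rw [hre, hyre]; linarith) (by rw [hre, hyre]; linarith) (by rw [hre, hyre]; exact c4)
    refine hasSum_vline (g := fun y => C₂ * (2 / κ) * M * (1 + |y|) ^ (-1 - ε))
      (fun ρ => (((((hzre ρ).1 c hc).sub (hi ρ c hc)).const_mul (zetaOrder ρ : ℂ)).congr
        (of_forall fun y => (hfrac ρ _).symm)).aestronglyMeasurable)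
      (fun y => by simpa only [hF, norm_mul _ (h _ / _)] using (hser y).1.mul_right _) (fun y => ?_)
      ((integrable_one_add_abs_rpow hε0).const_mul _) fun z _ => tsum_mul_right
    simp only [hF, norm_mul _ (h _ / _)]
    rw [tsum_mul_right, norm_div, div_eq_mul_one_div]
    have h1 := norm_le_of_one_add_abs c3 (hyre y)
    have h5 := hcomb (c + y * I) (by rw [hyre]; exact c1) (by rw [hyre]; exact c2)
    have hy : (c + y * I : ℂ).im = y := by simp
    rw [hy] at h1 h5
    refine (mul_bound (hser y).2.1 (mul_bound_left h1)).trans ?_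
    calc _ = C₂ * (2 / κ) * (1 + |y|)⁻¹ * ((1 + |(c + y * I + s).im|) ^ ε * ‖h (c + y * I)‖) := by ring
      _ ≤ C₂ * (2 / κ) * (1 + |y|)⁻¹ * (M * (1 + |y|) ^ (-ε)) := mul_bound_left h5
      _ = _ := by rw [sub_eq_add_neg, rpow_add (by positivity), rpow_neg_one]; ring
  have hS0 := (hS s (by linarith) (by linarith) (k3.trans (le_abs_self _))).1.of_norm.hasSum.mul_left (h 0)
  have hL : ∀ z : ℂ, -1 < z.re → κ ≤ |z.re - 1 / 2| → z ≠ 1 → _ := fun z hz h2 h1 =>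
    hRH.logDeriv_riemannZeta_eq hz h1 fun h0 => by rw [hRH.re_eq h0, sub_self, abs_zero] at h2; linarith
  have hvL : ∀ c : ℝ, (c = a ∨ c = b) → vline c (fun z => zetaLD (z + s) * (h z / z)) =
        vline c (fun z => g z / (z - 0)) - vline c (fun z => 1 / (z - (1 - s)) * (h z / z)) +
          vline c (fun z => zeroSeries (z + s) * (h z / z)) := fun c hc => by
    rw [← vline_sub (hgint c hc) (hpint c hc), ← vline_add ((hgint c hc).sub (hpint c hc)) (hlineS c hc).2]
    refine vline_congr fun z hz => ?_
    obtain ⟨c1, -, -, c4, c5⟩ := hcb c hc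
    rw [zetaLD, hL _ (by rw [hre]; linarith) (by rwa [hre, hz])
        (fun h0 => c5 (by rw [← hz, ← hre, h0, Complex.one_re])),
      hg, sub_zero, show z + s - 1 = z - (1 - s) by ring]
    ring
  simp_rw [hterm]
  refine hasSum_of_hasSum_of_eq (((hlineS a (inl rfl)).1.sub (hlineS b (inr rfl)).1).sub hS0) ?_
  rw [hvL a (inl rfl), hvL b (inr rfl), zetaLD, hL s (by linarith) (k3.trans (le_abs_self _)) (sub_ne_zero.1 hq0).symm, ← neg_sub 1 s, div_neg, ← zeroSeries]
  simp only [hg, zero_add] at hgres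
  linear_combination hpres - hgres

/-! ### Beta integrals and Mellin transforms of convolutions with powers -/

theorem norm_ofReal_cpow_of_pos {t : ℝ} (ht : 0 < t) (a : ℂ) : ‖(t : ℂ) ^ a‖ = t ^ a.re :=
  norm_cpow_eq_rpow_re_of_pos ht a

theorem continuousOn_ofReal_cpow (a : ℂ) : ContinuousOn (fun t : ℝ => (t : ℂ) ^ a) (Ioi 0) :=
  fun t ht => (Complex.continuousAt_ofReal_cpow_const t a (inr (ne_of_gt ht))).continuousWithinAt

theorem integrableOn_cpow_mul_exp {a : ℂ} (ha : 0 < a.re) {r : ℝ} (hr : 0 < r) :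
    IntegrableOn (fun t : ℝ => (t : ℂ) ^ (a - 1) * Complex.exp (-(r * t))) (Ioi 0) ∧
    ∫ t in Ioi (0 : ℝ), ‖(t : ℂ) ^ (a - 1) * Complex.exp (-(r * t))‖ = (1 / r) ^ a.re * Real.Gamma a.re := by
  have hn : ∀ t ∈ Ioi (0 : ℝ), ‖(t : ℂ) ^ (a - 1) * Complex.exp (-(r * t))‖ =
      t ^ (a.re - 1) * exp (-(r * t)) := fun t ht => by
    rw [norm_mul, norm_ofReal_cpow_of_pos ht, norm_exp]
    simp
  have hint : IntegrableOn (fun t : ℝ => t ^ (a.re - 1) * exp (-(r * t))) (Ioi 0) := by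
    refine Integrable.of_integral_ne_zero ?_
    rw [integral_rpow_mul_exp_neg_mul_Ioi ha hr]
    have := Real.Gamma_pos_of_pos ha
    positivity
  refine ⟨?_, ?_⟩
  · refine hint.mono' ?_ ((ae_restrict_mem measurableSet_Ioi).mono fun t ht => (hn t ht).le)
    refine ContinuousOn.aestronglyMeasurable (ContinuousOn.mul (continuousOn_ofReal_cpow _) ?_) measurableSet_Ioi
    fun_prop
  · rw [setIntegral_congr_fun measurableSet_Ioi hn, integral_rpow_mul_exp_neg_mul_Ioi ha hr]

/-- The Beta integral on the half-line. -/
theorem one_div_ofReal_cpow {x : ℝ} (hx : 0 < x) (a : ℂ) : ((1 : ℂ) / x) ^ a = (x : ℂ) ^ (-a) := by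
  rw [one_div, cpow_neg, inv_cpow]
  rw [arg_ofReal_of_nonneg hx.le]; exact pi_pos.ne

/-- `Γ(a+c)(1+t)^{-(a+c)}` is the integral of `ξ^{a+c-1} e^{-(1+t)ξ}`. After exchanging the
integrations the `t`-integral is `Γ(a)ξ^{-a}`, and the `ξ`-integral that remains is `Γ(c)`. -/
theorem integral_Ioi_beta {a c : ℂ} (ha : 0 < a.re) (hc : 0 < c.re) :
    IntegrableOn (fun t : ℝ => (t : ℂ) ^ (a - 1) * ((1 + t : ℝ) : ℂ) ^ (-(a + c))) (Ioi 0) ∧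
    ∫ t in Ioi (0 : ℝ), (t : ℂ) ^ (a - 1) * ((1 + t : ℝ) : ℂ) ^ (-(a + c)) = Gamma a * Gamma c / Gamma (a + c) := by
  have hac : 0 < (a + c).re := by rw [add_re]; linarith
  have hG : Gamma (a + c) ≠ 0 := Gamma_ne_zero_of_re_pos hac
  set μ := volume.restrict (Ioi (0 : ℝ)) with hμ
  set H : ℝ × ℝ → ℂ := fun p => ((p.1 : ℂ) ^ (a - 1) * Complex.exp (-(p.2 * p.1))) *
    ((p.2 : ℂ) ^ (a + c - 1) * Complex.exp (-p.2)) with hH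
  have hmeas : AEStronglyMeasurable H (μ.prod μ) := by
    rw [hμ, Measure.prod_restrict]
    refine ContinuousOn.aestronglyMeasurable ?_ (measurableSet_Ioi.prod measurableSet_Ioi)
    refine ContinuousOn.mul (ContinuousOn.mul ?_ (by fun_prop)) (ContinuousOn.mul ?_ (by fun_prop))
    · exact (continuousOn_ofReal_cpow (a - 1)).comp continuousOn_fst fun p hp => hp.1
    · exact (continuousOn_ofReal_cpow (a + c - 1)).comp continuousOn_snd fun p hp => hp.2
  have h1 : ∀ ξ ∈ Ioi (0 : ℝ), ∫ t in Ioi (0 : ℝ), H (t, ξ) =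
      Gamma a * ((ξ : ℂ) ^ (c - 1) * Complex.exp (-((1 : ℝ) * ξ))) := fun ξ hξ => by
    simp only [hH]
    rw [integral_mul_const, integral_cpow_mul_exp_neg_mul_Ioi ha hξ]
    have e2 : (ξ : ℂ) ^ (c - 1) = (ξ : ℂ) ^ (-a) * (ξ : ℂ) ^ (a + c - 1) := by
      rw [← cpow_add _ _ (ofReal_ne_zero.2 (ne_of_gt hξ))]; congr 1; ring
    rw [one_div_ofReal_cpow hξ, e2]; push_cast; ring_nf
  have h2 : ∀ t ∈ Ioi (0 : ℝ), ∫ ξ in Ioi (0 : ℝ), H (t, ξ) =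
      (t : ℂ) ^ (a - 1) * ((1 + t : ℝ) : ℂ) ^ (-(a + c)) * Gamma (a + c) := fun t ht => by
    have ht' : (0 : ℝ) < 1 + t := by have : (0 : ℝ) < t := ht; linarith
    have e0 : ∀ ξ : ℝ, H (t, ξ) = (t : ℂ) ^ (a - 1) *
        ((ξ : ℂ) ^ (a + c - 1) * Complex.exp (-((1 + t : ℝ) * ξ))) := fun ξ => by
      simp only [hH]
      have : Complex.exp (-((1 + t : ℝ) * ξ)) = Complex.exp (-(ξ * t)) * Complex.exp (-ξ) := by
        rw [← Complex.exp_add]; congr 1; push_cast; ring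
      rw [this]; ring
    simp_rw [e0]
    rw [integral_const_mul, integral_cpow_mul_exp_neg_mul_Ioi hac ht']
    rw [one_div_ofReal_cpow ht']; ring
  have hint : Integrable H (μ.prod μ) := by
    rw [integrable_prod_iff' hmeas]
    refine ⟨(ae_restrict_mem measurableSet_Ioi).mono fun ξ hξ => ?_, ?_⟩
    · have := (integrableOn_cpow_mul_exp ha hξ).1.mul_const ((ξ : ℂ) ^ (a + c - 1) * Complex.exp (-ξ))
      simpa only [hH] using this
    · have e3 : ∀ ξ ∈ Ioi (0 : ℝ), ∫ t in Ioi (0 : ℝ), ‖H (t, ξ)‖ =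
          Real.Gamma a.re * ‖(ξ : ℂ) ^ (c - 1) * Complex.exp (-((1 : ℝ) * ξ))‖ := fun ξ hξ => by
        have hξ' : (0 : ℝ) < ξ := hξ
        simp only [hH, norm_mul _ (_ * _)]
        rw [integral_mul_const, (integrableOn_cpow_mul_exp ha hξ).2]
        rw [norm_mul, norm_mul, norm_ofReal_cpow_of_pos hξ', norm_ofReal_cpow_of_pos hξ']
        have e4 : (1 / ξ) ^ a.re = ξ ^ (-a.re) := by rw [one_div, Real.inv_rpow hξ'.le, rpow_neg hξ'.le]
        have e5 : ξ ^ (c - 1).re = ξ ^ (-a.re) * ξ ^ (a + c - 1).re := by rw [← rpow_add hξ']; congr 1; simp; ring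
        rw [e4, e5]; push_cast; ring_nf
      exact (integrable_congr ((ae_restrict_mem measurableSet_Ioi).mono fun ξ hξ => e3 ξ hξ)).2
        ((integrableOn_cpow_mul_exp hc one_pos).1.norm.const_mul _)
  have hswap := integral_integral_swap (f := fun t ξ => H (t, ξ)) hint
  have hL : ∫ t in Ioi (0 : ℝ), ∫ ξ in Ioi (0 : ℝ), H (t, ξ) =
      (∫ t in Ioi (0 : ℝ), (t : ℂ) ^ (a - 1) * ((1 + t : ℝ) : ℂ) ^ (-(a + c))) * Gamma (a + c) := by
    rw [setIntegral_congr_fun measurableSet_Ioi h2, integral_mul_const]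
  have hR : ∫ ξ in Ioi (0 : ℝ), ∫ t in Ioi (0 : ℝ), H (t, ξ) =
      Gamma a * Gamma c := by
    rw [setIntegral_congr_fun measurableSet_Ioi h1, integral_const_mul, integral_cpow_mul_exp_neg_mul_Ioi hc one_pos]
    simp
  rw [hL, hR] at hswap
  refine ⟨?_, by rw [eq_div_iff hG, hswap]⟩
  exact (((integrable_congr ((ae_restrict_mem measurableSet_Ioi).mono h2)).1
    hint.integral_prod_left).mul_const (Gamma (a + c))⁻¹).congr (of_forall fun t => by
      simp only [mul_assoc, mul_inv_cancel₀ hG, mul_one])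

/-- The truncated power `t ↦ t^a` for `t > 0`. -/
noncomputable def posPow (a : ℂ) (t : ℝ) : ℂ := if 0 < t then (t : ℂ) ^ a else 0

theorem posPow_of_pos {t : ℝ} (ht : 0 < t) (a : ℂ) : posPow a t = (t : ℂ) ^ a := if_pos ht

theorem posPow_of_nonpos {t : ℝ} (ht : t ≤ 0) (a : ℂ) : posPow a t = 0 := if_neg (not_lt.2 ht)

theorem measurable_posPow (a : ℂ) : Measurable (posPow a) := by
  refine Measurable.ite measurableSet_Ioi ?_ measurable_const
  exact measurable_ofReal.pow_const a

theorem setIntegral_Ioi_cpow_mul (a : ℂ) (g : ℝ → ℂ) :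
    ∫ t in Ioi (0 : ℝ), (t : ℂ) ^ a * g t = ∫ t : ℝ, posPow a t * g t := by
  rw [← integral_indicator measurableSet_Ioi]
  refine integral_congr_ae (of_forall fun t => ?_)
  by_cases ht : t ∈ Ioi (0 : ℝ)
  · simp only [indicator_of_mem ht]; rw [posPow_of_pos ht]
  · simp only [indicator_of_notMem ht]; rw [posPow_of_nonpos (not_lt.1 ht), zero_mul]

theorem integrableOn_Ioi_cpow_mul_iff (a : ℂ) (g : ℝ → ℂ) : IntegrableOn (fun t : ℝ => (t : ℂ) ^ a * g t) (Ioi 0) ↔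
      Integrable fun t : ℝ => posPow a t * g t := by
  rw [← integrable_indicator_iff measurableSet_Ioi]
  refine integrable_congr (of_forall fun t => ?_)
  by_cases ht : t ∈ Ioi (0 : ℝ)
  · simp only [indicator_of_mem ht]; rw [posPow_of_pos ht]
  · simp only [indicator_of_notMem ht]; rw [posPow_of_nonpos (not_lt.1 ht), zero_mul]

theorem mellin_eq_integral_posPow (g : ℝ → ℂ) (z : ℂ) :
    mellin g z = ∫ t : ℝ, posPow (z - 1) t * g t := by
  simp only [mellin, smul_eq_mul]; exact setIntegral_Ioi_cpow_mul _ _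

theorem mellinConvergent_iff_posPow (g : ℝ → ℂ) (z : ℂ) :
    MellinConvergent g z ↔ Integrable fun t : ℝ => posPow (z - 1) t * g t := by
  simp only [MellinConvergent, smul_eq_mul]; exact integrableOn_Ioi_cpow_mul_iff _ _

theorem posPow_mul_pos {u t : ℝ} (hu : 0 < u) (a : ℂ) : posPow a (u * t) = (u : ℂ) ^ a * posPow a t := by
  rcases lt_or_ge 0 t with ht | ht
  · rw [posPow_of_pos ht, posPow_of_pos (mul_pos hu ht)]
    push_cast
    rw [Complex.mul_cpow_ofReal_nonneg hu.le ht.le]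
  · rw [posPow_of_nonpos ht, posPow_of_nonpos (mul_nonpos_of_nonneg_of_nonpos hu.le ht), mul_zero]

/-- The kernel `∫ (u+y)_+^{z-1} y_+^{w-1} dy`. -/
noncomputable def betaKernel (z w : ℂ) (u : ℝ) : ℂ := ∫ y : ℝ, posPow (z - 1) (u + y) * posPow (w - 1) y

/-- The translation `y ↦ y + u` interchanges the two powers, so negative `u` reduces to positive `u`
with `z` and `w` swapped. -/
theorem betaKernel_neg (z w : ℂ) (u : ℝ) : betaKernel z w (-u) = betaKernel w z u := by
  rw [betaKernel, betaKernel, ← integral_add_right_eq_self (fun y => posPow (z - 1) (-u + y) * posPow (w - 1) y) u]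
  refine integral_congr_ae (of_forall fun y => ?_)
  simp only []
  rw [show -u + (y + u) = y by ring, add_comm y u, mul_comm]

theorem posPow_add_mul_posPow_scale (z w : ℂ) {u : ℝ} (hu : 0 < u) (t : ℝ) :
    posPow (z - 1) (u + u * t) * posPow (w - 1) (u * t) =
      (u : ℂ) ^ (z + w - 1) * (u : ℂ)⁻¹ * (posPow (z - 1) (1 + t) * posPow (w - 1) t) := by
  rw [show u + u * t = u * (1 + t) by ring, posPow_mul_pos hu, posPow_mul_pos hu]
  have hu' : (u : ℂ) ≠ 0 := ofReal_ne_zero.2 hu.ne'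
  have e2 : (u : ℂ) ^ (z + w - 1) * (u : ℂ)⁻¹ = (u : ℂ) ^ (z - 1) * (u : ℂ) ^ (w - 1) := by
    rw [← Complex.cpow_neg_one, ← cpow_add _ _ hu', ← cpow_add _ _ hu']
    congr 1; ring
  rw [e2]; ring

/-- The scaling `y = ut` extracts the power of `u` and leaves the Beta integral with parameters `w`
and `1 - z - w`. -/
theorem betaKernel_of_pos {z w : ℂ} (hw : 0 < w.re) (hzw : (z + w).re < 1) {u : ℝ} (hu : 0 < u) :
    Integrable (fun y : ℝ => posPow (z - 1) (u + y) * posPow (w - 1) y) ∧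
    betaKernel z w u = (u : ℂ) ^ (z + w - 1) * (Gamma w * Gamma (1 - z - w) / Gamma (1 - z)) := by
  obtain ⟨h1, h2⟩ := integral_Ioi_beta (a := w) (c := 1 - z - w) hw (by simp at hzw ⊢; linarith)
  rw [show w + (1 - z - w) = 1 - z by ring, show -(1 - z) = z - 1 by ring] at *
  rw [integrableOn_Ioi_cpow_mul_iff] at h1
  rw [setIntegral_Ioi_cpow_mul] at h2
  have e0 : ∀ t : ℝ, posPow (w - 1) t * ((1 + t : ℝ) : ℂ) ^ (z - 1) =
      posPow (z - 1) (1 + t) * posPow (w - 1) t := fun t => by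
    rcases lt_or_ge 0 t with ht | ht
    · rw [posPow_of_pos (show 0 < 1 + t by linarith), mul_comm]
    · rw [posPow_of_nonpos ht, zero_mul, mul_zero]
  simp_rw [e0] at h1 h2
  have e1 := posPow_add_mul_posPow_scale z w hu
  constructor
  · rw [← integrable_comp_mul_left_iff (fun y => posPow (z - 1) (u + y) * posPow (w - 1) y) hu.ne']
    simp_rw [e1]
    exact h1.const_mul _
  · have e3 := Measure.integral_comp_mul_left (fun y => posPow (z - 1) (u + y) * posPow (w - 1) y) u
    simp_rw [e1] at e3
    rw [integral_const_mul, h2, abs_of_pos (inv_pos.2 hu)] at e3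
    rw [betaKernel]
    have hu' : (u : ℂ) ≠ 0 := ofReal_ne_zero.2 hu.ne'
    have e4 := congrArg (fun x => (u : ℂ) * x) e3
    simp only [real_smul, Complex.ofReal_inv] at e4
    rw [mul_inv_cancel_left₀ hu'] at e4
    rw [← e4]; field_simp

theorem integral_norm_posPow_add_mul_posPow (z w : ℂ) {u : ℝ} (hu : 0 < u) :
    ∫ y : ℝ, ‖posPow (z - 1) (u + y) * posPow (w - 1) y‖ =
      u ^ (z.re + w.re - 1) * ∫ y : ℝ, ‖posPow (z - 1) (1 + y) * posPow (w - 1) y‖ := by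
  have e3 := Measure.integral_comp_mul_left (fun y => ‖posPow (z - 1) (u + y) * posPow (w - 1) y‖) u
  have e1 : ∀ t : ℝ, ‖posPow (z - 1) (u + u * t) * posPow (w - 1) (u * t)‖ =
      u ^ (z.re + w.re - 1) * u⁻¹ * ‖posPow (z - 1) (1 + t) * posPow (w - 1) t‖ := fun t => by
    rw [posPow_add_mul_posPow_scale z w hu, norm_mul, norm_mul, norm_ofReal_cpow_of_pos hu, norm_inv,
      norm_real, norm_of_nonneg hu.le]
    simp
  simp_rw [e1] at e3
  rw [integral_const_mul, abs_of_pos (inv_pos.2 hu), smul_eq_mul] at e3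
  have hu' := hu.ne'
  field_simp at e3
  rw [← e3]

theorem integral_norm_betaKernel_neg (z w : ℂ) (u : ℝ) : ∫ y : ℝ, ‖posPow (z - 1) (-u + y) * posPow (w - 1) y‖ =
      ∫ y : ℝ, ‖posPow (w - 1) (u + y) * posPow (z - 1) y‖ := by
  rw [← integral_add_right_eq_self (fun y => ‖posPow (z - 1) (-u + y) * posPow (w - 1) y‖) u]
  refine integral_congr_ae (of_forall fun y => ?_)
  simp only []
  rw [show -u + (y + u) = y by ring, add_comm y u, mul_comm]

theorem integrable_betaKernel {z w : ℂ} (hz : 0 < z.re) (hw : 0 < w.re) (hzw : (z + w).re < 1)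
    {u : ℝ} (hu : u ≠ 0) : Integrable (fun y : ℝ => posPow (z - 1) (u + y) * posPow (w - 1) y) := by
  rcases hu.lt_or_gt with h | h
  · have h1 := (betaKernel_of_pos (z := w) (w := z) hz (by rwa [add_comm]) (neg_pos.2 h)).1
    have h2 := h1.comp_add_right u
    refine h2.congr (of_forall fun y => ?_)
    simp only []
    rw [show -u + (y + u) = y by ring, add_comm y u, mul_comm]
  · exact (betaKernel_of_pos hw hzw h).1

theorem integrable_bounded_mul_abs_rpow {φ : ℝ → ℂ} (hφ : Measurable φ) {D X p : ℝ}
    (hD : ∀ u, ‖φ u‖ ≤ D) (hX : ∀ u, X < |u| → φ u = 0) (hp : -1 < p) :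
    Integrable fun u : ℝ => ‖φ u‖ * |u| ^ p := by
  have h1 : IntegrableOn (fun u : ℝ => u ^ p) (Ioc 0 (max X 0)) := by
    rw [← intervalIntegrable_iff_integrableOn_Ioc_of_le (le_max_right _ _)]
    exact intervalIntegral.intervalIntegrable_rpow' hp
  have h2 : IntegrableOn (fun u : ℝ => ‖φ u‖ * |u| ^ p) (Ioc 0 (max X 0)) := by
    refine Integrable.mono' (h1.const_mul D) ?_ ((ae_restrict_mem measurableSet_Ioc).mono fun u hu => ?_)
    · exact (hφ.norm.mul (continuous_abs.measurable.pow_const p)).aestronglyMeasurable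
    · rw [abs_of_pos hu.1, norm_of_nonneg (mul_nonneg (norm_nonneg _) (rpow_nonneg hu.1.le _))]
      exact mul_le_mul_of_nonneg_right (hD u) (rpow_nonneg hu.1.le _)
  have h3 : IntegrableOn (fun u : ℝ => ‖φ (-u)‖ * |u| ^ p) (Ioc 0 (max X 0)) := by
    refine Integrable.mono' (h1.const_mul D) ?_ ((ae_restrict_mem measurableSet_Ioc).mono fun u hu => ?_)
    · exact ((hφ.comp measurable_neg).norm.mul (continuous_abs.measurable.pow_const p)).aestronglyMeasurable
    · rw [abs_of_pos hu.1, norm_of_nonneg (mul_nonneg (norm_nonneg _) (rpow_nonneg hu.1.le _))]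
      exact mul_le_mul_of_nonneg_right (hD _) (rpow_nonneg hu.1.le _)
  have ext : ∀ g : ℝ → ℝ, (∀ u, X < |u| → g u = 0) → IntegrableOn g (Ioc 0 (max X 0)) →
      IntegrableOn g (Ioi 0) := fun g hg hgi => by
    refine hgi.of_forall_sdiff_eq_zero measurableSet_Ioi fun u hu => hg u ?_
    have h4 : (0 : ℝ) < u := hu.1
    have h5 : max X 0 < u := by by_contra h6; exact hu.2 ⟨h4, not_lt.1 h6⟩
    rw [abs_of_pos h4]; exact lt_of_le_of_lt (le_max_left _ _) h5
  have h4 := ext _ (fun u hu => by rw [hX u hu]; simp) h2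
  have h5 := ext _ (fun u hu => by rw [hX (-u) (by rwa [abs_neg])]; simp) h3
  have h6 : IntegrableOn (fun u : ℝ => ‖φ u‖ * |u| ^ p) (Iio 0) := by
    have := (MeasurePreserving.integrableOn_comp_preimage (Measure.measurePreserving_neg volume)
      (Homeomorph.neg ℝ).measurableEmbedding (f := fun u : ℝ => ‖φ u‖ * |u| ^ p) (s := Iio 0)).1
    refine this ?_
    have hset : (fun x : ℝ => -x) ⁻¹' Iio 0 = Ioi 0 := by ext x; simp
    rw [show (Neg.neg : ℝ → ℝ) ⁻¹' Iio 0 = Ioi 0 from hset]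
    refine h5.congr_fun (fun u _ => ?_) measurableSet_Ioi
    simp
  rw [← integrableOn_univ, ← Set.Iio_union_Ici (a := (0 : ℝ)), integrableOn_union]
  exact ⟨h6, by rw [integrableOn_Ici_iff_integrableOn_Ioi]; exact h4⟩

/-- Mellin transform of a convolution with a power. -/
theorem mellin_posPow_conv {φ : ℝ → ℂ} (hφ : Measurable φ) {D X : ℝ} (hD : ∀ u, ‖φ u‖ ≤ D)
    (hX : ∀ u, X < |u| → φ u = 0) {z w : ℂ} (hz : 0 < z.re) (hw : 0 < w.re) (hzw : (z + w).re < 1) :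
    MellinConvergent (fun x => ∫ y : ℝ, posPow (w - 1) y * φ (x - y)) z ∧
    mellin (fun x => ∫ y : ℝ, posPow (w - 1) y * φ (x - y)) z = ∫ u : ℝ, φ u * betaKernel z w u := by
  set G : ℝ × ℝ → ℂ := fun p => φ p.1 * (posPow (z - 1) (p.1 + p.2) * posPow (w - 1) p.2) with hG
  set B₁ := ∫ y : ℝ, ‖posPow (z - 1) (1 + y) * posPow (w - 1) y‖ with hB₁
  set B₂ := ∫ y : ℝ, ‖posPow (w - 1) (1 + y) * posPow (z - 1) y‖ with hB₂
  have hB₁0 : 0 ≤ B₁ := integral_nonneg fun _ => norm_nonneg _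
  have hB₂0 : 0 ≤ B₂ := integral_nonneg fun _ => norm_nonneg _
  have hGm : Measurable G := by
    have h1 := measurable_posPow (z - 1)
    have h2 := measurable_posPow (w - 1)
    exact (hφ.comp measurable_fst).mul ((h1.comp (measurable_fst.add measurable_snd)).mul (h2.comp measurable_snd))
  have hne : ∀ᵐ u : ℝ, u ≠ 0 := by simp [ae_iff]
  have hGi : Integrable G (volume.prod volume) := by
    rw [integrable_prod_iff hGm.aestronglyMeasurable]
    refine ⟨hne.mono fun u hu => by simpa only [hG] using (integrable_betaKernel hz hw hzw hu).const_mul (φ u), ?_⟩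
    have hp : -1 < z.re + w.re - 1 := by linarith
    refine ((integrable_bounded_mul_abs_rpow hφ hD hX hp).const_mul (B₁ + B₂)).mono'
      hGm.norm.stronglyMeasurable.integral_prod_right.aestronglyMeasurable (hne.mono fun u hu => ?_)
    rw [norm_of_nonneg (integral_nonneg fun _ => norm_nonneg _)]
    simp only [hG, norm_mul (φ _)]
    rw [integral_const_mul]
    have h5 : ∫ y : ℝ, ‖posPow (z - 1) (u + y) * posPow (w - 1) y‖ ≤
        (B₁ + B₂) * |u| ^ (z.re + w.re - 1) := by
      have h6 : 0 ≤ |u| ^ (z.re + w.re - 1) := by positivity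
      rcases hu.lt_or_gt with h | h
      · have h7 := integral_norm_betaKernel_neg z w (-u)
        rw [neg_neg] at h7
        rw [h7, integral_norm_posPow_add_mul_posPow w z (neg_pos.2 h), abs_of_neg h, add_comm w.re]
        rw [abs_of_neg h] at h6
        nlinarith
      · rw [integral_norm_posPow_add_mul_posPow z w h, abs_of_pos h]
        rw [abs_of_pos h] at h6
        nlinarith
    calc _ ≤ ‖φ u‖ * ((B₁ + B₂) * |u| ^ (z.re + w.re - 1)) :=
          mul_bound_left h5
      _ = _ := by ring
  -- The measure-preserving shear `(x, y) ↦ (x - y, y)` replaces the variable `x` by `u = x - y`,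
  -- the argument of `φ`.
  have hmp := measurePreserving_sub_prod (volume : Measure ℝ) (volume : Measure ℝ)
  have hFi : Integrable (fun p : ℝ × ℝ => G (p.1 - p.2, p.2)) (volume.prod volume) :=
    hmp.integrable_comp_of_integrable hGi
  have hGF : ∀ x y : ℝ, G (x - y, y) = posPow (z - 1) x * (posPow (w - 1) y * φ (x - y)) := fun x y => by
    simp only [hG, sub_add_cancel]; ring
  have hconv := hFi.integral_prod_left
  simp only [hGF, integral_const_mul] at hconv
  refine ⟨(mellinConvergent_iff_posPow _ _).2 hconv, ?_⟩
  rw [mellin_eq_integral_posPow]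
  have e1 : ∫ x : ℝ, posPow (z - 1) x * ∫ y : ℝ, posPow (w - 1) y * φ (x - y) =
      ∫ x : ℝ, ∫ y : ℝ, G (x - y, y) := by
    simp only [hGF, integral_const_mul]
  rw [e1, integral_integral_swap (f := fun x y => G (x - y, y)) hFi]
  have e2 : ∀ y : ℝ, ∫ x : ℝ, G (x - y, y) = ∫ u : ℝ, G (u, y) := fun y =>
    integral_sub_right_eq_self (fun u => G (u, y)) y
  simp_rw [e2]
  rw [← integral_integral_swap (f := fun u y => G (u, y)) hGi]
  simp only [hG, integral_const_mul, betaKernel]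

/-- Parity folds the negative half-line onto the positive one, where the kernel is a pure power of
`u`. The two halves differ by exchanging `z` and `w`, and by the sign `ε`. -/
theorem integral_mul_betaKernel {φ : ℝ → ℂ} (hφ : Measurable φ) {D X : ℝ} (hD : ∀ u, ‖φ u‖ ≤ D)
    (hX : ∀ u, X < |u| → φ u = 0) {ε : ℂ} (hε : ∀ u, φ (-u) = ε * φ u) {z w : ℂ} (hz : 0 < z.re)
    (hw : 0 < w.re) (hzw : (z + w).re < 1) :
    ∫ u : ℝ, φ u * betaKernel z w u = mellin φ (z + w) * Gamma (1 - z - w) *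
      (Gamma w / Gamma (1 - z) + ε * (Gamma z / Gamma (1 - w))) := by
  have hp : -1 < z.re + w.re - 1 := by linarith
  have hI := integrable_bounded_mul_abs_rpow hφ hD hX hp
  have hzw' : (w + z).re < 1 := by rwa [add_comm]
  have hpos : ∀ u ∈ Ioi (0 : ℝ), φ u * betaKernel z w u = (u : ℂ) ^ (z + w - 1) * φ u *
      (Gamma w * Gamma (1 - z - w) / Gamma (1 - z)) := fun u hu => by
    rw [(betaKernel_of_pos hw hzw hu).2]; ring
  have hneg : ∀ u ∈ Ioi (0 : ℝ), φ (-u) * betaKernel z w (-u) = (u : ℂ) ^ (z + w - 1) * φ u *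
      (ε * (Gamma z * Gamma (1 - z - w) / Gamma (1 - w))) := fun u hu => by
    rw [betaKernel_neg, (betaKernel_of_pos hz hzw' hu).2, hε, add_comm w z, show 1 - w - z = 1 - z - w by ring]
    ring
  have hmi : IntegrableOn (fun u : ℝ => (u : ℂ) ^ (z + w - 1) * φ u) (Ioi 0) := by
    refine Integrable.mono' hI.integrableOn ?_ ((ae_restrict_mem measurableSet_Ioi).mono fun u hu => ?_)
    · exact ((continuousOn_ofReal_cpow _).aestronglyMeasurable measurableSet_Ioi).mul hφ.aestronglyMeasurable
    · have hu' : (0 : ℝ) < u := hu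
      rw [norm_mul, norm_ofReal_cpow_of_pos hu', abs_of_pos hu', mul_comm]
      simp
  have hi1 : IntegrableOn (fun u => φ u * betaKernel z w u) (Ioi 0) :=
    (integrableOn_congr_fun hpos measurableSet_Ioi).2 (hmi.mul_const _)
  have hi2' : IntegrableOn (fun u => φ (-u) * betaKernel z w (-u)) (Ioi 0) :=
    (integrableOn_congr_fun hneg measurableSet_Ioi).2 (hmi.mul_const _)
  have hi2 : IntegrableOn (fun u => φ u * betaKernel z w u) (Iic 0) := by
    rw [← neg_zero, ← integrableOn_Ici_iff_integrableOn_Ioi, ] at hi2'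
    have := (MeasurePreserving.integrableOn_comp_preimage (Measure.measurePreserving_neg volume)
      (Homeomorph.neg ℝ).measurableEmbedding (f := fun u : ℝ => φ u * betaKernel z w u)
      (s := Iic 0)).1
    refine this ?_
    have hset : (fun x : ℝ => -x) ⁻¹' Iic 0 = Set.Ici (-0) := by ext x; simp
    rw [show (Neg.neg : ℝ → ℝ) ⁻¹' Iic 0 = Set.Ici (-0) from hset]
    exact hi2'
  rw [← intervalIntegral.integral_Iic_add_Ioi hi2 hi1, ← neg_zero, ← integral_comp_neg_Ioi, neg_zero,
    setIntegral_congr_fun measurableSet_Ioi hpos, setIntegral_congr_fun measurableSet_Ioi hneg,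
    integral_mul_const, integral_mul_const, mellin]
  simp only [smul_eq_mul]
  ring

theorem one_div_Gamma_one_sub {z : ℂ} (h0 : 0 < z.re) (h1 : z.re < 1) :
    1 / Gamma (1 - z) = Gamma z * sin (π * z) / π ∧ sin (π * z) ≠ 0 := by
  have e := Gamma_mul_Gamma_one_sub z
  have g1 := Gamma_ne_zero_of_re_pos h0
  have g2 : Gamma (1 - z) ≠ 0 := Gamma_ne_zero_of_re_pos (by simp; linarith)
  have hπ : (π : ℂ) ≠ 0 := ofReal_ne_zero.2 pi_ne_zero
  have hs : sin (π * z) ≠ 0 := fun h => by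
    rw [h, div_zero] at e
    exact (mul_ne_zero g1 g2) e
  refine ⟨?_, hs⟩
  rw [eq_div_iff hs] at e
  rw [div_eq_div_iff g2 hπ]
  linear_combination -e

/-- The reflection formula at `z`, `w` and `z + w` turns the Gamma factors at reflected arguments
into sines. -/
theorem Gamma_beta_sum {z w : ℂ} (hz : 0 < z.re) (hw : 0 < w.re) (hzw : (z + w).re < 1) (ε : ℂ) :
    Gamma (1 - z - w) * (Gamma w / Gamma (1 - z) + ε * (Gamma z / Gamma (1 - w))) =
    Gamma z * Gamma w / Gamma (z + w) * ((sin (π * z) + ε * sin (π * w)) / sin (π * (z + w))) := by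
  have hre : (z + w).re = z.re + w.re := add_re z w
  obtain ⟨a1, a2⟩ := one_div_Gamma_one_sub hz (by linarith)
  obtain ⟨b1, b2⟩ := one_div_Gamma_one_sub hw (by linarith)
  obtain ⟨c1, c2⟩ := one_div_Gamma_one_sub (z := z + w) (by linarith) hzw
  have hG := Gamma_ne_zero_of_re_pos (s := z + w) (by linarith)
  have hπ : (π : ℂ) ≠ 0 := ofReal_ne_zero.2 pi_ne_zero
  have g2 : Gamma (1 - (z + w)) ≠ 0 := Gamma_ne_zero_of_re_pos (by simp at hzw ⊢; linarith)
  have c3 : Gamma (1 - z - w) =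
      π / (Gamma (z + w) * sin (π * (z + w))) := by
    rw [show 1 - z - w = 1 - (z + w) by ring]
    rw [eq_div_iff (mul_ne_zero hG c2)]
    rw [div_eq_div_iff g2 hπ] at c1
    linear_combination -c1
  rw [div_eq_mul_one_div (Gamma w) _, div_eq_mul_one_div (Gamma z) (Gamma (1 - w)), a1, b1, c3]
  field_simp

theorem sin_add_div_sin {z w : ℂ} (h : sin (π * (z + w)) ≠ 0) :
    (sin (π * z) + 1 * sin (π * w)) / sin (π * (z + w)) = cos (π * (z - w) / 2) / cos (π * (z + w) / 2) := by
  have e1 : sin (π * (z + w)) =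
      2 * sin (π * (z + w) / 2) * cos (π * (z + w) / 2) := by
    rw [← sin_two_mul]; congr 1; ring
  have e2 : sin (π * z) + 1 * sin (π * w) =
      2 * sin (π * (z + w) / 2) * cos (π * (z - w) / 2) := by
    rw [show (π : ℂ) * z = π * (z + w) / 2 + π * (z - w) / 2 by ring,
      show (π : ℂ) * w = π * (z + w) / 2 - π * (z - w) / 2 by ring,
      Complex.sin_add, Complex.sin_sub]
    ring
  rw [e1] at h ⊢
  have h1 := left_ne_zero_of_mul h
  have h2 := right_ne_zero_of_mul h
  rw [e2, div_eq_div_iff h h2]; ring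

/-- This is the even case with `w` replaced by `w + 1`. -/
theorem sin_sub_div_sin {z w : ℂ} (h : sin (π * (z + w)) ≠ 0) :
    (sin (π * z) + -1 * sin (π * w)) / sin (π * (z + w)) = sin (π * (z - w) / 2) / sin (π * (z + w) / 2) := by
  have := @sin_add_div_sin z (w + 1)
  rw [show (π : ℂ) * (w + 1) = π * w + π by ring,
    show (π : ℂ) * (z + (w + 1)) / 2 = π * (z + w) / 2 + π / 2 by ring,
    show (π : ℂ) * (z + (w + 1)) = π * (z + w) + π by ring,
    show (π : ℂ) * (z - (w + 1)) / 2 = π * (z - w) / 2 - π / 2 by ring, Complex.sin_add_pi,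
    Complex.sin_add_pi, Complex.cos_sub_pi_div_two, Complex.cos_add_pi_div_two, mul_neg, ← neg_mul,
    div_neg, div_neg, neg_inj] at this
  exact this (neg_ne_zero.2 h)

theorem cos_pi_half_ne_zero {z : ℂ} (h1 : -1 < z.re) (h2 : z.re < 1) :
    cos (π * z / 2) ≠ 0 := fun h => by
  rw [cos_eq_zero_iff] at h
  obtain ⟨k, hk⟩ := h
  have hπ : (π : ℂ) ≠ 0 := ofReal_ne_zero.2 pi_ne_zero
  have hz : z = 2 * k + 1 := by
    field_simp at hk
    linear_combination hk
  have hre := congrArg re hz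
  simp at hre
  rw [hre] at h1 h2
  have i1 : (-1 : ℝ) < ((2 * k + 1 : ℤ) : ℝ) := by push_cast; linarith
  have i2 : ((2 * k + 1 : ℤ) : ℝ) < ((1 : ℤ) : ℝ) := by push_cast; linarith
  have i1 : (-1 : ℤ) < 2 * k + 1 := by exact_mod_cast i1
  have i2 : 2 * k + 1 < (1 : ℤ) := by exact_mod_cast i2
  omega

theorem integral_posPow_Ioo {v : ℂ} (hv : 0 < v.re) {t : ℝ} (ht : 0 < t) :
    IntegrableOn (posPow (v - 1)) (Ioc 0 t) ∧ ∫ y in Ioc 0 t, posPow (v - 1) y = (t : ℂ) ^ v / v := by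
  have hv' : -1 < (v - 1).re := by simp; linarith
  have h1 : IntegrableOn (fun y : ℝ => (y : ℂ) ^ (v - 1)) (Ioc 0 t) := by
    rw [← intervalIntegrable_iff_integrableOn_Ioc_of_le ht.le]
    exact intervalIntegral.intervalIntegrable_cpow' hv'
  have h2 : ∀ y ∈ Ioc 0 t, (y : ℂ) ^ (v - 1) = posPow (v - 1) y := fun y hy => (posPow_of_pos hy.1 _).symm
  refine ⟨(integrableOn_congr_fun h2 measurableSet_Ioc).1 h1, ?_⟩
  rw [← setIntegral_congr_fun measurableSet_Ioc h2, ← intervalIntegral.integral_of_le ht.le, integral_cpow (inl hv')]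
  have hv0 : v ≠ 0 := by rintro rfl; simp at hv
  simp [hv0]

/-- Mellin transforms of tail integrals. -/
theorem integral_posPow_mul_tail {g : ℝ → ℂ} (hg : Measurable g) {D X : ℝ} (hD : ∀ u, ‖g u‖ ≤ D)
    (hX : ∀ u, X < |u| → g u = 0) {v : ℂ} (hv : 0 < v.re) :
    Integrable (fun y => posPow (v - 1) y * ∫ t in Ioi y, g t) ∧
    ∫ y : ℝ, posPow (v - 1) y * ∫ t in Ioi y, g t = (1 / v) * ∫ t : ℝ, posPow v t * g t := by
  set H : ℝ × ℝ → ℂ := fun p => if p.1 < p.2 then posPow (v - 1) p.1 * g p.2 else 0 with hH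
  have hv0 : v ≠ 0 := by rintro rfl; simp at hv
  have hHm : Measurable H := by
    refine Measurable.ite (measurableSet_lt measurable_fst measurable_snd) ?_ measurable_const
    exact ((measurable_posPow _).comp measurable_fst).mul (hg.comp measurable_snd)
  have hslice : ∀ t y : ℝ, H (y, t) = (Ioc 0 t).indicator (fun y => posPow (v - 1) y * g t) y ∨ y = t := fun t y => by
    by_cases hyt : y = t
    · exact inr hyt
    left
    by_cases h1 : y ∈ Ioc 0 t
    · rw [indicator_of_mem h1]
      exact if_pos (lt_of_le_of_ne h1.2 hyt)
    · rw [indicator_of_notMem h1]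
      simp only [hH]
      split_ifs with h2
      · have : y ≤ 0 := by by_contra h3; exact h1 ⟨not_le.1 h3, h2.le⟩
        rw [posPow_of_nonpos this, zero_mul]
      · rfl
  have hae : ∀ t : ℝ, (fun y => H (y, t)) =ᵐ[volume]
      (Ioc 0 t).indicator (fun y => posPow (v - 1) y * g t) := fun t => by
    have : ∀ᵐ y : ℝ, y ≠ t := by simp [ae_iff]
    exact this.mono fun y hy => (hslice t y).resolve_right hy
  have hval : ∀ t : ℝ, ∫ y, H (y, t) = (1 / v) * (posPow v t * g t) := fun t => by
    rw [integral_congr_ae (hae t), integral_indicator measurableSet_Ioc, integral_mul_const]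
    rcases lt_or_ge 0 t with ht | ht
    · rw [(integral_posPow_Ioo hv ht).2, posPow_of_pos ht]; ring
    · rw [Ioc_eq_empty (not_lt.2 ht), posPow_of_nonpos ht]; simp
  have hvr : 0 < ((v.re : ℝ) : ℂ).re := by simpa using hv
  have hnorm : ∀ t : ℝ, ∫ y, ‖H (y, t)‖ ≤ (1 / v.re) * (‖g t‖ * |t| ^ v.re) := fun t => by
    have h1 : (fun y => ‖H (y, t)‖) =ᵐ[volume]
        (Ioc 0 t).indicator (fun y => ‖posPow (v - 1) y‖ * ‖g t‖) := by
      filter_upwards [hae t] with y hy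
      rw [hy, norm_indicator_eq_indicator_norm]
      simp only [norm_mul]
    rw [integral_congr_ae h1, integral_indicator measurableSet_Ioc, integral_mul_const]
    rcases lt_or_ge 0 t with ht | ht
    · have h2 : ∫ y in Ioc 0 t, ‖posPow (v - 1) y‖ = t ^ v.re / v.re := by
        have h3 : ∀ y ∈ Ioc 0 t, ‖posPow (v - 1) y‖ = y ^ (v.re - 1) := fun y hy => by
          rw [posPow_of_pos hy.1, norm_ofReal_cpow_of_pos hy.1]; simp
        rw [setIntegral_congr_fun measurableSet_Ioc h3, ← intervalIntegral.integral_of_le ht.le,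
          integral_rpow (inl (by linarith))]
        simp [hv.ne']
      rw [h2, abs_of_pos ht]
      exact le_of_eq (by ring)
    · rw [Ioc_eq_empty (not_lt.2 ht)]
      simp; positivity
  have hHi : Integrable H (volume.prod volume) := by
    rw [integrable_prod_iff' hHm.aestronglyMeasurable]
    refine ⟨of_forall fun t => ?_, ?_⟩
    · rw [integrable_congr (hae t), integrable_indicator_iff measurableSet_Ioc]
      rcases lt_or_ge 0 t with ht | ht
      · exact (integral_posPow_Ioo hv ht).1.mul_const _
      · rw [Ioc_eq_empty (not_lt.2 ht)]; exact integrableOn_empty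
    · refine ((integrable_bounded_mul_abs_rpow hg hD hX (p := v.re) (by linarith)).const_mul
        (1 / v.re)).mono' ?_ (of_forall fun t => ?_)
      · exact (hHm.comp measurable_swap).norm.stronglyMeasurable.integral_prod_right.aestronglyMeasurable
      · rw [norm_of_nonneg (integral_nonneg fun _ => norm_nonneg _)]
        exact hnorm t
  have hy : ∀ y : ℝ, ∫ t, H (y, t) = posPow (v - 1) y * ∫ t in Ioi y, g t := fun y => by
    rw [← integral_indicator measurableSet_Ioi, ← integral_const_mul]
    refine integral_congr_ae (of_forall fun t => ?_)
    simp only [hH, indicator, mem_Ioi]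
    split_ifs <;> simp
  constructor
  · have := hHi.integral_prod_left
    simpa only [hy] using this
  · simp_rw [← hy]
    rw [integral_integral_swap (f := fun y t => H (y, t)) hHi]
    simp_rw [hval]
    rw [integral_const_mul]

/-! ### The sieving function, its derivative and the kernel -/

/-- An even sieving function `f` together with a normalised version `d` of its derivative. -/
structure IsSieveKernel (X : ℝ) (f d : ℝ → ℝ) : Prop where
  pos : 0 < X
  odd : ∀ u, d (-u) = -d u
  even : ∀ u, f (-u) = f u
  supp : ∀ u, X < |u| → d u = 0
  meas : Measurable d
  bdd : ∃ D, ∀ u, |d u| ≤ D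
  eq : ∀ x, f x = -∫ u in Ioi x, d u
  zero : f 0 = 1
  -- Bounded variation in dual form: testing `d` against `ψ` costs only the size of the integrals of
  -- `ψ` over intervals, so oscillation of `ψ` is a gain. This is the source of all decay in `Im v`.
  bv : ∃ V, 0 ≤ V ∧ ∀ (ψ : ℝ → ℂ) (S : ℝ), IntegrableOn ψ (Icc (-X) X) →
    (∀ a b, -X ≤ a → a ≤ b → b ≤ X → ‖∫ u in a..b, ψ u‖ ≤ S) → ‖∫ u, (d u : ℂ) * ψ u‖ ≤ V * S
  ae_cont : ∀ᵐ u : ℝ, ContinuousAt d u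

variable {X : ℝ} {f d : ℝ → ℝ}

namespace IsSieveKernel

theorem integrable (h : IsSieveKernel X f d) : Integrable d := by
  obtain ⟨D, hD⟩ := h.bdd
  have h1 : IntegrableOn d (Icc (-X) X) :=
    Measure.integrableOn_of_bounded (M := D) (by simp) h.meas.aestronglyMeasurable (of_forall hD)
  rw [← integrableOn_univ]
  refine h1.of_forall_sdiff_eq_zero MeasurableSet.univ fun u hu => h.supp u ?_
  by_contra h2
  exact hu.2 (abs_le.1 (not_lt.1 h2))

theorem integral_eq_zero (h : IsSieveKernel X f d) : ∫ u, d u = 0 := by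
  have h1 := integral_neg_eq_self d volume
  simp_rw [h.odd] at h1
  rw [integral_neg] at h1
  linarith

theorem f_eq_Iic (h : IsSieveKernel X f d) (x : ℝ) : f x = ∫ u in Iic x, d u := by
  have h1 := intervalIntegral.integral_Iic_add_Ioi (b := x) h.integrable.integrableOn h.integrable.integrableOn
  rw [h.integral_eq_zero] at h1
  rw [h.eq]; linarith

theorem f_supp (h : IsSieveKernel X f d) {x : ℝ} (hx : X ≤ |x|) : f x = 0 := by
  have key : ∀ y, X ≤ y → f y = 0 := fun y hy => by
    rw [h.eq, setIntegral_eq_zero_of_forall_eq_zero, neg_zero]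
    intro u hu
    have : y < u := hu
    exact h.supp u (lt_of_lt_of_le (by linarith) (le_abs_self u))
  rcases abs_choice x with h1 | h1
  · exact key x (h1 ▸ hx)
  · rw [← h.even]; exact key _ (h1 ▸ hx)

theorem continuous_f (h : IsSieveKernel X f d) : Continuous f := by
  have h1 : f = fun x => (∫ u in Iic (0 : ℝ), d u) + ∫ u in (0 : ℝ)..x, d u := by
    funext x
    rw [h.f_eq_Iic, ← intervalIntegral.integral_Iic_sub_Iic h.integrable.integrableOn h.integrable.integrableOn]
    ring
  rw [h1]
  exact continuous_const.add (intervalIntegral.continuous_primitive (fun a b => h.integrable.intervalIntegrable) 0)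

theorem exists_f_bdd (h : IsSieveKernel X f d) : ∃ D, ∀ u, ‖(f u : ℂ)‖ ≤ D := by
  refine ⟨∫ u, ‖d u‖, fun x => ?_⟩
  rw [norm_real, h.f_eq_Iic]
  exact (norm_integral_le_integral_norm _).trans (setIntegral_le_integral h.integrable.norm
    (of_forall fun _ => norm_nonneg _))

theorem exists_d_bdd (h : IsSieveKernel X f d) : ∃ D, ∀ u, ‖(d u : ℂ)‖ ≤ D := by
  obtain ⟨D, hD⟩ := h.bdd
  exact ⟨D, fun u => by rw [norm_real]; exact hD u⟩

theorem measurable_d (h : IsSieveKernel X f d) : Measurable fun u => (d u : ℂ) := measurable_ofReal.comp h.meas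

theorem supp_d (h : IsSieveKernel X f d) : ∀ u, X < |u| → (d u : ℂ) = 0 := fun u hu => by rw [h.supp u hu]; simp

end IsSieveKernel

/-- The Mellin transform attached to the derivative `d` of a sieving function. -/
noncomputable def sieveMellin (d : ℝ → ℝ) (z : ℂ) : ℂ :=
  -mellin (fun u => (d u : ℂ)) (z + 1) / (cos (π * z / 2) * Gamma (z + 1))

/-- The kernel `Γ(z+1) Γ(v+1) M(z+v) cos(π(z-v)/2)`. -/
noncomputable def sieveKer (d : ℝ → ℝ) (z v : ℂ) : ℂ :=
  Gamma (z + 1) * Gamma (v + 1) * sieveMellin d (z + v) * cos (π * (z - v) / 2)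

/-- `n_x(v) = ∫_0^∞ y^v d(x-y) dy`. -/
noncomputable def sieveConv (d : ℝ → ℝ) (v : ℂ) (x : ℝ) : ℂ := ∫ y : ℝ, posPow v y * (d (x - y) : ℂ)

theorem sieveKer_comm (d : ℝ → ℝ) (z v : ℂ) : sieveKer d z v = sieveKer d v z := by
  rw [sieveKer, sieveKer, add_comm z v, ← Complex.cos_neg (π * (z - v) / 2)]
  rw [show -((π : ℂ) * (z - v) / 2) = π * (v - z) / 2 by ring]; ring

namespace IsSieveKernel

theorem mellin_f (h : IsSieveKernel X f d) {v : ℂ} (hv : 0 < v.re) : MellinConvergent (fun x => (f x : ℂ)) v ∧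
    mellin (fun x => (f x : ℂ)) v = -(1 / v) * mellin (fun u => (d u : ℂ)) (v + 1) := by
  obtain ⟨D, hD⟩ := h.exists_d_bdd
  obtain ⟨h1, h2⟩ := integral_posPow_mul_tail h.measurable_d hD h.supp_d hv
  have hf : ∀ y : ℝ, ∫ t in Ioi y, (d t : ℂ) = -(f y : ℂ) := fun y => by
    rw [integral_complex_ofReal, h.eq]; push_cast; ring
  simp_rw [hf, mul_neg] at h1 h2
  rw [mellinConvergent_iff_posPow, mellin_eq_integral_posPow, mellin_eq_integral_posPow, add_sub_cancel_right]
  refine ⟨by simpa using h1.neg, ?_⟩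
  rw [integral_neg] at h2
  linear_combination -h2

theorem integral_Ioi_sub (h : IsSieveKernel X f d) (x y : ℝ) :
    ∫ t in Ioi y, (d (x - t) : ℂ) = (f (x - y) : ℂ) := by
  rw [integral_complex_ofReal, h.f_eq_Iic]
  congr 1
  rw [integral_Iic_eq_integral_Iio, ← integral_indicator measurableSet_Ioi, ← integral_indicator measurableSet_Iio,
    ← integral_sub_left_eq_self ((Iio (x - y)).indicator fun u => d u) volume x]
  refine integral_congr_ae (of_forall fun t => ?_)
  simp only [indicator, mem_Ioi, mem_Iio, sub_lt_sub_iff_left]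

/-- Integration by parts: `f(x - y)` is the tail integral of `t ↦ d(x - t)` from `y`. -/
theorem sieveConv_eq_mul (h : IsSieveKernel X f d) {v : ℂ} (hv : 0 < v.re) (x : ℝ) :
    sieveConv d v x = v * ∫ y : ℝ, posPow (v - 1) y * (f (x - y) : ℂ) := by
  obtain ⟨D, hD⟩ := h.exists_d_bdd
  have hm : Measurable fun t : ℝ => (d (x - t) : ℂ) := h.measurable_d.comp (measurable_const.sub measurable_id)
  have h1 := (integral_posPow_mul_tail hm (fun u => hD (x - u)) (X := X + |x|) (fun u hu => h.supp_d _ (by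
    have := abs_sub_abs_le_abs_sub u x
    rw [abs_sub_comm u x] at this
    linarith)) hv).2
  simp_rw [h.integral_Ioi_sub] at h1
  have hv0 : v ≠ 0 := by rintro rfl; simp at hv
  rw [h1, sieveConv]; field_simp

/-- The Mellin transform in `x` of `n_x(v)`. -/
theorem mellin_sieveConv_of_neg (h : IsSieveKernel X f d) {z v : ℂ} (hz : 0 < z.re)
    (hv : -1 < v.re) (hzv : (z + v).re < 0) :
    MellinConvergent (sieveConv d v) z ∧ mellin (sieveConv d v) z = sieveKer d z v / z := by
  obtain ⟨D, hD⟩ := h.exists_d_bdd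
  have hw : 0 < (v + 1).re := by simp; linarith
  have hzw : (z + (v + 1)).re < 1 := by simp at hzv ⊢; linarith
  obtain ⟨h1, h2⟩ := mellin_posPow_conv h.measurable_d hD h.supp_d hz hw hzw
  rw [integral_mul_betaKernel h.measurable_d hD h.supp_d (ε := -1)
    (fun u => by rw [h.odd]; push_cast; ring) hz hw hzw, mul_assoc, Gamma_beta_sum hz hw hzw,
    sin_sub_div_sin (one_div_Gamma_one_sub (by simp; simp at hw; linarith) hzw).2] at h2
  simp only [add_sub_cancel_right] at h1 h2
  refine ⟨h1, h2.trans ?_⟩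
  have hz0 : z ≠ 0 := by rintro rfl; simp at hz
  have e1 : sin (π * (z - (v + 1)) / 2) = -cos (π * (z - v) / 2) := by
    rw [show (π : ℂ) * (z - (v + 1)) / 2 = π * (z - v) / 2 - π / 2 by ring, Complex.sin_sub_pi_div_two]
  have e2 : sin (π * (z + (v + 1)) / 2) = cos (π * (z + v) / 2) := by
    rw [show (π : ℂ) * (z + (v + 1)) / 2 = π * (z + v) / 2 + π / 2 by ring, sin_add_pi_div_two]
  rw [e1, e2, sieveKer, sieveMellin, Gamma_add_one z hz0, ← add_assoc]
  field_simp

/-- For `Re v > 0` an integration by parts replaces the odd `d` by the even `f`, to which the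
convolution formula applies as long as `Re(z + v) < 1`. The cosine quotient now arises directly, and
`mellin_f` turns the transform of `f` back into that of `d`. -/
theorem mellin_sieveConv_of_pos (h : IsSieveKernel X f d) {z v : ℂ} (hz : 0 < z.re)
    (hv : 0 < v.re) (hzv : (z + v).re < 1) :
    MellinConvergent (sieveConv d v) z ∧ mellin (sieveConv d v) z = sieveKer d z v / z := by
  obtain ⟨D, hD⟩ := h.exists_f_bdd
  have hfm : Measurable fun u => (f u : ℂ) := measurable_ofReal.comp h.continuous_f.measurable
  have hfs : ∀ u, X < |u| → (f u : ℂ) = 0 := fun u hu => by rw [h.f_supp hu.le]; simp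
  obtain ⟨h1, h2⟩ := mellin_posPow_conv hfm hD hfs hz hv hzv
  have hre : (z + v).re = z.re + v.re := add_re z v
  rw [integral_mul_betaKernel hfm hD hfs (ε := 1)
    (fun u => by rw [h.even]; ring) hz hv hzv, mul_assoc, Gamma_beta_sum hz hv hzv,
    sin_add_div_sin (one_div_Gamma_one_sub (by linarith) hzv).2,
    (h.mellin_f (v := z + v) (by linarith)).2] at h2
  have hz0 : z ≠ 0 := by rintro rfl; simp at hz
  have hv0 : v ≠ 0 := by rintro rfl; simp at hv
  have hzv0 : z + v ≠ 0 := by intro h0; rw [h0] at hre; simp at hre; linarith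
  have hfun : sieveConv d v = fun x => v • ∫ y : ℝ, posPow (v - 1) y * (f (x - y) : ℂ) := by
    funext x; rw [h.sieveConv_eq_mul hv, smul_eq_mul]
  rw [hfun]
  refine ⟨h1.const_smul v, ?_⟩
  rw [mellin_const_smul, h2, smul_eq_mul, sieveKer, sieveMellin, Gamma_add_one z hz0,
    Gamma_add_one v hv0, Gamma_add_one _ hzv0]
  have hG := Gamma_ne_zero_of_re_pos (s := z + v) (by linarith)
  have hc := cos_pi_half_ne_zero (z := z + v) (by linarith) hzv
  field_simp

theorem sieveConv_zero (h : IsSieveKernel X f d) (x : ℝ) : sieveConv d 0 x = f x := by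
  have h1 := h.integral_Ioi_sub x 0
  rw [sub_zero] at h1
  rw [← h1, sieveConv, ← integral_indicator measurableSet_Ioi]
  refine integral_congr_ae (of_forall fun t => ?_)
  simp only [indicator, mem_Ioi, posPow]
  split_ifs <;> simp

/-- The case `v = 0` is reached by neither of the two previous ranges when `Re z > 0`; there `n_x(0)
= f(x)`. -/
theorem mellin_sieveConv_zero (h : IsSieveKernel X f d) {z : ℂ} (hz : 0 < z.re) (hz1 : z.re < 1) :
    MellinConvergent (sieveConv d 0) z ∧ mellin (sieveConv d 0) z = sieveKer d z 0 / z := by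
  have hz0 : z ≠ 0 := by rintro rfl; simp at hz
  obtain ⟨h1, h2⟩ := h.mellin_f hz
  have he : ∀ t ∈ Ioi (0 : ℝ), (t : ℂ) ^ (z - 1) • (f t : ℂ) = (t : ℂ) ^ (z - 1) • sieveConv d 0 t :=
    fun t _ => by rw [h.sieveConv_zero t]
  refine ⟨(integrableOn_congr_fun he measurableSet_Ioi).1 h1, ?_⟩
  have h3 : mellin (sieveConv d 0) z = mellin (fun x => (f x : ℂ)) z :=
    (setIntegral_congr_fun measurableSet_Ioi he).symm
  have hG := Gamma_ne_zero_of_re_pos (s := z + 1) (by simp; linarith)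
  have hc := cos_pi_half_ne_zero (z := z) (by linarith) hz1
  rw [h3, h2, sieveKer, sieveMellin, add_zero, sub_zero, zero_add, Gamma_one]
  generalize cos (π * z / 2) = c at hc ⊢
  field_simp

end IsSieveKernel

/-! ### The second mean value theorem and construction of the kernel data -/

/-- A superlevel set of a monotone function in an interval is an interval, up to a null set. -/
theorem Monotone.exists_ae_eq_Ioc {P : ℝ → ℝ} (hP : Monotone P) {a b : ℝ} (hab : a ≤ b) (τ : ℝ) :
    ∃ c, a ≤ c ∧ c ≤ b ∧ ∀ᵐ u : ℝ, (u ∈ Ioc a b ∧ τ ≤ P u) ↔ u ∈ Ioc c b := by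
  rcases lt_or_ge (P b) τ with h | h
  · refine ⟨b, hab, le_refl b, of_forall fun u => ?_⟩
    simp only [mem_Ioc]
    constructor
    · rintro ⟨⟨h1, h2⟩, h3⟩
      exact absurd (h3.trans (hP h2)) (not_le.2 h)
    · rintro ⟨h1, h2⟩; linarith
  · set S := {u | a ≤ u ∧ u ≤ b ∧ τ ≤ P u} with hS
    have hb : b ∈ S := ⟨hab, le_refl b, h⟩
    have hbdd : BddBelow S := ⟨a, fun u hu => hu.1⟩
    refine ⟨sInf S, le_csInf ⟨b, hb⟩ fun u hu => hu.1, csInf_le hbdd hb, ?_⟩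
    have : ∀ᵐ u : ℝ, u ≠ sInf S := by simp [ae_iff]
    filter_upwards [this] with u hu
    simp only [mem_Ioc]
    constructor
    · rintro ⟨⟨h1, h2⟩, h3⟩
      exact ⟨lt_of_le_of_ne (csInf_le hbdd ⟨h1.le, h2, h3⟩) (Ne.symm hu), h2⟩
    · rintro ⟨h1, h2⟩
      obtain ⟨w, hw, hwu⟩ := exists_lt_of_csInf_lt ⟨b, hb⟩ h1
      exact ⟨⟨lt_of_le_of_lt hw.1 hwu, h2⟩, hw.2.2.trans (hP hwu.le)⟩

/-- A form of the second mean value theorem. -/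
theorem Monotone.norm_integral_mul_le {P : ℝ → ℝ} (hP : Monotone P) {a b : ℝ} (hab : a ≤ b)
    {ψ : ℝ → ℂ} {S : ℝ} (hψ : IntegrableOn ψ (Ioc a b))
    (hS : ∀ c, a ≤ c → c ≤ b → ‖∫ u in Ioc c b, ψ u‖ ≤ S) :
    ‖∫ u in Ioc a b, (P u : ℂ) * ψ u‖ ≤ (|P a| + (P b - P a)) * S := by
  have hPab := hP hab
  set μ := (volume : Measure ℝ).restrict (Ioc a b) with hμ
  set ν := (volume : Measure ℝ).restrict (Ioc (P a) (P b)) with hν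
  -- Layer-cake decomposition: `P u - P a` is the length of the set of levels `τ` in `(P a, P b]`
  -- with `τ ≤ P u`. After Fubini each level contributes the integral of `ψ` over a final interval
  -- `(c, b]`.
  set W : Set (ℝ × ℝ) := {p | p.2 ≤ P p.1} with hW
  have hWm : MeasurableSet W := measurableSet_le measurable_snd (hP.measurable.comp measurable_fst)
  have hF : Integrable (fun p : ℝ × ℝ => W.indicator (fun p => ψ p.1) p) (μ.prod ν) := by
    refine Integrable.indicator ?_ hWm
    have : IsFiniteMeasure ν := ⟨by simp [hν]⟩
    exact Integrable.comp_fst hψ ν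
  have hinner : ∀ u ∈ Ioc a b, ∫ τ, W.indicator (fun p : ℝ × ℝ => ψ p.1) (u, τ) ∂ν =
      ((P u - P a : ℝ) : ℂ) * ψ u := fun u hu => by
    have e1 : ∀ τ : ℝ, W.indicator (fun p : ℝ × ℝ => ψ p.1) (u, τ) =
        (Iic (P u)).indicator (fun _ => ψ u) τ := fun τ => by
      simp only [indicator, hW, mem_ofPred_eq, Set.mem_Iic]
    simp_rw [e1]
    rw [integral_indicator measurableSet_Iic, hν, Measure.restrict_restrict measurableSet_Iic,
      setIntegral_const, real_smul]
    congr 2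
    rw [show Iic (P u) ∩ Ioc (P a) (P b) = Ioc (P a) (P u) from Set.ext fun τ =>
      ⟨fun h => ⟨h.2.1, h.1⟩, fun h => ⟨h.2, h.1, h.2.trans (hP hu.2)⟩⟩,
      Real.volume_real_Ioc_of_le (hP hu.1.le)]
  have hswap : ∫ u in Ioc a b, ((P u - P a : ℝ) : ℂ) * ψ u =
      ∫ τ in Ioc (P a) (P b), ∫ u in Ioc a b, W.indicator (fun p : ℝ × ℝ => ψ p.1) (u, τ) := by
    rw [← setIntegral_congr_fun measurableSet_Ioc hinner]
    exact integral_integral_swap (f := fun u τ => W.indicator (fun p : ℝ × ℝ => ψ p.1) (u, τ)) hF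
  have hτ : ∀ τ, ‖∫ u in Ioc a b, W.indicator (fun p : ℝ × ℝ => ψ p.1) (u, τ)‖ ≤ S := fun τ => by
    obtain ⟨c, hc1, hc2, hc⟩ := hP.exists_ae_eq_Ioc hab τ
    have : ∫ u in Ioc a b, W.indicator (fun p : ℝ × ℝ => ψ p.1) (u, τ) =
        ∫ u in Ioc c b, ψ u := by
      rw [← integral_indicator measurableSet_Ioc, ← integral_indicator measurableSet_Ioc]
      refine integral_congr_ae ?_
      filter_upwards [hc] with u hu
      by_cases h : u ∈ Ioc c b
      · obtain ⟨h1, h2⟩ := hu.2 h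
        simp [indicator_of_mem h1, indicator_of_mem h, hW, h2]
      · rw [indicator_of_notMem h]
        by_cases h1 : u ∈ Ioc a b
        · have h2 : ¬ τ ≤ P u := fun h2 => h (hu.1 ⟨h1, h2⟩)
          simp [indicator_of_mem h1, hW, h2]
        · rw [indicator_of_notMem h1]
    rw [this]; exact hS c hc1 hc2
  have h1 : ‖∫ u in Ioc a b, ((P u - P a : ℝ) : ℂ) * ψ u‖ ≤ (P b - P a) * S := by
    rw [hswap]
    refine (norm_setIntegral_le_of_norm_le_const (by simp) fun τ _ => hτ τ).trans_eq ?_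
    rw [Real.volume_real_Ioc_of_le hPab]; ring
  have hPm : AEStronglyMeasurable (fun u => (P u : ℂ)) μ :=
    (measurable_ofReal.comp hP.measurable).aestronglyMeasurable
  have hi : Integrable (fun u => ((P u - P a : ℝ) : ℂ) * ψ u) μ := by
    refine hψ.bdd_mul (c := P b - P a) (by
      push_cast
      exact hPm.sub aestronglyMeasurable_const) ?_
    rw [hμ, ae_restrict_iff' measurableSet_Ioc]
    refine of_forall fun u hu => ?_
    rw [norm_real, norm_of_nonneg (by linarith [hP hu.1.le])]
    linarith [hP hu.2]
  have h2 : ∫ u in Ioc a b, (P u : ℂ) * ψ u =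
      (∫ u in Ioc a b, ((P u - P a : ℝ) : ℂ) * ψ u) + (P a : ℂ) * ∫ u in Ioc a b, ψ u := by
    rw [← integral_const_mul, ← integral_add hi (hψ.const_mul _)]
    refine integral_congr_ae (of_forall fun u => ?_)
    push_cast; ring
  rw [h2]
  refine (norm_add_le _ _).trans ?_
  rw [norm_mul, norm_real, norm_eq_abs]
  have := mul_le_mul_of_nonneg_left (hS a (le_refl a) hab) (abs_nonneg (P a))
  linarith

/-- The odd function equal to `P - Q` on `(0, X)` and vanishing outside `(-X, X)`. -/
noncomputable def oddCut (X : ℝ) (P Q : ℝ → ℝ) (u : ℝ) : ℝ :=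
  if 0 < u then (if u < X then P u - Q u else 0) else (if -X < u ∧ u < 0 then Q (-u) - P (-u) else 0)

theorem oddCut_neg (X : ℝ) (P Q : ℝ → ℝ) (u : ℝ) : oddCut X P Q (-u) = -oddCut X P Q u := by
  rcases lt_trichotomy u 0 with h | h | h
  · have h1 : 0 < -u := by linarith
    have h2 : ¬ 0 < u := by linarith
    simp only [oddCut, h1, h2, if_true, if_false, h, and_true]
    by_cases h3 : -X < u
    · rw [if_pos (by linarith), if_pos h3]; ring
    · rw [if_neg (by linarith), if_neg h3]; ring
  · subst h; simp [oddCut]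
  · have h1 : -u < 0 := by linarith
    have h2 : ¬ 0 < -u := by linarith
    simp only [oddCut, h1, h2, if_true, if_false, h, and_true]
    by_cases h3 : u < X
    · rw [if_pos (by linarith), if_pos h3]; simp
    · rw [if_neg (by linarith), if_neg h3]; ring

theorem oddCut_of_mem {X : ℝ} {P Q : ℝ → ℝ} {u : ℝ} (h0 : 0 < u) (h1 : u < X) :
    oddCut X P Q u = P u - Q u := by simp [oddCut, h0, h1]

theorem oddCut_of_ge {X : ℝ} (hX : 0 < X) {P Q : ℝ → ℝ} {u : ℝ} (h1 : X ≤ u) : oddCut X P Q u = 0 := by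
  have h0 : 0 < u := by linarith
  simp [oddCut, h0, not_lt.2 h1]

theorem oddCut_of_le_abs {X : ℝ} (hX : 0 < X) {P Q : ℝ → ℝ} {u : ℝ} (hu : X ≤ |u|) :
    oddCut X P Q u = 0 := by
  rcases le_total 0 u with h | h
  · exact oddCut_of_ge hX (by rwa [abs_of_nonneg h] at hu)
  · rw [← neg_neg u, oddCut_neg, oddCut_of_ge hX (by rwa [abs_of_nonpos h] at hu), neg_zero]

theorem measurable_oddCut {X : ℝ} {P Q : ℝ → ℝ} (hP : Monotone P) (hQ : Monotone Q) :
    Measurable (oddCut X P Q) := by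
  have h1 := hP.measurable
  have h2 := hQ.measurable
  refine Measurable.ite measurableSet_Ioi (Measurable.ite measurableSet_Iio (h1.sub h2) measurable_const)
    (Measurable.ite measurableSet_Ioo ((h2.comp measurable_neg).sub (h1.comp measurable_neg)) measurable_const)

theorem oddCut_bounded {X : ℝ} (hX : 0 < X) {P Q : ℝ → ℝ} (hP : Monotone P) (hQ : Monotone Q) (u : ℝ) :
    |oddCut X P Q u| ≤ |P 0| + |P X| + |Q 0| + |Q X| := by
  have key : ∀ u, 0 ≤ u → |oddCut X P Q u| ≤ |P 0| + |P X| + |Q 0| + |Q X| := fun u hu => by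
    rcases hu.eq_or_lt with rfl | hu
    · simp [oddCut]; positivity
    rcases lt_or_ge u X with h | h
    · rw [oddCut_of_mem hu h, abs_le]
      have a1 := hP hu.le
      have a2 := hP h.le
      have a3 := hQ hu.le
      have a4 := hQ h.le
      have := neg_abs_le (P 0); have := le_abs_self (P 0)
      have := neg_abs_le (P X); have := le_abs_self (P X)
      have := neg_abs_le (Q 0); have := le_abs_self (Q 0)
      have := neg_abs_le (Q X); have := le_abs_self (Q X)
      have := abs_nonneg (P 0); have := abs_nonneg (P X)
      have := abs_nonneg (Q 0); have := abs_nonneg (Q X)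
      constructor <;> linarith
    · rw [oddCut_of_ge hX h, abs_zero]; positivity
  rcases le_total 0 u with h | h
  · exact key u h
  · have := key (-u) (by linarith)
    rwa [oddCut_neg, abs_neg] at this

theorem oddCut_ae_continuousAt {X : ℝ} (hX : 0 < X) {P Q : ℝ → ℝ} (hP : Monotone P) (hQ : Monotone Q) :
    ∀ᵐ u : ℝ, ContinuousAt (oddCut X P Q) u := by
  set B : Set ℝ := {u | ¬ ContinuousAt P u} ∪ {u | ¬ ContinuousAt Q u} ∪ {0, X} with hB
  have hBc : B.Countable := (hP.countable_not_continuousAt.union hQ.countable_not_continuousAt).union (by simp)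
  have key : ∀ u, 0 < u → u ∉ B → ContinuousAt (oddCut X P Q) u := fun u hu huB => by
    simp only [hB, Set.mem_union, mem_ofPred_eq, not_or, not_not, Set.mem_insert_iff, Set.mem_singleton_iff] at huB
    obtain ⟨⟨c1, c2⟩, -, c3⟩ := huB
    rcases lt_or_gt_of_ne c3 with h | h
    · refine (c1.sub c2).congr ?_
      filter_upwards [Ioo_mem_nhds hu h] with w hw
      exact (oddCut_of_mem hw.1 hw.2).symm
    · refine (continuousAt_const (y := (0 : ℝ))).congr ?_
      filter_upwards [Ioi_mem_nhds h] with w hw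
      exact (oddCut_of_ge hX (le_of_lt hw)).symm
  have hn : (Neg.neg ⁻¹' B).Countable := hBc.preimage neg_injective
  filter_upwards [hBc.ae_notMem volume, hn.ae_notMem volume] with u h1 h2
  rcases lt_trichotomy u 0 with h | h | h
  · have h3 := key (-u) (by linarith) h2
    have h4 : oddCut X P Q = fun w => -oddCut X P Q (-w) := by funext w; rw [oddCut_neg, neg_neg]
    rw [h4]
    exact (ContinuousAt.comp (f := fun w : ℝ => -w) (x := u) h3 continuous_neg.continuousAt).neg
  · exact absurd (by simp [hB, h]) h1
  · exact key u h h1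

theorem integral_oddCut_mul {X : ℝ} (hX : 0 < X) {P Q : ℝ → ℝ} (hP : Monotone P) (hQ : Monotone Q)
    {ψ : ℝ → ℂ} (hψ : IntegrableOn ψ (Icc (-X) X)) :
    ∫ u, (oddCut X P Q u : ℂ) * ψ u = ∫ u in Ioc 0 X, ((P u : ℂ) - Q u) * (ψ u - ψ (-u)) := by
  set d := oddCut X P Q with hd
  have hdm : Measurable fun u => (d u : ℂ) := measurable_ofReal.comp (measurable_oddCut hP hQ)
  have hsupp : ∀ u, u ∉ Icc (-X) X → d u = 0 := fun u hu =>
    oddCut_of_le_abs hX (le_of_not_ge fun h => hu (abs_le.1 h))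
  have hint : Integrable fun u => (d u : ℂ) * ψ u := by
    have h1 : IntegrableOn (fun u => (d u : ℂ) * ψ u) (Icc (-X) X) := by
      refine hψ.bdd_mul (c := |P 0| + |P X| + |Q 0| + |Q X|) hdm.aestronglyMeasurable (of_forall fun u => ?_)
      rw [norm_real]; exact oddCut_bounded hX hP hQ u
    rw [← integrableOn_univ]
    refine h1.of_forall_sdiff_eq_zero MeasurableSet.univ fun u hu => ?_
    rw [hsupp u hu.2]; simp
  have hneg : Integrable fun u => (d (-u) : ℂ) * ψ (-u) := hint.comp_neg
  rw [← intervalIntegral.integral_Iic_add_Ioi (b := (0 : ℝ)) hint.integrableOn hint.integrableOn]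
  have h1 := integral_comp_neg_Ioi (0 : ℝ) (fun u => (d u : ℂ) * ψ u)
  rw [neg_zero] at h1
  rw [← h1, ← integral_add hneg.integrableOn hint.integrableOn]
  have h2 : Ioi (0 : ℝ) = Ioc 0 X ∪ Ioi X := (Set.Ioc_union_Ioi_eq_Ioi hX.le).symm
  have h3 : ∀ u ∈ Ioi X, (d (-u) : ℂ) * ψ (-u) + (d u : ℂ) * ψ u = 0 := fun u hu => by
    rw [hd, oddCut_neg, oddCut_of_ge hX (le_of_lt hu)]; simp
  have h4 : Integrable fun u => (d (-u) : ℂ) * ψ (-u) + (d u : ℂ) * ψ u := hneg.add hint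
  rw [h2, setIntegral_union (Set.Ioc_disjoint_Ioi le_rfl) measurableSet_Ioi
    h4.integrableOn h4.integrableOn, setIntegral_eq_zero_of_forall_eq_zero h3,
    add_zero]
  refine setIntegral_congr_ae measurableSet_Ioc ?_
  have : ∀ᵐ u : ℝ, u ≠ X := by simp [ae_iff]
  filter_upwards [this] with u hu hu2
  rw [hd, oddCut_neg, oddCut_of_mem hu2.1 (lt_of_le_of_ne hu2.2 hu)]
  push_cast; ring

/-- By oddness only `(0, X]` matters, with `ψ(u) - ψ(-u)` in place of `ψ`; this is the factor 2.
There the function is a difference of two monotone ones, and the second mean value theorem applies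
to each. -/
theorem oddCut_bv {X : ℝ} (hX : 0 < X) {P Q : ℝ → ℝ} (hP : Monotone P) (hQ : Monotone Q) :
    ∃ V, 0 ≤ V ∧ ∀ (ψ : ℝ → ℂ) (S : ℝ), IntegrableOn ψ (Icc (-X) X) →
    (∀ a b, -X ≤ a → a ≤ b → b ≤ X → ‖∫ u in a..b, ψ u‖ ≤ S) →
    ‖∫ u, (oddCut X P Q u : ℂ) * ψ u‖ ≤ V * S := by
  have p1 := hP hX.le
  have q1 := hQ hX.le
  refine ⟨((|P 0| + (P X - P 0)) + (|Q 0| + (Q X - Q 0))) * 2, by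
    have := abs_nonneg (P 0); have := abs_nonneg (Q 0)
    exact mul_nonneg (by linarith) (by norm_num), ?_⟩
  intro ψ S hψ hS
  rw [integral_oddCut_mul hX hP hQ hψ]
  have hψ1 : IntegrableOn ψ (Ioc 0 X) := hψ.mono_set fun u hu => ⟨by linarith [hu.1], hu.2⟩
  have hψ2 : IntegrableOn (fun u => ψ (-u)) (Ioc 0 X) := by
    have h1 : IntegrableOn ψ (Set.Ico (-X) 0) := hψ.mono_set fun u hu => ⟨hu.1, by linarith [hu.2]⟩
    have h2 := (MeasurePreserving.integrableOn_comp_preimage (Measure.measurePreserving_neg volume)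
      (Homeomorph.neg ℝ).measurableEmbedding (f := ψ) (s := Set.Ico (-X) 0)).2 h1
    refine h2.mono_set fun u hu => ?_
    simp only [Set.mem_preimage, Set.mem_Ico]
    constructor <;> linarith [hu.1, hu.2]
  have hΨ : IntegrableOn (fun u => ψ u - ψ (-u)) (Ioc 0 X) := hψ1.sub hψ2
  have hΨS : ∀ c, 0 ≤ c → c ≤ X → ‖∫ u in Ioc c X, (ψ u - ψ (-u))‖ ≤ 2 * S := fun c hc hcX => by
    have hs : Ioc c X ⊆ Ioc 0 X := Set.Ioc_subset_Ioc_left hc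
    rw [integral_sub (hψ1.mono_set hs) (hψ2.mono_set hs), ← intervalIntegral.integral_of_le hcX,
      ← intervalIntegral.integral_of_le hcX, intervalIntegral.integral_comp_neg]
    refine (norm_sub_le _ _).trans ?_
    have h1 := hS c X (by linarith) hcX le_rfl
    have h2 := hS (-X) (-c) le_rfl (by linarith) (by linarith)
    linarith
  have a1 := hP.norm_integral_mul_le hX.le hΨ hΨS
  have a2 := hQ.norm_integral_mul_le hX.le hΨ hΨS
  have hb : ∀ {R : ℝ → ℝ}, Monotone R → IntegrableOn (fun u => (R u : ℂ) * (ψ u - ψ (-u))) (Ioc 0 X) := fun {R} hR => by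
    refine hΨ.bdd_mul (c := |R 0| + |R X|) (measurable_ofReal.comp hR.measurable).aestronglyMeasurable ?_
    rw [ae_restrict_iff' measurableSet_Ioc]
    refine of_forall fun u hu => ?_
    rw [norm_real, norm_eq_abs, abs_le]
    have := hR hu.1.le; have := hR hu.2
    have := neg_abs_le (R 0); have := le_abs_self (R X)
    have := abs_nonneg (R 0); have := abs_nonneg (R X)
    constructor <;> linarith
  simp_rw [sub_mul]
  rw [integral_sub (hb hP) (hb hQ)]
  refine (norm_sub_le _ _).trans ((add_le_add a1 a2).trans_eq (by ring))

/-- The Jordan decomposition of the derivative of `E` is rescaled and restricted to `(0, X)`, then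
extended oddly. This changes the derivative only on a null set, so absolute continuity still
recovers `f` as its integral. -/
theorem IsSievingFunction.exists_sieveKernel {E : ℝ → ℝ} (hE : IsSievingFunction E) {X : ℝ}
    (hX : 0 < X) : ∃ d, IsSieveKernel X (fun x => E (x / X)) d := by
  obtain ⟨g, hg, hder⟩ := hE.deriv_bv
  obtain ⟨p, q, hp, hq, hpq⟩ := hg.locallyBoundedVariationOn.exists_monotoneOn_sub_monotoneOn
  rw [monotoneOn_univ] at hp hq
  set P : ℝ → ℝ := fun u => p (u / X) / X with hPdef
  set Q : ℝ → ℝ := fun u => q (u / X) / X with hQdef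
  have hP : Monotone P := fun a b hab => div_le_div_of_nonneg_right (hp (div_le_div_of_nonneg_right hab hX.le)) hX.le
  have hQ : Monotone Q := fun a b hab => div_le_div_of_nonneg_right (hq (div_le_div_of_nonneg_right hab hX.le)) hX.le
  have hcont : Continuous E := continuous_iff_continuousAt.2 fun x =>
    ((hE.abs_cont (x - 1) (x + 1)).continuousOn).continuousAt (by
      rw [uIcc_of_le (by linarith)]; exact Icc_mem_nhds (by linarith) (by linarith))
  -- The support hypothesis says nothing at `|x| = 1`; continuity supplies the value there.
  have hE1 : E 1 = 0 := by
    have h1 : Tendsto E (𝓝[>] 1) (𝓝 (E 1)) := hcont.continuousAt.mono_left nhdsWithin_le_nhds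
    have h2 : Tendsto E (𝓝[>] 1) (𝓝 0) := by
      refine tendsto_const_nhds.congr' ?_
      filter_upwards [self_mem_nhdsWithin] with x hx
      exact (hE.support x (lt_of_lt_of_le hx (le_abs_self x))).symm
    exact tendsto_nhds_unique h1 h2
  have hFTC : ∀ y, y ≤ 1 → ∫ u in y..1, (p u - q u) = - E y := fun y _ => by
    have h1 := (hE.abs_cont y 1).integral_deriv_eq_sub
    rw [hE1] at h1
    rw [show -E y = 0 - E y by ring, ← h1]
    refine intervalIntegral.integral_congr_ae ?_
    filter_upwards [hder] with u hu _
    rw [hu.deriv, hpq]; rfl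
  have hpos : ∀ x, 0 ≤ x → E (x / X) = -∫ u in Ioi x, oddCut X P Q u := fun x hx => by
    rcases le_total x X with hxX | hxX
    · have h1 : ∫ u in Ioi x, oddCut X P Q u = ∫ u in x..X, oddCut X P Q u := by
        rw [intervalIntegral.integral_of_le hxX]
        refine setIntegral_eq_of_subset_of_forall_sdiff_eq_zero measurableSet_Ioi
          Ioc_subset_Ioi_self fun u hu => oddCut_of_ge hX (le_of_not_ge fun h => hu.2 ⟨hu.1, h⟩)
      have h2 : ∫ u in x..X, oddCut X P Q u = ∫ u in x..X, X⁻¹ * (p (u / X) - q (u / X)) := by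
        refine intervalIntegral.integral_congr_ae ?_
        have : ∀ᵐ u : ℝ, u ≠ X := by simp [ae_iff]
        filter_upwards [this] with u hu hu2
        rw [Set.uIoc_of_le hxX] at hu2
        rw [oddCut_of_mem (lt_of_le_of_lt hx hu2.1) (lt_of_le_of_ne hu2.2 hu)]
        simp only [hPdef, hQdef]; ring
      rw [h1, h2, intervalIntegral.integral_const_mul,
        intervalIntegral.integral_comp_div (fun u => p u - q u) hX.ne', div_self hX.ne',
        hFTC _ ((div_le_one hX).2 hxX), smul_eq_mul, inv_mul_cancel_left₀ hX.ne']
      ring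
    · have h1 : ∀ u ∈ Ioi x, oddCut X P Q u = 0 := fun u hu => oddCut_of_ge hX (hxX.trans (le_of_lt hu))
      rw [setIntegral_eq_zero_of_forall_eq_zero h1, neg_zero]
      rcases hxX.eq_or_lt with rfl | h
      · rw [div_self hX.ne', hE1]
      · exact hE.support _ (by rw [abs_of_nonneg (by positivity)]; exact (one_lt_div hX).2 h)
  have hm := measurable_oddCut (X := X) hP hQ
  have hi : Integrable (oddCut X P Q) := by
    have h1 : IntegrableOn (oddCut X P Q) (Icc (-X) X) :=
      Measure.integrableOn_of_bounded (M := |P 0| + |P X| + |Q 0| + |Q X|) (by simp)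
        hm.aestronglyMeasurable (of_forall (oddCut_bounded hX hP hQ))
    rw [← integrableOn_univ]
    exact h1.of_forall_sdiff_eq_zero MeasurableSet.univ fun u hu =>
      oddCut_of_le_abs hX (le_of_not_ge fun h => hu.2 (abs_le.1 h))
  refine ⟨oddCut X P Q, hX, oddCut_neg X P Q, fun u => ?_, fun u hu => oddCut_of_le_abs hX hu.le, hm,
    ⟨_, oddCut_bounded hX hP hQ⟩, fun x => ?_, ?_, oddCut_bv hX hP hQ, oddCut_ae_continuousAt hX hP hQ⟩
  · simp only [neg_div]; exact hE.even _
  · rcases le_total 0 x with h | h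
    · exact hpos x h
    · have h1 := hpos (-x) (by linarith)
      rw [neg_div, hE.even] at h1
      have h2 := integral_comp_neg_Ioi x (oddCut X P Q)
      simp_rw [oddCut_neg] at h2
      rw [integral_neg] at h2
      have h3 := intervalIntegral.integral_Iic_add_Ioi (b := -x) hi.integrableOn hi.integrableOn
      have h4 : ∫ u, oddCut X P Q u = 0 := by
        have h1 := integral_neg_eq_self (oddCut X P Q) volume
        simp_rw [oddCut_neg] at h1
        rw [integral_neg] at h1
        linarith
      rw [h1]; linarith
  · simp [hE.zero]

/-! ### Identification of `sieveMellin` with `M^λ` -/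

theorem integral_exp_neg_mul_sin {ξ : ℝ} (hξ : 0 < ξ) :
    IntegrableOn (fun t : ℝ => Complex.exp (-(t * ξ)) * sin t) (Ioi 0) ∧
    ∫ t in Ioi (0 : ℝ), Complex.exp (-(t * ξ)) * sin t = 1 / (1 + (ξ : ℂ) ^ 2) := by
  have e : ∀ t : ℝ, Complex.exp (-(t * ξ)) * sin t = (I / 2) * Complex.exp ((-ξ - I) * t) -
        (I / 2) * Complex.exp ((-ξ + I) * t) := fun t => by
    rw [sin, show (-ξ - I) * (t : ℂ) = -(t * ξ) + -t * I by ring,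
      show (-ξ + I) * (t : ℂ) = -(t * ξ) + t * I by ring, Complex.exp_add,
      Complex.exp_add]
    ring
  have r1 : (-(ξ : ℂ) - I).re < 0 := by simpa using hξ
  have r2 : (-(ξ : ℂ) + I).re < 0 := by simpa using hξ
  have i1 := (integrableOn_exp_mul_complex_Ioi r1 0).const_mul (I / 2)
  have i2 := (integrableOn_exp_mul_complex_Ioi r2 0).const_mul (I / 2)
  simp_rw [e]
  refine ⟨i1.sub i2, ?_⟩
  rw [integral_sub i1 i2, integral_const_mul, integral_const_mul, integral_exp_mul_complex_Ioi r1,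
    integral_exp_mul_complex_Ioi r2]
  have n1 : -(ξ : ℂ) - I ≠ 0 := by intro h; rw [h] at r1; simp at r1
  have n2 : -(ξ : ℂ) + I ≠ 0 := by intro h; rw [h] at r2; simp at r2
  have n3 : (1 : ℂ) + (ξ : ℂ) ^ 2 ≠ 0 := by
    rw [show (1 : ℂ) + (ξ : ℂ) ^ 2 = (-(ξ : ℂ) - I) * (-(ξ : ℂ) + I) by linear_combination I_sq]
    exact mul_ne_zero n1 n2
  simp only [ofReal_zero, mul_zero, Complex.exp_zero]
  field_simp
  linear_combination -2 * (ξ : ℂ) ^ 2 * I_sq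

/-- Substituting `t²` for the variable gives the Beta integral with parameters `(z+1)/2` and
`(1-z)/2`, whose sum is 1; the reflection formula evaluates it. -/
theorem integral_cpow_div_one_add_sq {z : ℂ} (h1 : -1 < z.re) (h2 : z.re < 1) :
    ∫ t in Ioi (0 : ℝ), (t : ℂ) ^ z * (1 / (1 + (t : ℂ) ^ 2)) = π / (2 * cos (π * z / 2)) := by
  have ha : 0 < ((z + 1) / 2).re := by simp; linarith
  have hc : 0 < ((1 - z) / 2).re := by simp; linarith
  have hb := (integral_Ioi_beta ha hc).2
  have hm := mellin_comp_rpow (fun t : ℝ => (1 : ℂ) / (1 + t)) (z + 1) 2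
  have e1 : mellin (fun t : ℝ => (1 : ℂ) / (1 + ((t ^ (2 : ℝ) : ℝ) : ℂ))) (z + 1) =
      ∫ t in Ioi (0 : ℝ), (t : ℂ) ^ z * (1 / (1 + (t : ℂ) ^ 2)) := by
    rw [mellin]
    refine setIntegral_congr_fun measurableSet_Ioi fun t _ => ?_
    simp only [add_sub_cancel_right, smul_eq_mul]
    norm_cast
  have e2 : mellin (fun t : ℝ => (1 : ℂ) / (1 + t)) ((z + 1) / 2) =
      ∫ t in Ioi (0 : ℝ), (t : ℂ) ^ ((z + 1) / 2 - 1) * ((1 + t : ℝ) : ℂ) ^ (-((z + 1) / 2 + (1 - z) / 2)) := by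
    rw [mellin]
    refine setIntegral_congr_fun measurableSet_Ioi fun t _ => ?_
    simp only [smul_eq_mul]
    rw [show -((z + 1) / 2 + (1 - z) / 2) = (-1 : ℂ) by ring, Complex.cpow_neg_one]
    push_cast
    rw [one_div]
  rw [← e1, hm]
  rw [show ((2 : ℝ) : ℂ) = 2 by norm_num, e2, hb, show (1 - z) / 2 = 1 - (z + 1) / 2 by ring,
    Gamma_mul_Gamma_one_sub, add_sub_cancel, Gamma_one,
    show (π : ℂ) * ((z + 1) / 2) = π * z / 2 + π / 2 by ring,
    sin_add_pi_div_two, abs_of_pos (by norm_num : (0 : ℝ) < 2), real_smul]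
  push_cast
  generalize cos (π * z / 2) = c
  rcases eq_or_ne c 0 with rfl | hc
  · simp
  · field_simp

theorem integrableOn_rpow_mul_abs_sin {x : ℝ} (h0 : 0 < x) (h1 : x < 1) :
    IntegrableOn (fun t : ℝ => t ^ (-x - 1) * |Real.sin t|) (Ioi 0) := by
  have hm : ∀ s : Set ℝ, AEStronglyMeasurable (fun t : ℝ => t ^ (-x - 1) * |Real.sin t|)
      (volume.restrict s) := fun s =>
    ((measurable_id.pow_const _).mul Real.measurable_sin.norm).aestronglyMeasurable
  rw [← Set.Ioc_union_Ioi_eq_Ioi (zero_le_one' ℝ)]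
  refine IntegrableOn.union ?_ ?_
  · have h2 : IntegrableOn (fun t : ℝ => t ^ (-x)) (Ioc 0 1) := by
      rw [← intervalIntegrable_iff_integrableOn_Ioc_of_le zero_le_one]
      exact intervalIntegral.intervalIntegrable_rpow' (by linarith)
    refine Integrable.mono' h2 (hm _) ((ae_restrict_iff' measurableSet_Ioc).2 (of_forall fun t ht => ?_))
    have htp : 0 < t := ht.1
    rw [norm_of_nonneg (by positivity)]
    have h3 : |Real.sin t| ≤ t := by have := Real.abs_sin_le_abs (x := t); rwa [abs_of_pos htp] at this
    calc t ^ (-x - 1) * |Real.sin t| ≤ t ^ (-x - 1) * t := mul_bound_left h3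
      _ = t ^ (-x) := by
        nth_rewrite 2 [← rpow_one t]
        rw [← rpow_add htp]; congr 1; ring
  · have h2 := integrableOn_Ioi_rpow_of_lt (a := -x - 1) (by linarith) zero_lt_one
    refine Integrable.mono' h2 (hm _) ((ae_restrict_iff' measurableSet_Ioi).2 (of_forall fun t ht => ?_))
    have htp : 0 < t := lt_trans zero_lt_one ht
    rw [norm_of_nonneg (by positivity)]
    exact mul_le_of_le_one_right (by positivity) (Real.abs_sin_le_one t)

/-- `Γ(z+1) t^{-z-1}` is the Laplace integral of `ξ^z`. Exchanging the integrations leaves `∫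
e^{-tξ} sin t dt = 1/(1+ξ²)`. With the exponent `-z-1` and `0 < Re z < 1` everything converges
absolutely at both ends. -/
theorem integral_cpow_mul_sin {z : ℂ} (h0 : 0 < z.re) (h1 : z.re < 1) :
    IntegrableOn (fun t : ℝ => (t : ℂ) ^ (-z - 1) * sin t) (Ioi 0) ∧
    ∫ t in Ioi (0 : ℝ), (t : ℂ) ^ (-z - 1) * sin t = π / (2 * cos (π * z / 2) * Gamma (z + 1)) := by
  have hsin : ∀ t : ℝ, ‖sin (t : ℂ)‖ = |Real.sin t| := fun t => by rw [← Complex.ofReal_sin, norm_real, norm_eq_abs]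
  have hn : ∀ t ∈ Ioi (0 : ℝ), t ^ (-z.re - 1) * |Real.sin t| = ‖(t : ℂ) ^ (-z - 1) * sin t‖ :=
    fun t ht => by rw [norm_mul, norm_ofReal_cpow_of_pos ht, hsin]; simp
  have hcont : ContinuousOn (fun t : ℝ => (t : ℂ) ^ (-z - 1) * sin t) (Ioi 0) := (continuousOn_ofReal_cpow _).mul
      (Complex.continuous_sin.comp continuous_ofReal).continuousOn
  have hint : IntegrableOn (fun t : ℝ => (t : ℂ) ^ (-z - 1) * sin t) (Ioi 0) :=
    (integrable_norm_iff (hcont.aestronglyMeasurable measurableSet_Ioi)).1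
      ((integrableOn_congr_fun hn measurableSet_Ioi).1 (integrableOn_rpow_mul_abs_sin h0 h1))
  refine ⟨hint, ?_⟩
  have hz1 : 0 < (z + 1).re := by simp; linarith
  have hG := Gamma_ne_zero_of_re_pos hz1
  have hxi : ∀ t ∈ Ioi (0 : ℝ), ∫ ξ in Ioi (0 : ℝ), (ξ : ℂ) ^ z * (Complex.exp (-(t * ξ)) * sin t) =
      Gamma (z + 1) * ((t : ℂ) ^ (-z - 1) * sin t) := fun t ht => by
    have htp : 0 < t := ht
    have := integral_cpow_mul_exp_neg_mul_Ioi hz1 htp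
    simp_rw [← mul_assoc]
    rw [integral_mul_const]
    rw [add_sub_cancel_right] at this
    rw [this, one_div_ofReal_cpow htp, show -(z + 1) = -z - 1 by ring]
    ring
  set μ := (volume : Measure ℝ).restrict (Ioi 0) with hμ
  have hprod : Integrable (fun p : ℝ × ℝ => (p.2 : ℂ) ^ z * (Complex.exp (-(p.1 * p.2)) * sin p.1))
      (μ.prod μ) := by
    rw [integrable_prod_iff (Measurable.aestronglyMeasurable (by fun_prop))]
    have hnorm : ∀ t ∈ Ioi (0 : ℝ), ∀ ξ ∈ Ioi (0 : ℝ), ‖(ξ : ℂ) ^ z * (Complex.exp (-(t * ξ)) * sin t)‖ =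
          ξ ^ z.re * exp (-(t * ξ)) * |Real.sin t| := fun t _ ξ hξ => by
      rw [norm_mul, norm_mul, norm_ofReal_cpow_of_pos hξ, hsin, norm_exp]
      simp [mul_assoc]
    have hz1' : 0 < z.re + 1 := by linarith
    constructor
    · refine (ae_restrict_iff' measurableSet_Ioi).2 (of_forall fun t ht => ?_)
      have htp : 0 < t := ht
      have h3 := (integrableOn_cpow_mul_exp hz1 htp).1
      rw [add_sub_cancel_right] at h3
      refine (h3.mul_const (sin t)).congr (of_forall fun ξ => ?_)
      simp only [mul_assoc]
    · have h4 : IntegrableOn (fun t : ℝ => Real.Gamma (z.re + 1) * (t ^ (-z.re - 1) * |Real.sin t|))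
          (Ioi 0) := (integrableOn_rpow_mul_abs_sin h0 h1).const_mul _
      refine (integrableOn_congr_fun (fun t ht => ?_) measurableSet_Ioi).1 h4
      have htp : 0 < t := ht
      rw [hμ, setIntegral_congr_fun measurableSet_Ioi (hnorm t ht), integral_mul_const]
      have h5 := integral_rpow_mul_exp_neg_mul_Ioi hz1' htp
      rw [add_sub_cancel_right] at h5
      rw [h5, one_div, Real.inv_rpow htp.le, ← rpow_neg htp.le, show -(z.re + 1) = -z.re - 1 by ring]
      ring
  have hswap := integral_integral_swap (f := fun t ξ : ℝ => (ξ : ℂ) ^ z * (Complex.exp (-(t * ξ)) * sin t)) hprod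
  rw [hμ, setIntegral_congr_fun measurableSet_Ioi hxi, integral_const_mul] at hswap
  have h6 : ∀ ξ ∈ Ioi (0 : ℝ), ∫ t in Ioi (0 : ℝ), (ξ : ℂ) ^ z *
      (Complex.exp (-(t * ξ)) * sin t) = (ξ : ℂ) ^ z * (1 / (1 + (ξ : ℂ) ^ 2)) := fun ξ hξ => by
    rw [integral_const_mul, (integral_exp_neg_mul_sin hξ).2]
  rw [setIntegral_congr_fun measurableSet_Ioi h6, integral_cpow_div_one_add_sq (by linarith) h1] at hswap
  have hc := cos_pi_half_ne_zero (z := z) (by linarith) h1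
  rw [eq_div_iff (mul_ne_zero (mul_ne_zero two_ne_zero hc) hG)]
  rw [eq_div_iff (mul_ne_zero two_ne_zero hc)] at hswap
  linear_combination hswap

theorem cos_pi_half_ne_zero_of_ne {z : ℂ} (h1 : -1 < z.re) (h2 : ∀ k : ℕ, z ≠ 2 * (k : ℂ) + 1) :
    cos (π * z / 2) ≠ 0 := fun h => by
  rw [cos_eq_zero_iff] at h
  obtain ⟨k, hk⟩ := h
  have hπ : (π : ℂ) ≠ 0 := ofReal_ne_zero.2 pi_ne_zero
  have hz : z = 2 * k + 1 := by
    field_simp at hk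
    linear_combination hk
  have hre := congrArg re hz
  simp at hre
  rw [hre] at h1
  have i1 : (-1 : ℝ) < ((2 * k + 1 : ℤ) : ℝ) := by push_cast; linarith
  have i1 : (-1 : ℤ) < 2 * k + 1 := by exact_mod_cast i1
  obtain ⟨m, rfl⟩ := Int.eq_ofNat_of_zero_le (a := k) (by omega)
  exact h2 m (by simpa using hz)

namespace IsSieveKernel

theorem differentiableAt_mellin (h : IsSieveKernel X f d) {z : ℂ} (hz : 0 < z.re) :
    DifferentiableAt ℂ (mellin fun u => (d u : ℂ)) z := by
  obtain ⟨D, hD⟩ := h.exists_d_bdd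
  refine mellin_differentiableAt_of_isBigO_rpow (a := z.re + 1) (b := 0) ?_ ?_ (by linarith) ?_ hz
  · exact (h.integrable.ofReal.locallyIntegrable).locallyIntegrableOn _
  · refine Asymptotics.IsBigO.of_bound 1 ?_
    filter_upwards [eventually_gt_atTop X] with u hu
    rw [h.supp_d u (lt_of_lt_of_le hu (le_abs_self u)), norm_zero]; positivity
  · refine Asymptotics.IsBigO.of_bound D (of_forall fun u => ?_)
    simpa using hD u

theorem analyticAt_mellin_add_one (h : IsSieveKernel X f d) {z : ℂ} (hz : -1 < z.re) :
    AnalyticAt ℂ (fun z => mellin (fun u => (d u : ℂ)) (z + 1)) z := by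
  have ho : IsOpen {z : ℂ | -1 < z.re} := isOpen_lt continuous_const continuous_re
  have h1 : DifferentiableOn ℂ (fun z => mellin (fun u => (d u : ℂ)) (z + 1)) {z : ℂ | -1 < z.re} := fun w hw => by
    have hw' : -1 < w.re := hw
    have h2 := h.differentiableAt_mellin (z := w + 1) (by simp; linarith)
    exact (h2.comp w (differentiableAt_id.add_const 1)).differentiableWithinAt
  exact h1.analyticAt (ho.mem_nhds hz)

theorem _root_.analyticAt_cos_mul_Gamma {z : ℂ} (hz : -1 < z.re) : AnalyticAt ℂ (fun z : ℂ => cos (π * z / 2)) z ∧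
      AnalyticAt ℂ (fun z : ℂ => Gamma (z + 1)) z := by
  have ho : IsOpen {z : ℂ | -1 < z.re} := isOpen_lt continuous_const continuous_re
  constructor
  · have : Differentiable ℂ fun z : ℂ => cos (π * z / 2) := by fun_prop
    exact this.analyticAt z
  · have h1 : DifferentiableOn ℂ (fun z : ℂ => Gamma (z + 1)) {z : ℂ | -1 < z.re} := fun w hw => by
      have hw' : -1 < w.re := hw
      have h2 : DifferentiableAt ℂ Gamma (w + 1) := by
        refine differentiableAt_Gamma _ fun m hm => ?_
        have := congrArg re hm
        simp at this
        linarith [(cast_nonneg m : (0 : ℝ) ≤ m)]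
      exact (h2.comp w (differentiableAt_id.add_const 1)).differentiableWithinAt
    exact h1.analyticAt (ho.mem_nhds hz)

theorem analyticAt_sieveMellin (h : IsSieveKernel X f d) {z : ℂ} (hz : -1 < z.re)
    (h2 : ∀ k : ℕ, z ≠ 2 * (k : ℂ) + 1) : AnalyticAt ℂ (sieveMellin d) z := by
  obtain ⟨a1, a2⟩ := analyticAt_cos_mul_Gamma hz
  have hG := Gamma_ne_zero_of_re_pos (s := z + 1) (by simp; linarith)
  exact (h.analyticAt_mellin_add_one hz).neg.div (a1.mul a2) (mul_ne_zero (cos_pi_half_ne_zero_of_ne hz h2) hG)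

theorem differentiableAt_sieveMellin (h : IsSieveKernel X f d) {z : ℂ} (hz : -1 < z.re)
    (h1 : z.re < 1) : DifferentiableAt ℂ (sieveMellin d) z :=
  (h.analyticAt_sieveMellin hz fun k hk => by
    have := congrArg re hk
    simp at this
    linarith [(cast_nonneg k : (0 : ℝ) ≤ k)]).differentiableAt

/-- The only possible singularity comes from the cosine in the denominator, which has simple zeros
at the odd integers. -/
theorem meromorphicAt_sieveMellin (h : IsSieveKernel X f d) (k : ℕ) :
    MeromorphicAt (sieveMellin d) (2 * (k : ℂ) + 1) ∧
      (-1 : ℤ) ≤ meromorphicOrderAt (sieveMellin d) (2 * (k : ℂ) + 1) := by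
  have hk : (0 : ℝ) ≤ k := cast_nonneg k
  have hz : -1 < (2 * (k : ℂ) + 1).re := by simp; linarith
  set z : ℂ := 2 * (k : ℂ) + 1 with hzdef
  obtain ⟨a1, a2⟩ := analyticAt_cos_mul_Gamma hz
  have a3 := (h.analyticAt_mellin_add_one hz).neg
  have hG := Gamma_ne_zero_of_re_pos (s := z + 1) (by simp at hz ⊢; linarith)
  have e : sieveMellin d = (fun z : ℂ => cos (π * z / 2))⁻¹ *
      ((-fun z => mellin (fun u => (d u : ℂ)) (z + 1)) * (fun z : ℂ => Gamma (z + 1))⁻¹) := by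
    funext w
    simp only [sieveMellin, Pi.mul_apply, Pi.inv_apply, Pi.neg_apply]
    rw [div_eq_mul_inv, mul_inv]; ring
  have a4 := a3.mul (a2.inv hG)
  have hord : meromorphicOrderAt (fun z : ℂ => cos (π * z / 2)) z = 1 := by
    have h0 : cos (π * z / 2) = 0 := by rw [cos_eq_zero_iff]; exact ⟨k, by rw [hzdef]; push_cast; ring⟩
    have hd : HasDerivAt (fun z : ℂ => cos (π * z / 2))
        (-sin (π * z / 2) * (π / 2)) z := by
      have h1 : HasDerivAt (fun z : ℂ => (π : ℂ) * z / 2) (π / 2) z := by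
        simpa using ((hasDerivAt_id z).const_mul (π : ℂ)).div_const 2
      exact h1.ccos
    have hs : sin (π * z / 2) ≠ 0 := fun hs => by
      have := Complex.sin_sq_add_cos_sq (π * z / 2)
      rw [hs, h0] at this; norm_num at this
    have hπ : (π : ℂ) ≠ 0 := ofReal_ne_zero.2 pi_ne_zero
    have h1 : analyticOrderAt (fun z : ℂ => cos (π * z / 2)) z = 1 := by
      have := a1.analyticOrderAt_sub_eq_one_of_deriv_ne_zero (by
        rw [hd.deriv]; exact mul_ne_zero (neg_ne_zero.2 hs) (div_ne_zero hπ two_ne_zero))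
      simpa [h0] using this
    rw [a1.meromorphicOrderAt_eq, h1]; rfl
  rw [e]
  refine ⟨a1.meromorphicAt.inv.mul a4.meromorphicAt, ?_⟩
  rw [meromorphicOrderAt_mul a1.meromorphicAt.inv a4.meromorphicAt, meromorphicOrderAt_inv, hord]
  have h5 := a4.meromorphicOrderAt_nonneg
  calc (((-1 : ℤ)) : WithTop ℤ) = -1 + 0 := rfl
    _ ≤ _ := add_le_add_right h5 _

theorem integrable_mul_of_continuous (h : IsSieveKernel X f d) {g : ℝ → ℂ} (hg : Continuous g) :
    Integrable (fun u => (f u : ℂ) * g u) ∧ Integrable (fun u => (d u : ℂ) * g u) := by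
  have key : ∀ φ : ℝ → ℂ, Integrable φ → (∀ u, X < |u| → φ u = 0) →
      Integrable (fun u => φ u * g u) := fun φ hφ hs => by
    obtain ⟨C, hC⟩ := (isCompact_Icc (a := -X) (b := X)).exists_bound_of_continuousOn hg.continuousOn
    have h1 : IntegrableOn (fun u => φ u * g u) (Icc (-X) X) :=
      hφ.integrableOn.mul_bdd (c := C) hg.aestronglyMeasurable ((ae_restrict_iff' measurableSet_Icc).2 (of_forall hC))
    rw [← integrableOn_univ]
    refine h1.of_forall_sdiff_eq_zero MeasurableSet.univ fun u hu => ?_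
    rw [hs u, zero_mul]
    by_contra h2
    exact hu.2 (abs_le.1 (not_lt.1 h2))
  have hfi : Integrable fun u => (f u : ℂ) := by
    have h1 : IntegrableOn (fun u => (f u : ℂ)) (Icc (-X) X) :=
      (continuous_ofReal.comp h.continuous_f).continuousOn.integrableOn_compact isCompact_Icc
    rw [← integrableOn_univ]
    refine h1.of_forall_sdiff_eq_zero MeasurableSet.univ fun u hu => ?_
    rw [h.f_supp, ofReal_zero]
    by_contra h2
    exact hu.2 (abs_le.1 (not_le.1 h2).le)
  refine ⟨key _ hfi fun u hu => ?_, key _ h.integrable.ofReal h.supp_d⟩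
  rw [h.f_supp hu.le, ofReal_zero]

/-- Integration by parts written as Fubini on the triangle `y < u`, so that `f` need not be
differentiable everywhere. -/
theorem integral_Ioi_mul (h : IsSieveKernel X f d) {g : ℝ → ℂ} (hg : Continuous g) :
    ∫ y in Ioi (0 : ℝ), (f y : ℂ) * g y = -∫ u in Ioi (0 : ℝ), (d u : ℂ) * ∫ y in (0 : ℝ)..u, g y := by
  set H : ℝ × ℝ → ℂ := fun p => if p.1 < p.2 then g p.1 * (d p.2 : ℂ) else 0 with hH
  set μ := (volume : Measure ℝ).restrict (Ioc 0 X) with hμ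
  have hfin : IsFiniteMeasure μ := ⟨by simp [hμ]⟩
  have hHm : Measurable H := by
    refine Measurable.ite (measurableSet_lt measurable_fst measurable_snd) ?_ measurable_const
    exact (hg.measurable.comp measurable_fst).mul (h.measurable_d.comp measurable_snd)
  obtain ⟨C, hC⟩ := (isCompact_Icc (a := 0) (b := X)).exists_bound_of_continuousOn hg.continuousOn
  obtain ⟨D, hD⟩ := h.exists_d_bdd
  have hC0 : 0 ≤ C := (norm_nonneg _).trans (hC 0 ⟨le_refl 0, h.pos.le⟩)
  have hD0 : 0 ≤ D := (norm_nonneg _).trans (hD 0)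
  have hHi : Integrable H (μ.prod μ) := by
    refine Integrable.of_bound hHm.aestronglyMeasurable (C * D) ?_
    rw [hμ, Measure.prod_restrict, ae_restrict_iff' (measurableSet_Ioc.prod measurableSet_Ioc)]
    refine of_forall fun p hp => ?_
    simp only [hH]
    split_ifs
    · rw [norm_mul]
      exact mul_le_mul (hC _ ⟨hp.1.1.le, hp.1.2⟩) (hD _) (norm_nonneg _) hC0
    · rw [norm_zero]; positivity
  have hsupp : ∀ φ : ℝ → ℂ, (∀ u, X < |u| → φ u = 0) → ∫ u in Ioi (0 : ℝ), φ u = ∫ u in Ioc 0 X, φ u := fun φ hφ =>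
    setIntegral_eq_of_subset_of_forall_sdiff_eq_zero measurableSet_Ioi
      Ioc_subset_Ioi_self fun u hu => hφ u (by
        rw [abs_of_pos hu.1]
        by_contra h2; exact hu.2 ⟨hu.1, not_lt.1 h2⟩)
  have hswap := integral_integral_swap (f := fun y u => H (y, u)) hHi
  have e1 : ∀ y ∈ Ioc 0 X, ∫ u, H (y, u) ∂μ = -((f y : ℂ) * g y) := fun y hy => by
    have h1 : ∀ u, H (y, u) = (Ioi y).indicator (fun u => g y * (d u : ℂ)) u := fun u => by
      simp only [hH, indicator, mem_Ioi]
    simp_rw [h1]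
    rw [integral_indicator measurableSet_Ioi, hμ, Measure.restrict_restrict measurableSet_Ioi, integral_const_mul]
    have h2 : ∫ u in Ioi y ∩ Ioc 0 X, (d u : ℂ) = ∫ u in Ioi y, (d u : ℂ) := by
      symm
      refine setIntegral_eq_of_subset_of_forall_sdiff_eq_zero measurableSet_Ioi
        Set.inter_subset_left fun u hu => h.supp_d u ?_
      have h3 : 0 < u := lt_trans hy.1 hu.1
      rw [abs_of_pos h3]
      by_contra h2; exact hu.2 ⟨hu.1, h3, not_lt.1 h2⟩
    rw [h2, integral_complex_ofReal, h.eq y]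
    push_cast; ring
  have e2 : ∀ u ∈ Ioc 0 X, ∫ y, H (y, u) ∂μ = (d u : ℂ) * ∫ y in (0 : ℝ)..u, g y := fun u hu => by
    have h1 : ∀ y, H (y, u) = (Iio u).indicator (fun y => (d u : ℂ) * g y) y := fun y => by
      simp only [hH, indicator, mem_Iio, mul_comm]
    simp_rw [h1]
    rw [integral_indicator measurableSet_Iio, hμ, Measure.restrict_restrict measurableSet_Iio, integral_const_mul]
    have h2 : Iio u ∩ Ioc 0 X = Set.Ioo 0 u := by
      ext y
      simp only [Set.mem_inter_iff, mem_Iio, mem_Ioc, Set.mem_Ioo]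
      constructor
      · rintro ⟨h1, h2, h3⟩; exact ⟨h2, h1⟩
      · rintro ⟨h1, h2⟩; exact ⟨h2, h1, by linarith [hu.2]⟩
    rw [h2, ← integral_Ioc_eq_integral_Ioo, intervalIntegral.integral_of_le hu.1.le]
  rw [hμ, setIntegral_congr_fun measurableSet_Ioc e1, setIntegral_congr_fun measurableSet_Ioc e2,
    integral_neg] at hswap
  rw [hsupp _ fun u hu => by rw [h.f_supp hu.le]; simp, hsupp _ fun u hu => by rw [h.supp u hu]; simp]
  rw [← hswap, neg_neg]

theorem integral_mul_exp (h : IsSieveKernel X f d) {t : ℝ} (ht : 0 < t) :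
    ∫ x : ℝ, (f x : ℂ) * Complex.exp (-I * (x : ℂ) * (t : ℂ)) =
      -(2 / t) * ∫ u in Ioi (0 : ℝ), (d u : ℂ) * sin ((u * t : ℝ) : ℂ) := by
  have ht0 : (t : ℂ) ≠ 0 := ofReal_ne_zero.2 ht.ne'
  set φ : ℝ → ℂ := fun x => (f x : ℂ) * Complex.exp (-I * (x : ℂ) * (t : ℂ)) with hφ
  have hi : Integrable φ := (h.integrable_mul_of_continuous (by fun_prop)).1
  have h1 := integral_comp_neg_Ioi (0 : ℝ) φ
  rw [neg_zero] at h1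
  rw [← intervalIntegral.integral_Iic_add_Ioi (b := (0 : ℝ)) hi.integrableOn hi.integrableOn, ← h1,
    ← integral_add hi.comp_neg.integrableOn hi.integrableOn]
  have h2 : ∀ x : ℝ, φ (-x) + φ x = (f x : ℂ) * (2 * cos (t * x)) := fun x => by
    simp only [hφ, h.even]
    rw [cos, show -I * ((-x : ℝ) : ℂ) * t = t * x * I by push_cast; ring,
      show -I * (x : ℂ) * t = -(t * x) * I by ring]
    ring
  simp_rw [h2]
  rw [h.integral_Ioi_mul (by fun_prop), neg_mul, ← integral_const_mul]
  congr 1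
  refine integral_congr_ae (of_forall fun u => ?_)
  have h3 : ∫ y in (0 : ℝ)..u, (2 * cos (t * y)) = 2 * (sin (t * u) / t) := by
    rw [intervalIntegral.integral_const_mul, integral_cos_mul_complex ht0]
    simp
  simp only [h3]
  push_cast
  rw [mul_comm (u : ℂ)]
  ring

/-- After Fubini the `t`-integral scales to `u^z` times the sine integral `integral_cpow_mul_sin`.
The integral over `u` is then the Mellin transform of `d` at `z + 1`, which explains the shape of
`sieveMellin`. -/
theorem integral_sieve_mellin (h : IsSieveKernel X f d) {z : ℂ} (h0 : 0 < z.re) (h1 : z.re < 1)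
    {F : ℝ → ℂ} (hF : ∀ t, 0 < t → F t = -(2 / t) * ∫ u in Ioi (0 : ℝ), (d u : ℂ) * sin ((u * t : ℝ) : ℂ)) :
    IntegrableOn (fun t : ℝ => F t * (t : ℂ) ^ (-z)) (Ioi 0) ∧
    sieveMellin d z = 1 / (π : ℂ) * ∫ t in Ioi (0 : ℝ), F t * (t : ℂ) ^ (-z) := by
  obtain ⟨hSi, hS⟩ := integral_cpow_mul_sin h0 h1
  set S : ℂ := ∫ t in Ioi (0 : ℝ), (t : ℂ) ^ (-z - 1) * sin t with hSdef
  set μ := (volume : Measure ℝ).restrict (Ioi 0) with hμ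
  set H : ℝ × ℝ → ℂ := fun p => (d p.2 : ℂ) * ((p.1 : ℂ) ^ (-z - 1) * sin ((p.2 * p.1 : ℝ) : ℂ)) with hH
  have hHm : AEStronglyMeasurable H (μ.prod μ) := by
    exact ((h.measurable_d.comp measurable_snd).mul (by fun_prop)).aestronglyMeasurable
  have hscale : ∀ u ∈ Ioi (0 : ℝ), ∀ t ∈ Ioi (0 : ℝ), (t : ℂ) ^ (-z - 1) * sin ((u * t : ℝ) : ℂ) =
        (u : ℂ) ^ (z + 1) * (((u * t : ℝ) : ℂ) ^ (-z - 1) * sin ((u * t : ℝ) : ℂ)) := fun u hu t ht => by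
    have hu' : (u : ℂ) ≠ 0 := ofReal_ne_zero.2 (ne_of_gt hu)
    rw [Complex.ofReal_mul, Complex.mul_cpow_ofReal_nonneg (le_of_lt hu) (le_of_lt ht)]
    rw [show -z - 1 = -(z + 1) by ring, cpow_neg (u : ℂ)]
    have : (u : ℂ) ^ (z + 1) ≠ 0 := by simp [Complex.cpow_eq_zero_iff, hu']
    field_simp
  have hinner : ∀ u ∈ Ioi (0 : ℝ), IntegrableOn (fun t : ℝ => (t : ℂ) ^ (-z - 1) * sin ((u * t : ℝ) : ℂ)) (Ioi 0) ∧
      ∫ t in Ioi (0 : ℝ), (t : ℂ) ^ (-z - 1) * sin ((u * t : ℝ) : ℂ) = (u : ℂ) ^ z * S ∧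
      ∫ t in Ioi (0 : ℝ), ‖(t : ℂ) ^ (-z - 1) * sin ((u * t : ℝ) : ℂ)‖ =
        u ^ z.re * ∫ t in Ioi (0 : ℝ), ‖(t : ℂ) ^ (-z - 1) * sin t‖ := fun u hu => by
    have hup : 0 < u := hu
    have hu' : (u : ℂ) ≠ 0 := ofReal_ne_zero.2 (ne_of_gt hu)
    refine ⟨?_, ?_, ?_⟩
    · have h2 := (integrableOn_Ioi_comp_mul_left_iff (fun t : ℝ => (t : ℂ) ^ (-z - 1) * sin t)
        0 hup).2 (by simpa using hSi)
      exact (integrableOn_congr_fun (fun t ht => (hscale u hu t ht).symm) measurableSet_Ioi).1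
        (Integrable.const_mul h2 ((u : ℂ) ^ (z + 1)))
    · rw [setIntegral_congr_fun measurableSet_Ioi (hscale u hu), integral_const_mul,
        integral_comp_mul_left_Ioi (fun t : ℝ => (t : ℂ) ^ (-z - 1) * sin t) 0 hup, mul_zero,
        real_smul, cpow_add _ _ hu', Complex.cpow_one, hSdef, hμ]
      push_cast
      field_simp
    · have h2 : ∀ t ∈ Ioi (0 : ℝ), ‖(t : ℂ) ^ (-z - 1) * sin ((u * t : ℝ) : ℂ)‖ =
          u ^ (z.re + 1) * ‖((u * t : ℝ) : ℂ) ^ (-z - 1) * sin ((u * t : ℝ) : ℂ)‖ := fun t ht => by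
        rw [hscale u hu t ht, norm_mul, norm_ofReal_cpow_of_pos hup]; simp
      rw [setIntegral_congr_fun measurableSet_Ioi h2, integral_const_mul,
        integral_comp_mul_left_Ioi (fun t : ℝ => ‖(t : ℂ) ^ (-z - 1) * sin t‖) 0 hup, mul_zero,
        smul_eq_mul, rpow_add hup, rpow_one]
      field_simp
  have hHi : Integrable H (μ.prod μ) := by
    rw [integrable_prod_iff' hHm]
    constructor
    · refine (ae_restrict_iff' measurableSet_Ioi).2 (of_forall fun u hu => ?_)
      exact Integrable.const_mul (hinner u hu).1 (d u : ℂ)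
    · obtain ⟨D, hD⟩ := h.exists_d_bdd
      have h2 : IntegrableOn (fun u : ℝ => (∫ t in Ioi (0 : ℝ), ‖(t : ℂ) ^ (-z - 1) * sin t‖) *
          ‖(d u : ℂ) * (|u| ^ z.re : ℝ)‖) (Ioi 0) := by
        have := (h.integrable_mul_of_continuous (g := fun u => ((|u| ^ z.re : ℝ) : ℂ))
          (continuous_ofReal.comp (continuous_abs.rpow_const fun u => inr h0.le))).2
        exact (this.norm.const_mul _).integrableOn
      refine (integrableOn_congr_fun (fun u hu => ?_) measurableSet_Ioi).1 h2
      have hup : 0 < u := hu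
      simp only [hH]
      simp_rw [norm_mul (d u : ℂ)]
      rw [integral_const_mul, hμ, (hinner u hu).2.2, abs_of_pos hup, norm_real (u ^ z.re),
        norm_of_nonneg (by positivity)]
      ring
  have hval : ∀ t ∈ Ioi (0 : ℝ), -2 * ∫ u, H (t, u) ∂μ = F t * (t : ℂ) ^ (-z) := fun t ht => by
    have ht' : (t : ℂ) ≠ 0 := ofReal_ne_zero.2 (ne_of_gt ht)
    have h2 : ∀ u, H (t, u) = (t : ℂ) ^ (-z - 1) * ((d u : ℂ) * sin ((u * t : ℝ) : ℂ)) := fun u => by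
      simp only [hH]; ring
    simp_rw [h2]
    rw [integral_const_mul, hF t ht, Complex.cpow_sub _ _ ht', Complex.cpow_one]
    generalize ∫ u, (d u : ℂ) * sin ((u * t : ℝ) : ℂ) ∂μ = J
    field_simp
  have hswap := integral_integral_swap (f := fun t u => H (t, u)) hHi
  refine ⟨(integrableOn_congr_fun hval measurableSet_Ioi).1 (hHi.integral_prod_left.const_mul (-2)), ?_⟩
  rw [← setIntegral_congr_fun measurableSet_Ioi hval, integral_const_mul, hswap]
  have h3 : ∀ u ∈ Ioi (0 : ℝ), ∫ t, H (t, u) ∂μ = S * ((u : ℂ) ^ (z + 1 - 1) • (d u : ℂ)) := fun u hu => by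
    simp only [hH]
    rw [integral_const_mul, hμ, (hinner u hu).2.1, add_sub_cancel_right, smul_eq_mul]; ring
  rw [hμ, setIntegral_congr_fun measurableSet_Ioi h3, integral_const_mul, ← mellin, hS, sieveMellin]
  have hc := cos_pi_half_ne_zero (z := z) (by linarith) h1
  have hG := Gamma_ne_zero_of_re_pos (s := z + 1) (by simp; linarith)
  have hπ : (π : ℂ) ≠ 0 := ofReal_ne_zero.2 pi_ne_zero
  generalize cos (π * z / 2) = c at hc ⊢
  field_simp

theorem isMellinTransform {E : ℝ → ℝ} (h : IsSieveKernel X (fun x => E (x / X)) d) :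
    IsMellinTransform E X (sieveMellin d) := by
  have hF : ∀ t, 0 < t → sieveFourier E X t =
      -(2 / t) * ∫ u in Ioi (0 : ℝ), (d u : ℂ) * sin ((u * t : ℝ) : ℂ) := fun t ht =>
    h.integral_mul_exp ht
  exact ⟨fun z h0 h1 => (h.integral_sieve_mellin h0 h1 hF).1,
    fun z h0 h1 => (h.integral_sieve_mellin h0 h1 hF).2, fun z hz h2 => h.analyticAt_sieveMellin hz h2,
    fun k => (h.meromorphicAt_sieveMellin k).1, fun k => (h.meromorphicAt_sieveMellin k).2⟩

theorem mellin_one (h : IsSieveKernel X f d) : mellin (fun u => (d u : ℂ)) 1 = -1 := by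
  have h1 := h.eq 0
  rw [h.zero] at h1
  rw [mellin]
  simp only [sub_self, Complex.cpow_zero, one_smul]
  rw [integral_complex_ofReal]
  have : ∫ u in Ioi (0 : ℝ), d u = -1 := by linarith
  rw [this]; simp

theorem mellin_two (h : IsSieveKernel X f d) :
    mellin (fun u => (d u : ℂ)) 2 = -((∫ u in Ioi (0 : ℝ), f u : ℝ) : ℂ) := by
  have h1 := (h.mellin_f (v := 1) (by simp)).2
  rw [show (1 : ℂ) + 1 = 2 by norm_num] at h1
  have h2 : mellin (fun x => (f x : ℂ)) 1 = ((∫ u in Ioi (0 : ℝ), f u : ℝ) : ℂ) := by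
    rw [mellin, ← integral_complex_ofReal]; simp
  rw [← h2, h1]; ring

theorem sieveMellin_zero (h : IsSieveKernel X f d) : sieveMellin d 0 = 1 := by simp [sieveMellin, h.mellin_one]

/-! ### Size of `sieveConv`, `sieveMellin` and the kernel -/

theorem _root_.intervalIntegrable_posPow {v : ℂ} (hv : 0 < v.re) (a b : ℝ) :
    IntervalIntegrable (posPow (v - 1)) volume a b := by
  have hint : ∀ a b : ℝ, IntegrableOn (posPow (v - 1)) (Ioc a b) := fun a b => by
    rcases lt_or_ge 0 b with hb | hb
    · refine (integral_posPow_Ioo hv hb).1.of_forall_sdiff_eq_zero measurableSet_Ioc fun u hu => posPow_of_nonpos ?_ _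
      by_contra h2; exact hu.2 ⟨not_le.1 h2, hu.1.2⟩
    · refine (integrableOn_empty (f := posPow (v - 1))).of_forall_sdiff_eq_zero measurableSet_Ioc
        fun u hu => posPow_of_nonpos (hu.1.2.trans hb) _
  exact ⟨hint a b, hint b a⟩

theorem _root_.norm_integral_posPow_le {v : ℂ} (hv : 0 < v.re) {B Y : ℝ} (hB : v.re ≤ B) (hY : 1 ≤ Y)
    {a b : ℝ} (ha : a ≤ Y) (hb : b ≤ Y) :
    ‖∫ u in a..b, posPow (v - 1) u‖ ≤ 2 * (Y ^ B / ‖v‖) := by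
  have hvn : 0 < ‖v‖ := norm_pos_iff.2 (by rintro rfl; simp at hv)
  have hprim : ∀ b, b ≤ Y → ‖∫ u in (0 : ℝ)..b, posPow (v - 1) u‖ ≤ Y ^ B / ‖v‖ := fun b hb => by
    rcases lt_or_ge 0 b with hb0 | hb0
    · rw [intervalIntegral.integral_of_le hb0.le, (integral_posPow_Ioo hv hb0).2, norm_div,
        norm_ofReal_cpow_of_pos hb0]
      exact div_le_div_of_nonneg_right ((rpow_bound hb).trans (rpow_le_rpow_of_exponent_le hY hB)) hvn.le
    · rw [intervalIntegral.integral_of_ge hb0,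
        setIntegral_eq_zero_of_forall_eq_zero fun u hu => posPow_of_nonpos hu.2 _]
      simp; positivity
  rw [← intervalIntegral.integral_add_adjacent_intervals (intervalIntegrable_posPow hv a 0)
    (intervalIntegrable_posPow hv 0 b), intervalIntegral.integral_symm]
  refine (norm_add_le _ _).trans ?_
  rw [norm_neg]
  linarith [hprim a ha, hprim b hb]

/-- The primitive `y^{v+1}/(v+1)` is smaller than `y^v` by a factor `|v+1|`, and bounded variation
transfers this gain to the integral against `d`. -/
theorem exists_sieveConv_bound (h : IsSieveKernel X f d) {δ : ℝ} (hδ : 0 < δ) (B x : ℝ) :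
    ∃ C, 0 < C ∧ ∀ v : ℂ, -1 + δ ≤ v.re → v.re ≤ B → ‖sieveConv d v x‖ ≤ C * (1 + |v.im|) ^ (-1 : ℝ) := by
  obtain ⟨V, hV, hbv⟩ := h.bv
  have hX := h.pos
  set Y := |x| + X + 1 with hY
  have hY1 : 1 ≤ Y := by linarith [abs_nonneg x]
  have hYx : ∀ u, -X ≤ u → x - u ≤ Y := fun u hu => by linarith [le_abs_self x]
  refine ⟨V * (2 * Y ^ (B + 1) * (1 + 1 / δ)) + 1, by positivity, fun v hv hvB => ?_⟩
  have hw0 : 0 < (v + 1).re := by simp; linarith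
  have hwn : (1 + |v.im|) ≤ (1 + 1 / δ) * ‖v + 1‖ := by
    have h1 := abs_im_le_norm (v + 1)
    have h2 : δ ≤ ‖v + 1‖ := by
      have h4 := (le_abs_self (v + 1).re).trans (abs_re_le_norm (v + 1))
      rw [add_re, one_re] at h4
      linarith
    have h3 : 1 ≤ 1 / δ * ‖v + 1‖ := by rw [one_div, inv_mul_eq_div, le_div_iff₀ hδ]; linarith
    simp only [add_im, one_im, add_zero] at h1
    linarith
  have hwp : 0 < ‖v + 1‖ := norm_pos_iff.2 fun h0 => by rw [h0] at hw0; simp at hw0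
  have hmain := hbv (fun u => posPow v (x - u)) (2 * (Y ^ (B + 1) / ‖v + 1‖))
    (by
      have h1 := (intervalIntegrable_posPow hw0 (x - -X) (x - X)).comp_sub_left x
      rw [sub_sub_cancel, sub_sub_cancel, add_sub_cancel_right] at h1
      rw [integrableOn_Icc_iff_integrableOn_Ioc]
      exact h1.1)
    (fun a b ha hab hb => by
      have h1 := norm_integral_posPow_le hw0 (B := B + 1) (by simpa using hvB) hY1 (hYx b (by linarith)) (hYx a ha)
      rw [add_sub_cancel_right] at h1
      rwa [intervalIntegral.integral_comp_sub_left (posPow v) x])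
  have e : sieveConv d v x = ∫ u, (d u : ℂ) * posPow v (x - u) := by
    rw [sieveConv, ← integral_sub_left_eq_self (fun u => (d u : ℂ) * posPow v (x - u)) volume x]
    simp_rw [sub_sub_cancel, mul_comm]
  rw [e, rpow_neg_one, ← div_eq_mul_inv]
  refine hmain.trans ?_
  rw [le_div_iff₀ (by positivity)]
  calc V * (2 * (Y ^ (B + 1) / ‖v + 1‖)) * (1 + |v.im|) ≤
        V * (2 * (Y ^ (B + 1) / ‖v + 1‖)) * ((1 + 1 / δ) * ‖v + 1‖) :=
        mul_bound_left hwn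
    _ = V * (2 * Y ^ (B + 1) * (1 + 1 / δ)) := by field_simp
    _ ≤ _ := by linarith

theorem mellin_eq_neg_sieveConv (h : IsSieveKernel X f d) (z : ℂ) :
    mellin (fun u => (d u : ℂ)) (z + 1) = -sieveConv d z 0 := by
  rw [mellin_eq_integral_posPow, sieveConv, add_sub_cancel_right, ← integral_neg]
  simp [h.odd]

end IsSieveKernel

theorem norm_cos_le_exp_abs_im (w : ℂ) : ‖cos w‖ ≤ exp |w.im| := by
  have h1 : ‖Complex.exp (-w * I)‖ ≤ exp |w.im| := by rw [norm_exp]; exact exp_le_exp.2 (by simpa using le_abs_self _)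
  have h2 : ‖Complex.exp (w * I)‖ ≤ exp |w.im| := by rw [norm_exp]; exact exp_le_exp.2 (by simpa using neg_le_abs _)
  rw [cos, norm_div, norm_ofNat, div_le_iff₀ (by norm_num)]
  refine (norm_add_le _ _).trans (by linarith)

theorem norm_sin_le_exp_abs_im (w : ℂ) : ‖sin w‖ ≤ exp |w.im| := by
  rw [← Complex.cos_pi_div_two_sub]
  simpa using norm_cos_le_exp_abs_im (π / 2 - w)

/-- The reflection formula moves `Γ(z+1)` and the cosine out of the denominator, so that upper
bounds for `Γ` suffice to estimate `sieveMellin`. -/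
theorem sieveMellin_eq_of_im_ne_zero (d : ℝ → ℝ) {z : ℂ} (h : -1 < z.re) (hz : z.im ≠ 0) :
    sieveMellin d z = 2 / π * mellin (fun u => (d u : ℂ)) (z + 1) * Gamma (-z) * sin (π * z / 2) := by
  have e := Gamma_mul_Gamma_one_sub (z + 1)
  have g1 := Gamma_ne_zero_of_re_pos (s := z + 1) (by simp; linarith)
  have g2 : Gamma (-z) ≠ 0 := Complex.Gamma_ne_zero fun m hm => hz (by
    have := congrArg im hm
    simpa using this)
  have e1 : sin (π * (z + 1)) =
      -(2 * sin (π * z / 2) * cos (π * z / 2)) := by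
    rw [show (π : ℂ) * (z + 1) = π * z + π by ring, Complex.sin_add_pi, ← sin_two_mul]
    congr 2; ring
  rw [show 1 - (z + 1) = -z by ring, e1] at e
  have hπ : (π : ℂ) ≠ 0 := ofReal_ne_zero.2 pi_ne_zero
  set c := cos (π * z / 2) with hc
  set q := sin (π * z / 2) with hq
  have hcq : -(2 * q * c) ≠ 0 := fun h0 => by
    rw [h0, div_zero] at e
    exact mul_ne_zero g1 g2 e
  have hc0 : c ≠ 0 := fun h0 => hcq (by rw [h0]; ring)
  rw [eq_div_iff hcq] at e
  rw [sieveMellin, ← hc, div_eq_iff (mul_ne_zero hc0 g1)]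
  field_simp
  linear_combination (mellin (fun u => (d u : ℂ)) (z + 1)) * e

namespace IsSieveKernel

/-- The exponent `-Re z - 3/2` is `-1` from bounded variation plus `-Re z - 1/2` from `Γ(-z)`; the
exponential factors of `Γ(-z)` and the sine cancel. Small `|Im z|` is covered by compactness. -/
theorem exists_sieveMellin_bound (h : IsSieveKernel X f d) {δ : ℝ} (hδ : 0 < δ) (hδ1 : δ < 1) :
    ∃ C, 0 < C ∧ ∀ z : ℂ, -1 + δ ≤ z.re → z.re ≤ 1 - δ → ‖sieveMellin d z‖ ≤ C * (1 + |z.im|) ^ (-z.re - 3 / 2) := by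
  obtain ⟨C₁, hC₁, h1⟩ := exists_norm_Gamma_le_of_one_le 2
  obtain ⟨C₂, hC₂, h2⟩ := h.exists_sieveConv_bound hδ 1 0
  have hcomp : IsCompact (Icc (-1 + δ) (1 - δ) ×ℂ Icc (-1 : ℝ) 1) := isCompact_Icc.reProdIm isCompact_Icc
  have hcont : ContinuousOn (sieveMellin d) (Icc (-1 + δ) (1 - δ) ×ℂ Icc (-1 : ℝ) 1) := fun z hz => by
    obtain ⟨hz1, -⟩ := mem_reProdIm.1 hz
    exact (h.differentiableAt_sieveMellin (by linarith [hz1.1]) (by linarith [hz1.2])).continuousAt.continuousWithinAt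
  obtain ⟨B, hB⟩ := hcomp.exists_bound_of_continuousOn hcont
  refine ⟨|B| * 2 ^ (5 / 2 : ℝ) + 2 / π * C₂ * C₁, by positivity, fun z hz1 hz2 => ?_⟩
  have hy : 1 ≤ 1 + |z.im| := by linarith [abs_nonneg z.im]
  have hy0 : 0 < 1 + |z.im| := by linarith
  have hpw : 0 < (1 + |z.im|) ^ (-z.re - 3 / 2) := Real.rpow_pos_of_pos hy0 _
  rw [add_mul]
  rcases le_or_gt |z.im| 1 with hi | hi
  · have hb := hB z (mem_reProdIm.2 ⟨⟨hz1, hz2⟩, abs_le.1 hi⟩)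
    have h3 : 1 ≤ 2 ^ (5 / 2 : ℝ) * (1 + |z.im|) ^ (-z.re - 3 / 2) := by
      have h4 : (2 : ℝ) ^ (-(5 / 2) : ℝ) ≤ (1 + |z.im|) ^ (-z.re - 3 / 2) := by
        calc (2 : ℝ) ^ (-(5 / 2) : ℝ) ≤ (1 + |z.im|) ^ (-(5 / 2) : ℝ) :=
              rpow_le_rpow_of_nonpos hy0 (by linarith) (by norm_num)
          _ ≤ _ := rpow_bound_exp hy
      calc (1 : ℝ) = 2 ^ (5 / 2 : ℝ) * 2 ^ (-(5 / 2) : ℝ) := by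
            rw [← rpow_add (by norm_num)]; norm_num
        _ ≤ _ := mul_bound_left h4
    calc ‖sieveMellin d z‖ ≤ |B| * 1 := by rw [mul_one]; exact hb.trans (le_abs_self B)
      _ ≤ |B| * (2 ^ (5 / 2 : ℝ) * (1 + |z.im|) ^ (-z.re - 3 / 2)) := mul_le_mul_of_nonneg_left h3 (abs_nonneg B)
      _ ≤ _ := by
        rw [← mul_assoc]
        exact le_add_of_nonneg_right (by positivity)
  · have hz0 : z.im ≠ 0 := by intro h0; rw [h0] at hi; norm_num at hi
    rw [sieveMellin_eq_of_im_ne_zero d (by linarith) hz0, norm_mul, norm_mul, norm_mul, norm_div,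
      norm_ofNat, norm_real, norm_of_nonneg pi_pos.le]
    have a1 := h2 z hz1 (by linarith)
    rw [← norm_neg, ← h.mellin_eq_neg_sieveConv] at a1
    have a2 := h1 (-z) (by simp; linarith) (by simp; linarith) (by simpa using hi.le)
    have a3 := norm_sin_le_exp_abs_im (π * z / 2)
    have e3 : (π * z / 2).im = π * z.im / 2 := by simp
    rw [e3, abs_div, abs_mul, abs_of_pos pi_pos, abs_of_pos (by norm_num : (0 : ℝ) < 2)] at a3
    simp only [Complex.neg_im, abs_neg, neg_re] at a2
    calc 2 / π * ‖mellin (fun u => (d u : ℂ)) (z + 1)‖ * ‖Gamma (-z)‖ *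
          ‖sin (π * z / 2)‖ ≤ 2 / π * (C₂ * (1 + |z.im|) ^ (-1 : ℝ)) *
          (C₁ * (1 + |z.im|) ^ (-z.re - 1 / 2) * exp (-(π * |z.im| / 2))) *
          exp (π * |z.im| / 2) := by
          refine mul_bound (mul_bound (mul_bound_left a1) a2) a3
      _ = 2 / π * C₂ * C₁ * ((1 + |z.im|) ^ (-1 : ℝ) * (1 + |z.im|) ^ (-z.re - 1 / 2)) *
          (exp (-(π * |z.im| / 2)) * exp (π * |z.im| / 2)) := by ring
      _ = 2 / π * C₂ * C₁ * (1 + |z.im|) ^ (-z.re - 3 / 2) := by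
          rw [← exp_add, ← rpow_add hy0, neg_add_cancel, Real.exp_zero, mul_one]
          congr 2; ring
      _ ≤ _ := le_add_of_nonneg_left (by positivity)

/-- The two Gamma factors decay like `e^{-π|Im z|/2}` and `e^{-π|Im v|/2}`, and the cosine grows at
most like `e^{π|Im z - Im v|/2}`. The triangle inequality leaves powers only. -/
theorem exists_sieveKer_bound (h : IsSieveKernel X f d) {δ : ℝ} (hδ : 0 < δ) (hδ1 : δ < 1) (B : ℝ) :
    ∃ C, 0 < C ∧ ∀ z v : ℂ, -1 + δ ≤ z.re → z.re ≤ B → -1 + δ ≤ v.re → v.re ≤ B →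
      -1 + δ ≤ z.re + v.re → z.re + v.re ≤ 1 - δ →
      ‖sieveKer d z v‖ ≤ C * ((1 + |z.im|) ^ (z.re + 1 / 2) * (1 + |v.im|) ^ (v.re + 1 / 2) *
        (1 + |z.im + v.im|) ^ (-(z.re + v.re) - 3 / 2)) := by
  obtain ⟨C₁, hC₁, h1⟩ := exists_norm_Gamma_le (x₀ := δ) (X := B + 1) hδ
  obtain ⟨C₂, hC₂, h2⟩ := h.exists_sieveMellin_bound hδ hδ1
  refine ⟨C₁ * C₁ * C₂, by positivity, fun z v a1 a2 a3 a4 a5 a6 => ?_⟩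
  have b1 := h1 (z + 1) (by simp; linarith) (by simp; linarith)
  have b2 := h1 (v + 1) (by simp; linarith) (by simp; linarith)
  have b3 := h2 (z + v) (by simpa using a5) (by simpa using a6)
  have b4 := norm_cos_le_exp_abs_im (π * (z - v) / 2)
  have e1 : (π * (z - v) / 2).im = π * (z.im - v.im) / 2 := by simp
  rw [e1, abs_div, abs_mul, abs_of_pos pi_pos, abs_of_pos (by norm_num : (0 : ℝ) < 2)] at b4
  have b5 : exp (π * |z.im - v.im| / 2) ≤
      exp (π * |z.im| / 2) * exp (π * |v.im| / 2) := by
    rw [← exp_add]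
    refine exp_le_exp.2 ?_
    have := mul_le_mul_of_nonneg_left (abs_sub z.im v.im) pi_pos.le
    linarith
  simp only [add_im, one_im, add_zero, add_re, one_re] at b1 b2 b3
  rw [show z.re + 1 - 1 / 2 = z.re + 1 / 2 by ring] at b1
  rw [show v.re + 1 - 1 / 2 = v.re + 1 / 2 by ring] at b2
  rw [sieveKer, norm_mul, norm_mul, norm_mul]
  set P := (1 + |z.im|) ^ (z.re + 1 / 2)
  set Q := (1 + |v.im|) ^ (v.re + 1 / 2)
  set R := (1 + |z.im + v.im|) ^ (-(z.re + v.re) - 3 / 2)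
  have hP : 0 ≤ P := by positivity
  have hQ : 0 ≤ Q := by positivity
  have hR : 0 ≤ R := by positivity
  calc _ ≤ (C₁ * P * exp (-(π * |z.im| / 2))) *
        (C₁ * Q * exp (-(π * |v.im| / 2))) * (C₂ * R) *
        (exp (π * |z.im| / 2) * exp (π * |v.im| / 2)) :=
        mul_bound (mul_bound (mul_bound b1 b2) b3) (b4.trans b5)
    _ = C₁ * C₁ * C₂ * (P * Q * R) * ((exp (-(π * |z.im| / 2)) * exp (π * |z.im| / 2)) *
        (exp (-(π * |v.im| / 2)) * exp (π * |v.im| / 2))) := by ring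
    _ = _ := by rw [← exp_add, ← exp_add, neg_add_cancel, neg_add_cancel, Real.exp_zero]; ring

theorem differentiableAt_sieveKer {V : Type*} [NormedAddCommGroup V] [NormedSpace ℂ V]
    (h : IsSieveKernel X f d) {F G : V → ℂ} {s : V}
    (hF : DifferentiableAt ℂ F s) (hG : DifferentiableAt ℂ G s) (h1 : -1 < (F s).re)
    (h2 : -1 < (G s).re) (h3 : -1 < (F s).re + (G s).re) (h4 : (F s).re + (G s).re < 1) :
    DifferentiableAt ℂ (fun s => sieveKer d (F s) (G s)) s := by
  have hM : DifferentiableAt ℂ (sieveMellin d) (F s + G s) :=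
    h.differentiableAt_sieveMellin (by simpa using h3) (by simpa using h4)
  have hΓ : ∀ {w : ℂ}, -1 < w.re → DifferentiableAt ℂ (fun z : ℂ => Gamma (z + 1)) w :=
    fun hw => (analyticAt_cos_mul_Gamma hw).2.differentiableAt
  have d1 : DifferentiableAt ℂ (fun s => Gamma (F s + 1)) s := (hΓ h1).comp s hF
  have d2 : DifferentiableAt ℂ (fun s => Gamma (G s + 1)) s := (hΓ h2).comp s hG
  have d3 : DifferentiableAt ℂ (fun s => sieveMellin d (F s + G s)) s :=
    DifferentiableAt.comp (g := sieveMellin d) (f := fun s => F s + G s) s hM (hF.add hG)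
  have d4 : DifferentiableAt ℂ (fun s => cos (π * (F s - G s) / 2)) s := by fun_prop
  exact ((d1.mul d2).mul d3).mul d4

/-! ### The pole of the diagonal term at `s = 1/2` -/

/-- The polar part of `s ↦ Γ(1-s)² M(2-2s)` at `s = 1/2`. -/
theorem exists_sieveKer_diag (h : IsSieveKernel X f d) : ∃ Q : ℂ → ℂ,
    DifferentiableOn ℂ Q {s : ℂ | 0 < s.re ∧ s.re < 1} ∧ ∀ s : ℂ, 1 / 2 < s.re → s.re < 1 →
      sieveKer d (1 - s) (1 - s) / (1 - s) ^ 2 = ((∫ u in Ioi (0 : ℝ), f u : ℝ) : ℂ) / (s - 1 / 2) + Q s := by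
  set U : Set ℂ := {s : ℂ | 0 < s.re ∧ s.re < 1} with hU
  have hhalf : U ∈ 𝓝 (1 / 2 : ℂ) := (isOpen_strip 0 1).mem_nhds ⟨by norm_num, by norm_num⟩
  -- In `0 < Re s < 1` the argument `2 - 2s` has real part in `(0, 2)`, so this cosine in the
  -- denominator of `M(2-2s)` vanishes only at `s = 1/2`, to first order. Dividing it by `s - 1/2`
  -- leaves a nonvanishing function.
  set k : ℂ → ℂ := fun s => cos (π * (2 - 2 * s) / 2) with hk
  have hkd : Differentiable ℂ k := by simp only [hk]; fun_prop
  have hπ : (π : ℂ) ≠ 0 := ofReal_ne_zero.2 pi_ne_zero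
  have hk0 : k (1 / 2) = 0 := by
    simp only [hk]
    rw [show (π : ℂ) * (2 - 2 * (1 / 2)) / 2 = π / 2 by ring, Complex.cos_pi_div_two]
  have hkder : deriv k (1 / 2) = π := by
    have h1 : HasDerivAt (fun s : ℂ => (π : ℂ) * (2 - 2 * s) / 2) (-π) (1 / 2) := by
      have := ((((hasDerivAt_id (1 / 2 : ℂ)).const_mul 2).const_sub 2).const_mul (π : ℂ)).div_const 2
      refine this.congr_deriv ?_
      ring
    have h2 := h1.ccos
    rw [show (π : ℂ) * (2 - 2 * (1 / 2)) / 2 = π / 2 by ring, Complex.sin_pi_div_two] at h2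
    rw [show k = fun s => cos (π * (2 - 2 * s) / 2) from rfl, h2.deriv]; ring
  set c := dslope k (1 / 2) with hc
  have hcd : DifferentiableOn ℂ c U := (differentiableOn_dslope hhalf).2 hkd.differentiableOn
  have hkc : ∀ s, k s = (s - 1 / 2) * c s := fun s => by
    have := sub_smul_dslope k (1 / 2) s
    rw [hk0, sub_zero, smul_eq_mul] at this
    exact this.symm
  have hcne : ∀ s ∈ U, c s ≠ 0 := fun s hs => by
    rcases eq_or_ne s (1 / 2) with rfl | hne
    · rw [hc, dslope_same, hkder]; exact hπ
    · intro h0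
      refine cos_pi_half_ne_zero_of_ne (z := 2 - 2 * s) (by simp; linarith [hs.2]) (fun m hm => ?_)
        (show k s = 0 by rw [hkc, h0, mul_zero])
      rcases Nat.eq_zero_or_pos m with rfl | hm0
      · apply hne
        simp at hm
        linear_combination -(1 / 2) * hm
      · have h1 := congrArg re hm
        simp at h1
        have h2 : (1 : ℝ) ≤ m := by exact_mod_cast hm0
        linarith [hs.1]
  set P : ℂ → ℂ := fun s => Gamma (1 - s + 1) ^ 2 / (1 - s) ^ 2 *
    (-mellin (fun u => (d u : ℂ)) (2 - 2 * s + 1) / Gamma (2 - 2 * s + 1)) with hP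
  have hPd : DifferentiableOn ℂ P U := fun s hs => by
    have r1 : -1 < (1 - s).re := by simp; linarith [hs.2]
    have r2 : -1 < (2 - 2 * s).re := by simp; linarith [hs.2]
    have d0 : DifferentiableAt ℂ (fun s : ℂ => 2 - 2 * s) s := by fun_prop
    have d1 := (analyticAt_cos_mul_Gamma r1).2.differentiableAt.fun_comp' s (f := fun s : ℂ => 1 - s) (by fun_prop)
    have d2 := (analyticAt_cos_mul_Gamma r2).2.differentiableAt.fun_comp' s d0
    have d3 := (h.analyticAt_mellin_add_one r2).differentiableAt.fun_comp' s d0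
    have n1 : (1 - s) ^ 2 ≠ 0 := pow_ne_zero _ (ne_zero_of_re_ne (by simp; linarith [hs.2]))
    have n2 := Gamma_ne_zero_of_re_pos (s := 2 - 2 * s + 1) (by simp at r2 ⊢; linarith)
    exact ((d1.pow 2).fun_div (by fun_prop) n1 |>.mul (d3.neg.fun_div d2 n2)).differentiableWithinAt
  set F : ℂ → ℂ := fun s => P s / c s with hF
  have hFd : DifferentiableOn ℂ F U := hPd.div hcd hcne
  -- The residue: `Γ(3/2)²/(1/2)² = π` cancels the derivative `π` of the cosine, and the Mellin
  -- transform of `d` at 2 is `-∫_0^∞ f`.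
  have hFhalf : F (1 / 2) = ((∫ u in Ioi (0 : ℝ), f u : ℝ) : ℂ) := by
    have hG := Gamma_mul_Gamma_one_sub (1 / 2)
    rw [show (1 : ℂ) - 1 / 2 = 1 / 2 by norm_num, show (π : ℂ) * (1 / 2) = π / 2 by ring,
      Complex.sin_pi_div_two, div_one] at hG
    have hG2 : Gamma 2 = 1 := by
      have := Gamma_add_one 1 one_ne_zero
      rwa [Gamma_one, mul_one, show (1 : ℂ) + 1 = 2 by norm_num] at this
    simp only [hF, hP, hc, dslope_same, hkder]
    rw [show (2 : ℂ) - 2 * (1 / 2) + 1 = 2 by norm_num, h.mellin_two,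
      show (1 : ℂ) - 1 / 2 + 1 = 1 / 2 + 1 by norm_num, Gamma_add_one _ (by norm_num),
      hG2, mul_pow, sq (Gamma _), hG]
    field_simp
    norm_num
  refine ⟨dslope F (1 / 2), (differentiableOn_dslope hhalf).2 hFd, fun s hs hs1 => ?_⟩
  have hsU : s ∈ U := ⟨by linarith, hs1⟩
  have hne : s - 1 / 2 ≠ 0 := ne_zero_of_re_ne (by simp; linarith)
  have e1 : F s = ((∫ u in Ioi (0 : ℝ), f u : ℝ) : ℂ) + (s - 1 / 2) * dslope F (1 / 2) s := by
    have := sub_smul_dslope F (1 / 2) s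
    rw [hFhalf, smul_eq_mul] at this
    linear_combination -this
  have e2 : sieveKer d (1 - s) (1 - s) / (1 - s) ^ 2 = F s / (s - 1 / 2) := by
    have h2 : (π : ℂ) * (1 - s + (1 - s)) / 2 = π * (2 - 2 * s) / 2 := by ring
    have h3 : cos (π * (2 - 2 * s) / 2) = (s - 1 / 2) * c s := hkc s
    rw [sieveKer, sieveMellin, h2, h3, show (1 - s + (1 - s)) = 2 - 2 * s by ring, sub_self, mul_zero,
      zero_div, Complex.cos_zero]
    simp only [hF, hP]
    have hcn := hcne s hsU
    have n2 := Gamma_ne_zero_of_re_pos (s := 2 - 2 * s + 1) (by simp; linarith)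
    have n1 : (1 - s) ≠ 0 := ne_zero_of_re_ne (by simp; linarith)
    generalize c s = cs at hcn ⊢
    field_simp
  rw [e2, e1, add_div, mul_div_cancel_left₀ _ hne]

end IsSieveKernel

/-! ### Regularity of `n_x(v)` and Mellin inversion -/

theorem vline_cpow_mul_mellin {g : ℝ → ℂ} {a x : ℝ} (hx : 0 < x) (hg : MellinConvergent g a)
    {G : ℂ → ℂ} (hG : ∀ z : ℂ, z.re = a → mellin g z = G z)
    (hi : Integrable fun y : ℝ => G (a + y * I)) (hc : ContinuousAt g x) :
    vline a (fun z => (x : ℂ) ^ (-z) * G z) = g x := by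
  have e : ∀ y : ℝ, mellin g (a + y * I) = G (a + y * I) := fun y => hG _ (by simp)
  have h1 := mellinInv_mellin_eq a g hx hg (by rw [Complex.VerticalIntegrable]; simpa only [e] using hi) hc
  rw [mellinInv] at h1
  simp only [e, smul_eq_mul] at h1
  rw [← h1, vline, real_smul]
  push_cast
  rfl

namespace IsSieveKernel

theorem sieveConv_eq_mellin (d : ℝ → ℝ) (v : ℂ) (x : ℝ) :
    sieveConv d v x = mellin (fun y => (d (x - y) : ℂ)) (v + 1) := by
  rw [mellin_eq_integral_posPow, add_sub_cancel_right]; rfl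

/-- Differentiability of the Mellin transform of a shifted compactly supported function. -/
theorem _root_.differentiableAt_mellin_shift {φ : ℝ → ℂ} (hφ : Integrable φ) {D X : ℝ}
    (hD : ∀ u, ‖φ u‖ ≤ D) (hX : ∀ u, X < |u| → φ u = 0) {x : ℝ} {v : ℂ} (hv : 0 < v.re ∨ X < x) :
    DifferentiableAt ℂ (mellin fun y => φ (x - y)) v := by
  have hi : Integrable fun y => φ (x - y) := hφ.comp_sub_left x
  have htop : (fun y => φ (x - y)) =O[atTop] fun y => y ^ (-(v.re + 1)) := by
    refine Asymptotics.IsBigO.of_bound 1 ?_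
    filter_upwards [eventually_gt_atTop (X + |x|), eventually_gt_atTop 0] with y hy hy0
    rw [hX (x - y), norm_zero]
    · positivity
    · have := abs_sub_abs_le_abs_sub y x
      rw [abs_sub_comm, abs_of_pos hy0] at this
      linarith
  rcases hv with hv | hv
  · refine mellin_differentiableAt_of_isBigO_rpow (b := 0) (hi.locallyIntegrable.locallyIntegrableOn _)
      htop (by linarith) (Asymptotics.IsBigO.of_bound D (of_forall fun u => ?_)) hv
    simpa using hD _
  · refine mellin_differentiableAt_of_isBigO_rpow (b := v.re - 1)
      (hi.locallyIntegrable.locallyIntegrableOn _) htop (by linarith)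
      (Asymptotics.IsBigO.of_bound 1 ?_) (by linarith)
    have : ∀ᶠ y : ℝ in 𝓝[>] 0, y < x - X := nhdsWithin_le_nhds (Iio_mem_nhds (by linarith))
    filter_upwards [this, self_mem_nhdsWithin] with y hy hy0
    rw [hX (x - y) (lt_of_lt_of_le (by linarith) (le_abs_self _)), norm_zero]; positivity

/-- For `x > X` the integrand vanishes near `y = 0`, so there is no restriction on `v`. -/
theorem differentiableAt_sieveConv (h : IsSieveKernel X f d) {x : ℝ} {v : ℂ}
    (hv : -1 < v.re ∨ X < x) : DifferentiableAt ℂ (fun v => sieveConv d v x) v := by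
  obtain ⟨D, hD⟩ := h.exists_d_bdd
  have h1 : DifferentiableAt ℂ (mellin fun y => (d (x - y) : ℂ)) (v + 1) :=
    differentiableAt_mellin_shift (φ := fun u => (d u : ℂ)) h.integrable.ofReal hD h.supp_d
      (hv.imp_left fun hv => by simp; linarith)
  have e : (fun v => sieveConv d v x) = fun v => mellin (fun y => (d (x - y) : ℂ)) (v + 1) :=
    funext fun v => sieveConv_eq_mellin d v x
  rw [e]
  exact DifferentiableAt.comp (g := mellin fun y => (d (x - y) : ℂ)) (f := fun v : ℂ => v + 1) v h1 (by fun_prop)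

/-- Pointwise Mellin inversion needs continuity in `x`. It follows from dominated convergence, since
`d` is continuous almost everywhere. -/
theorem continuousAt_sieveConv (h : IsSieveKernel X f d) {v : ℂ} (hv : -1 < v.re) (x : ℝ) :
    ContinuousAt (sieveConv d v) x := by
  obtain ⟨D, hD⟩ := h.exists_d_bdd
  have hD0 : 0 ≤ D := (norm_nonneg _).trans (hD 0)
  set φ : ℝ → ℂ := (Icc (-(X + |x| + 1)) (X + |x| + 1)).indicator fun _ => (D : ℂ) with hφ
  have hφi := integrable_bounded_mul_abs_rpow (φ := φ) (D := D) (X := X + |x| + 1)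
    (measurable_const.indicator measurableSet_Icc) (fun u => by
      simp only [hφ, indicator]
      split_ifs
      · rw [norm_real, norm_of_nonneg hD0]
      · simpa using hD0) (fun u hu => by
      rw [hφ, indicator_of_notMem]
      exact fun h2 => not_lt.2 (abs_le.2 h2) hu) hv
  have hfun : sieveConv d v = fun x => ∫ y : ℝ, posPow v y * (d (x - y) : ℂ) := rfl
  rw [hfun]
  refine continuousAt_of_dominated (of_forall fun x' => ?_) (bound := fun y => ‖φ y‖ * |y| ^ v.re) ?_ hφi ?_
  · exact ((measurable_posPow v).mul (h.measurable_d.comp (measurable_const.sub measurable_id))).aestronglyMeasurable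
  · filter_upwards [ball_mem_nhds x zero_lt_one] with x' hx'
    refine of_forall fun y => ?_
    have hxx : |x' - x| < 1 := hx'
    by_cases hy : X + |x| + 1 < |y|
    · rw [h.supp_d, mul_zero, norm_zero]
      · positivity
      · have h1 := abs_sub_abs_le_abs_sub y x'
        rw [abs_sub_comm y x'] at h1
        have h2 := abs_sub_abs_le_abs_sub x' x
        linarith
    · have h1 : φ y = D := by
        rw [hφ, indicator_of_mem]
        exact abs_le.1 (not_lt.1 hy)
      rw [h1, norm_real, norm_of_nonneg hD0, norm_mul, mul_comm]
      refine mul_le_mul (hD _) ?_ (norm_nonneg _) hD0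
      rcases lt_or_ge 0 y with h2 | h2
      · rw [posPow_of_pos h2, norm_ofReal_cpow_of_pos h2, abs_of_pos h2]
      · rw [posPow_of_nonpos h2, norm_zero]; positivity
  · have := (Measure.measurePreserving_sub_left volume x).quasiMeasurePreserving.ae h.ae_cont
    filter_upwards [this] with y hy
    have h1 : ContinuousAt (fun x' : ℝ => d (x' - y)) x :=
      ContinuousAt.comp (f := fun x' : ℝ => x' - y) (x := x) hy (by fun_prop)
    exact continuousAt_const.mul (continuous_ofReal.continuousAt.comp h1)

/-- A version of the kernel bound which decays in the first variable only. -/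
theorem exists_sieveKer_bound_left (h : IsSieveKernel X f d) {δ : ℝ} (hδ : 0 < δ) (hδ1 : δ < 1) (B : ℝ) :
    ∃ C, 0 < C ∧ ∀ z v : ℂ, -1 + δ ≤ z.re → z.re ≤ B → -1 + δ ≤ v.re → v.re ≤ B →
      -1 + δ ≤ z.re + v.re → z.re + v.re ≤ 1 - δ →
      ‖sieveKer d z v‖ ≤ C * (1 + |v.im|) ^ (3 * B + 2) * (1 + |z.im|) ^ (-1 - v.re) := by
  obtain ⟨C, hC, h1⟩ := h.exists_sieveKer_bound hδ hδ1 B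
  refine ⟨C, hC, fun z v a1 a2 a3 a4 a5 a6 => (h1 z v a1 a2 a3 a4 a5 a6).trans ?_⟩
  have hq : 0 ≤ z.re + v.re + 3 / 2 := by linarith
  have hz : 0 < 1 + |z.im| := by positivity
  have hv : 0 < 1 + |v.im| := by positivity
  have hv1 : 1 ≤ 1 + |v.im| := by linarith [abs_nonneg v.im]
  have hw : 0 < 1 + |z.im + v.im| := by positivity
  -- The inequality `1 + |a| ≤ (1 + |a+b|)(1 + |b|)` moves the decay in `z + v` onto `z` at the
  -- price of a power of `v`.
  have h2 : (1 + |z.im|) ^ (z.re + v.re + 3 / 2) ≤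
      (1 + |z.im + v.im|) ^ (z.re + v.re + 3 / 2) * (1 + |v.im|) ^ (z.re + v.re + 3 / 2) := by
    have := one_add_abs_add_rpow_le (z.im + v.im) (-v.im) hq
    rwa [add_neg_cancel_right, abs_neg] at this
  have h3 : (1 + |z.im + v.im|) ^ (-(z.re + v.re) - 3 / 2) ≤
      (1 + |v.im|) ^ (z.re + v.re + 3 / 2) * (1 + |z.im|) ^ (-(z.re + v.re + 3 / 2)) := by
    rw [show -(z.re + v.re) - 3 / 2 = -(z.re + v.re + 3 / 2) by ring, rpow_neg hw.le,
      rpow_neg hz.le, ← div_eq_mul_inv, inv_le_iff_one_le_mul₀ (by positivity), div_mul_eq_mul_div,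
      one_le_div (by positivity)]
    rwa [mul_comm]
  rw [mul_assoc C]
  refine mul_bound_left ?_
  calc _ ≤ (1 + |z.im|) ^ (z.re + 1 / 2) * (1 + |v.im|) ^ (v.re + 1 / 2) *
        ((1 + |v.im|) ^ (z.re + v.re + 3 / 2) * (1 + |z.im|) ^ (-(z.re + v.re + 3 / 2))) :=
        mul_bound_left h3
    _ = ((1 + |v.im|) ^ (v.re + 1 / 2) * (1 + |v.im|) ^ (z.re + v.re + 3 / 2)) *
        ((1 + |z.im|) ^ (z.re + 1 / 2) * (1 + |z.im|) ^ (-(z.re + v.re + 3 / 2))) := by ring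
    _ = (1 + |v.im|) ^ (v.re + 1 / 2 + (z.re + v.re + 3 / 2)) * (1 + |z.im|) ^ (-1 - v.re) := by
        rw [← rpow_add hv, ← rpow_add hz]; congr 2; ring
    _ ≤ _ := mul_bound_right (rpow_bound_exp hv1)

theorem integrable_sieveKer_div (h : IsSieveKernel X f d) {a : ℝ} {v : ℂ} (ha : -1 < a) (ha0 : a ≠ 0)
    (hv : -1 < v.re) (h1 : -1 < a + v.re) (h2 : a + v.re < 1) :
    Integrable fun y : ℝ => sieveKer d (a + y * I) v / (a + y * I) := by
  obtain ⟨δ, hδ, hδ'⟩ := exists_between (show (0 : ℝ) < min (min (1 + a) (1 + v.re))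
    (min (1 + (a + v.re)) (1 - (a + v.re))) by simp; constructor <;> constructor <;> linarith)
  simp only [lt_min_iff] at hδ'
  obtain ⟨⟨b1, b2⟩, b3, b4⟩ := hδ'
  obtain ⟨C, hC, hb⟩ := h.exists_sieveKer_bound_left hδ (by linarith) (max a v.re)
  have := integrable_vertical_div_sub (h := fun z => sieveKer d z v) (c := a) (p := 0) (by simpa using ha0)
    (fun z hz => (h.differentiableAt_sieveKer (F := fun z => z) (G := fun _ => v) differentiableAt_id
      (differentiableAt_const v) (by rwa [hz]) hv (by rwa [hz]) (by rwa [hz])).continuousAt)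
    (η := 1 + v.re) (by linarith) (fun z hz => by
      rw [neg_add']
      exact hb z v (by linarith) (by rw [hz]; exact le_max_left _ _)
        (by linarith) (le_max_right _ _) (by linarith) (by linarith))
  simpa using this

/-- Mellin inversion for the kernel. -/
theorem vline_cpow_mul_sieveKer (h : IsSieveKernel X f d) {a x : ℝ} {v : ℂ} (hx : 0 < x) (ha : 0 < a)
    (hv : v = 0 ∧ a < 1 ∨ -1 < v.re ∧ a + v.re < 0 ∨ 0 < v.re ∧ a + v.re < 1) :
    vline a (fun z => (x : ℂ) ^ (-z) * (sieveKer d z v / z)) = sieveConv d v x := by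
  have hv1 : -1 < v.re := by
    rcases hv with ⟨rfl, -⟩ | ⟨h1, -⟩ | ⟨h1, -⟩
    · simp
    · exact h1
    · linarith
  have hv2 : a + v.re < 1 := by
    rcases hv with ⟨rfl, h1⟩ | ⟨-, h1⟩ | ⟨-, h1⟩
    · simpa using h1
    · linarith
    · exact h1
  have key : ∀ z : ℂ, z.re = a → MellinConvergent (sieveConv d v) z ∧
      mellin (sieveConv d v) z = sieveKer d z v / z := fun z hz => by
    have hre : (z + v).re = a + v.re := by simp [hz]
    rcases hv with ⟨rfl, h1⟩ | ⟨h1, h2⟩ | ⟨h1, h2⟩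
    · exact h.mellin_sieveConv_zero (by linarith) (by linarith)
    · exact h.mellin_sieveConv_of_neg (by linarith) h1 (by linarith)
    · exact h.mellin_sieveConv_of_pos (by linarith) h1 (by linarith)
  exact vline_cpow_mul_mellin hx (key a (by simp)).1 (fun z hz => (key z hz).2)
    (h.integrable_sieveKer_div (by linarith) ha.ne' hv1 (by linarith) hv2) (h.continuousAt_sieveConv hv1 x)

/-- Mellin inversion for `n_x`. -/
theorem vline_cpow_mul_sieveConv (h : IsSieveKernel X f d) {a x l : ℝ} (hl : 0 < l) (ha : 0 < a) :
    vline a (fun z => (l : ℂ) ^ (-z) * (sieveConv d z x / z)) = f (x - l) := by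
  obtain ⟨D, hD⟩ := h.exists_f_bdd
  have hf : Continuous fun u => (f u : ℂ) := continuous_ofReal.comp h.continuous_f
  have hmel : ∀ z : ℂ, z.re = a → mellin (fun y => (f (x - y) : ℂ)) z = sieveConv d z x / z := fun z hz => by
    have hz0 : z ≠ 0 := by rintro rfl; simp at hz; linarith
    rw [h.sieveConv_eq_mul (by linarith), mul_div_cancel_left₀ _ hz0, mellin_eq_integral_posPow]
  have hconv : MellinConvergent (fun y => (f (x - y) : ℂ)) a := by
    rw [mellinConvergent_iff_posPow]
    have h1 := integrable_bounded_mul_abs_rpow (φ := fun y => (f (x - y) : ℂ)) (D := D) (X := X + |x|)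
      (hf.measurable.comp (measurable_const.sub measurable_id)) (fun u => hD _) (fun u hu => by
        rw [h.f_supp, ofReal_zero]
        have := abs_sub_abs_le_abs_sub u x
        rw [abs_sub_comm u x] at this
        linarith) (p := a - 1) (by linarith)
    refine h1.mono' ((measurable_posPow _).mul
      (hf.measurable.comp (measurable_const.sub measurable_id))).aestronglyMeasurable
      (of_forall fun y => ?_)
    rw [norm_mul, mul_comm]
    refine mul_bound_left ?_
    rcases lt_or_ge 0 y with h2 | h2
    · rw [posPow_of_pos h2, norm_ofReal_cpow_of_pos h2, abs_of_pos h2]; simp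
    · rw [posPow_of_nonpos h2, norm_zero]; positivity
  obtain ⟨C, hC, hb⟩ := h.exists_sieveConv_bound zero_lt_one a x
  refine vline_cpow_mul_mellin (g := fun y => (f (x - y) : ℂ)) hl hconv hmel ?_
    (hf.comp (continuous_const.sub continuous_id)).continuousAt
  have := integrable_vertical_div_sub (h := fun z => sieveConv d z x) (c := a) (p := 0)
    (by simpa using ha.ne') (fun z hz => (h.differentiableAt_sieveConv (inl (by linarith))).continuousAt)
    zero_lt_one (fun z hz => hb z (by linarith) hz.le)
  simpa using this

end IsSieveKernel

/-! ### Behaviour of `n_k(v)` for large `k` -/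

/-- An integer `k > X` is at least `⌊X⌋ + 1`, so `k - X` is a fixed proportion of `k`. On the
support of `y ↦ f(k - y)` one then has `y` comparable to `k`, uniformly in `k`. -/
theorem exists_mul_natCast_le_sub {X : ℝ} (hX : 0 < X) : ∃ c : ℝ, 0 < c ∧ c ≤ 1 ∧ ∀ k : ℕ, X < k →
    1 ≤ (k : ℝ) ∧ c * k ≤ k - X := by
  set N : ℝ := (⌊X⌋₊ : ℝ) + 1 with hN
  have hXN : X < N := Nat.lt_floor_add_one X
  have hN0 : 0 < N := by linarith
  refine ⟨1 - X / N, sub_pos.2 ((div_lt_one hN0).2 hXN), by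
    have : 0 ≤ X / N := by positivity
    linarith, fun k hk => ?_⟩
  have h1 : N ≤ k := by
    rw [hN]
    exact_mod_cast (Nat.floor_lt hX.le).2 hk
  refine ⟨by linarith [(cast_nonneg ⌊X⌋₊ : (0 : ℝ) ≤ _)], ?_⟩
  have : X ≤ X / N * k := by
    rw [div_mul_eq_mul_div, le_div_iff₀ hN0]
    exact mul_bound_left h1
  linarith

theorem rpow_le_of_mul_le {c x y p : ℝ} (hc : 0 < c) (hc1 : c ≤ 1) (hx : 0 < x) (hy : c * x ≤ y)
    (hp : -2 ≤ p) (hp0 : p ≤ 0) : y ^ p ≤ c ^ (-2 : ℝ) * x ^ p :=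
  calc y ^ p ≤ (c * x) ^ p := rpow_le_rpow_of_nonpos (by positivity) hy hp0
    _ = c ^ p * x ^ p := mul_rpow hc.le hx.le
    _ ≤ _ := mul_bound_right (rpow_le_rpow_of_exponent_ge hc hc1 hp)

namespace IsSieveKernel

theorem f_shift_eq_zero (h : IsSieveKernel X f d) {x y : ℝ} (hy : y ∉ Icc (x - X) (x + X)) :
    (f (x - y) : ℂ) = 0 := by
  rw [h.f_supp, ofReal_zero]
  by_contra h1
  have := abs_lt.1 (not_le.1 h1)
  exact hy ⟨by linarith, by linarith⟩

theorem norm_integral_mul_f_le (h : IsSieveKernel X f d) {D : ℝ} (hD : ∀ u, ‖(f u : ℂ)‖ ≤ D) {x K : ℝ}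
    {ψ : ℝ → ℂ} (hψ : ∀ y ∈ Icc (x - X) (x + X), ‖ψ y‖ ≤ K) :
    ‖∫ y, ψ y * (f (x - y) : ℂ)‖ ≤ K * D * (2 * X) := by
  rw [← setIntegral_eq_integral_of_forall_compl_eq_zero (s := Icc (x - X) (x + X)) fun y hy => by
    rw [h.f_shift_eq_zero hy, mul_zero]]
  have hX := h.pos
  have h1 := norm_setIntegral_le_of_norm_le_const (μ := volume) (s := Icc (x - X) (x + X))
    (f := fun y => ψ y * (f (x - y) : ℂ)) (C := K * D) (by simp) fun y hy => by
      rw [norm_mul]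
      exact mul_le_mul (hψ y hy) (hD _) (norm_nonneg _) ((norm_nonneg _).trans (hψ y hy))
  rwa [Measure.real, Real.volume_Icc, toReal_ofReal (by linarith), show x + X - (x - X) = 2 * X by ring] at h1

/-- Both sides are entire in `v` when `x > X`, and they agree near `v = 1`. -/
theorem sieveConv_eq_mul_of_lt (h : IsSieveKernel X f d) {x : ℝ} (hx : X < x) (v : ℂ) :
    sieveConv d v x = v * ∫ y : ℝ, posPow (v - 1) y * (f (x - y) : ℂ) := by
  obtain ⟨D, hD⟩ := h.exists_f_bdd
  have hfi : Integrable fun u => (f u : ℂ) := by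
    simpa using (h.integrable_mul_of_continuous (g := fun _ => 1) continuous_const).1
  have d1 : Differentiable ℂ fun v => sieveConv d v x := fun v => h.differentiableAt_sieveConv (inr hx)
  have d2 : Differentiable ℂ fun v => v * mellin (fun y => (f (x - y) : ℂ)) v := fun v =>
    differentiableAt_id.mul (differentiableAt_mellin_shift (φ := fun u => (f u : ℂ)) hfi hD
      (fun u hu => by rw [h.f_supp hu.le, ofReal_zero]) (inr hx))
  have he : ∀ᶠ v : ℂ in 𝓝 1, sieveConv d v x = v * mellin (fun y => (f (x - y) : ℂ)) v := by
    have ho : IsOpen {z : ℂ | 0 < z.re} := isOpen_lt continuous_const continuous_re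
    filter_upwards [ho.mem_nhds (show (1 : ℂ) ∈ {z : ℂ | 0 < z.re} by norm_num)] with v hv
    rw [mellin_eq_integral_posPow]
    exact h.sieveConv_eq_mul hv x
  have := congrFun (AnalyticOnNhd.eq_of_eventuallyEq (fun z _ => d1.analyticAt z) (fun z _ => d2.analyticAt z) he) v
  rwa [mellin_eq_integral_posPow] at this

/-- Interpolation between two bounds. The trivial one through `f` is of size `|v| x^{Re v - 1}`;
bounded variation adds the factor `(x/(1+|Im v|))²`. The smaller of 1 and the square of a positive
number is at most its power `θ`, for `0 ≤ θ ≤ 2`. -/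
theorem exists_sieveConv_large_bound (h : IsSieveKernel X f d) {c θ : ℝ} (hc : 0 < c) (hc1 : c ≤ 1)
    (hθ : 0 ≤ θ) (hθ2 : θ ≤ 2) : ∃ C, 0 < C ∧ ∀ (x : ℝ) (v : ℂ), 1 ≤ x → X < x → c * x ≤ x - X →
      -1 ≤ v.re → v.re ≤ 1 →
      ‖sieveConv d v x‖ ≤ C * ‖v‖ * x ^ (v.re - 1 + θ) * (1 + |v.im|) ^ (-θ) := by
  obtain ⟨D, hD⟩ := h.exists_f_bdd
  obtain ⟨V, hV, hbv⟩ := h.bv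
  have hD0 : 0 ≤ D := (norm_nonneg _).trans (hD 0)
  have hX := h.pos
  have hcp : 0 < c ^ (-2 : ℝ) := by positivity
  set C₁ := c ^ (-2 : ℝ) * D * (2 * X) with hC₁
  refine ⟨4 * C₁ + 64 * V + 1, by positivity, fun x v hx hXx hcx hv1 hv2 => ?_⟩
  have hx0 : 0 < x := by linarith
  set A := 1 + |v.im| with hA
  have hA0 : 0 < A := by positivity
  have hpos : ∀ y ∈ Icc (x - X) (x + X), 0 < y := fun y hy => lt_of_lt_of_le (by linarith) hy.1
  have hb1 : ‖sieveConv d v x‖ ≤ C₁ * (‖v‖ * x ^ (v.re - 1)) := by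
    rw [h.sieveConv_eq_mul_of_lt hXx, norm_mul]
    have := h.norm_integral_mul_f_le hD (x := x) (ψ := posPow (v - 1)) (K := c ^ (-2 : ℝ) * x ^ (v.re - 1))
      fun y hy => by
        rw [posPow_of_pos (hpos y hy), norm_ofReal_cpow_of_pos (hpos y hy), sub_re, one_re]
        exact rpow_le_of_mul_le hc hc1 hx0 (hcx.trans hy.1) (by linarith) (by linarith)
    refine (mul_le_mul_of_nonneg_left this (norm_nonneg v)).trans_eq ?_
    rw [hC₁]; ring
  have hxp : 0 < x ^ (v.re - 1) := by positivity
  have hb2 : ‖sieveConv d v x‖ ≤ (4 * C₁ + 64 * V) * (‖v‖ * x ^ (v.re - 1)) * (x / A) ^ 2 := by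
    rcases le_or_gt |v.im| 1 with hi | hi
    · have h1 : 1 ≤ 4 * (x / A) ^ 2 := by
        have : 1 / 2 ≤ x / A := by rw [le_div_iff₀ hA0, hA]; linarith
        nlinarith
      have h2 : 0 ≤ C₁ * (‖v‖ * x ^ (v.re - 1)) := by positivity
      have h3 : 0 ≤ 64 * V * (‖v‖ * x ^ (v.re - 1)) * (x / A) ^ 2 := by positivity
      nlinarith
    · have hw : v + 1 ≠ 0 := fun h0 => by
        have := congrArg im h0
        simp at this; rw [this] at hi; norm_num at hi
      have hw0 : 0 < ‖v + 1‖ := norm_pos_iff.2 hw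
      have e : sieveConv d v x = ∫ u, (d u : ℂ) * posPow v (x - u) := by
        rw [sieveConv, ← integral_sub_left_eq_self (fun u => (d u : ℂ) * posPow v (x - u)) volume x]
        simp_rw [sub_sub_cancel, mul_comm]
      have hcont : ContinuousOn (fun u => posPow v (x - u)) (Icc (-X) X) := by
        refine ContinuousOn.congr (f := fun u : ℝ => ((x - u : ℝ) : ℂ) ^ v) ?_ fun u hu =>
          posPow_of_pos (by linarith [hu.2]) v
        exact (continuousOn_ofReal_cpow v).comp (by fun_prop) fun u hu => by simp only [mem_Ioi]; linarith [hu.2]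
      have hend : ∀ t, -X ≤ t → t ≤ X → ‖((x - t : ℝ) : ℂ) ^ (v + 1)‖ ≤ 4 * x ^ (v.re + 1) := fun t ht1 ht2 => by
        have h0 : 0 < x - t := by linarith
        rw [norm_ofReal_cpow_of_pos h0]
        calc (x - t) ^ (v + 1).re ≤ (2 * x) ^ (v.re + 1) := by
              rw [add_re, one_re]
              exact rpow_bound (by linarith)
          _ = 2 ^ (v.re + 1) * x ^ (v.re + 1) := mul_rpow (by norm_num) hx0.le
          _ ≤ 2 ^ (2 : ℝ) * x ^ (v.re + 1) := mul_bound_right (rpow_bound_exp (by norm_num))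
          _ = _ := by norm_num
      have h1 := hbv (fun u => posPow v (x - u)) (8 * x ^ (v.re + 1) / ‖v + 1‖)
        (hcont.integrableOn_compact isCompact_Icc) (fun a b ha hab hb => by
          rw [intervalIntegral.integral_comp_sub_left (posPow v) x]
          have e2 : ∫ u in (x - b)..(x - a), posPow v u = ∫ u in (x - b)..(x - a), (u : ℂ) ^ v := by
            refine intervalIntegral.integral_congr fun u hu => ?_
            rw [uIcc_of_le (by linarith)] at hu
            exact posPow_of_pos (by linarith [hu.1]) v
          rw [e2, integral_cpow (inr ⟨fun h0 => hw (by rw [h0]; ring), fun h0 => by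
            rw [uIcc_of_le (by linarith)] at h0; linarith [h0.1]⟩), norm_div]
          refine div_le_div_of_nonneg_right ((norm_sub_le _ _).trans ?_) hw0.le
          have := hend a ha (by linarith)
          have := hend b (by linarith) hb
          linarith)
      rw [← e] at h1
      have hi1 := abs_im_le_norm v
      have hi2 := abs_im_le_norm (v + 1)
      simp only [add_im, one_im, add_zero] at hi2
      have h2 : A ^ 2 ≤ 4 * (‖v‖ * ‖v + 1‖) := by
        have h5 : A ≤ 2 * ‖v‖ := by linarith
        have h6 : A ≤ 2 * ‖v + 1‖ := by linarith
        nlinarith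
      have h3 : x ^ (v.re + 1) = x ^ (v.re - 1) * x ^ 2 := by
        rw [← rpow_natCast x 2, ← rpow_add hx0]; congr 1; push_cast; ring
      refine h1.trans ?_
      have h4 : 8 * x ^ (v.re + 1) / ‖v + 1‖ ≤ 32 * (‖v‖ * x ^ (v.re - 1)) * (x / A) ^ 2 := by
        rw [div_pow, ← mul_div_assoc, div_le_div_iff₀ hw0 (by positivity), h3]
        have : 0 ≤ x ^ (v.re - 1) * x ^ 2 := by positivity
        nlinarith
      have h5 := mul_le_mul_of_nonneg_left h4 hV
      have h6 : 0 ≤ (4 * C₁ + 32 * V) * (‖v‖ * x ^ (v.re - 1)) * (x / A) ^ 2 := by positivity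
      linarith
  have hr : 0 < x / A := by positivity
  have e3 : C₁ * (‖v‖ * x ^ (v.re - 1)) ≤ (4 * C₁ + 64 * V) * (‖v‖ * x ^ (v.re - 1)) := by
    refine mul_bound_right ?_
    have : 0 ≤ C₁ := by positivity
    linarith
  have hfin : ‖sieveConv d v x‖ ≤ (4 * C₁ + 64 * V) * (‖v‖ * x ^ (v.re - 1)) * (x / A) ^ θ := by
    rcases le_total (x / A) 1 with h1 | h1
    · refine hb2.trans (mul_bound_left ?_)
      rw [← rpow_natCast]
      exact rpow_le_rpow_of_exponent_ge hr h1 (by exact_mod_cast hθ2)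
    · exact (hb1.trans e3).trans (le_mul_of_one_le_right (by positivity) (one_le_rpow h1 hθ))
  rw [div_rpow hx0.le hA0.le, div_eq_mul_inv, ← rpow_neg hA0.le] at hfin
  rw [rpow_add hx0]
  refine hfin.trans ?_
  have : 0 ≤ 1 * (‖v‖ * x ^ (v.re - 1)) * (x ^ θ * A ^ (-θ)) := by positivity
  linarith

/-- On the support of `f(x - y)` the power `y^{-s}` differs from `x^{-s}` by `O(|s| x^{-Re s - 1})`,
by the mean value theorem. -/
theorem exists_sieveConv_main_term (h : IsSieveKernel X f d) {c : ℝ} (hc : 0 < c) (hc1 : c ≤ 1) :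
    ∃ C, 0 < C ∧ ∀ (x : ℝ) (s : ℂ), 1 ≤ x → X < x → c * x ≤ x - X → 0 ≤ s.re → s.re ≤ 1 →
      ‖sieveConv d (1 - s) x - (1 - s) * ((x : ℂ) ^ (-s) * ((∫ u, f u : ℝ) : ℂ))‖ ≤
        C * ‖1 - s‖ * ‖s‖ * x ^ (-s.re - 1) := by
  obtain ⟨D, hD⟩ := h.exists_f_bdd
  have hD0 : 0 ≤ D := (norm_nonneg _).trans (hD 0)
  have hX := h.pos
  refine ⟨c ^ (-2 : ℝ) * X * D * (2 * X) + 1, by positivity, fun x s hx hXx hcx hs hs1 => ?_⟩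
  have hx0 : 0 < x := by linarith
  have hpos : ∀ y ∈ Icc (x - X) (x + X), 0 < y := fun y hy => lt_of_lt_of_le (by linarith) hy.1
  have hf : Continuous fun y => (f (x - y) : ℂ) :=
    continuous_ofReal.comp (h.continuous_f.comp (continuous_const.sub continuous_id))
  have hfi : Integrable fun y => (f (x - y) : ℂ) := by
    have := (h.integrable_mul_of_continuous (g := fun _ => 1) continuous_const).1
    simp only [mul_one] at this
    exact this.comp_sub_left x
  have hcont : ContinuousOn (fun y => posPow (1 - s - 1) y * (f (x - y) : ℂ)) (Icc (x - X) (x + X)) :=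
    (ContinuousOn.congr ((continuousOn_ofReal_cpow (1 - s - 1)).mono hpos) fun y hy =>
      posPow_of_pos (hpos y hy) _).mul hf.continuousOn
  have hi1 : Integrable fun y => posPow (1 - s - 1) y * (f (x - y) : ℂ) := by
    rw [← integrableOn_univ]
    exact (hcont.integrableOn_compact isCompact_Icc).of_forall_sdiff_eq_zero MeasurableSet.univ
      fun y hy => by rw [h.f_shift_eq_zero hy.2, mul_zero]
  have e : sieveConv d (1 - s) x - (1 - s) * ((x : ℂ) ^ (-s) * ((∫ u, f u : ℝ) : ℂ)) =
      (1 - s) * ∫ y : ℝ, (posPow (1 - s - 1) y - (x : ℂ) ^ (-s)) * (f (x - y) : ℂ) := by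
    simp_rw [sub_mul (posPow _ _)]
    rw [integral_sub hi1 (hfi.const_mul _), integral_const_mul,
      integral_sub_left_eq_self (fun u => (f u : ℂ)) volume x, integral_complex_ofReal,
      h.sieveConv_eq_mul_of_lt hXx]
    ring
  rw [e, norm_mul]
  have hK := h.norm_integral_mul_f_le hD (x := x) (ψ := fun y => posPow (1 - s - 1) y - (x : ℂ) ^ (-s))
    (K := ‖s‖ * (c ^ (-2 : ℝ) * x ^ (-s.re - 1)) * X) fun y hy => by
      rw [posPow_of_pos (hpos y hy), show 1 - s - 1 = -s by ring]
      have h1 := Convex.norm_image_sub_le_of_norm_hasDerivWithin_le (f := fun y : ℝ => (1 : ℂ) * (y : ℂ) ^ (-s))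
        (f' := fun y : ℝ => 1 * (-s) * (y : ℂ) ^ (-s - 1)) (s := Icc (x - X) (x + X))
        (C := ‖s‖ * (c ^ (-2 : ℝ) * x ^ (-s.re - 1)))
        (fun t ht => (hasDerivAt_ofReal_cpow_mul (hpos t ht) 1 (-s)).hasDerivWithinAt)
        (fun t ht => by
          rw [one_mul, norm_mul, norm_neg, norm_ofReal_cpow_of_pos (hpos t ht)]
          refine mul_le_mul_of_nonneg_left ?_ (norm_nonneg s)
          simp only [sub_re, neg_re, one_re]
          exact rpow_le_of_mul_le hc hc1 hx0 (hcx.trans ht.1) (by linarith) (by linarith))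
        (convex_Icc _ _) (x := x) (y := y) ⟨by linarith, by linarith⟩ hy
      simp only [one_mul] at h1
      refine h1.trans (mul_bound_left ?_)
      rw [norm_eq_abs, abs_le]
      constructor <;> linarith [hy.1, hy.2]
  refine (mul_bound_left hK).trans ?_
  have : 0 ≤ ‖1 - s‖ * ‖s‖ * x ^ (-s.re - 1) := by positivity
  nlinarith

theorem integral_f (h : IsSieveKernel X f d) : ∫ u, f u = 2 * ∫ u in Ioi (0 : ℝ), f u := by
  have := integral_comp_abs (f := f)
  rw [← this]
  refine integral_congr_ae (of_forall fun u => ?_)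
  rcases abs_choice u with h1 | h1 <;> simp only [h1, h.even]

end IsSieveKernel

/-! ### Local uniform convergence of the series over zeros -/

theorem rpow_one_add_abs_sub_le {γ t T p : ℝ} (hp : 0 ≤ p) (ht : |t| ≤ T) :
    (1 + |γ - t|) ^ (-p) ≤ (1 + T) ^ p * (1 + |γ|) ^ (-p) := by
  have h1 := one_add_abs_add_rpow_le (γ - t) t hp
  rw [sub_add_cancel] at h1
  have hT : 0 ≤ T := (abs_nonneg t).trans ht
  rw [rpow_neg (by positivity), rpow_neg (by positivity), ← div_eq_mul_inv,
    inv_le_iff_one_le_mul₀ (by positivity), div_mul_eq_mul_div, one_le_div (by positivity), mul_comm]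
  exact h1.trans (mul_bound_left (rpow_le_rpow (by positivity) (by linarith) hp))

/-- In the second family the inner sum runs over zeros near height `-Im ρ` and is `O((1+|Im
ρ|)^{η/2})`, which the remaining decay in `ρ` absorbs. -/
theorem RiemannHypothesis.summable_zeros_prod (hRH : RiemannHypothesis) {η : ℝ} (hη : 0 < η) :
    Summable fun p : zetaZeros × zetaZeros => zetaOrder p.1 * zetaOrder p.2 *
      ((1 + |(p.1 : ℂ).im|) ^ (-1 - η) * (1 + |(p.2 : ℂ).im|) ^ (-1 - η) +
        (1 + |(p.1 : ℂ).im|) ^ (-1 - η) * (1 + |(p.1 : ℂ).im + (p.2 : ℂ).im|) ^ (-1 - η)) := by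
  obtain ⟨C, hC, hb⟩ := hRH.exists_tsum_bound (half_pos hη) hη
  have h0 := hRH.summable_zeros (half_pos hη) 0
  have hs : ∀ t, Summable fun ρ : zetaZeros => zetaOrder ρ * (1 + |t + ρ.1.im|) ^ (-1 - η) := fun t => by
    have := (hb (-t)).1
    simpa only [sub_neg_eq_add, add_comm _ t] using this
  have hz : Summable fun ρ : zetaZeros => zetaOrder ρ * (1 + |ρ.1.im|) ^ (-1 - η) := by simpa using hs 0
  have hnn := zetaOrder_nonneg
  simp_rw [mul_add]
  refine Summable.add ?_ ?_
  · refine (hz.mul_of_nonneg hz (fun ρ => mul_nonneg (hnn _) (by positivity))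
      (fun ρ => mul_nonneg (hnn _) (by positivity))).congr fun p => ?_
    ring
  · rw [summable_prod_of_nonneg fun p => mul_nonneg (mul_nonneg (hnn _) (hnn _)) (by positivity)]
    constructor
    · intro ρ
      exact ((hs ρ.1.im).mul_left (zetaOrder ρ * (1 + |ρ.1.im|) ^ (-1 - η))).congr fun ρ' => by ring
    · refine Summable.of_nonneg_of_le (fun ρ => tsum_nonneg fun ρ' =>
        mul_nonneg (mul_nonneg (hnn _) (hnn _)) (by positivity)) (fun ρ => ?_) (h0.mul_left C)
      have e : ∀ ρ' : zetaZeros, zetaOrder ρ * zetaOrder ρ' * ((1 + |ρ.1.im|) ^ (-1 - η) *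
          (1 + |ρ.1.im + (ρ' : ℂ).im|) ^ (-1 - η)) = zetaOrder ρ * (1 + |ρ.1.im|) ^ (-1 - η) *
          (zetaOrder ρ' * (1 + |(ρ' : ℂ).im - -ρ.1.im|) ^ (-1 - η)) := fun ρ' => by
        rw [sub_neg_eq_add, add_comm ρ.1.im]; ring
      simp only [e]
      rw [tsum_mul_left]
      have h1 := mul_le_mul_of_nonneg_left (hb (-ρ.1.im)).2
        (mul_nonneg (hnn ρ) (by positivity : 0 ≤ (1 + |ρ.1.im|) ^ (-1 - η)))
      refine h1.trans_eq ?_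
      rw [abs_neg, sub_zero, show -1 - η / 2 = (-1 - η) + η / 2 by ring, rpow_add (by positivity)]
      ring

namespace IsSieveKernel

theorem singleTerm_eq (d : ℝ → ℝ) {s : ℂ} {ρ : zetaZeros} (h : ρ.1 - s ≠ 0) :
    singleTerm (sieveMellin d) s ρ = (zetaOrder ρ : ℂ) * (sieveKer d (ρ - s) 0 / (ρ - s)) := by
  rw [singleTerm, zetaMult_eq, sieveKer, Gamma_add_one _ h, zero_add, Gamma_one, add_zero, sub_zero]
  field_simp

theorem doubleTerm_eq (d : ℝ → ℝ) {s : ℂ} {p : zetaZeros × zetaZeros} (h1 : (p.1 : ℂ) - s ≠ 0)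
    (h2 : (p.2 : ℂ) - s ≠ 0) :
    doubleTerm (sieveMellin d) s p = (zetaOrder p.2 : ℂ) * (((zetaOrder p.1 : ℂ) *
      (sieveKer d (p.1 - s) (p.2 - s) / (p.1 - s))) / (p.2 - s)) := by
  rw [doubleTerm, zetaMult_eq, zetaMult_eq, sieveKer, Gamma_add_one _ h1,
    Gamma_add_one _ h2, show (p.1 : ℂ) - s + (p.2 - s) = p.1 + p.2 - 2 * s by ring,
    show (p.1 : ℂ) - s - (p.2 - s) = p.1 - p.2 by ring]
  field_simp

/-- After the factors `1/(ρ-s)` the kernel bound has exponents about `σ`, `σ` and `5/2 - 2σ`. The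
condition `σ > 1/2` makes the first two exceed 1 in total, and all three sum to about `5/2 > 2`, so
`one_add_abs_kernel_le` applies. -/
theorem local_series (hRH : RiemannHypothesis) (h : IsSieveKernel X f d) {s₀ : ℂ} (h1 : 1 / 2 < s₀.re)
    (h2 : s₀.re < 1) : ∃ r > 0, (∀ s ∈ ball s₀ r,
      Summable (singleTerm (sieveMellin d) s) ∧ Summable (doubleTerm (sieveMellin d) s)) ∧
      DifferentiableOn ℂ (fun s => ∑' ρ, singleTerm (sieveMellin d) s ρ) (ball s₀ r) ∧
      DifferentiableOn ℂ (fun s => ∑' p, doubleTerm (sieveMellin d) s p) (ball s₀ r) := by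
  -- The factor 4 leaves room both for the variation of `s` in the ball and for taking `r` itself as
  -- the excess `η` in the kernel estimate.
  obtain ⟨r, hr0, hr1, hr2⟩ : ∃ r > 0, 4 * r ≤ s₀.re - 1 / 2 ∧ 4 * r ≤ 1 - s₀.re := by
    have := mul_pos (sub_pos.2 h1) (sub_pos.2 h2)
    exact ⟨(s₀.re - 1 / 2) * (1 - s₀.re) / 4, by linarith, by nlinarith, by nlinarith⟩
  set T := |s₀.im| + r with hT
  have hT0 : 0 ≤ T := by positivity
  have hball : ∀ s ∈ ball s₀ r, s₀.re - r ≤ s.re ∧ s.re ≤ s₀.re + r ∧ |s.im| ≤ T := fun s hs =>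
    have h := re_im_norm_of_mem_ball hs
    ⟨h.1.1.le, h.1.2.le, h.2.1⟩
  have hre := fun (ρ : zetaZeros) s => hRH.re_sub s ρ
  have hne : ∀ (ρ : zetaZeros), ∀ s ∈ ball s₀ r, ρ.1 - s ≠ 0 := fun ρ s hs h0 => by
    have := hre ρ s
    rw [h0, zero_re] at this
    linarith [(hball s hs).1]
  have hinv : ∀ (ρ : zetaZeros), ∀ s ∈ ball s₀ r,
      1 / ‖ρ.1 - s‖ ≤ 2 / r * (1 + |ρ.1.im - s.im|)⁻¹ := fun ρ s hs => by
    have := norm_le_of_one_add_abs (c := 1 / 2 - s.re) (κ := r) (by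
      rw [abs_of_neg (by linarith [(hball s hs).1])]; linarith [(hball s hs).1]) (hre ρ s)
    simpa using this
  have hnn := zetaOrder_nonneg
  have hdiff1 : ∀ ρ : zetaZeros, DifferentiableOn ℂ (fun s => singleTerm (sieveMellin d) s ρ)
      (ball s₀ r) := fun ρ => by
    refine DifferentiableOn.congr (f := fun s => (zetaOrder ρ : ℂ) * (sieveKer d (ρ - s) 0 / (ρ - s)))
      (fun s hs => DifferentiableAt.differentiableWithinAt ?_) fun s hs => singleTerm_eq d (hne ρ s hs)
    obtain ⟨b1, b2, -⟩ := hball s hs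
    have hk := h.differentiableAt_sieveKer (F := fun s => ρ.1 - s) (G := fun _ => 0) (s := s)
      (by fun_prop) (by fun_prop) (by rw [hre]; linarith) (by simp)
      (by rw [hre, zero_re]; linarith) (by rw [hre, zero_re]; linarith)
    exact (hk.fun_div (by fun_prop) (hne ρ s hs)).const_mul _
  have hdiff2 : ∀ p : zetaZeros × zetaZeros, DifferentiableOn ℂ (fun s => doubleTerm (sieveMellin d) s p)
      (ball s₀ r) := fun p => by
    refine DifferentiableOn.congr (f := fun s => (zetaOrder p.2 : ℂ) * (((zetaOrder p.1 : ℂ) *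
      (sieveKer d (p.1 - s) (p.2 - s) / (p.1 - s))) / (p.2 - s)))
      (fun s hs => DifferentiableAt.differentiableWithinAt ?_)
      fun s hs => doubleTerm_eq d (hne p.1 s hs) (hne p.2 s hs)
    obtain ⟨b1, b2, -⟩ := hball s hs
    have hk := h.differentiableAt_sieveKer (F := fun s => (p.1 : ℂ) - s) (G := fun s => (p.2 : ℂ) - s)
      (s := s) (by fun_prop) (by fun_prop) (by rw [hre]; linarith) (by rw [hre]; linarith)
      (by rw [hre, hre]; linarith) (by rw [hre, hre]; linarith)
    exact (((hk.fun_div (by fun_prop) (hne p.1 s hs)).const_mul _).fun_div (by fun_prop) (hne p.2 s hs)).const_mul _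
  obtain ⟨C₁, hC₁, hb1⟩ := h.exists_sieveKer_bound_left (δ := 1 / 4) (by norm_num) (by norm_num) 1
  obtain ⟨C₂, hC₂, hb2⟩ := h.exists_sieveKer_bound (δ := r) hr0 (by linarith) 1
  have hu1 : Summable fun ρ : zetaZeros => C₁ * (2 / r) * (1 + T) ^ (2 : ℝ) *
      (zetaOrder ρ * (1 + |ρ.1.im|) ^ (-1 - 1 : ℝ)) := by
    have := hRH.summable_zeros zero_lt_one 0
    simp only [sub_zero] at this
    exact this.mul_left _
  have hle1 : ∀ (ρ : zetaZeros), ∀ s ∈ ball s₀ r, ‖singleTerm (sieveMellin d) s ρ‖ ≤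
      C₁ * (2 / r) * (1 + T) ^ (2 : ℝ) * (zetaOrder ρ * (1 + |ρ.1.im|) ^ (-1 - 1 : ℝ)) := fun ρ s hs => by
    obtain ⟨c1, c2, c3⟩ := hball s hs
    rw [singleTerm_eq d (hne ρ s hs), norm_mul, norm_real, norm_of_nonneg (hnn _), norm_div, div_eq_mul_one_div]
    have e1 := hb1 (ρ - s) 0 (by rw [hre]; linarith) (by rw [hre]; linarith) (by norm_num) (by norm_num)
      (by rw [hre, zero_re]; linarith) (by rw [hre, zero_re]; linarith)
    simp only [Complex.zero_im, abs_zero, add_zero, Real.one_rpow, mul_one, zero_re, sub_zero, sub_im] at e1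
    have e2 := hinv ρ s hs
    have e3 := rpow_one_add_abs_sub_le (γ := ρ.1.im) (p := 2) (by norm_num) c3
    set A := 1 + |ρ.1.im - s.im|
    have hA : 0 < A := by positivity
    calc zetaOrder ρ * (‖sieveKer d (ρ - s) 0‖ * (1 / ‖ρ.1 - s‖)) ≤
          zetaOrder ρ * ((C₁ * A ^ (-1 : ℝ)) * (2 / r * A⁻¹)) := mul_le_mul_of_nonneg_left
          (mul_bound e1 e2) (hnn _)
      _ = zetaOrder ρ * (C₁ * (2 / r)) * A ^ (-2 : ℝ) := by
          rw [← rpow_neg_one A, show (-2 : ℝ) = -1 + -1 by norm_num, rpow_add hA]; ring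
      _ ≤ zetaOrder ρ * (C₁ * (2 / r)) * ((1 + T) ^ (2 : ℝ) * (1 + |ρ.1.im|) ^ (-2 : ℝ)) :=
          mul_le_mul_of_nonneg_left e3 (mul_nonneg (hnn _) (by positivity))
      _ = _ := by rw [show (-1 - 1 : ℝ) = -2 by norm_num]; ring
  set σ₁ := s₀.re - r with hσ₁
  set q := 5 / 2 - 2 * (s₀.re + r) with hq
  set K := C₂ * (2 / r) ^ 2 * ((1 + T) ^ σ₁ * (1 + T) ^ σ₁ * (1 + 2 * T) ^ q * (2 ^ q + 2 ^ σ₁)) with hK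
  have hu2 := (hRH.summable_zeros_prod hr0).mul_left K
  have hle2 : ∀ (p : zetaZeros × zetaZeros), ∀ s ∈ ball s₀ r,
      ‖doubleTerm (sieveMellin d) s p‖ ≤ K * (zetaOrder p.1 * zetaOrder p.2 *
      ((1 + |(p.1 : ℂ).im|) ^ (-1 - r) * (1 + |(p.2 : ℂ).im|) ^ (-1 - r) +
        (1 + |(p.1 : ℂ).im|) ^ (-1 - r) * (1 + |(p.1 : ℂ).im + (p.2 : ℂ).im|) ^ (-1 - r))) := fun p s hs => by
    obtain ⟨c1, c2, c3⟩ := hball s hs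
    have hq0 : 0 < q := by linarith
    rw [doubleTerm_eq d (hne p.1 s hs) (hne p.2 s hs), norm_mul, norm_div, norm_mul, norm_div,
      norm_real, norm_real, norm_of_nonneg (hnn _), norm_of_nonneg (hnn _),
      div_eq_mul_one_div, div_eq_mul_one_div (‖sieveKer d _ _‖)]
    have e1 := hb2 (p.1 - s) (p.2 - s) (by rw [hre]; linarith) (by rw [hre]; linarith)
      (by rw [hre]; linarith) (by rw [hre]; linarith) (by rw [hre, hre]; linarith) (by rw [hre, hre]; linarith)
    rw [hre, hre] at e1
    simp only [sub_im] at e1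
    have e2 := hinv p.1 s hs
    have e3 := hinv p.2 s hs
    have f3 := rpow_one_add_abs_sub_le (γ := (p.1 : ℂ).im + (p.2 : ℂ).im) (t := 2 * s.im) (T := 2 * T) hq0.le
      (by rw [abs_mul, abs_two]; linarith)
    rw [show (p.1 : ℂ).im + (p.2 : ℂ).im - 2 * s.im = (p.1 : ℂ).im - s.im + ((p.2 : ℂ).im - s.im) by ring] at f3
    have hker := one_add_abs_kernel_le (p := σ₁) (p' := σ₁) (q := q) (η := r) (p.1 : ℂ).im (p.2 : ℂ).im
    have hP : ∀ γ : ℝ, (1 + |γ - s.im|) ^ (1 / 2 - s.re + 1 / 2) * (1 + |γ - s.im|)⁻¹ ≤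
        (1 + T) ^ σ₁ * (1 + |γ|) ^ (-σ₁) := fun γ => by
      refine le_trans ?_ (rpow_one_add_abs_sub_le (γ := γ) (by linarith) c3)
      rw [← rpow_neg_one, ← rpow_add (by positivity)]
      exact rpow_bound_exp (by simp)
    have hP1 := hP (p.1 : ℂ).im
    have hP2 := hP (p.2 : ℂ).im
    set A := 1 + |(p.1 : ℂ).im - s.im|
    set B := 1 + |(p.2 : ℂ).im - s.im|
    set D := 1 + |(p.1 : ℂ).im - s.im + ((p.2 : ℂ).im - s.im)| with hD
    have hpowD : D ^ (-(1 / 2 - s.re + (1 / 2 - s.re)) - 3 / 2) ≤ D ^ (-q) :=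
      rpow_le_rpow_of_exponent_le (by simp [hD]) (by rw [hq]; linarith)
    have hm := mul_nonneg (hnn (p.1 : ℂ)) (hnn (p.2 : ℂ))
    calc _ ≤ zetaOrder p.2 * (zetaOrder p.1 * (C₂ * (A ^ (1 / 2 - s.re + 1 / 2) *
          B ^ (1 / 2 - s.re + 1 / 2) * D ^ (-(1 / 2 - s.re + (1 / 2 - s.re)) - 3 / 2)) *
          (2 / r * A⁻¹)) * (2 / r * B⁻¹)) := by
          refine mul_le_mul_of_nonneg_left (mul_le_mul (mul_le_mul_of_nonneg_left
            (mul_bound e1 e2) (hnn _)) e3 (by positivity) ?_) (hnn _)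
          exact mul_nonneg (hnn _) (by positivity)
      _ = (zetaOrder p.1 * zetaOrder p.2) * (C₂ * (2 / r) ^ 2) * (A ^ (1 / 2 - s.re + 1 / 2) * A⁻¹ *
          (B ^ (1 / 2 - s.re + 1 / 2) * B⁻¹) * D ^ (-(1 / 2 - s.re + (1 / 2 - s.re)) - 3 / 2)) := by ring
      _ ≤ (zetaOrder p.1 * zetaOrder p.2) * (C₂ * (2 / r) ^ 2) *
          (((1 + T) ^ σ₁ * (1 + |(p.1 : ℂ).im|) ^ (-σ₁)) * ((1 + T) ^ σ₁ * (1 + |(p.2 : ℂ).im|) ^ (-σ₁)) *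
          ((1 + 2 * T) ^ q * (1 + |(p.1 : ℂ).im + (p.2 : ℂ).im|) ^ (-q))) :=
          mul_le_mul_of_nonneg_left (mul_bound (mul_bound hP1 hP2) (hpowD.trans f3)) (mul_nonneg hm (by positivity))
      _ = (zetaOrder p.1 * zetaOrder p.2) * (C₂ * (2 / r) ^ 2) * ((1 + T) ^ σ₁ * (1 + T) ^ σ₁ *
          (1 + 2 * T) ^ q) * ((1 + |(p.1 : ℂ).im|) ^ (-σ₁) * (1 + |(p.2 : ℂ).im|) ^ (-σ₁) *
          (1 + |(p.1 : ℂ).im + (p.2 : ℂ).im|) ^ (-q)) := by ring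
      _ ≤ _ := mul_le_mul_of_nonneg_left hker (mul_nonneg (mul_nonneg hm (by positivity)) (by positivity))
      _ = _ := by rw [hK]; ring
  exact ⟨r, hr0, fun s hs => ⟨Summable.of_norm_bounded hu1 fun ρ => hle1 ρ s hs,
    Summable.of_norm_bounded hu2 fun p => hle2 p s hs⟩,
    differentiableOn_tsum_of_summable_norm hu1 hdiff1 isOpen_ball hle1,
    differentiableOn_tsum_of_summable_norm hu2 hdiff2 isOpen_ball hle2⟩

end IsSieveKernel

/-! ### Dirichlet series and double integrals on vertical lines -/

/-- The terms `Λ(k) k^{-s}`. -/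
noncomputable def vmTerm (s : ℂ) (k : ℕ) : ℂ := (ArithmeticFunction.vonMangoldt k : ℂ) * (k : ℂ) ^ (-s)

theorem vmTerm_zero (s : ℂ) : vmTerm s 0 = 0 := by simp [vmTerm]

theorem norm_vmTerm (s : ℂ) (k : ℕ) :
    ‖vmTerm s k‖ = ArithmeticFunction.vonMangoldt k * (k : ℝ) ^ (-s.re) := by
  rcases Nat.eq_zero_or_pos k with rfl | hk
  · simp [vmTerm]
  · rw [vmTerm, norm_mul, norm_real, norm_of_nonneg ArithmeticFunction.vonMangoldt_nonneg,
      norm_natCast_cpow_of_pos hk, neg_re]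

theorem vmTerm_mul_cpow (s z : ℂ) (k : ℕ) : vmTerm s k * (k : ℂ) ^ (-z) = vmTerm (z + s) k := by
  rcases Nat.eq_zero_or_pos k with rfl | hk
  · simp [vmTerm]
  · rw [vmTerm, vmTerm, mul_assoc, ← cpow_add _ _ (by exact_mod_cast hk.ne')]
    congr 2; ring

theorem hasSum_vmTerm {w : ℂ} (hw : 1 < w.re) :
    Summable (fun k => ‖vmTerm w k‖) ∧ HasSum (vmTerm w) (-zetaLD w) := by
  have e : vmTerm w = LSeries.term (fun n => (ArithmeticFunction.vonMangoldt n : ℂ)) w := by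
    funext k
    rcases Nat.eq_zero_or_pos k with rfl | hk
    · simp [vmTerm]
    · rw [LSeries.term_of_ne_zero hk.ne', vmTerm, cpow_neg, div_eq_mul_inv]
  have h1 := ArithmeticFunction.LSeriesSummable_vonMangoldt hw
  have h2 := h1.LSeriesHasSum
  rw [ArithmeticFunction.LSeries_vonMangoldt_eq_deriv_riemannZeta_div hw, neg_div] at h2
  rw [e]
  exact ⟨h1.norm, h2⟩

theorem RiemannHypothesis.differentiableAt_zetaLD (hRH : RiemannHypothesis) {w : ℂ} (h : -1 < w.re)
    (h1 : w ≠ 1) (h2 : w.re ≠ 1 / 2) : DifferentiableAt ℂ zetaLD w := by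
  have h0 : riemannZeta w ≠ 0 := fun h0 => by
    have h3 : riemannZeta₁ w = 0 := by rw [riemannZeta₁_eq h1, h0, mul_zero]
    exact h2 (hRH.re_eq ((hRH.riemannZeta₁_eq_zero_iff h).1 h3))
  have ho : IsOpen {w : ℂ | w ≠ 1} := isOpen_ne
  have hd : DifferentiableOn ℂ riemannZeta {w : ℂ | w ≠ 1} := fun w hw =>
    (differentiableAt_riemannZeta hw).differentiableWithinAt
  exact ((hd.deriv ho).differentiableAt (ho.mem_nhds h1)).div (differentiableAt_riemannZeta h1) h0

/-- Termwise integration of the Dirichlet series of `ζ'/ζ` along a vertical line. -/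
theorem hasSum_vmTerm_mul_vline {s : ℂ} {a : ℝ} (ha : 1 < s.re + a) {F : ℂ → ℂ}
    (hF : Integrable fun y : ℝ => F (a + y * I)) :
    HasSum (fun k : ℕ => vmTerm s k * vline a (fun z => (k : ℂ) ^ (-z) * F z))
      (-vline a (fun z => zetaLD (z + s) * F z)) := by
  have hre : ∀ y : ℝ, 1 < ((a + y * I : ℂ) + s).re := fun y => by simp; linarith
  have hn : ∀ (y : ℝ) (k : ℕ), ‖vmTerm ((a + y * I : ℂ) + s) k‖ = ‖vmTerm (a + s) k‖ := fun y k => by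
    rw [norm_vmTerm, norm_vmTerm]; simp
  have hs0 : Summable fun k => ‖vmTerm (a + s) k‖ := by simpa using (hasSum_vmTerm (hre 0)).1
  have hmeas : ∀ k : ℕ, Measurable fun y : ℝ => vmTerm ((a + y * I : ℂ) + s) k := fun k => by unfold vmTerm; fun_prop
  have key := hasSum_integral_of_tsum_norm_le (μ := volume)
    (F := fun k (y : ℝ) => vmTerm ((a + y * I : ℂ) + s) k * F (a + y * I))
    (g := fun y => (∑' k, ‖vmTerm (a + s) k‖) * ‖F (a + y * I)‖)
    (fun k => (hmeas k).aestronglyMeasurable.mul hF.aestronglyMeasurable)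
    (fun y => by simp only [norm_mul, hn]; exact hs0.mul_right _)
    (fun y => by simp only [norm_mul, hn]; rw [tsum_mul_right])
    (hF.norm.const_mul _)
  have h1 := key.2.2.mul_left (1 / (2 * (π : ℂ)))
  have e1 : ∀ y : ℝ, ∑' k, vmTerm ((a + y * I : ℂ) + s) k * F (a + y * I) =
      -(zetaLD ((a + y * I : ℂ) + s) * F (a + y * I)) := fun y => by
    rw [tsum_mul_right, (hasSum_vmTerm (hre y)).2.tsum_eq, neg_mul]
  simp_rw [e1] at h1
  rw [integral_neg, mul_neg] at h1
  refine h1.congr_fun fun k => ?_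
  simp only [vline]
  rw [mul_left_comm, ← integral_const_mul]
  congr 2
  funext y
  rw [← mul_assoc, vmTerm_mul_cpow]

theorem vline_vline_swap {c c' : ℝ} {H : ℂ → ℂ → ℂ}
    (hi : Integrable (fun p : ℝ × ℝ => H (c + p.1 * I) (c' + p.2 * I))) :
    (Integrable fun y : ℝ => vline c' (H (c + y * I))) ∧
    vline c (fun z => vline c' (H z)) = vline c' (fun z' => vline c fun z => H z z') := by
  refine ⟨hi.integral_prod_left.const_mul _, ?_⟩
  have := integral_integral_swap (f := fun y y' : ℝ => H (c + y * I) (c' + y' * I)) hi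
  simp only [vline]
  rw [integral_const_mul, integral_const_mul, this]

theorem integrable_prod_one_add_abs {η : ℝ} (hη : 0 < η) : Integrable fun p : ℝ × ℝ =>
    (1 + |p.1|) ^ (-1 - η) * (1 + |p.2|) ^ (-1 - η) + (1 + |p.1|) ^ (-1 - η) * (1 + |p.1 + p.2|) ^ (-1 - η) := by
  have h1 := (integrable_one_add_abs_rpow hη).mul_prod (integrable_one_add_abs_rpow hη)
  refine h1.add ?_
  exact (measurePreserving_prod_add volume volume).integrable_comp_of_integrable h1

namespace IsSieveKernel

/-- Absolute integrability of the kernel on a product of two vertical lines. -/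
theorem exists_kernel_prod_bound (h : IsSieveKernel X f d) {c C : ℝ} (hc : c = 1 / 4 ∨ c = -3 / 8) :
    ∃ K, ∀ (w z z' : ℂ), z.re = c → z'.re = -3 / 8 →
      ‖w‖ ≤ C * ((1 + |z.im|) ^ (1 / 64 : ℝ) * (1 + |z'.im|) ^ (1 / 64 : ℝ)) →
      ‖w * (sieveKer d z z' / (z * z'))‖ ≤ K * ((1 + |z.im|) ^ (-1 - 1 / 16 : ℝ) * (1 + |z'.im|) ^ (-1 - 1 / 16 : ℝ) +
          (1 + |z.im|) ^ (-1 - 1 / 16 : ℝ) * (1 + |z.im + z'.im|) ^ (-1 - 1 / 16 : ℝ)) := by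
  obtain ⟨C₁, hC₁, hb⟩ := h.exists_sieveKer_bound (δ := 1 / 4) (by norm_num) (by norm_num) 1
  have hc1 : -3 / 8 ≤ c ∧ c ≤ 1 / 4 ∧ 1 / 4 ≤ |c| := by rcases hc with rfl | rfl <;> norm_num [abs_of_pos, abs_of_neg]
  -- Exponents after the factor `1/z` and a growth `1/64` of the weights; on the line `-3/8` the
  -- same count gives `7/8 - 1/64`. For `c = 1/4` the sum `P + (7/8 - 1/64)` still exceeds `1 +
  -- 1/16`, whereas two lines at `1/4` would give less than 1.
  set P := 1 / 2 - c - 1 / 64 with hP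
  set q := c + 9 / 8 with hq
  refine ⟨|C| * C₁ * (2 / (1 / 4)) ^ 2 * (2 ^ q + 2 ^ (7 / 8 - 1 / 64 : ℝ)), fun w z z' hz hz' hw => ?_⟩
  have e1 := hb z z' (by linarith) (by linarith) (by linarith) (by linarith) (by linarith) (by linarith)
  have e2 := norm_le_of_one_add_abs (κ := 1 / 4) hc1.2.2 hz
  have e3 := norm_le_of_one_add_abs (c := -3 / 8) (κ := 1 / 4) (by rw [abs_of_neg] <;> norm_num) hz'
  have hker := one_add_abs_kernel_le (p := P) (p' := 7 / 8 - 1 / 64) (q := q) (η := 1 / 16) z.im z'.im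
  rw [hz, hz'] at e1
  set A := 1 + |z.im|
  set B := 1 + |z'.im|
  set D := 1 + |z.im + z'.im|
  have hA : 0 < A := by positivity
  have hB : 0 < B := by positivity
  have hD : 0 < D := by positivity
  have hw' : ‖w‖ ≤ |C| * (A ^ (1 / 64 : ℝ) * B ^ (1 / 64 : ℝ)) := hw.trans (mul_bound_right (le_abs_self C))
  rw [norm_mul, norm_div, norm_mul, div_eq_mul_one_div, ← one_div_mul_one_div]
  calc ‖w‖ * (‖sieveKer d z z'‖ * (1 / ‖z‖ * (1 / ‖z'‖))) ≤
        (|C| * (A ^ (1 / 64 : ℝ) * B ^ (1 / 64 : ℝ))) * ((C₁ * (A ^ (c + 1 / 2) * B ^ (-3 / 8 + 1 / 2 : ℝ) *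
          D ^ (-(c + -3 / 8) - 3 / 2))) * (2 / (1 / 4) * A⁻¹ * (2 / (1 / 4) * B⁻¹))) :=
        mul_bound hw' (mul_bound e1 (mul_bound e2 e3))
    _ = |C| * C₁ * (2 / (1 / 4)) ^ 2 * ((A ^ (1 / 64 : ℝ) * A ^ (c + 1 / 2) * A ^ (-1 : ℝ)) *
        (B ^ (1 / 64 : ℝ) * B ^ (-3 / 8 + 1 / 2 : ℝ) * B ^ (-1 : ℝ)) * D ^ (-(c + -3 / 8) - 3 / 2)) := by
        rw [rpow_neg_one, rpow_neg_one]; ring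
    _ = |C| * C₁ * (2 / (1 / 4)) ^ 2 * (A ^ (-P) * B ^ (-(7 / 8 - 1 / 64) : ℝ) * D ^ (-q)) := by
        rw [← rpow_add hA, ← rpow_add hA, ← rpow_add hB, ← rpow_add hB, hP, hq]
        ring_nf
    _ ≤ _ := (mul_bound_left hker).trans_eq (by ring)

theorem integrable_kernel_prod (h : IsSieveKernel X f d) {c C : ℝ} (hc : c = 1 / 4 ∨ c = -3 / 8)
    {w₁ w₂ : ℂ → ℂ} (h1 : ∀ z : ℂ, z.re = c → ContinuousAt w₁ z ∧ ‖w₁ z‖ ≤ C * (1 + |z.im|) ^ (1 / 64 : ℝ))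
    (h2 : ∀ z : ℂ, z.re = -3 / 8 → ContinuousAt w₂ z ∧ ‖w₂ z‖ ≤ C * (1 + |z.im|) ^ (1 / 64 : ℝ)) :
    Integrable (fun p : ℝ × ℝ => (fun z z' => w₁ z * w₂ z' * (sieveKer d z z' / (z * z')))
      (c + p.1 * I) ((-3 / 8 : ℝ) + p.2 * I)) := by
  obtain ⟨K, hK⟩ := h.exists_kernel_prod_bound (C := C * C) hc
  have hc1 : -3 / 8 ≤ c ∧ c ≤ 1 / 4 ∧ c ≠ 0 := by rcases hc with rfl | rfl <;> norm_num
  refine ((integrable_prod_one_add_abs (η := 1 / 16) (by norm_num)).const_mul K).mono' ?_ (of_forall fun p => ?_)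
  · refine Continuous.aestronglyMeasurable (continuous_iff_continuousAt.2 fun p => ?_)
    have c1 : ContinuousAt (fun p : ℝ × ℝ => (c + p.1 * I : ℂ)) p := by fun_prop
    have c2 : ContinuousAt (fun p : ℝ × ℝ => ((-3 / 8 : ℝ) + p.2 * I : ℂ)) p := by fun_prop
    have r1 : (c + p.1 * I : ℂ).re = c := by simp
    have r2 : ((-3 / 8 : ℝ) + p.2 * I : ℂ).re = -3 / 8 := by simp
    have k1 : ContinuousAt (fun p : ℝ × ℝ => w₁ (c + p.1 * I)) p :=
      ContinuousAt.comp (f := fun p : ℝ × ℝ => (c + p.1 * I : ℂ)) (h1 _ r1).1 c1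
    have k2 : ContinuousAt (fun p : ℝ × ℝ => w₂ ((-3 / 8 : ℝ) + p.2 * I)) p :=
      ContinuousAt.comp (f := fun p : ℝ × ℝ => ((-3 / 8 : ℝ) + p.2 * I : ℂ)) (h2 _ r2).1 c2
    have n1 := ne_zero_of_re_ne (by rw [r1]; exact hc1.2.2)
    have n2 := ne_zero_of_re_ne (by rw [r2]; norm_num)
    have k3 := (h.differentiableAt_sieveKer (F := Prod.fst) (G := Prod.snd)
      (s := ((c + p.1 * I, (-3 / 8 : ℝ) + p.2 * I) : ℂ × ℂ)) (by fun_prop) (by fun_prop)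
      (by rw [r1]; linarith) (by rw [r2]; norm_num) (by rw [r1, r2]; linarith)
      (by rw [r1, r2]; linarith)).continuousAt
    exact (k1.mul k2).mul ((ContinuousAt.comp (f := fun p : ℝ × ℝ =>
      ((c + p.1 * I, (-3 / 8 : ℝ) + p.2 * I) : ℂ × ℂ)) k3 (c1.prodMk c2)).div (c1.mul c2)
      (mul_ne_zero n1 n2))
  · obtain ⟨-, b1⟩ := h1 (c + p.1 * I) (by simp)
    obtain ⟨-, b2⟩ := h2 ((-3 / 8 : ℝ) + p.2 * I) (by simp)
    have := hK (w₁ (c + p.1 * I) * w₂ ((-3 / 8 : ℝ) + p.2 * I)) (c + p.1 * I)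
      ((-3 / 8 : ℝ) + p.2 * I) (by simp) (by simp) (by
        rw [norm_mul]
        refine (mul_le_mul b1 b2 (norm_nonneg _) ((norm_nonneg _).trans b1)).trans_eq (by ring))
    simpa using this

/-- The sum over the zeros of the kernel, on a vertical line. -/
theorem exists_zero_sum_bound (hRH : RiemannHypothesis) (h : IsSieveKernel X f d) {s : ℂ}
    (hs : 3 / 4 < s.re) (hs1 : s.re < 7 / 8) {c : ℝ} (hc : c = 1 / 4 ∨ c = -3 / 8) : ∃ C, ∀ z : ℂ, z.re = c →
    Summable (fun ρ : zetaZeros => ‖(zetaOrder ρ : ℂ) * (sieveKer d z (ρ - s) / (ρ - s))‖) ∧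
    ∑' ρ : zetaZeros, ‖(zetaOrder ρ : ℂ) * (sieveKer d z (ρ - s) / (ρ - s))‖ / ‖z‖ ≤
      C * (1 + |z.im|) ^ (-1 - (s.re - 3 / 4) / 2) := by
  obtain ⟨C₁, hC₁, hb⟩ := h.exists_sieveKer_bound (δ := 1 / 4) (by norm_num) (by norm_num) 1
  -- For `c = 1/4` the exponents `1/2 - c` and `Re s` sum to exactly `1 + η`; this is where `Re s >
  -- 3/4` is needed.
  set η := s.re - 3 / 4 with hη
  have hη0 : 0 < η := by linarith
  obtain ⟨C₂, hC₂, hz⟩ := hRH.exists_tsum_bound (half_pos hη0) hη0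
  have hc1 : -3 / 8 ≤ c ∧ c ≤ 1 / 4 ∧ 1 / 4 ≤ |c| := by rcases hc with rfl | rfl <;> norm_num [abs_of_pos, abs_of_neg]
  have hre := hRH.re_sub s
  set q := c + 2 - s.re with hq
  set K := C₁ * (2 / (1 / 4)) ^ 2 * (2 ^ q + 2 ^ s.re) with hK
  have hT : 1 ≤ (1 + |s.im|) ^ (η / 2) := one_le_rpow (by linarith [abs_nonneg s.im]) (by linarith)
  refine ⟨K * (2 * C₂ * (1 + |s.im|) ^ (η / 2)), fun z hzc => ?_⟩
  have hz0 : 0 < ‖z‖ := norm_pos_iff.2 fun h0 => by rw [h0] at hzc; rw [← hzc] at hc1; norm_num at hc1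
  set A := 1 + |z.im| with hA
  have hA0 : 0 < A := by positivity
  have hA1 : 1 ≤ A := le_add_of_nonneg_right (abs_nonneg _)
  have hterm : ∀ ρ : zetaZeros, ‖(zetaOrder ρ : ℂ) * (sieveKer d z (ρ - s) / (ρ - s))‖ / ‖z‖ ≤
      K * A ^ (-1 - η) * (zetaOrder ρ * (1 + |ρ.1.im - s.im|) ^ (-1 - η) +
        zetaOrder ρ * (1 + |ρ.1.im - (s.im - z.im)|) ^ (-1 - η)) := fun ρ => by
    have e1 := hb z (ρ - s) (by linarith) (by linarith) (by rw [hre]; linarith) (by rw [hre]; linarith)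
      (by rw [hre]; linarith) (by rw [hre]; linarith)
    have e2 := norm_le_of_one_add_abs (κ := 1 / 4) hc1.2.2 hzc
    have e3 := norm_le_of_one_add_abs (κ := 1 / 4) (by rw [abs_of_neg] <;> linarith) (hre ρ)
    have hker := one_add_abs_kernel_le (p := 1 / 2 - c) (p' := s.re) (q := q) (η := η) z.im (ρ.1 - s).im
    rw [hzc, hre] at e1
    have e4 : ρ.1.im - (s.im - z.im) = z.im + (ρ.1 - s).im := by simp; ring
    rw [e4, ← sub_im]
    set B := 1 + |(ρ.1 - s).im|
    set D := 1 + |z.im + (ρ.1 - s).im|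
    have hB : 0 < B := by positivity
    have hD : 0 < D := by positivity
    rw [norm_mul, norm_div, norm_zetaOrder,
      show zetaOrder ρ * (‖sieveKer d z (ρ - s)‖ / ‖ρ.1 - s‖) / ‖z‖ = zetaOrder ρ *
        (‖sieveKer d z (ρ - s)‖ * (1 / ‖z‖ * (1 / ‖ρ.1 - s‖))) by field_simp]
    calc _ ≤ zetaOrder ρ * ((C₁ * (A ^ (c + 1 / 2) * B ^ (1 / 2 - s.re + 1 / 2) *
          D ^ (-(c + (1 / 2 - s.re)) - 3 / 2))) * (2 / (1 / 4) * A⁻¹ * (2 / (1 / 4) * B⁻¹))) :=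
          mul_le_mul_of_nonneg_left (mul_bound e1 (mul_bound e2 e3)) (zetaOrder_nonneg _)
      _ = zetaOrder ρ * (C₁ * (2 / (1 / 4)) ^ 2) * ((A ^ (c + 1 / 2) * A ^ (-1 : ℝ)) *
          (B ^ (1 / 2 - s.re + 1 / 2) * B ^ (-1 : ℝ)) * D ^ (-(c + (1 / 2 - s.re)) - 3 / 2)) := by
          rw [rpow_neg_one, rpow_neg_one]; ring
      _ = zetaOrder ρ * (C₁ * (2 / (1 / 4)) ^ 2) * (A ^ (-(1 / 2 - c)) * B ^ (-s.re) * D ^ (-q)) := by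
          rw [← rpow_add hA0, ← rpow_add hB, hq]; ring_nf
      _ ≤ _ := (mul_le_mul_of_nonneg_left hker (mul_nonneg (zetaOrder_nonneg _) (by positivity))).trans
          (le_of_eq (by ring))
  obtain ⟨s1, t1⟩ := hz s.im
  obtain ⟨s2, t2⟩ := hz (s.im - z.im)
  have hsum := (s1.add s2).mul_left (K * A ^ (-1 - η))
  have hS := Summable.of_nonneg_of_le (fun ρ => by positivity) hterm hsum
  refine ⟨(hS.mul_right ‖z‖).congr fun ρ => div_mul_cancel₀ _ hz0.ne', ?_⟩
  refine (hS.tsum_le_tsum hterm hsum).trans ?_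
  rw [tsum_mul_left, s1.tsum_add s2]
  have t3 : (1 + |s.im - z.im|) ^ (η / 2) ≤ (1 + |s.im|) ^ (η / 2) * A ^ (η / 2) := by
    have := one_add_abs_add_rpow_le s.im (-z.im) (half_pos hη0).le
    rwa [abs_neg] at this
  have hAη : 1 ≤ A ^ (η / 2) := one_le_rpow hA1 (by linarith)
  have t4 : C₂ * (1 + |s.im|) ^ (η / 2) + C₂ * (1 + |s.im - z.im|) ^ (η / 2) ≤
      2 * C₂ * (1 + |s.im|) ^ (η / 2) * A ^ (η / 2) := by
    have := mul_bound_left (a := C₂) t3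
    have : C₂ * (1 + |s.im|) ^ (η / 2) * 1 ≤ C₂ * (1 + |s.im|) ^ (η / 2) * A ^ (η / 2) := mul_bound_left hAη
    linarith
  have hK0 : 0 ≤ K * A ^ (-1 - η) := by positivity
  refine (mul_le_mul_of_nonneg_left ((add_le_add t1 t2).trans t4) hK0).trans_eq ?_
  rw [show -1 - η / 2 = (-1 - η) + η / 2 by ring, rpow_add hA0]; ring

end IsSieveKernel

/-- The bound is uniform for `s` in a small ball, as required for differentiating line integrals in
`s`. The radius is half the smallest distance of the shifted line from `-1`, `1/2`, `1` and `2`. -/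
theorem RiemannHypothesis.exists_zetaLD_line_bound (hRH : RiemannHypothesis) {s₀ : ℂ} {c ε : ℝ} (hε : 0 < ε)
    (h1 : -1 < s₀.re + c := by linarith) (h2 : s₀.re + c < 2 := by linarith)
    (h3 : s₀.re + c ≠ 1 / 2 := by linarith) (h4 : s₀.re + c ≠ 1 := by linarith) :
    ∃ r, 0 < r ∧ ∃ C, 0 < C ∧ ∀ s ∈ ball s₀ r, ∀ z : ℂ, z.re = c →
      DifferentiableAt ℂ zetaLD (z + s) ∧ ‖zetaLD (z + s)‖ ≤ C * (1 + |z.im|) ^ ε := by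
  set κ := min (min (s₀.re + c + 1) (2 - (s₀.re + c))) (min |s₀.re + c - 1 / 2| |s₀.re + c - 1|) / 2 with hκ
  have k1 : 0 < min (min (s₀.re + c + 1) (2 - (s₀.re + c))) (min |s₀.re + c - 1 / 2| |s₀.re + c - 1|) :=
    lt_min (lt_min (by linarith) (by linarith)) (lt_min (abs_pos.2 (sub_ne_zero.2 h3)) (abs_pos.2 (sub_ne_zero.2 h4)))
  have e1 : 2 * κ ≤ s₀.re + c + 1 := by
    rw [hκ, mul_div_cancel₀ _ two_ne_zero]; exact (min_le_left _ _).trans (min_le_left _ _)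
  have e2 : 2 * κ ≤ 2 - (s₀.re + c) := by
    rw [hκ, mul_div_cancel₀ _ two_ne_zero]; exact (min_le_left _ _).trans (min_le_right _ _)
  have e3 : 2 * κ ≤ |s₀.re + c - 1 / 2| := by
    rw [hκ, mul_div_cancel₀ _ two_ne_zero]; exact (min_le_right _ _).trans (min_le_left _ _)
  have e4 : 2 * κ ≤ |s₀.re + c - 1| := by
    rw [hκ, mul_div_cancel₀ _ two_ne_zero]; exact (min_le_right _ _).trans (min_le_right _ _)
  have hκ0 : 0 < κ := half_pos k1
  have hκ1 : κ < 1 := by linarith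
  obtain ⟨C, hC, hb⟩ := hRH.exists_logDeriv_bound hκ0 hκ1 hε
  refine ⟨κ, hκ0, C * (1 + (|s₀.im| + κ)) ^ ε, by positivity, fun s hs z hz => ?_⟩
  have hs' : ‖s - s₀‖ < κ := by rwa [← dist_eq_norm]
  have hre : |s.re - s₀.re| < κ := ((abs_re_le_norm (s - s₀)).trans_lt hs')
  have him : |s.im| ≤ |s₀.im| + κ := by
    have := (abs_im_le_norm (s - s₀)).trans hs'.le
    rw [sub_im] at this
    linarith [abs_sub_abs_le_abs_sub s.im s₀.im]
  have hw : (z + s).re = c + s.re := by rw [add_re, hz]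
  have hab := abs_lt.1 hre
  have t : ∀ x : ℝ, 2 * κ ≤ |s₀.re + c - x| → κ ≤ |(z + s).re - x| := fun x hx => by
    rw [hw]
    have := abs_sub_abs_le_abs_sub (s₀.re + c - x) (c + s.re - x)
    rw [show s₀.re + c - x - (c + s.re - x) = -(s.re - s₀.re) by ring, abs_neg] at this
    linarith
  have t1 := t _ e3
  have t2 := t _ e4
  refine ⟨hRH.differentiableAt_zetaLD (by rw [hw]; linarith) (fun h0 => ?_) (fun h0 => ?_), ?_⟩
  · rw [h0] at t2; simp at t2; linarith
  · rw [h0] at t1; simp at t1; linarith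
  · refine (hb (z + s) (by rw [hw]; linarith) (by rw [hw]; linarith) t1 (t2.trans ?_)).trans ?_
    · simpa using abs_re_le_norm (z + s - 1)
    · rw [add_im, mul_assoc]
      refine mul_bound_left ((one_add_abs_add_rpow_le _ _ hε.le).trans ?_)
      rw [mul_comm]
      exact mul_bound_right (rpow_bound (by linarith))

theorem vline_mul_mul_div_mul (c : ℝ) (u k : ℂ → ℂ) (w z' : ℂ) :
    (vline c fun z => u z * w * (k z / (z * z'))) = w * ((vline c fun z => u z * (k z / z)) / z') := by
  rw [show w * ((vline c fun z => u z * (k z / z)) / z') = w / z' * vline c fun z => u z * (k z / z) by ring,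
    ← vline_const_mul]
  congr 1; funext z
  rw [div_eq_mul_inv, div_eq_mul_inv, div_eq_mul_inv, mul_inv]; ring

theorem vline_linear_comb {c : ℝ} {p q r t : ℂ → ℂ} (a b : ℂ) (hp : Integrable fun y : ℝ => p (c + y * I))
    (hq : Integrable fun y : ℝ => q (c + y * I)) (hr : Integrable fun y : ℝ => r (c + y * I))
    (ht : Integrable fun y : ℝ => t (c + y * I)) :
    vline c (fun z => p z - q z + a * r z - b * t z) = vline c p - vline c q + a * vline c r - b * vline c t := by
  have h1 : Integrable fun y : ℝ => (fun z => p z - q z) (c + y * I) := hp.sub hq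
  have h2 : Integrable fun y : ℝ => (fun z => a * r z) (c + y * I) := hr.const_mul a
  have h3 : Integrable fun y : ℝ => (fun z => b * t z) (c + y * I) := ht.const_mul b
  have h4 : Integrable fun y : ℝ => (fun z => p z - q z + a * r z) (c + y * I) := h1.add h2
  rw [vline_sub h4 h3, vline_add h1 h2, vline_sub hp hq, vline_const_mul, vline_const_mul]

/-! ### The explicit formula for `3/4 < Re s < 7/8` -/

namespace IsSieveKernel

/-- The integral of `ζ'/ζ(z+s)` against the kernel along a vertical line. -/
noncomputable def kerInt (d : ℝ → ℝ) (s : ℂ) (c : ℝ) (v : ℂ) : ℂ :=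
  vline c fun z => zetaLD (z + s) * (sieveKer d z v / z)

/-- The integral of `ζ'/ζ(z+s)` against `sieveConv` along a vertical line. -/
noncomputable def convInt (d : ℝ → ℝ) (s : ℂ) (c x : ℝ) : ℂ :=
  vline c fun z => zetaLD (z + s) * (sieveConv d z x / z)

/-- The double integral of the kernel against `ζ'/ζ(z+s) ζ'/ζ(z'+s)`. -/
noncomputable def kerIntInt (d : ℝ → ℝ) (s : ℂ) : ℂ :=
  vline (-3 / 8) fun z => vline (-3 / 8) fun z' => zetaLD (z + s) * zetaLD (z' + s) * (sieveKer d z z' / (z * z'))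

theorem hasSum_sieveKer_zeros (hRH : RiemannHypothesis) (h : IsSieveKernel X f d) {s v : ℂ}
    (hs : 3 / 4 < s.re) (hs1 : s.re < 7 / 8) (hv : -3 / 8 ≤ v.re) (hv1 : v.re ≤ 1 / 4) :
    HasSum (fun ρ : zetaZeros => (zetaOrder ρ : ℂ) * (sieveKer d (ρ - s) v / (ρ - s)))
      (kerInt d s (1 / 4) v - kerInt d s (-3 / 8) v + sieveKer d (1 - s) v / (1 - s) -
        zetaLD s * sieveKer d 0 v) := by
  obtain ⟨C, hC, hb⟩ := h.exists_sieveKer_bound_left (δ := 1 / 4) (by norm_num) (by norm_num) 1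
  exact hRH.residue_sum (η := 1 + v.re) (C := C * (1 + |v.im|) ^ (3 * 1 + 2 : ℝ)) (h := fun z => sieveKer d z v)
    (fun z h1 h2 => h.differentiableAt_sieveKer (F := fun z => z) (G := fun _ => v) differentiableAt_id
      (differentiableAt_const v) (by linarith) (by linarith) (by linarith) (by linarith)) (by linarith) fun z h1 h2 => by
      rw [neg_add']
      exact hb z v (by linarith) (by linarith) (by linarith) (by linarith) (by linarith) (by linarith)

theorem hasSum_sieveConv_zeros (hRH : RiemannHypothesis) (h : IsSieveKernel X f d) {s : ℂ}
    (hs : 3 / 4 < s.re) (hs1 : s.re < 7 / 8) (x : ℝ) :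
    HasSum (fun ρ : zetaZeros => (zetaOrder ρ : ℂ) * (sieveConv d (ρ - s) x / (ρ - s)))
      (convInt d s (1 / 4) x - convInt d s (-3 / 8) x + sieveConv d (1 - s) x / (1 - s) - zetaLD s * f x) := by
  obtain ⟨C, hC, hb⟩ := h.exists_sieveConv_bound (δ := 5 / 8) (by norm_num) (1 / 4) x
  rw [← h.sieveConv_zero]
  exact hRH.residue_sum (h := fun z => sieveConv d z x)
    (fun z h1 h2 => h.differentiableAt_sieveConv (inl (by linarith))) one_pos
    fun z h1 h2 => hb z (by linarith) (by linarith)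

/-- On `Re z = 1/4` the Dirichlet series of `ζ'/ζ(z+s)` converges absolutely, and Mellin inversion
of `K(z,v)/z` at `k` gives `n_k(v)`. The three ranges of `v` are those with a known Mellin
transform; of them `v = 0` and `v = 1 - s` are used later. -/
theorem hasSum_vmTerm_mul_sieveConv (h : IsSieveKernel X f d) {s v : ℂ} (hs : 3 / 4 < s.re)
    (hv : v = 0 ∨ -1 < v.re ∧ v.re < -1 / 4 ∨ 0 < v.re ∧ v.re < 3 / 4) :
    HasSum (fun k : ℕ => vmTerm s k * sieveConv d v k) (-kerInt d s (1 / 4) v) := by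
  have hi : Integrable fun y : ℝ => sieveKer d ((1 / 4 : ℝ) + y * I) v / ((1 / 4 : ℝ) + y * I) := by
    refine h.integrable_sieveKer_div (by norm_num) (by norm_num) ?_ ?_ ?_ <;>
      rcases hv with rfl | ⟨h1, h2⟩ | ⟨h1, h2⟩ <;> norm_num <;> linarith
  have := hasSum_vmTerm_mul_vline (s := s) (a := 1 / 4) (by linarith) (F := fun z => sieveKer d z v / z) hi
  refine this.congr_fun fun k => ?_
  rcases Nat.eq_zero_or_pos k with rfl | hk
  · simp [vmTerm_zero]
  · rw [← h.vline_cpow_mul_sieveKer (a := 1 / 4) (x := k) (v := v) (by exact_mod_cast hk) (by norm_num)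
      (by rcases hv with h0 | ⟨h1, h2⟩ | ⟨h1, h2⟩
          · exact inl ⟨h0, by norm_num⟩
          · exact inr (inl ⟨h1, by linarith⟩)
          · exact inr (inr ⟨h1, by linarith⟩))]
    simp

theorem hasSum_vmTerm_mul_f (h : IsSieveKernel X f d) {s : ℂ} (hs : 3 / 4 < s.re) (x : ℝ) :
    HasSum (fun k : ℕ => vmTerm s k * f (x - k)) (-convInt d s (1 / 4) x) := by
  obtain ⟨C, hC, hb⟩ := h.exists_sieveConv_bound (δ := 5 / 8) (by norm_num) (1 / 4) x
  have hi : Integrable fun y : ℝ => sieveConv d ((1 / 4 : ℝ) + y * I) x / ((1 / 4 : ℝ) + y * I) := by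
    have := integrable_vertical_div_sub (h := fun z => sieveConv d z x) (c := 1 / 4) (p := 0) (by norm_num)
      (fun z hz => (h.differentiableAt_sieveConv (inl (by rw [hz]; norm_num))).continuousAt)
      zero_lt_one (fun z hz => hb z (by rw [hz]; norm_num) hz.le)
    simpa using this
  have := hasSum_vmTerm_mul_vline (s := s) (a := 1 / 4) (by linarith) (F := fun z => sieveConv d z x / z) hi
  refine this.congr_fun fun k => ?_
  rcases Nat.eq_zero_or_pos k with rfl | hk
  · simp [vmTerm_zero]
  · rw [← h.vline_cpow_mul_sieveConv (a := 1 / 4) (x := x) (l := k) (by exact_mod_cast hk) (by norm_num)]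
    simp

theorem exists_zetaLD_weight (hRH : RiemannHypothesis) {s : ℂ} (hs : 3 / 4 < s.re) (hs1 : s.re < 7 / 8)
    {ε : ℝ} (hε : 0 < ε) :
    ∃ C, 1 ≤ C ∧ ∀ c : ℝ, c = 1 / 4 ∨ c = -3 / 8 → ∀ z : ℂ, z.re = c →
      ContinuousAt (fun z => zetaLD (z + s)) z ∧ ‖zetaLD (z + s)‖ ≤ C * (1 + |z.im|) ^ ε := by
  obtain ⟨r₁, hr₁, C₁, hC₁, h1⟩ := hRH.exists_zetaLD_line_bound (s₀ := s) (c := 1 / 4) hε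
  obtain ⟨r₂, hr₂, C₂, hC₂, h2⟩ := hRH.exists_zetaLD_line_bound (s₀ := s) (c := -3 / 8) hε
  refine ⟨max 1 (max C₁ C₂), le_max_left _ _, fun c hc z hz => ?_⟩
  have key : DifferentiableAt ℂ zetaLD (z + s) ∧ ‖zetaLD (z + s)‖ ≤ max C₁ C₂ * (1 + |z.im|) ^ ε := by
    rcases hc with rfl | rfl
    · obtain ⟨a, b⟩ := h1 s (mem_ball_self hr₁) z hz
      exact ⟨a, b.trans (mul_bound_right (le_max_left _ _))⟩
    · obtain ⟨a, b⟩ := h2 s (mem_ball_self hr₂) z hz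
      exact ⟨a, b.trans (mul_bound_right (le_max_right _ _))⟩
  exact ⟨ContinuousAt.comp (g := zetaLD) (f := fun z => z + s) key.1.continuousAt (by fun_prop),
    key.2.trans (mul_bound_right (le_max_right _ _))⟩

theorem integrable_zetaLD_mul_sieveKer (hRH : RiemannHypothesis) (h : IsSieveKernel X f d) {s v : ℂ}
    (hs : 3 / 4 < s.re) (hs1 : s.re < 7 / 8) (hv : 0 ≤ v.re) (hv1 : v.re ≤ 1 / 4) :
    Integrable fun y : ℝ => zetaLD (((-3 / 8 : ℝ) + y * I) + s) *
      (sieveKer d ((-3 / 8 : ℝ) + y * I) v / ((-3 / 8 : ℝ) + y * I)) := by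
  obtain ⟨C₀, -, h0⟩ := exists_zetaLD_weight hRH hs hs1 (ε := 1 / 64) (by norm_num)
  obtain ⟨C, hC, hb⟩ := h.exists_sieveKer_bound_left (δ := 1 / 4) (by norm_num) (by norm_num) 1
  have := integrable_vertical_div_sub (h := fun z => zetaLD (z + s) * sieveKer d z v) (c := -3 / 8) (p := 0)
    (C := C₀ * (C * (1 + |v.im|) ^ (3 * 1 + 2 : ℝ))) (η := 1 / 2) (by norm_num) (fun z hz => ((h0 _ (inr rfl) z hz).1.mul
      (h.differentiableAt_sieveKer (F := fun z => z) (G := fun _ => v) differentiableAt_id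
      (differentiableAt_const v) (by rw [hz]; norm_num) (by linarith) (by rw [hz]; linarith)
      (by rw [hz]; linarith)).continuousAt)) (by norm_num) (fun z hz => by
      have b := hb z v (by rw [hz]; norm_num) (by rw [hz]; norm_num) (by linarith) (by linarith)
        (by rw [hz]; linarith) (by rw [hz]; linarith)
      have a := (h0 _ (inr rfl) z hz).2
      have hA : 1 ≤ 1 + |z.im| := le_add_of_nonneg_right (abs_nonneg _)
      rw [norm_mul]
      refine (mul_le_mul a b (norm_nonneg _) ((norm_nonneg _).trans a)).trans ?_
      rw [show C₀ * (1 + |z.im|) ^ (1 / 64 : ℝ) * (C * (1 + |v.im|) ^ (3 * 1 + 2 : ℝ) * (1 + |z.im|) ^ (-1 - v.re)) =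
        C₀ * (C * (1 + |v.im|) ^ (3 * 1 + 2 : ℝ)) * ((1 + |z.im|) ^ (1 / 64 : ℝ) * (1 + |z.im|) ^ (-1 - v.re)) by ring,
        ← rpow_add (by linarith)]
      refine mul_le_mul_of_nonneg_left (rpow_bound_exp hA)
        (mul_nonneg (le_of_mul_le_mul_right (a := (1 + |z.im|) ^ (1 / 64 : ℝ)) ?_ (by positivity)) (by positivity))
      rw [zero_mul]
      exact (norm_nonneg _).trans a)
  refine this.congr (of_forall fun y => ?_)
  simp only [sub_zero, mul_div_assoc]

/-- Interchange of the Dirichlet series of `ζ'/ζ` with the integral over the left line. -/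
theorem hasSum_vmTerm_mul_convInt (hRH : RiemannHypothesis) (h : IsSieveKernel X f d) {s : ℂ}
    (hs : 3 / 4 < s.re) (hs1 : s.re < 7 / 8) :
    HasSum (fun k : ℕ => vmTerm s k * convInt d s (-3 / 8) k)
      (-vline (-3 / 8) fun z => zetaLD (z + s) * (kerInt d s (1 / 4) z / z)) ∧
    Integrable fun y : ℝ => zetaLD (((-3 / 8 : ℝ) + y * I) + s) *
      (kerInt d s (1 / 4) ((-3 / 8 : ℝ) + y * I) / ((-3 / 8 : ℝ) + y * I)) := by
  obtain ⟨C₀, hC₀, h0⟩ := exists_zetaLD_weight hRH hs hs1 (ε := 1 / 64) (by norm_num)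
  -- The constant weight 1 is given the same growth bound as `ζ'/ζ`, so that the integrability lemma
  -- also covers the bounded weights `k^{-z}`.
  have hone : ∀ (z : ℂ), ‖(1 : ℂ)‖ ≤ C₀ * (1 + |z.im|) ^ (1 / 64 : ℝ) := fun z => by
    rw [norm_one]
    exact one_le_mul_of_one_le_of_one_le hC₀ (one_le_rpow (le_add_of_nonneg_right (abs_nonneg _)) (by norm_num))
  have i1 := h.integrable_kernel_prod (inl rfl) (h0 _ (inl rfl)) (h0 _ (inr rfl))
  have i2 := h.integrable_kernel_prod (inl rfl) (w₁ := fun _ => 1)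
    (fun z hz => ⟨continuousAt_const, hone z⟩) (h0 _ (inr rfl))
  have hF := (vline_vline_swap (H := fun z z' => 1 * zetaLD (z' + s) * (sieveKer d z z' / (z * z'))) i2).1
  have e1 : ∀ z' : ℂ, (vline (1 / 4) fun z => zetaLD (z + s) * zetaLD (z' + s) * (sieveKer d z z' / (z * z'))) =
      zetaLD (z' + s) * (kerInt d s (1 / 4) z' / z') := fun z' => by
    rw [vline_mul_mul_div_mul, kerInt]
  have s1 := (vline_vline_swap (H := fun z z' => zetaLD (z + s) * zetaLD (z' + s) * (sieveKer d z z' / (z * z'))) i1).2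
  simp only [e1] at s1
  refine ⟨?_, ?_⟩
  · rw [← s1]
    have h2 := hasSum_vmTerm_mul_vline (s := s) (a := 1 / 4) (by linarith) (F := fun z => vline (-3 / 8) fun z' =>
      1 * zetaLD (z' + s) * (sieveKer d z z' / (z * z'))) hF
    have e2 : (fun z => zetaLD (z + s) * vline (-3 / 8) fun z' => 1 * zetaLD (z' + s) * (sieveKer d z z' / (z * z'))) =
        fun z => vline (-3 / 8) fun z' => zetaLD (z + s) * zetaLD (z' + s) * (sieveKer d z z' / (z * z')) := by
      funext z
      rw [← vline_const_mul]; congr 1; funext z'; ring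
    rw [e2] at h2
    refine h2.congr_fun fun k => ?_
    rcases Nat.eq_zero_or_pos k with rfl | hk
    · simp [vmTerm_zero]
    have i3 := h.integrable_kernel_prod (inl rfl) (w₁ := fun z => (k : ℂ) ^ (-z))
      (C := C₀) (fun z hz => ⟨by
        have : (k : ℂ) ≠ 0 := by exact_mod_cast hk.ne'
        exact (continuousAt_const_cpow this).comp (f := fun z : ℂ => -z) continuousAt_neg, by
        refine le_trans ?_ (hone z)
        rw [norm_natCast_cpow_of_pos hk, neg_re, hz, norm_one]
        exact Real.rpow_le_one_of_one_le_of_nonpos (by exact_mod_cast hk) (by norm_num)⟩) (h0 _ (inr rfl))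
    have s3 := (vline_vline_swap (H := fun z z' => (k : ℂ) ^ (-z) * zetaLD (z' + s) * (sieveKer d z z' / (z * z'))) i3).2
    congr 1
    rw [convInt]
    have e3 : (fun z : ℂ => (k : ℂ) ^ (-z) * vline (-3 / 8) fun z' => 1 * zetaLD (z' + s) * (sieveKer d z z' / (z * z'))) =
        fun z => vline (-3 / 8) fun z' => (k : ℂ) ^ (-z) * zetaLD (z' + s) * (sieveKer d z z' / (z * z')) := by
      funext z
      rw [← vline_const_mul]; congr 1; funext z'; ring
    rw [e3, s3]
    refine vline_congr fun z' hz' => ?_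
    rw [← h.vline_cpow_mul_sieveKer (a := 1 / 4) (x := k) (v := z') (by exact_mod_cast hk) (by norm_num)
      (inr (inl ⟨by rw [hz']; norm_num, by rw [hz']; norm_num⟩)), vline_mul_mul_div_mul]
    simp
  · refine (i1.integral_prod_right.const_mul (1 / (2 * (π : ℂ)))).congr (of_forall fun y => ?_)
    beta_reduce
    rw [← e1]; rfl

/-- The value of the sum of the kernel over the zeros. -/
noncomputable def kerZeroSum (d : ℝ → ℝ) (s z : ℂ) : ℂ :=
  kerInt d s (1 / 4) z - kerInt d s (-3 / 8) z + sieveKer d (1 - s) z / (1 - s) - zetaLD s * sieveKer d 0 z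

/-- The zero-sum identity for the kernel, integrated termwise along a second line against a weight.
It is used with `ζ'/ζ(z+s)`, with 1, and with `k^{-z}`. -/
theorem hasSum_vline_sieveKer_zeros (hRH : RiemannHypothesis) (h : IsSieveKernel X f d) {s : ℂ}
    (hs : 3 / 4 < s.re) (hs1 : s.re < 7 / 8) {c : ℝ} (hc : c = 1 / 4 ∨ c = -3 / 8) {w : ℂ → ℂ} {C₀ : ℝ}
    (hw : ∀ z : ℂ, z.re = c → ContinuousAt w z ∧ ‖w z‖ ≤ C₀ * (1 + |z.im|) ^ ((s.re - 3 / 4) / 4)) :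
    HasSum (fun ρ : zetaZeros => (zetaOrder ρ : ℂ) * ((vline c fun z => w z * (sieveKer d z (ρ - s) / z)) / (ρ - s)))
      (vline c fun z => w z * (kerZeroSum d s z / z)) ∧
    Integrable fun y : ℝ => (fun z => w z * (kerZeroSum d s z / z)) (c + y * I) := by
  obtain ⟨C, hC⟩ := h.exists_zero_sum_bound hRH hs hs1 hc
  have hc1 : -3 / 8 ≤ c ∧ c ≤ 1 / 4 ∧ c ≠ 0 := by rcases hc with rfl | rfl <;> norm_num
  have hcount := hRH.countable_zetaZeros
  have hre := hRH.re_sub s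
  have hn : ∀ (ρ : zetaZeros) (z : ℂ), ‖w z * (((zetaOrder ρ : ℂ) * (sieveKer d z (ρ - s) / (ρ - s))) / z)‖ =
      ‖w z‖ * (‖(zetaOrder ρ : ℂ) * (sieveKer d z (ρ - s) / (ρ - s))‖ / ‖z‖) := fun ρ z => by
    rw [norm_mul, norm_div]
  have hline : ∀ y : ℝ, (c + y * I : ℂ).re = c := fun y => by simp
  have key := hasSum_vline (c := c) (ι := zetaZeros)
    (F := fun ρ z => w z * (((zetaOrder ρ : ℂ) * (sieveKer d z (ρ - s) / (ρ - s))) / z))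
    (R := fun z => w z * (kerZeroSum d s z / z))
    (g := fun y => C₀ * C * (1 + |y|) ^ (-1 - (s.re - 3 / 4) / 4)) ?_ ?_ ?_
    ((integrable_one_add_abs_rpow (by linarith)).const_mul _) ?_
  · refine ⟨key.1.congr_fun fun ρ => ?_, key.2⟩
    rw [show (zetaOrder ρ : ℂ) *
      ((vline c fun z => w z * (sieveKer d z (ρ - s) / z)) / (ρ - s)) = zetaOrder ρ / (ρ - s) *
        vline c fun z => w z * (sieveKer d z (ρ - s) / z) by ring, ← vline_const_mul]
    congr 1; funext z; ring
  · refine fun ρ => (continuous_vertical (F := fun z => w z * ((zetaOrder ρ : ℂ) *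
      (sieveKer d z (ρ - s) / (ρ - s)) / z)) fun z hz => ?_).aestronglyMeasurable
    exact (hw z hz).1.mul ((continuousAt_const.mul (((h.differentiableAt_sieveKer (F := fun z => z)
      (G := fun _ => ρ.1 - s) differentiableAt_id (differentiableAt_const _) (by linarith)
      (by rw [hre]; linarith) (by rw [hre]; linarith) (by rw [hre]; linarith)).continuousAt).div_const _)).div
      continuousAt_id fun h0 => hc1.2.2 (by rw [← hz, show z = 0 from h0, zero_re]))
  · intro y
    simp only [hn]
    exact ((hC _ (hline y)).1.div_const _).mul_left _
  · intro y
    simp only [hn]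
    rw [tsum_mul_left]
    have b1 := (hw _ (hline y)).2
    have b2 := (hC _ (hline y)).2
    have him : (c + y * I : ℂ).im = y := by simp
    rw [him] at b1 b2
    refine (mul_le_mul b1 b2 (tsum_nonneg fun ρ => by positivity) ((norm_nonneg _).trans b1)).trans_eq ?_
    rw [mul_mul_mul_comm, ← rpow_add (by positivity)]
    ring_nf
  · intro z hz
    rw [tsum_mul_left, tsum_div_const]
    have := h.hasSum_sieveKer_zeros hRH hs hs1 (v := z) (by linarith) (by linarith)
    simp only [sieveKer_comm d _ z] at this
    rw [this.tsum_eq, kerZeroSum, sieveKer_comm d z, sieveKer_comm d z]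

/-- The sum over pairs of zeros and the left line. -/
theorem hasSum_kerInt_left (hRH : RiemannHypothesis) (h : IsSieveKernel X f d) {s : ℂ}
    (hs : 3 / 4 < s.re) (hs1 : s.re < 7 / 8) :
    ∃ B, HasSum (fun ρ : zetaZeros => (zetaOrder ρ : ℂ) * (kerInt d s (-3 / 8) (ρ - s) / (ρ - s))) B ∧
      B + zetaLD s * kerInt d s (-3 / 8) 0 =
        (vline (-3 / 8) fun z => zetaLD (z + s) * (kerInt d s (1 / 4) z / z)) - kerIntInt d s +
          kerInt d s (-3 / 8) (1 - s) / (1 - s) := by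
  obtain ⟨C₁, -, hw⟩ := exists_zetaLD_weight hRH hs hs1 (ε := (s.re - 3 / 4) / 4) (by linarith)
  obtain ⟨C₀, -, h0⟩ := exists_zetaLD_weight hRH hs hs1 (ε := 1 / 64) (by norm_num)
  obtain ⟨hB, -⟩ := h.hasSum_vline_sieveKer_zeros hRH hs hs1 (inr rfl) (hw _ (inr rfl))
  refine ⟨_, hB, ?_⟩
  have i1 := (h.hasSum_vmTerm_mul_convInt hRH hs hs1).2
  have e2 : ∀ z : ℂ, (vline (-3 / 8) fun z' => zetaLD (z + s) * zetaLD (z' + s) * (sieveKer d z z' / (z * z'))) =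
      zetaLD (z + s) * (kerInt d s (-3 / 8) z / z) := fun z => by
    have := vline_mul_mul_div_mul (-3 / 8) (fun z' => zetaLD (z' + s)) (fun z' => sieveKer d z' z) (zetaLD (z + s)) z
    rw [kerInt, ← this]
    refine vline_congr fun z' _ => ?_
    rw [mul_comm z, sieveKer_comm d z, mul_comm (zetaLD _)]
  have i2 : Integrable fun y : ℝ => (fun z => zetaLD (z + s) * (kerInt d s (-3 / 8) z / z))
      ((-3 / 8 : ℝ) + y * I) := by
    have i0 := h.integrable_kernel_prod (c := -3 / 8) (inr rfl) (h0 _ (inr rfl)) (h0 _ (inr rfl))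
    have := (vline_vline_swap (H := fun z z' => zetaLD (z + s) * zetaLD (z' + s) * (sieveKer d z z' / (z * z'))) i0).1
    simpa only [e2] using this
  have i3 := h.integrable_zetaLD_mul_sieveKer hRH hs hs1 (v := 1 - s) (by simp; linarith) (by simp; linarith)
  have i4 := h.integrable_zetaLD_mul_sieveKer hRH hs hs1 (v := 0) (by simp) (by simp)
  have e3 : kerIntInt d s = vline (-3 / 8) fun z => zetaLD (z + s) * (kerInt d s (-3 / 8) z / z) := by
    rw [kerIntInt]; congr 1; funext z; exact e2 z
  have := vline_linear_comb (p := fun z => zetaLD (z + s) * (kerInt d s (1 / 4) z / z))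
    (q := fun z => zetaLD (z + s) * (kerInt d s (-3 / 8) z / z))
    (r := fun z => zetaLD (z + s) * (sieveKer d z (1 - s) / z))
    (t := fun z => zetaLD (z + s) * (sieveKer d z 0 / z)) (1 / (1 - s)) (zetaLD s) i1 i2 i3 i4
  rw [e3, show (vline (-3 / 8) fun z => zetaLD (z + s) * (kerZeroSum d s z / z)) = _ from
    (vline_congr fun z _ => ?_).trans this]
  · rw [kerInt, kerInt]; ring
  · rw [kerZeroSum, sieveKer_comm d (1 - s), sieveKer_comm d 0]; ring

/-- The sum over pairs of zeros and the right line. -/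
theorem hasSum_kerInt_right (hRH : RiemannHypothesis) (h : IsSieveKernel X f d) {s : ℂ}
    (hs : 3 / 4 < s.re) (hs1 : s.re < 7 / 8) :
    ∃ A, HasSum (fun ρ : zetaZeros => (zetaOrder ρ : ℂ) * (kerInt d s (1 / 4) (ρ - s) / (ρ - s))) A ∧
      HasSum (fun k : ℕ => vmTerm s k * (convInt d s (1 / 4) k - convInt d s (-3 / 8) k +
        sieveConv d (1 - s) k / (1 - s))) (-(A + zetaLD s * kerInt d s (1 / 4) 0)) := by
  obtain ⟨C₁, hC₁, hw⟩ := exists_zetaLD_weight hRH hs hs1 (ε := (s.re - 3 / 4) / 4) (by linarith)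
  obtain ⟨hA, -⟩ := h.hasSum_vline_sieveKer_zeros hRH hs hs1 (inl rfl) (hw _ (inl rfl))
  have hone : ∀ (z : ℂ), ‖(1 : ℂ)‖ ≤ C₁ * (1 + |z.im|) ^ ((s.re - 3 / 4) / 4) := fun z => by
    rw [norm_one]
    exact one_le_mul_of_one_le_of_one_le hC₁ (one_le_rpow (le_add_of_nonneg_right (abs_nonneg _)) (by linarith))
  have hi := (h.hasSum_vline_sieveKer_zeros hRH hs hs1 (inl rfl) (w := fun _ => 1)
    (fun z hz => ⟨continuousAt_const, hone z⟩)).2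
  refine ⟨_, hA, ?_⟩
  have h2 := hasSum_vmTerm_mul_vline (s := s) (a := 1 / 4) (by linarith) (F := fun z => 1 * (kerZeroSum d s z / z)) hi
  have h3 := (h.hasSum_vmTerm_mul_sieveConv hs (v := 0) (inl rfl)).mul_left (zetaLD s)
  have h4 := h2.add h3
  rw [mul_neg, ← neg_add] at h4
  simp only [one_mul] at h4
  refine h4.congr_fun fun k => ?_
  rcases Nat.eq_zero_or_pos k with rfl | hk
  · simp [vmTerm_zero]
  have hk0 : (k : ℂ) ≠ 0 := by exact_mod_cast hk.ne'
  have h5 := (h.hasSum_vline_sieveKer_zeros hRH hs hs1 (inl rfl) (w := fun z => (k : ℂ) ^ (-z))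
    (fun z hz => ⟨(continuousAt_const_cpow hk0).comp (f := fun z : ℂ => -z) continuousAt_neg, by
      refine le_trans ?_ (hone z)
      rw [norm_natCast_cpow_of_pos hk, neg_re, hz, norm_one]
      exact Real.rpow_le_one_of_one_le_of_nonpos (by exact_mod_cast hk) (by norm_num)⟩)).1
  have h6 := h.hasSum_sieveConv_zeros hRH hs hs1 k
  -- On the right line the integral against `k^{-z}` is Mellin inversion at `v = ρ - s`, so the
  -- weighted identity becomes the zero sum of `n_k`, whose value is already known.
  have h7 : ∀ ρ : zetaZeros, (vline (1 / 4) fun z => (k : ℂ) ^ (-z) * (sieveKer d z (ρ - s) / z)) =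
      sieveConv d (ρ - s) k := fun ρ => by
    have hre := hRH.re_sub s ρ
    rw [← h.vline_cpow_mul_sieveKer (a := 1 / 4) (x := k) (v := ρ - s) (by exact_mod_cast hk) (by norm_num)
      (inr (inl ⟨by rw [hre]; linarith, by rw [hre]; linarith⟩))]
    simp
  simp only [h7] at h5
  rw [h5.unique h6, h.sieveConv_zero]
  ring

/-- The explicit formula for the sum over pairs of zeros. -/
theorem zeroSum_eq (hRH : RiemannHypothesis) (h : IsSieveKernel X f d) {s : ℂ}
    (hs : 3 / 4 < s.re) (hs1 : s.re < 7 / 8) (hsum : Summable (doubleTerm (sieveMellin d) s)) :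
    Summable (fun k : ℕ => vmTerm s k * ∑' l : ℕ, vmTerm s l * f (k - l)) ∧
    Summable (fun k : ℕ => vmTerm s k * convInt d s (-3 / 8) k) ∧
    Summable (fun k : ℕ => vmTerm s k * (sieveConv d (1 - s) k / (1 - s))) ∧
    zeroSum (sieveMellin d) s = ∑' k : ℕ, vmTerm s k * (∑' l : ℕ, vmTerm s l * f (k - l)) +
      2 * ∑' k : ℕ, vmTerm s k * convInt d s (-3 / 8) k -
      2 * ∑' k : ℕ, vmTerm s k * (sieveConv d (1 - s) k / (1 - s)) +
      kerIntInt d s - 2 * (kerInt d s (-3 / 8) (1 - s) / (1 - s)) + sieveKer d (1 - s) (1 - s) / (1 - s) ^ 2 := by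
  obtain ⟨B, hB, eB⟩ := h.hasSum_kerInt_left hRH hs hs1
  obtain ⟨A, hA, eA⟩ := h.hasSum_kerInt_right hRH hs hs1
  have hQ := (h.hasSum_vmTerm_mul_convInt hRH hs hs1).1
  have hN := (h.hasSum_vmTerm_mul_sieveConv hs (v := 1 - s) (inr (inr
    ⟨by simp; linarith, by simp; linarith⟩))).div_const (1 - s)
  simp only [mul_div_assoc] at hN
  have hf : ∀ k : ℕ, convInt d s (1 / 4) k = -∑' l : ℕ, vmTerm s l * f (k - l) := fun k => by
    rw [(h.hasSum_vmTerm_mul_f hs k).tsum_eq, neg_neg]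
  -- The right-line integrals of `n_k` are minus the inner sums over `l`. The formula `eA` contains
  -- them together with the left-line integrals and the terms at `1 - s`, so subtracting the latter
  -- two families isolates the double sum.
  have hT : HasSum (fun k : ℕ => vmTerm s k * ∑' l : ℕ, vmTerm s l * f (k - l)) _ :=
    ((hN.sub hQ).sub eA).congr_fun fun k => by rw [hf]; ring
  refine ⟨hT.summable, hQ.summable, hN.summable, ?_⟩
  have hre := hRH.re_sub s
  have hne : ∀ ρ : zetaZeros, ρ.1 - s ≠ 0 := fun ρ => ne_zero_of_re_ne (by rw [hre]; linarith)
  have hS := h.hasSum_sieveKer_zeros hRH hs hs1 (v := 0) (by norm_num) (by norm_num)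
  have hP := h.hasSum_sieveKer_zeros hRH hs hs1 (v := 1 - s) (by simp; linarith) (by simp; linarith)
  have hS0 : sieveKer d 0 0 = 1 := by simp [sieveKer, h.sieveMellin_zero]
  have e1 : ∑' ρ : zetaZeros, singleTerm (sieveMellin d) s ρ = kerInt d s (1 / 4) 0 - kerInt d s (-3 / 8) 0 +
      sieveKer d (1 - s) 0 / (1 - s) - zetaLD s := by
    rw [hS0, mul_one] at hS
    rw [← hS.tsum_eq]
    exact tsum_congr fun ρ => singleTerm_eq d (hne ρ)
  -- The double series is summed over one zero by the residue formula with `v = ρ - s`, then over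
  -- the other. The right and left line parts give `A` and `B`; the residues at `1 - s` and at the
  -- origin give two further single sums over zeros.
  have e2 : ∑' p : zetaZeros × zetaZeros, doubleTerm (sieveMellin d) s p = A - B +
      (kerInt d s (1 / 4) (1 - s) - kerInt d s (-3 / 8) (1 - s) + sieveKer d (1 - s) (1 - s) / (1 - s) -
        zetaLD s * sieveKer d 0 (1 - s)) / (1 - s) - zetaLD s * (kerInt d s (1 / 4) 0 - kerInt d s (-3 / 8) 0 +
      sieveKer d (1 - s) 0 / (1 - s) - zetaLD s * sieveKer d 0 0) := by
    have hsw := (Equiv.prodComm zetaZeros zetaZeros).summable_iff.2 hsum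
    rw [← (Equiv.prodComm zetaZeros zetaZeros).tsum_eq]
    refine hsw.tsum_prod.trans ?_
    have hin : ∀ ρ : zetaZeros, HasSum (fun ρ' : zetaZeros => doubleTerm (sieveMellin d) s (ρ', ρ))
        ((zetaOrder ρ : ℂ) * ((kerInt d s (1 / 4) (ρ - s) - kerInt d s (-3 / 8) (ρ - s) +
          sieveKer d (1 - s) (ρ - s) / (1 - s) - zetaLD s * sieveKer d 0 (ρ - s)) / (ρ - s))) := fun ρ => by
      have := h.hasSum_sieveKer_zeros hRH hs hs1 (v := ρ - s) (by rw [hre]; linarith) (by rw [hre]; linarith)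
      exact ((this.div_const (ρ.1 - s)).mul_left (zetaOrder ρ : ℂ)).congr_fun fun ρ' =>
        doubleTerm_eq d (p := (ρ', ρ)) (hne ρ') (hne ρ)
    have hout := (((hA.sub hB).add (hP.div_const (1 - s))).sub (hS.mul_left (zetaLD s)))
    rw [← hout.tsum_eq]
    refine tsum_congr fun ρ => (hin ρ).tsum_eq.trans ?_
    rw [sieveKer_comm d (1 - s) (ρ - s), sieveKer_comm d 0 (ρ - s)]
    ring
  rw [zeroSum, e1, e2, hT.tsum_eq, hQ.tsum_eq, hN.tsum_eq, hS0, sieveKer_comm d 0 (1 - s)]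
  have h1s : (1 - s : ℂ) ≠ 0 := ne_zero_of_re_ne (by simp; linarith)
  rw [← zetaLD, show B = (vline (-3 / 8) fun z => zetaLD (z + s) * (kerInt d s (1 / 4) z / z)) - kerIntInt d s +
          kerInt d s (-3 / 8) (1 - s) / (1 - s) - zetaLD s * kerInt d s (-3 / 8) 0
    from eq_sub_of_add_eq eB]
  generalize (vline (-3 / 8) fun z => zetaLD (z + s) * (kerInt d s (1 / 4) z / z)) = q
  field_simp
  ring

end IsSieveKernel

/-! ### Continuation of the individual terms to `0 < Re s < 7/8` -/

theorem differentiableAt_tsum_of_bound {F : ℕ → ℂ → ℂ} {s₀ : ℂ} {r : ℝ} {u : ℕ → ℝ} (N : ℕ) (hr : 0 < r)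
    (hu : Summable u) (hd : ∀ k, ∀ s ∈ ball s₀ r, DifferentiableAt ℂ (F k) s)
    (hb : ∀ k, N ≤ k → ∀ s ∈ ball s₀ r, ‖F k s‖ ≤ u k) :
    DifferentiableAt ℂ (fun s => ∑' k, F k s) s₀ ∧ Summable fun k => F k s₀ := by
  have hu' := (summable_nat_add_iff N).2 hu
  have hs : ∀ s ∈ ball s₀ r, Summable fun k => F k s := fun s hs =>
    (summable_nat_add_iff N).1 (hu'.of_norm_bounded fun k => hb _ (Nat.le_add_left _ _) s hs)
  have h1 := (differentiableOn_tsum_of_summable_norm hu'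
    (fun k s hs => (hd (k + N) s hs).differentiableWithinAt) isOpen_ball
    fun k s hs => hb _ (Nat.le_add_left _ _) s hs).differentiableAt (ball_mem_nhds _ hr)
  have h2 : DifferentiableAt ℂ (fun s => ∑ k ∈ Finset.range N, F k s) s₀ :=
    DifferentiableAt.fun_sum fun k _ => hd k s₀ (mem_ball_self hr)
  refine ⟨(h2.add h1).congr_of_eventuallyEq ?_, hs s₀ (mem_ball_self hr)⟩
  filter_upwards [ball_mem_nhds s₀ hr] with s hs' using ((hs s hs').sum_add_tsum_nat_add N).symm

theorem differentiableAt_vline {c r : ℝ} {s₀ : ℂ} {F : ℂ → ℂ → ℂ} {g : ℝ → ℝ} (hg : Integrable g)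
    (h : ∀ s ∈ ball s₀ r, ∀ z : ℂ, z.re = c → ContinuousAt (F s) z ∧
      DifferentiableAt ℂ (fun s => F s z) s ∧ ‖F s z‖ ≤ g z.im) :
    ∀ s ∈ ball s₀ r, DifferentiableAt ℂ (fun s => vline c (F s)) s ∧ ‖vline c (F s)‖ ≤ ∫ y, g y := by
  have hline : ∀ y : ℝ, (c + y * I : ℂ).re = c ∧ (c + y * I : ℂ).im = y := fun y => by simp
  have hb : ∀ s ∈ ball s₀ r, ∀ y : ℝ, ‖F s (c + y * I)‖ ≤ g y := fun s hs y => by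
    have := (h s hs _ (hline y).1).2.2
    rwa [(hline y).2] at this
  have key := differentiableOn_integral_of_locally_dominated (μ := volume) (U := ball s₀ r)
    (F := fun s (y : ℝ) => F s (c + y * I)) isOpen_ball
    (fun s hs => (continuous_vertical fun z hz => (h s hs z hz).1).aestronglyMeasurable)
    (fun y s hs => (h s hs _ (hline y).1).2.1.differentiableWithinAt)
    (fun s _ => ⟨1, one_pos, g, hg, fun s' _ hs' y => hb s' hs' y⟩)
  intro s hs
  refine ⟨(key.differentiableAt (isOpen_ball.mem_nhds hs)).const_mul _, ?_⟩
  rw [vline, norm_mul]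
  have h1 := norm_integral_le_of_norm_le hg (of_forall (hb s hs))
  have h2 : ‖1 / (2 * (π : ℂ))‖ ≤ 1 := by
    rw [norm_div, norm_mul, norm_real, norm_of_nonneg pi_pos.le]
    rw [norm_one, norm_ofNat, div_le_one (by positivity)]
    linarith [Real.pi_gt_three]
  exact (mul_le_of_le_one_left (norm_nonneg _) h2).trans h1

namespace IsSieveKernel

/-- With both variables on `Re z = -3/8` the argument of `ζ'/ζ` has real part strictly between
`-3/8` and `1/2`, where it has no poles, so no residue appears as `s` moves in this strip. -/
theorem differentiableAt_kerIntInt (hRH : RiemannHypothesis) (h : IsSieveKernel X f d) {s₀ : ℂ}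
    (h0 : 0 < s₀.re) (h1 : s₀.re < 7 / 8) : DifferentiableAt ℂ (kerIntInt d) s₀ := by
  obtain ⟨r, hr, C, hC, hb⟩ := hRH.exists_zetaLD_line_bound (s₀ := s₀) (c := -3 / 8) (ε := 1 / 64) (by norm_num)
  obtain ⟨K, hK⟩ := h.exists_kernel_prod_bound (C := C * C) (inr rfl)
  have hline : ∀ y : ℝ, ((-3 / 8 : ℝ) + y * I : ℂ).re = -3 / 8 ∧ ((-3 / 8 : ℝ) + y * I : ℂ).im = y := fun y => by simp
  have hi : ∀ s ∈ ball s₀ r, _ := fun s hs => h.integrable_kernel_prod (C := C) (inr rfl)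
    (w₁ := fun z => zetaLD (z + s)) (w₂ := fun z => zetaLD (z + s))
    (fun z hz => ⟨ContinuousAt.comp (g := zetaLD) (f := fun z => z + s) (hb s hs z hz).1.continuousAt (by fun_prop), (hb s hs z hz).2⟩)
    (fun z hz => ⟨ContinuousAt.comp (g := zetaLD) (f := fun z => z + s) (hb s hs z hz).1.continuousAt (by fun_prop), (hb s hs z hz).2⟩)
  have e : ∀ s ∈ ball s₀ r, kerIntInt d s = 1 / (2 * (π : ℂ)) * (1 / (2 * (π : ℂ)) *
      ∫ p : ℝ × ℝ, (fun z z' => zetaLD (z + s) * zetaLD (z' + s) * (sieveKer d z z' / (z * z')))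
      ((-3 / 8 : ℝ) + p.1 * I) ((-3 / 8 : ℝ) + p.2 * I)) := fun s hs => by
    simp only [kerIntInt, vline, integral_const_mul]
    congr 2
    exact (integral_prod (μ := volume) (ν := volume) _ (hi s hs)).symm
  have hd := differentiableOn_integral_of_locally_dominated (μ := (volume : Measure (ℝ × ℝ)))
    (U := ball s₀ r) (F := fun s (p : ℝ × ℝ) =>
      (fun z z' => zetaLD (z + s) * zetaLD (z' + s) * (sieveKer d z z' / (z * z')))
      ((-3 / 8 : ℝ) + p.1 * I) ((-3 / 8 : ℝ) + p.2 * I)) isOpen_ball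
    (fun s hs => (hi s hs).aestronglyMeasurable)
    (fun p s hs => by
      have d1 := fun y : ℝ => DifferentiableAt.comp (g := zetaLD)
        (f := fun s => ((-3 / 8 : ℝ) + y * I : ℂ) + s) s (hb s hs _ (hline y).1).1 (by fun_prop)
      exact (((d1 p.1).mul (d1 p.2)).mul_const _).differentiableWithinAt)
    (fun s _ => ⟨1, one_pos, _, (integrable_prod_one_add_abs (η := 1 / 16) (by norm_num)).const_mul K,
      fun s' _ hs' p => by
        have b1 := fun y : ℝ => (hb s' hs' _ (hline y).1).2
        have := hK (zetaLD (((-3 / 8 : ℝ) + p.1 * I : ℂ) + s') *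
          zetaLD (((-3 / 8 : ℝ) + p.2 * I : ℂ) + s')) _ _ (hline p.1).1 (hline p.2).1 (by
            rw [norm_mul]
            exact (mul_le_mul (b1 _) (b1 _) (norm_nonneg _) ((norm_nonneg _).trans (b1 _))).trans
              (le_of_eq (by ring)))
        rwa [(hline _).2, (hline _).2] at this⟩)
  refine (((hd.differentiableAt (ball_mem_nhds _ hr)).const_mul
    (1 / (2 * (π : ℂ)))).const_mul (1 / (2 * (π : ℂ)))).congr_of_eventuallyEq ?_
  filter_upwards [ball_mem_nhds s₀ hr] with s hs using e s hs

theorem differentiableAt_kerInt (hRH : RiemannHypothesis) (h : IsSieveKernel X f d) {s₀ : ℂ}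
    (h0 : 0 < s₀.re) (h1 : s₀.re < 7 / 8) :
    DifferentiableAt ℂ (fun s => kerInt d s (-3 / 8) (1 - s) / (1 - s)) s₀ := by
  obtain ⟨r, hr, C, hC, hb⟩ := hRH.exists_zetaLD_line_bound (s₀ := s₀) (c := -3 / 8) (ε := 1 / 2) (by norm_num)
  obtain ⟨K, hK, hk⟩ := h.exists_sieveKer_bound_left (δ := 1 / 8) (by norm_num) (by norm_num) 1
  set r' := min r (min s₀.re (7 / 8 - s₀.re)) with hr'
  have hr0 : 0 < r' := lt_min hr (lt_min h0 (by linarith))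
  have hre : ∀ s ∈ ball s₀ r', 0 < s.re ∧ s.re < 7 / 8 ∧ |s.im| ≤ |s₀.im| + r' := fun s hs => by
    obtain ⟨⟨a, a'⟩, b, -⟩ := re_im_norm_of_mem_ball hs
    have c1 : r' ≤ s₀.re := (min_le_right _ _).trans (min_le_left _ _)
    have c2 : r' ≤ 7 / 8 - s₀.re := (min_le_right _ _).trans (min_le_right _ _)
    exact ⟨by linarith, by linarith, b⟩
  have key := differentiableAt_vline (c := -3 / 8) (s₀ := s₀) (r := r')
    (F := fun s z => zetaLD (z + s) * (sieveKer d z (1 - s) / z))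
    (g := fun y => C * (K * (1 + (|s₀.im| + r')) ^ (3 * 1 + 2 : ℝ)) * (2 / (1 / 4)) * (1 + |y|) ^ (-1 - 1 / 2 : ℝ))
    ((integrable_one_add_abs_rpow (by norm_num)).const_mul _) (fun s hs z hz => by
      obtain ⟨a1, a2, a3⟩ := hre s hs
      obtain ⟨b1, b2⟩ := hb s (ball_subset_ball (min_le_left _ _) hs) z hz
      have hz0 : z ≠ 0 := fun hz0 => by rw [hz0] at hz; norm_num at hz
      have dk : ∀ F G : ℂ → ℂ, ∀ w, DifferentiableAt ℂ F w → DifferentiableAt ℂ G w → (F w).re = -3 / 8 →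
          (G w).re = 1 - s.re → DifferentiableAt ℂ (fun w => sieveKer d (F w) (G w)) w := fun F G w hF hG e1 e2 =>
        h.differentiableAt_sieveKer hF hG (by rw [e1]; norm_num) (by rw [e2]; linarith)
          (by rw [e1, e2]; linarith) (by rw [e1, e2]; linarith)
      refine ⟨(ContinuousAt.comp (g := zetaLD) (f := fun z => z + s) b1.continuousAt (by fun_prop)).mul
        ((dk (fun z => z) (fun _ => 1 - s) z differentiableAt_id (differentiableAt_const _) hz
          (by simp)).continuousAt.div continuousAt_id hz0),
        (b1.fun_comp' s (f := fun s => z + s) (by fun_prop)).mul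
        ((dk (fun _ => z) (fun s => 1 - s) s (differentiableAt_const _) (by fun_prop) hz (by simp)).div_const _), ?_⟩
      have e1 := hk z (1 - s) (by rw [hz]; norm_num) (by rw [hz]; norm_num) (by simp; linarith) (by simp; linarith)
        (by simp [hz]; linarith) (by simp [hz]; linarith)
      have e2 := norm_le_of_one_add_abs (κ := 1 / 4) (by rw [abs_of_neg] <;> norm_num) hz
      have hA : 1 ≤ 1 + |z.im| := le_add_of_nonneg_right (abs_nonneg _)
      have e3 : ‖sieveKer d z (1 - s)‖ ≤ K * (1 + (|s₀.im| + r')) ^ (3 * 1 + 2 : ℝ) * (1 + |z.im|) ^ (-1 : ℝ) := by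
        refine e1.trans (mul_bound (mul_bound_left (rpow_bound ?_)) (rpow_le_rpow_of_exponent_le hA (by simp; linarith)))
        simpa using a3
      rw [norm_mul, norm_div, div_eq_mul_one_div]
      refine (mul_bound b2 (mul_bound e3 e2)).trans_eq ?_
      generalize (1 + (|s₀.im| + r')) ^ (3 * 1 + 2 : ℝ) = T
      rw [← rpow_neg_one, show (-1 - 1 / 2 : ℝ) = 1 / 2 + -1 + -1 by norm_num,
        rpow_add (by positivity), rpow_add (by positivity)]
      ring) s₀ (mem_ball_self hr0)
  exact key.1.div (by fun_prop) (ne_zero_of_re_ne (by simp; linarith))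

/-- The radius and the constant `C` do not depend on `x`, and the bound is linear in `K`; both are
needed for summing over `x = k`. -/
theorem exists_convInt_bound (hRH : RiemannHypothesis) (d : ℝ → ℝ) {s₀ : ℂ} {c ε : ℝ} (hε : 0 < ε)
    (h1 : -1 < s₀.re + c) (h2 : s₀.re + c < 1 / 2) (hc : c ≠ 0) :
    ∃ r, 0 < r ∧ ∃ C, 0 < C ∧ ∀ x K, (∀ z : ℂ, z.re = c → ContinuousAt (fun z => sieveConv d z x) z ∧
        ‖sieveConv d z x / z‖ ≤ K * (1 + |z.im|) ^ (-1 - 2 * ε)) →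
      ∀ s ∈ ball s₀ r, DifferentiableAt ℂ (fun s => convInt d s c x) s ∧ ‖convInt d s c x‖ ≤ C * K := by
  obtain ⟨r, hr, C, hC, hb⟩ := hRH.exists_zetaLD_line_bound hε h1 (by linarith) h2.ne (by linarith)
  have hi := integrable_one_add_abs_rpow hε
  refine ⟨r, hr, C * (∫ y : ℝ, (1 + |y|) ^ (-1 - ε)) + 1,
    by have := integral_nonneg (μ := volume) (f := fun y : ℝ => (1 + |y|) ^ (-1 - ε)) fun y => by positivity
       positivity, fun x K hx s hs => ?_⟩
  have hK : 0 ≤ K := by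
    have := (norm_nonneg _).trans (hx c (by simp)).2
    simpa using this
  obtain ⟨a, b⟩ := differentiableAt_vline (c := c) (F := fun s z => zetaLD (z + s) * (sieveConv d z x / z))
    (hi.const_mul (C * K)) (fun s hs z hz => by
      obtain ⟨b1, b2⟩ := hb s hs z hz
      obtain ⟨c1, c2⟩ := hx z hz
      refine ⟨(ContinuousAt.comp (g := zetaLD) (f := fun z => z + s) b1.continuousAt (by fun_prop)).mul
        (c1.div continuousAt_id fun hz0 => hc (by rw [← hz, show z = 0 from hz0, zero_re])),
        (b1.fun_comp' s (f := fun s => z + s) (by fun_prop)).mul_const _, ?_⟩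
      rw [norm_mul]
      refine (mul_bound b2 c2).trans_eq ?_
      rw [show -1 - ε = ε + (-1 - 2 * ε) by ring, rpow_add (by positivity)]
      ring) s hs
  refine ⟨a, b.trans ?_⟩
  rw [integral_const_mul]
  linarith

end IsSieveKernel

theorem norm_vmTerm_mul_rpow (w : ℂ) (p : ℝ) (k : ℕ) : ‖vmTerm w k‖ * (k : ℝ) ^ p = ‖vmTerm (w - p) k‖ := by
  rcases Nat.eq_zero_or_pos k with rfl | hk
  · simp [vmTerm_zero]
  · rw [norm_vmTerm, norm_vmTerm, mul_assoc, ← rpow_add (by exact_mod_cast hk)]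
    congr 2; simp; ring

theorem norm_vmTerm_le {w s : ℂ} (h : w.re ≤ s.re) (k : ℕ) : ‖vmTerm s k‖ ≤ ‖vmTerm w k‖ := by
  rcases Nat.eq_zero_or_pos k with rfl | hk
  · simp [vmTerm_zero]
  · rw [norm_vmTerm, norm_vmTerm]
    exact mul_le_mul_of_nonneg_left (rpow_bound_exp (by exact_mod_cast hk)) ArithmeticFunction.vonMangoldt_nonneg

theorem differentiable_natCast_cpow_neg {k : ℕ} (hk : 0 < k) : Differentiable ℂ fun s : ℂ => (k : ℂ) ^ (-s) :=
  fun s => differentiableAt_id.neg.const_cpow (inl (by exact_mod_cast hk.ne'))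

theorem differentiable_vmTerm (k : ℕ) : Differentiable ℂ fun s => vmTerm s k := by
  rcases Nat.eq_zero_or_pos k with rfl | hk
  · simp only [vmTerm_zero]; exact differentiable_const 0
  · exact (differentiable_natCast_cpow_neg hk).const_mul _

namespace IsSieveKernel

/-- For `k > X` the function `n_k` is entire and the line moves from `-3/8` to `-1` without meeting
a pole. There `n_k(z)/z` is `O(k^{-1+2ε})` with integrable decay in `Im z`, so the series converges
for `Re s > 0`. The finitely many other `k` stay on the old line. -/
theorem exists_convInt_sum (hRH : RiemannHypothesis) (h : IsSieveKernel X f d) : ∃ q : ℂ → ℂ,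
    (∀ s : ℂ, 0 < s.re → s.re < 7 / 8 → DifferentiableAt ℂ q s) ∧ ∀ s : ℂ, 3 / 4 < s.re → s.re < 7 / 8 →
      ∑' k : ℕ, vmTerm s k * convInt d s (-3 / 8) k = q s := by
  classical
  obtain ⟨c, hc, hc1, hk⟩ := exists_mul_natCast_le_sub h.pos
  refine ⟨fun s => ∑' k : ℕ, vmTerm s k * (if X < k then convInt d s (-1) k else convInt d s (-3 / 8) k),
    fun s₀ h0 h1 => ?_, fun s hs hs1 => tsum_congr fun k => ?_⟩
  · set ε := s₀.re / 8 with hε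
    have hε0 : 0 < ε := by positivity
    obtain ⟨r₁, hr₁, C₁, hC₁, hb₁⟩ := exists_convInt_bound hRH d (s₀ := s₀) (c := -1) hε0 (by linarith)
      (by linarith) (by norm_num)
    obtain ⟨r₂, hr₂, C₂, hC₂, hb₂⟩ := exists_convInt_bound hRH d (s₀ := s₀) (c := -3 / 8) hε0 (by linarith)
      (by linarith) (by norm_num)
    obtain ⟨C₃, hC₃, hl⟩ := h.exists_sieveConv_large_bound hc hc1 (θ := 1 + 2 * ε) (by linarith) (by linarith)
    have large : ∀ k : ℕ, X < k → ∀ s ∈ ball s₀ r₁, DifferentiableAt ℂ (fun s => convInt d s (-1) k) s ∧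
        ‖convInt d s (-1) k‖ ≤ C₁ * (C₃ * (k : ℝ) ^ (-1 + 2 * ε)) := fun k hX => by
      refine hb₁ k _ fun z hz => ⟨(h.differentiableAt_sieveConv (inr hX)).continuousAt, ?_⟩
      have hz0 : 0 < ‖z‖ := norm_pos_iff.2 fun hz0 => by rw [hz0] at hz; norm_num at hz
      have := hl k z (hk k hX).1 hX (hk k hX).2 (by rw [hz]) (by rw [hz]; norm_num)
      rw [norm_div, div_le_iff₀ hz0]
      refine this.trans_eq ?_
      rw [hz, show (-1 - 1 + (1 + 2 * ε) : ℝ) = -1 + 2 * ε by ring, show -(1 + 2 * ε) = -1 - 2 * ε by ring]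
      ring
    have small : ∀ k : ℕ, ∀ s ∈ ball s₀ r₂, DifferentiableAt ℂ (fun s => convInt d s (-3 / 8) k) s :=
      fun k s hs => by
      obtain ⟨C, hC, hb⟩ := h.exists_sieveConv_bound (δ := 5 / 8) (by norm_num) 0 k
      refine (hb₂ k (C * (2 / (1 / 4))) (fun z hz =>
        ⟨(h.differentiableAt_sieveConv (inl (by rw [hz]; norm_num))).continuousAt, ?_⟩) s hs).1
      have e2 := norm_le_of_one_add_abs (κ := 1 / 4) (by rw [abs_of_neg] <;> norm_num) hz
      have hA : 1 ≤ 1 + |z.im| := le_add_of_nonneg_right (abs_nonneg _)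
      rw [norm_div, div_eq_mul_one_div]
      refine (mul_bound (hb z (by rw [hz]; norm_num) (by rw [hz]; norm_num)) e2).trans ?_
      rw [← rpow_neg_one, mul_mul_mul_comm, ← rpow_add (by positivity)]
      exact mul_bound_left (rpow_bound_exp hA)
    set r := min (min r₁ r₂) (s₀.re / 2) with hr
    have hr0 : 0 < r := lt_min (lt_min hr₁ hr₂) (by linarith)
    refine (differentiableAt_tsum_of_bound (s₀ := s₀) (F := fun k s =>
      vmTerm s k * (if X < k then convInt d s (-1) k else convInt d s (-3 / 8) k)) (⌊X⌋₊ + 1) hr0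
      (u := fun k => C₁ * C₃ * ‖vmTerm ((1 + s₀.re / 4 : ℝ) : ℂ) k‖) ((hasSum_vmTerm
      (by rw [ofReal_re]; linarith)).1.mul_left _)
      (fun k s hs => ((differentiable_vmTerm k) s).mul ?_) (fun k hk s hs => ?_)).1
    · split_ifs with hX
      · exact (large k hX s (ball_subset_ball ((min_le_left _ _).trans (min_le_left _ _)) hs)).1
      · exact small k s (ball_subset_ball ((min_le_left _ _).trans (min_le_right _ _)) hs)
    · have hX : X < k := Nat.lt_of_floor_lt hk
      have a := (re_im_norm_of_mem_ball hs).1.1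
      have b : r ≤ s₀.re / 2 := min_le_right _ _
      rw [if_pos hX, norm_mul]
      refine (mul_bound (norm_vmTerm_le (w := ((s₀.re / 2 : ℝ) : ℂ)) (by rw [ofReal_re]; linarith) k)
        (large k hX s (ball_subset_ball ((min_le_left _ _).trans (min_le_left _ _)) hs)).2).trans_eq ?_
      rw [← mul_assoc C₁, mul_left_comm, norm_vmTerm_mul_rpow]
      congr 3
      rw [← Complex.ofReal_sub]; congr 1; rw [hε]; ring
  · split_ifs with hX
    swap
    · rfl
    congr 1
    obtain ⟨C, hC, hl⟩ := h.exists_sieveConv_large_bound hc hc1 (θ := 3 / 2) (by norm_num) (by norm_num)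
    have := hRH.residue_sum (s := s) (a := 1 / 4) (b := -1) (η := 1 / 2) (C := C * 2 * k)
      (h := fun z => sieveConv d z k)
      (fun z h1 h2 => h.differentiableAt_sieveConv (inr hX)) (by norm_num) (fun z h1 h2 => by
        obtain ⟨hk1, hk2⟩ := hk k hX
        refine (hl k z hk1 hX hk2 h1 (by linarith)).trans ?_
        have hz : ‖z‖ ≤ 2 * (1 + |z.im|) := by
          have : |z.re| ≤ 1 := abs_le.2 ⟨h1, by linarith⟩
          linarith [norm_le_abs_re_add_abs_im z, abs_nonneg z.im]
        have hx : (k : ℝ) ^ (z.re - 1 + 3 / 2) ≤ k := by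
          conv_rhs => rw [← rpow_one (k : ℝ)]
          exact rpow_bound_exp hk1
        refine (mul_bound_right (mul_bound (mul_bound_left hz) hx)).trans_eq ?_
        rw [show (-(1 / 2) : ℝ) = 1 + -(3 / 2) by norm_num, rpow_add (by positivity), rpow_one]
        generalize (1 + |z.im|) ^ (-(3 / 2) : ℝ) = T
        ring)
    -- Both left lines give the same sum over zeros and the same residues at `0` and `1 - s`, hence
    -- the two left-line integrals are equal.
    have e := this.unique (h.hasSum_sieveConv_zeros hRH hs hs1 k)
    rw [h.sieveConv_zero] at e
    simp only [convInt] at e ⊢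
    linear_combination e

/-- Subtracting the main term `k^{-s} ∫ f` leaves `O(k^{-Re s - 1})`, and the remaining series
converges for `Re s > 0`. The main terms sum to `-(∫ f) ζ'/ζ(2s)`, and `∫ f` is twice the integral
over the half-line. -/
theorem exists_sieveConv_sum (h : IsSieveKernel X f d) : ∃ g : ℂ → ℂ,
    (∀ s : ℂ, 0 < s.re → s.re < 1 → DifferentiableAt ℂ g s) ∧ ∀ s : ℂ, 1 / 2 < s.re → s.re < 1 →
      ∑' k : ℕ, vmTerm s k * (sieveConv d (1 - s) k / (1 - s)) =
        g s - 2 * ((∫ u in Ioi (0 : ℝ), f u : ℝ) : ℂ) * zetaLD (2 * s) := by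
  obtain ⟨c, hc, hc1, hk⟩ := exists_mul_natCast_le_sub h.pos
  obtain ⟨C, hC, hm⟩ := h.exists_sieveConv_main_term hc hc1
  set J : ℂ := ((∫ u, f u : ℝ) : ℂ) with hJ
  have key : ∀ s₀ : ℂ, 0 < s₀.re → s₀.re < 1 → _ := fun s₀ h0 h1 => by
    set r := min (s₀.re / 2) (1 - s₀.re) with hr
    have hr0 : 0 < r := lt_min (by linarith) (by linarith)
    have hre : ∀ s ∈ ball s₀ r, s₀.re / 2 < s.re ∧ s.re < 1 ∧ ‖s‖ ≤ ‖s₀‖ + r ∧ 1 - s ≠ 0 := fun s hs => by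
      obtain ⟨⟨a, a'⟩, -, b⟩ := re_im_norm_of_mem_ball hs
      have e1 : r ≤ s₀.re / 2 := min_le_left _ _
      have e2 : r ≤ 1 - s₀.re := min_le_right _ _
      exact ⟨by linarith, by linarith, b, ne_zero_of_re_ne (by simp; linarith)⟩
    exact differentiableAt_tsum_of_bound (s₀ := s₀)
      (F := fun k s => vmTerm s k * (sieveConv d (1 - s) k / (1 - s) - (k : ℂ) ^ (-s) * J)) (⌊X⌋₊ + 1) hr0
      (u := fun k => C * (‖s₀‖ + r) * ‖vmTerm ((s₀.re + 1 : ℝ) : ℂ) k‖)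
      ((hasSum_vmTerm (by rw [ofReal_re]; linarith)).1.mul_left _) (fun k s hs => by
        obtain ⟨a1, a2, a3, a4⟩ := hre s hs
        rcases Nat.eq_zero_or_pos k with rfl | hk0
        · simp only [vmTerm_zero, zero_mul]; exact differentiableAt_const 0
        refine ((differentiable_vmTerm k) s).mul (DifferentiableAt.sub (DifferentiableAt.fun_div ?_ (by fun_prop) a4)
          ((differentiable_natCast_cpow_neg hk0 s).mul_const J))
        exact DifferentiableAt.comp (g := fun v => sieveConv d v k) (f := fun s => 1 - s) s
          (h.differentiableAt_sieveConv (inl (by simp; linarith))) (by fun_prop)) (fun k hkX s hs => by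
        obtain ⟨a1, a2, a3, a4⟩ := hre s hs
        have hX : X < k := Nat.lt_of_floor_lt hkX
        obtain ⟨hk1, hk2⟩ := hk k hX
        have e : sieveConv d (1 - s) k / (1 - s) - (k : ℂ) ^ (-s) * J =
            (sieveConv d (1 - s) k - (1 - s) * ((k : ℂ) ^ (-s) * J)) / (1 - s) := by field_simp
        have b := hm k s hk1 hX hk2 (by linarith) (by linarith)
        rw [Complex.ofReal_natCast] at b
        have b2 : ‖sieveConv d (1 - s) k / (1 - s) - (k : ℂ) ^ (-s) * J‖ ≤ C * (‖s₀‖ + r) *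
            (k : ℝ) ^ (-(s₀.re / 2) - 1) := by
          rw [e, norm_div, div_le_iff₀ (norm_pos_iff.2 a4)]
          refine b.trans ?_
          have := rpow_le_rpow_of_exponent_le hk1 (show -s.re - 1 ≤ -(s₀.re / 2) - 1 by linarith)
          calc _ = C * ‖s‖ * (k : ℝ) ^ (-s.re - 1) * ‖1 - s‖ := by ring
            _ ≤ _ := mul_bound_right (mul_bound (mul_bound_left a3) this)
        rw [norm_mul]
        refine (mul_bound (norm_vmTerm_le (w := ((s₀.re / 2 : ℝ) : ℂ)) (by rw [ofReal_re]; linarith) k) b2).trans_eq ?_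
        rw [mul_left_comm, norm_vmTerm_mul_rpow, ← Complex.ofReal_sub]
        ring_nf)
  refine ⟨_, fun s h0 h1 => (key s h0 h1).1, fun s hs hs1 => ?_⟩
  have h1 := (key s (by linarith) hs1).2.hasSum
  have h2 := (hasSum_vmTerm (w := 2 * s) (by simp; linarith)).2.mul_left J
  rw [show ∑' k : ℕ, vmTerm s k * (sieveConv d (1 - s) k / (1 - s)) = _ from
    ((h1.add h2).congr_fun fun k => ?_).tsum_eq]
  · have : J = 2 * ((∫ u in Ioi (0 : ℝ), f u : ℝ) : ℂ) := by rw [hJ, h.integral_f]; push_cast; ring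
    rw [this]; ring
  · have := vmTerm_mul_cpow s s k
    rw [← two_mul] at this
    rw [← this]; ring

end IsSieveKernel

/-! ### From the double sum over prime powers to the weighted pair sum -/

open ArithmeticFunction in
theorem exists_vonMangoldt_add_le {ε : ℝ} (hε : 0 < ε) (j : ℕ) : ∃ C, 0 < C ∧ ∀ k : ℕ, 0 < k →
    vonMangoldt (k + j) ≤ C * (k : ℝ) ^ ε := by
  refine ⟨(1 + j) ^ ε / ε, by positivity, fun k hk => ?_⟩
  have hk1 : (1 : ℝ) ≤ k := by exact_mod_cast hk
  refine vonMangoldt_le_log.trans ((Real.log_le_rpow_div (by positivity) hε).trans ?_)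
  rw [div_mul_eq_mul_div, ← mul_rpow (by positivity) (by positivity)]
  refine div_le_div_of_nonneg_right (rpow_bound ?_) hε.le
  push_cast
  nlinarith [(cast_nonneg j : (0 : ℝ) ≤ j)]

theorem exists_norm_vmTerm_add_le {ε : ℝ} (hε : 0 < ε) (j : ℕ) : ∃ C, 0 < C ∧ ∀ k : ℕ, 0 < k → ∀ s : ℂ, 0 ≤ s.re →
    ‖vmTerm s (k + j)‖ ≤ C * (k : ℝ) ^ (ε - s.re) := by
  obtain ⟨C, hC, h⟩ := exists_vonMangoldt_add_le hε j
  refine ⟨C, hC, fun k hk s hs => ?_⟩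
  have hk0 : (0 : ℝ) < k := by exact_mod_cast hk
  rw [norm_vmTerm, sub_eq_add_neg, rpow_add hk0, ← mul_assoc]
  exact mul_bound (h k hk) (rpow_le_rpow_of_nonpos hk0 (by push_cast; linarith) (by linarith))

theorem summable_vmTerm_mul {s : ℂ} (hs : 1 / 2 < s.re) (j : ℕ) :
    Summable fun k => ‖vmTerm s k * vmTerm s (k + j)‖ := by
  obtain ⟨C, hC, h⟩ := exists_norm_vmTerm_add_le (sub_pos.2 hs) j
  refine ((hasSum_vmTerm (w := s - ((s.re - 1 / 2 - s.re : ℝ) : ℂ)) (by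
    rw [sub_re, ofReal_re]; linarith)).1.mul_left C).of_nonneg_of_le (fun k => norm_nonneg _) fun k => ?_
  rcases Nat.eq_zero_or_pos k with rfl | hk
  · simp [vmTerm_zero]
  rw [norm_mul, ← norm_vmTerm_mul_rpow, mul_left_comm]
  exact mul_bound_left (h k hk s (by linarith))

theorem term_pairCoeff (r : ℕ) (s : ℂ) (k : ℕ) : LSeries.term (pairCoeff r) (2 * s) k =
    vmTerm s k * ((ArithmeticFunction.vonMangoldt (k + 2 * r) : ℂ) * (k : ℂ) ^ (-s)) := by
  rcases Nat.eq_zero_or_pos k with rfl | hk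
  · simp [vmTerm_zero]
  have hk0 : (k : ℂ) ≠ 0 := by exact_mod_cast hk.ne'
  rw [LSeries.term_of_ne_zero hk.ne', pairCoeff, vmTerm, div_eq_mul_inv, ← cpow_neg,
    show -(2 * s) = -s + -s by ring, cpow_add _ _ hk0]
  push_cast; ring

theorem lseriesSummable_pairCoeff {s : ℂ} (hs : 1 / 2 < s.re) (r : ℕ) : LSeriesSummable (pairCoeff r) (2 * s) := by
  obtain ⟨C, hC, h⟩ := exists_vonMangoldt_add_le (sub_pos.2 hs) (2 * r)
  refine ((hasSum_vmTerm (w := s - ((s.re - 1 / 2 + -s.re : ℝ) : ℂ)) (by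
    rw [sub_re, ofReal_re]; linarith)).1.mul_left C).of_norm_bounded fun k => ?_
  rcases Nat.eq_zero_or_pos k with rfl | hk
  · simp [vmTerm_zero]
  have hk0 : (0 : ℝ) < k := by exact_mod_cast hk
  rw [term_pairCoeff, norm_mul, ← norm_vmTerm_mul_rpow, mul_left_comm, norm_mul, norm_real,
    norm_of_nonneg ArithmeticFunction.vonMangoldt_nonneg, norm_natCast_cpow_of_pos hk, neg_re,
    rpow_add hk0, ← mul_assoc C]
  exact mul_bound_left (mul_bound_right (h k hk))

theorem norm_natCast_add_cpow_sub_le {k : ℕ} (hk : 0 < k) (j : ℕ) {s : ℂ} (hs : 0 ≤ s.re) :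
    ‖((k + j : ℕ) : ℂ) ^ (-s) - (k : ℂ) ^ (-s)‖ ≤ ‖s‖ * (k : ℝ) ^ (-s.re - 1) * j := by
  have hk0 : (0 : ℝ) < k := by exact_mod_cast hk
  have hpos : ∀ t ∈ Icc (k : ℝ) (k + j), 0 < t := fun t ht => hk0.trans_le ht.1
  have h1 := Convex.norm_image_sub_le_of_norm_hasDerivWithin_le (f := fun y : ℝ => (1 : ℂ) * (y : ℂ) ^ (-s))
    (f' := fun y : ℝ => 1 * (-s) * (y : ℂ) ^ (-s - 1)) (s := Icc (k : ℝ) (k + j))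
    (C := ‖s‖ * (k : ℝ) ^ (-s.re - 1))
    (fun t ht => (hasDerivAt_ofReal_cpow_mul (hpos t ht) 1 (-s)).hasDerivWithinAt)
    (fun t ht => by
      rw [one_mul, norm_mul, norm_neg, norm_ofReal_cpow_of_pos (hpos t ht)]
      refine mul_le_mul_of_nonneg_left ?_ (norm_nonneg s)
      simp only [sub_re, neg_re, one_re]
      exact rpow_le_rpow_of_nonpos hk0 ht.1 (by linarith))
    (convex_Icc _ _) (x := k) (y := k + j) ⟨le_refl _, by simp⟩ ⟨by simp, le_refl _⟩
  simpa using h1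

/-- Replacing `(k+2r)^{-s}` by `k^{-s}` changes the summand by a factor `O(1/k)`, enough for
convergence when `Re s > 0`. -/
theorem differentiableAt_even_shift (r : ℕ) {s₀ : ℂ} (h0 : 0 < s₀.re) : DifferentiableAt ℂ (fun s =>
    ∑' k : ℕ, (vmTerm s k * vmTerm s (k + 2 * r) - LSeries.term (pairCoeff r) (2 * s) k)) s₀ := by
  obtain ⟨C, hC, hb⟩ := exists_vonMangoldt_add_le (half_pos h0) (2 * r)
  refine (differentiableAt_tsum_of_bound (s₀ := s₀) (F := fun k s => vmTerm s k * vmTerm s (k + 2 * r) -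
    LSeries.term (pairCoeff r) (2 * s) k) 1 (half_pos h0)
    (u := fun k => C * ((‖s₀‖ + s₀.re / 2) * (2 * r : ℕ)) * ‖vmTerm ((1 + s₀.re / 2 : ℝ) : ℂ) k‖)
    ((hasSum_vmTerm (by rw [ofReal_re]; linarith)).1.mul_left _) (fun k s hs => ?_) fun k hk s hs => ?_).1
  · rcases Nat.eq_zero_or_pos k with rfl | hk
    · simp [vmTerm_zero]
    simp only [term_pairCoeff]
    exact ((differentiable_vmTerm k s).mul (differentiable_vmTerm _ s)).sub ((differentiable_vmTerm k s).mul
      ((differentiable_natCast_cpow_neg hk s).const_mul _))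
  · obtain ⟨⟨a, -⟩, -, b⟩ := re_im_norm_of_mem_ball hs
    have hk0 : (0 : ℝ) < k := by exact_mod_cast hk
    have e1 := (norm_natCast_add_cpow_sub_le hk (2 * r) (s := s) (by linarith)).trans
      (mul_bound_right (mul_bound b (rpow_le_rpow_of_exponent_le (by exact_mod_cast hk)
        (show -s.re - 1 ≤ -(s₀.re / 2) - 1 by linarith))))
    rw [term_pairCoeff, ← mul_sub, show vmTerm s (k + 2 * r) = (ArithmeticFunction.vonMangoldt (k + 2 * r) : ℂ) *
      ((k + 2 * r : ℕ) : ℂ) ^ (-s) from rfl, ← mul_sub, norm_mul, norm_mul, norm_real,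
      norm_of_nonneg ArithmeticFunction.vonMangoldt_nonneg]
    refine (mul_bound (norm_vmTerm_le (w := ((s₀.re / 2 : ℝ) : ℂ)) (by rw [ofReal_re]; linarith) k)
      (mul_bound (hb k hk) e1)).trans_eq ?_
    rw [show (((1 + s₀.re / 2 : ℝ) : ℂ)) = ((s₀.re / 2 : ℝ) : ℂ) - ((s₀.re / 2 + (-(s₀.re / 2) - 1) : ℝ) : ℂ) by
      push_cast; ring, ← norm_vmTerm_mul_rpow, rpow_add hk0]
    ring

theorem summable_two_pow {δ : ℝ} (hδ : 0 < δ) :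
    Summable (indicator (Set.range fun a : ℕ => 2 ^ a) fun k : ℕ => (k : ℝ) ^ (-δ)) := by
  refine ((Nat.pow_right_injective (le_refl 2)).summable_iff fun x hx => indicator_of_notMem hx _).1 ?_
  have : (indicator (Set.range fun a : ℕ => 2 ^ a) fun k : ℕ => (k : ℝ) ^ (-δ)) ∘ (fun a : ℕ => 2 ^ a) =
      fun a : ℕ => ((2 : ℝ) ^ (-δ)) ^ a := by
    funext a
    rw [Function.comp, indicator_of_mem (Set.mem_range_self a)]
    push_cast
    rw [← rpow_natCast, ← rpow_natCast, ← Real.rpow_mul (by norm_num), ← Real.rpow_mul (by norm_num), mul_comm]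
  rw [this]
  exact summable_geometric_of_lt_one (by positivity) (Real.rpow_lt_one_of_one_lt_of_neg one_lt_two (by linarith))

theorem eq_two_pow_of_even {n : ℕ} (h : Even n) (hn : ArithmeticFunction.vonMangoldt n ≠ 0) :
    n ∈ Set.range fun a : ℕ => 2 ^ a := by
  rw [ArithmeticFunction.vonMangoldt_ne_zero_iff, isPrimePow_nat_iff] at hn
  obtain ⟨p, a, hp, ha, rfl⟩ := hn
  have h2 := Nat.prime_two.dvd_of_dvd_pow h.two_dvd
  rw [← (Nat.prime_dvd_prime_iff_eq Nat.prime_two hp).1 h2]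
  exact ⟨a, rfl⟩

/-- Two numbers with odd difference have opposite parity, so if both are prime powers the even one
is a power of 2. The sum is dominated by geometric series. -/
theorem differentiableAt_odd_shift (r : ℕ) {s₀ : ℂ} (h0 : 0 < s₀.re) : DifferentiableAt ℂ (fun s =>
    ∑' k : ℕ, vmTerm s k * vmTerm s (k + (2 * r + 1))) s₀ := by
  set j := 2 * r + 1 with hj
  obtain ⟨C, hC, hb⟩ := exists_norm_vmTerm_add_le (ε := s₀.re / 4) (by linarith) j
  obtain ⟨C₀, hC₀, hb₀⟩ := exists_norm_vmTerm_add_le (ε := s₀.re / 4) (by linarith) 0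
  set g := indicator (Set.range fun a : ℕ => 2 ^ a) fun k : ℕ => (k : ℝ) ^ (-(s₀.re / 2)) with hg
  have hgs : Summable g := summable_two_pow (by linarith)
  have hg0 : ∀ k, 0 ≤ g k := fun k => Set.indicator_nonneg (fun k _ => by positivity) k
  refine (differentiableAt_tsum_of_bound (s₀ := s₀) (F := fun k s => vmTerm s k * vmTerm s (k + j)) 1 (half_pos h0)
    (u := fun k => C₀ * C * (g k + (1 + j : ℝ) ^ (s₀.re / 2) * g (k + j)))
    ((hgs.add (((summable_nat_add_iff j).2 hgs).mul_left _)).mul_left _)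
    (fun k s _ => (differentiable_vmTerm k s).mul (differentiable_vmTerm _ s)) fun k hk s hs => ?_).1
  have hG : 0 ≤ (1 + j : ℝ) ^ (s₀.re / 2) * g (k + j) := mul_nonneg (by positivity) (hg0 _)
  by_cases hz : vmTerm s k * vmTerm s (k + j) = 0
  · rw [hz, norm_zero]
    have := hg0 k
    positivity
  have hz1 := left_ne_zero_of_mul hz
  have hz2 := right_ne_zero_of_mul hz
  obtain ⟨⟨a, -⟩, -⟩ := re_im_norm_of_mem_ball hs
  have hk1 : (1 : ℝ) ≤ k := by exact_mod_cast hk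
  have e : ‖vmTerm s k * vmTerm s (k + j)‖ ≤ C₀ * C * (k : ℝ) ^ (-(s₀.re / 2)) := by
    rw [norm_mul]
    refine (mul_bound (hb₀ k hk s (by linarith)) (hb k hk s (by linarith))).trans ?_
    rw [mul_mul_mul_comm, ← rpow_add (by linarith)]
    exact mul_bound_left (rpow_bound_exp hk1)
  refine e.trans (mul_bound_left ?_)
  rcases Nat.even_or_odd k with he | ho
  · have hm : k ∈ Set.range fun a : ℕ => 2 ^ a := eq_two_pow_of_even he fun h => hz1 (by simp [vmTerm, h])
    rw [hg, indicator_of_mem hm, ← hg]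
    linarith
  · have hm : k + j ∈ Set.range fun a : ℕ => 2 ^ a :=
      eq_two_pow_of_even (ho.add_odd ⟨r, hj⟩) fun h => hz2 (by simp [vmTerm, h])
    have h1 : g (k + j) = ((k + j : ℕ) : ℝ) ^ (-(s₀.re / 2)) := by rw [hg, indicator_of_mem hm]
    have h2 : (k : ℝ) ^ (-(s₀.re / 2)) ≤ (1 + j : ℝ) ^ (s₀.re / 2) * g (k + j) := by
      rw [h1, rpow_neg (by positivity), rpow_neg (by positivity), ← div_eq_mul_inv, inv_eq_one_div,
        div_le_div_iff₀ (by positivity) (by positivity), one_mul, ← mul_rpow (by positivity) (by positivity)]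
      refine rpow_bound ?_
      push_cast
      nlinarith [(cast_nonneg j : (0 : ℝ) ≤ j)]
    linarith [hg0 k]

/-- The sum is split by the sign of `k - l`; the diagonal occurs in both halves and is subtracted
once. -/
theorem tsum_mul_sub_eq {a : ℕ → ℂ} {f : ℝ → ℝ} (hf : ∀ u, f (-u) = f u) (hf0 : f 0 = 1) {M : ℕ}
    (hM : ∀ j : ℕ, M ≤ j → f j = 0) (k : ℕ) :
    ∑' l : ℕ, a l * (f (k - l) : ℂ) = ∑ j ∈ Finset.range M, (f j : ℂ) * a (k + j) +
      ∑ j ∈ Finset.range M, (f j : ℂ) * (if j ≤ k then a (k - j) else 0) - a k := by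
  have e1 : ∑ j ∈ Finset.range M, (f j : ℂ) * (if j ≤ k then a (k - j) else 0) =
      ∑ l ∈ Finset.range (k + 1), a l * (f (k - l) : ℂ) := by
    rw [← Finset.sum_range_reflect (fun l : ℕ => a l * (f (k - l) : ℂ)) (k + 1)]
    trans ∑ j ∈ Finset.range (k + 1), (f j : ℂ) * (if j ≤ k then a (k - j) else 0)
    · trans ∑ j ∈ Finset.range (M + (k + 1)), (f j : ℂ) * (if j ≤ k then a (k - j) else 0)
      · refine Finset.sum_subset (Finset.range_subset_range.2 (by omega)) fun j _ hj => ?_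
        rw [hM j (by simpa using hj)]; simp
      · refine (Finset.sum_subset (Finset.range_subset_range.2 (by omega)) fun j _ hj => ?_).symm
        rw [if_neg (by simp at hj; omega), mul_zero]
    · refine sum_congr rfl fun j hj => ?_
      have hj : j ≤ k := by simp at hj; omega
      rw [if_pos hj, Nat.add_sub_cancel, Nat.cast_sub hj, sub_sub_cancel, mul_comm]
  rw [tsum_eq_sum (s := Finset.range (k + M)) fun l hl => ?_, Finset.sum_range_add, e1, sum_range_succ]
  · have e2 : ∀ j : ℕ, a (k + j) * (f ((k : ℝ) - (k + j : ℕ)) : ℂ) = (f j : ℂ) * a (k + j) := fun j => by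
      rw [Nat.cast_add, sub_add_cancel_left, hf, mul_comm]
    simp only [e2, sub_self, hf0]
    push_cast; ring
  · have hl : k + M ≤ l := by simpa using hl
    rw [← hf, neg_sub, ← Nat.cast_sub (by omega), hM _ (by omega)]; simp

/-- The double sum over prime powers is the weighted pair sum up to an analytic function. -/
theorem IsSieveKernel.exists_pair_sum {E d : ℝ → ℝ} {X : ℝ} (h : IsSieveKernel X (fun x => E (x / X)) d) :
    ∃ g : ℂ → ℂ, (∀ s : ℂ, 0 < s.re → DifferentiableAt ℂ g s) ∧ ∀ s : ℂ, 1 / 2 < s.re →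
      ∑' k : ℕ, vmTerm s k * ∑' l : ℕ, vmTerm s l * (E ((k - l) / X) : ℂ) = weightedPairSum E X s + g s := by
  set m := ⌊X / 2⌋₊ with hm
  set f : ℝ → ℝ := fun x => E (x / X) with hf
  have hM : ∀ j : ℕ, 2 * (m + 1) ≤ j → f j = 0 := fun j hj => h.f_supp (by
    have h1 := Nat.lt_floor_add_one (X / 2)
    have h2 : ((2 * (m + 1) : ℕ) : ℝ) ≤ j := by exact_mod_cast hj
    push_cast at h2
    rw [abs_of_nonneg (cast_nonneg j)]; linarith)
  refine ⟨fun s => 2 * ∑ r ∈ Finset.range (m + 1), ((f (2 * r : ℕ) : ℂ) * ∑' k : ℕ, (vmTerm s k *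
    vmTerm s (k + 2 * r) - LSeries.term (pairCoeff r) (2 * s) k) +
    (f (2 * r + 1 : ℕ) : ℂ) * ∑' k : ℕ, vmTerm s k * vmTerm s (k + (2 * r + 1))), fun s hs => ?_, fun s hs => ?_⟩
  · exact (DifferentiableAt.fun_sum fun r _ => ((differentiableAt_even_shift r hs).const_mul _).add
      ((differentiableAt_odd_shift r hs).const_mul _)).const_mul _
  have hP : ∀ j, HasSum (fun k => vmTerm s k * vmTerm s (k + j)) (∑' k, vmTerm s k * vmTerm s (k + j)) :=
    fun j => (summable_vmTerm_mul hs j).of_norm.hasSum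
  set P : ℕ → ℂ := fun j => ∑' k, vmTerm s k * vmTerm s (k + j) with hPdef
  have hP' : ∀ j, HasSum (fun k => vmTerm s k * (if j ≤ k then vmTerm s (k - j) else 0)) (P j) := fun j => by
    have := (hasSum_nat_add_iff (f := fun k => vmTerm s k * (if j ≤ k then vmTerm s (k - j) else 0)) j).1
      ((hP j).congr_fun fun k => by simp [mul_comm])
    rwa [Finset.sum_eq_zero fun i hi => by rw [if_neg (by simpa using hi), mul_zero], add_zero] at this
  have hT : HasSum (fun k : ℕ => vmTerm s k * ∑' l : ℕ, vmTerm s l * (f (k - l) : ℂ))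
      (∑ j ∈ Finset.range (2 * (m + 1)), (f j : ℂ) * P j + ∑ j ∈ Finset.range (2 * (m + 1)), (f j : ℂ) * P j - P 0) :=
    (((hasSum_sum fun j _ => (hP j).mul_left (f j : ℂ)).add
      (hasSum_sum fun j _ => (hP' j).mul_left (f j : ℂ))).sub (hP 0)).congr_fun fun k => by
      rw [tsum_mul_sub_eq h.even h.zero hM, mul_sub, mul_add, mul_sum, mul_sum, add_zero]
      congr 2 <;> exact sum_congr rfl fun j _ => by ring
  have hsplit : ∀ (n : ℕ) (G : ℕ → ℂ), ∑ j ∈ Finset.range (2 * n), G j =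
      ∑ r ∈ Finset.range n, (G (2 * r) + G (2 * r + 1)) := fun n G => by
    induction n with
    | zero => simp
    | succ n ih => rw [mul_add, mul_one, sum_range_succ, sum_range_succ, sum_range_succ, ih]; ring
  have hD : ∀ r, P (2 * r) = pairSeries r s + ∑' k : ℕ, (vmTerm s k *
      vmTerm s (k + 2 * r) - LSeries.term (pairCoeff r) (2 * s) k) := fun r => by
    have h2 := (lseriesSummable_pairCoeff hs r)
    rw [(hP (2 * r)).summable.tsum_sub h2, pairSeries, LSeries]; ring
  have h00 : P 0 = pairSeries 0 s := by
    rw [pairSeries, LSeries]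
    refine tsum_congr fun k => ?_
    rw [term_pairCoeff]; rfl
  have hW : weightedPairSum E X s = 2 * ∑ r ∈ Finset.range (m + 1), (f (2 * r : ℕ) : ℂ) * pairSeries r s -
      pairSeries 0 s := by
    rw [weightedPairSum, Finset.range_eq_Ico, Finset.sum_eq_sum_Ico_succ_bot (by omega)]
    have h0 : f ((2 * 0 : ℕ) : ℝ) = 1 := by simpa using h.zero
    have hI : Finset.Ico (0 + 1) (m + 1) = Finset.Icc 1 m := by ext; simp
    rw [h0, hI]
    simp only [hf]
    push_cast; ring
  rw [hT.tsum_eq, hsplit, hW, h00]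
  simp only [hD, mul_add, sum_add_distrib]
  ring

/-! ### Assembly and gluing -/

theorem analyticOnNhd_strip {a b : ℝ} {F : ℂ → ℂ} (h : ∀ s : ℂ, a < s.re → s.re < b → DifferentiableAt ℂ F s) :
    AnalyticOnNhd ℂ F {s : ℂ | a < s.re ∧ s.re < b} :=
  DifferentiableOn.analyticOnNhd (fun s hs => (h s hs.1 hs.2).differentiableWithinAt) (isOpen_strip a b)

theorem differentiableAt_weightedPairSum (E : ℝ → ℝ) (lam : ℝ) {s : ℂ} (hs : 1 / 2 < s.re) :
    DifferentiableAt ℂ (weightedPairSum E lam) s := by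
  have h1 : ∀ r, DifferentiableAt ℂ (pairSeries r) s := fun r => by
    have ha : LSeries.abscissaOfAbsConv (pairCoeff r) ≤ 1 :=
      LSeries.abscissaOfAbsConv_le_of_forall_lt_LSeriesSummable fun y hy => by
        have := lseriesSummable_pairCoeff (s := ((y / 2 : ℝ) : ℂ)) (by rw [ofReal_re]; linarith) r
        rwa [show 2 * ((y / 2 : ℝ) : ℂ) = y by push_cast; ring] at this
    have h2 : LSeries.abscissaOfAbsConv (pairCoeff r) < (2 * s).re :=
      ha.trans_lt (by rw [← EReal.coe_one]; exact EReal.coe_lt_coe (by simp; linarith))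
    exact DifferentiableAt.comp (g := LSeries (pairCoeff r)) (f := fun s => 2 * s) s
      (LSeries_analyticOnNhd _ _ h2).differentiableAt (by fun_prop)
  exact (h1 0).add ((DifferentiableAt.fun_sum fun r _ => (h1 r).const_mul _).const_mul _)

theorem IsSieveKernel.differentiableAt_zeroSum (hRH : RiemannHypothesis) {X : ℝ} {f d : ℝ → ℝ}
    (h : IsSieveKernel X f d) {s : ℂ} (h1 : 1 / 2 < s.re) (h2 : s.re < 1) :
    DifferentiableAt ℂ (zeroSum (sieveMellin d)) s := by
  obtain ⟨r, hr, -, d1, d2⟩ := h.local_series hRH h1 h2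
  have hb := ball_mem_nhds s hr
  have d3 := hRH.differentiableAt_zetaLD (w := s) (by linarith) (fun h0 => by rw [h0] at h2; simp at h2) (by linarith)
  exact ((d3.pow 2).add ((d3.const_mul 2).mul (d1.differentiableAt hb))).add (d2.differentiableAt hb)

theorem IsSievingFunction.integral_Ioi_div {E : ℝ → ℝ} (hE : IsSievingFunction E) {lam : ℝ} (hlam : 0 < lam) :
    ∫ u in Ioi (0 : ℝ), E (u / lam) = sieveMean E * lam := by
  have h1 := integral_comp_mul_left_Ioi E 0 (inv_pos.2 hlam)
  simp only [mul_zero, inv_inv, smul_eq_mul] at h1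
  have h2 : ∫ u in Ioi (0 : ℝ), E u = sieveMean E := by
    rw [sieveMean, intervalIntegral.integral_of_le zero_le_one]
    refine setIntegral_eq_of_subset_of_forall_sdiff_eq_zero measurableSet_Ioi Ioc_subset_Ioi_self fun x hx => ?_
    have h3 : 1 < x := by
      by_contra h4
      exact hx.2 ⟨hx.1, not_lt.1 h4⟩
    exact hE.support x (lt_of_lt_of_le h3 (le_abs_self x))
  rw [← h2, mul_comm, ← h1]
  simp only [div_eq_inv_mul]

theorem theorem3p1 (hRH : RiemannHypothesis) (E : ℝ → ℝ) (hE : IsSievingFunction E) (lam : ℝ) (hlam : 0 < lam) :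
    ∃ M : ℂ → ℂ, IsMellinTransform E lam M ∧ ∃ H₀ : ℂ → ℂ, AnalyticOnNhd ℂ H₀ {s : ℂ | 0 < s.re ∧ s.re < 1} ∧
        ∀ s : ℂ, 1 / 2 < s.re → s.re < 1 → (∀ r : ℕ, LSeriesSummable (pairCoeff r) (2 * s)) ∧
          Summable (singleTerm M s) ∧
          Summable (doubleTerm M s) ∧
          ∃ Z : ℂ, HasSymmetricZeroSum (fun ρ => 1 / (2 * s - ρ)) Z ∧ weightedPairSum E lam s =
              2 * (sieveMean E : ℂ) * (lam : ℂ) / (2 * s - 1) - 4 * (sieveMean E : ℂ) * (lam : ℂ) * Z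
                + zeroSum M s + H₀ s := by
  classical
  obtain ⟨d, h⟩ := hE.exists_sieveKernel hlam
  set A : ℂ := ((∫ u in Ioi (0 : ℝ), E (u / lam) : ℝ) : ℂ) with hA
  have hA' : A = sieveMean E * lam := by rw [hA, hE.integral_Ioi_div hlam]; push_cast; rfl
  obtain ⟨Q, hQ, eQ⟩ := h.exists_sieveKer_diag
  obtain ⟨q, hq, eq⟩ := h.exists_convInt_sum hRH
  obtain ⟨g, hg, eg⟩ := h.exists_sieveConv_sum
  obtain ⟨t, ht, et⟩ := h.exists_pair_sum
  obtain ⟨C₀, hC₀⟩ := exists_hasSymmetricZeroSum hRH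
  have hne : ∀ s : ℂ, 1 / 2 < s.re → 2 * s - 1 ≠ 0 := fun s hs => ne_zero_of_re_ne (by simp; linarith)
  have hld : ∀ s : ℂ, 1 / 2 < s.re → zeroSeries (2 * s) = zetaLD (2 * s) - zetaRegular (2 * s) + 1 / (2 * s - 1) :=
    fun s hs => by
    rw [zetaLD, hRH.logDeriv_riemannZeta_eq (by simp; linarith) (sub_ne_zero.1 (hne s hs))
      (fun h0 => by have := h0.2.2; simp at this; linarith)]
    ring
  have d2 : ∀ (F : ℂ → ℂ) (s : ℂ), DifferentiableAt ℂ F (2 * s) → DifferentiableAt ℂ (fun s => F (2 * s)) s :=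
    fun F s hF => DifferentiableAt.comp (g := F) (f := fun s => 2 * s) s hF (by fun_prop)
  have dreg : ∀ s : ℂ, 0 < s.re → DifferentiableAt ℂ (fun s => zetaRegular (2 * s)) s := fun s hs =>
    d2 _ s (hRH.zetaRegular_spec (by simp; linarith)).1.differentiableAt
  have dinv : ∀ s : ℂ, 1 / 2 < s.re → ∀ c : ℂ, DifferentiableAt ℂ (fun s => c / (2 * s - 1)) s := fun s hs c =>
    DifferentiableAt.fun_div (differentiableAt_const c) (by fun_prop) (hne s hs)
  -- `H₁` is the remainder assembled from the continued terms, analytic for `0 < Re s < 7/8`; `H`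
  -- below is the remainder forced by the claim, analytic for `1/2 < Re s < 1`. They have to be
  -- shown equal where both are defined.
  set H₁ : ℂ → ℂ := fun s => 4 * A * C₀ - (t s + 2 * q s - 2 * g s + 4 * A * zetaRegular (2 * s) +
    IsSieveKernel.kerIntInt d s - 2 * (IsSieveKernel.kerInt d s (-3 / 8) (1 - s) / (1 - s)) + Q s) with hH₁
  set H : ℂ → ℂ := fun s => weightedPairSum E lam s - (2 * A / (2 * s - 1) - 4 * A * (zeroSeries (2 * s) + C₀) +
    zeroSum (sieveMellin d) s) with hH
  have dH₁ : ∀ s : ℂ, 0 < s.re → s.re < 7 / 8 → DifferentiableAt ℂ H₁ s := fun s h0 h1 =>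
    (differentiableAt_const _).sub (((((((ht s h0).add ((hq s h0 h1).const_mul 2)).sub
      ((hg s h0 (by linarith)).const_mul 2)).add ((dreg s h0).const_mul _)).add
      (h.differentiableAt_kerIntInt hRH h0 h1)).sub ((h.differentiableAt_kerInt hRH h0 h1).const_mul 2)).add
      (hQ.differentiableAt ((isOpen_strip 0 1).mem_nhds ⟨h0, by linarith⟩)))
  have dH : ∀ s : ℂ, 1 / 2 < s.re → s.re < 1 → DifferentiableAt ℂ H s := fun s h0 h1 => by
    have dz : DifferentiableAt ℂ (fun s => zeroSeries (2 * s)) s := by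
      refine (((d2 zetaLD s (hRH.differentiableAt_zetaLD (by simp; linarith) (sub_ne_zero.1 (hne s h0))
        (by simp; linarith))).sub (dreg s (by linarith))).add (dinv s h0 1)).congr_of_eventuallyEq ?_
      filter_upwards [(isOpen_lt continuous_const continuous_re).mem_nhds h0] with w hw using hld w hw
    exact (differentiableAt_weightedPairSum E lam h0).sub (((dinv s h0 _).sub ((dz.add_const C₀).const_mul _)).add
      (h.differentiableAt_zeroSum hRH h0 h1))
  have hser : ∀ s : ℂ, 1 / 2 < s.re → s.re < 1 → Summable (singleTerm (sieveMellin d) s) ∧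
      Summable (doubleTerm (sieveMellin d) s) := fun s h0 h1 => by
    obtain ⟨r, hr, hs, -⟩ := h.local_series hRH h0 h1
    exact hs s (mem_ball_self hr)
  have key : ∀ s : ℂ, 3 / 4 < s.re → s.re < 7 / 8 → H s = H₁ s := fun s h0 h1 => by
    obtain ⟨-, -, -, e⟩ := h.zeroSum_eq hRH h0 h1 (hser s (by linarith) (by linarith)).2
    rw [et s (by linarith), eq s h0 h1, eg s (by linarith) (by linarith), eQ s (by linarith) (by linarith)] at e
    have e1 := hld s (by linarith)
    have e2 : A / (s - 1 / 2) = 2 * A / (2 * s - 1) := by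
      rw [show s - 1 / 2 = (2 * s - 1) / 2 by ring, div_div_eq_mul_div, mul_comm]
    rw [e2] at e
    simp only [hH, hH₁]
    rw [e1, e]
    ring
  -- The explicit formula gives equality for `3/4 < Re s < 7/8`; the identity theorem carries it
  -- down to `Re s > 1/2`, starting from the interior point `13/16`.
  have key2 : Set.EqOn H H₁ {s : ℂ | 1 / 2 < s.re ∧ s.re < 7 / 8} := by
    refine (analyticOnNhd_strip fun s a b => dH s a (by linarith)).eqOn_of_preconnected_of_eventuallyEq
      (analyticOnNhd_strip fun s a b => dH₁ s (by linarith) b)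
      ((convex_halfSpace_re_gt _).inter (convex_halfSpace_re_lt _)).isPreconnected (z₀ := ((13 / 16 : ℝ) : ℂ))
      ⟨by rw [ofReal_re]; norm_num, by rw [ofReal_re]; norm_num⟩ ?_
    filter_upwards [(isOpen_strip (3 / 4) (7 / 8)).mem_nhds
      (show ((13 / 16 : ℝ) : ℂ) ∈ _ from ⟨by rw [ofReal_re]; norm_num, by rw [ofReal_re]; norm_num⟩)]
      with s hs using key s hs.1 hs.2
  -- The two remainders are glued along `Re s = 7/8`. Near that line the glued function coincides
  -- with `H`, because `H = H₁` just to the left of it.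
  refine ⟨sieveMellin d, h.isMellinTransform, fun s => if s.re < 7 / 8 then H₁ s else H s,
    analyticOnNhd_strip fun s h0 h1 => ?_, fun s h0 h1 => ⟨lseriesSummable_pairCoeff h0, (hser s h0 h1).1,
      (hser s h0 h1).2, _, hC₀ (2 * s) (by simp; linarith) (by simp; linarith), ?_⟩⟩
  · by_cases hs : s.re < 7 / 8
    · refine (dH₁ s h0 hs).congr_of_eventuallyEq ?_
      filter_upwards [(isOpen_lt continuous_re continuous_const).mem_nhds hs] with w hw using if_pos hw
    · refine (dH s (by linarith) h1).congr_of_eventuallyEq ?_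
      filter_upwards [(isOpen_lt continuous_const continuous_re).mem_nhds
        (show (1 / 2 : ℝ) < s.re by linarith)] with w hw
      split_ifs with hw'
      · exact (key2 ⟨hw, hw'⟩).symm
      · rfl
  · have : (if s.re < 7 / 8 then H₁ s else H s) = H s := by
      split_ifs with hs
      · exact (key2 ⟨h0, hs⟩).symm
      · rfl
    beta_reduce
    rw [this, hH, mul_assoc 2, mul_assoc 4, ← hA']
    ring
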